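/- Let $d\ge 1$. **Energy density.** Let $f:\mathbb R\to\mathbb R\cup\{+\infty\}$ be convex and lower semicontinuous with $f(0)=0$, $f=+\infty$ on $(-\infty,0)$ and $\operatorname{int}(\operatorname{dom} f)\neq\emptyset$. For a finite Borel measure $\rho$ on $\mathbb R^d$ with finite second moment $M_2(\rho)=\int|x|^2d\rho$, let $\mathcal F(\rho)=\int f(\rho(x))\,dx$ if $d\rho=\rho(x)dx$; otherwise let $\mathcal F(\rho)$ be the infimum of $\liminf_n\mathcal F(\rho_n)$ over sequences of absolutely continuous finite measures with $W_2(\rho_n,\rho)\to0$. Assume there is a nondecreasing concave $H:[0,\infty)\to[0,\infty)$ with $H(0)=0$ and $\mathcal F(\rho)\ge -H\big(\int(1+|x|^2)\,d\rho\big)$ for all such $\rho$. **Mollifier.** Let $\varphi\in C^2(\mathbb R^d)$ be nonnegative and even with $\int\varphi=1$, $\int|x|^2\varphi(x)\,dx<\infty$, $\varphi(x)\le C_\varphi|x|^{-r}$ for $x\neq0$, for some $C_\varphi>0$ and $r>\max\{d,2\}$, and $\varphi,\nabla\varphi,D^2\varphi\in L^1\cap L^\infty$. Put $\varphi_\varepsilon(x)=\varepsilon^{-d}\varphi(x/\varepsilon)$.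 **Regularized energy.** Let $\delta:(0,1)\to(0,\infty)$ be nondecreasing with $\lim_{\varepsilon\to0}\delta(\varepsilon)=0$. Write ${}^{\gamma}f(a)=\inf_{b\ge0}\{f(b)+|a-b|^2/(2\gamma)\}$, and let $f_\varepsilon(a)=\frac{\delta(\varepsilon)}2|a|^2+{}^{\delta(\varepsilon)}f(a)-{}^{\delta(\varepsilon)}f(0)$ for $a\ge0$ and $f_\varepsilon(a)=+\infty$ for $a<0$; $f_\varepsilon'(0)$ denotes the right derivative. Let $\mathcal F_\varepsilon(\rho)=\int f_\varepsilon(\varphi_\varepsilon*\rho)\,dx$, and let $\mathcal S(\rho)=\int\rho\log\rho\,dx$ if $\rho$ is absolutely continuous, $\mathcal S(\rho)=+\infty$ otherwise. **Limiting data.** Let $v:[0,\infty)\times\mathbb R^d\to\mathbb R^d$ satisfy $v\in L^1_{\rm loc}([0,\infty);W^{1,1}_{\rm loc}(\mathbb R^d))$ and $\frac{|v|^2+(\nabla\cdot v)_+}{1+|x|^2}\in L^1_{\rm loc}([0,\infty);L^\infty(\mathbb R^d))$. Let $\rho^0\in\mathcal P_2(\mathbb R^d)$, the probability measures with finite second moment,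 satisfy $\mathcal F(\rho^0)+\mathcal S(\rho^0)<\infty$. **Well-prepared data.** For $\varepsilon\in(0,1)$ let $\rho^0_\varepsilon\in\mathcal P_2(\mathbb R^d)\cap C_c^\infty(\mathbb R^d)$ and $v_\varepsilon\in C_c^\infty([0,\infty)\times\mathbb R^d)$ be such that, for every $T>0$, $$\sup_{\varepsilon\in(0,1)}\Big(\mathcal F_\varepsilon(\rho^0_\varepsilon)+\mathcal S(\rho^0_\varepsilon)+M_2(\rho^0_\varepsilon)+\int_0^T\Big\|\frac{|v_\varepsilon(t,\cdot)|^2+(\nabla\cdot v_\varepsilon(t,\cdot))_+}{1+|\cdot|^2}\Big\|_{L^\infty}dt\Big)<\infty,$$ and such that, as $\varepsilon\to0$, $v_\varepsilon\to v$ in $L^1_{\rm loc}([0,\infty)\times\mathbb R^d)$ and $W_2(\rho^0_\varepsilon,\rho^0)\to0$. **Claim.** For every $T>0$ there is a constant $C_{d,T}>0$, independent of $\varepsilon$ (it may depend on $d$, $T$ and the data fixed above), such that for every $\varepsilon\in(0,1)$ and every solution $\rho_\varepsilon\in AC^2_{\rm loc}([0,\infty);\mathcal P_2(\mathbb R^d))$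 of $$\partial_t\rho_\varepsilon-\nabla\cdot\big(\rho_\varepsilon(\nabla p_\varepsilon+v_\varepsilon)\big)=0\ \text{ in duality with }C_c^\infty((0,\infty)\times\mathbb R^d),\qquad p_\varepsilon=\varphi_\varepsilon*f_\varepsilon'(\varphi_\varepsilon*\rho_\varepsilon),\qquad \rho_\varepsilon(0)=\rho_\varepsilon^0,$$ the following holds for all $t\in[0,T]$, with $\mu_\varepsilon=\varphi_\varepsilon*\rho_\varepsilon$ and $q_\varepsilon=f_\varepsilon'(\mu_\varepsilon)$: the measure $\rho_\varepsilon(t)$ is absolutely continuous and $$\int_{\mathbb R^d}\rho_\varepsilon(t,x)\,|\log\rho_\varepsilon(t,x)|\,dx+\|\nabla\mu_\varepsilon\cdot\nabla q_\varepsilon\|_{L^1([0,t]\times\mathbb R^d)}\le C_{d,T}.$$ -/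

import Mathlib

open MeasureTheory Filter Topology Set
open scoped ENNReal NNReal ContDiff

noncomputable section

namespace NonlocalDiffusion

/-- The Euclidean space `ℝ^d`. -/
abbrev Space (d : ℕ) : Type := EuclideanSpace ℝ (Fin d)

variable {d : ℕ}

/-! ### Measures on `ℝ^d` -/

/-- The integral of an extended-real function: integral of the positive part minus integral of
the negative part. With the convention `⊤ - ⊤ = ⊥` of `EReal`, a value `> ⊥` entails that the
negative part is integrable. -/
def eIntegral {α : Type*} [MeasurableSpace α] (μ : Measure α) (g : α → EReal) : EReal :=
  ((∫⁻ x, (g x).toENNReal ∂μ : ℝ≥0∞) : EReal) - ((∫⁻ x, (-(g x)).toENNReal ∂μ : ℝ≥0∞) : EReal)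

/-- The second moment `M₂(μ) = ∫ |x|² dμ`. -/
def secondMoment (μ : Measure (Space d)) : ℝ≥0∞ := ∫⁻ x, ‖x‖ₑ ^ 2 ∂μ

/-- The 2-Wasserstein distance, as the infimum of the quadratic cost over all transport plans
(`⊤` if there is no transport plan, that is, if the masses differ). -/
def wasserstein₂ (μ ν : Measure (Space d)) : ℝ≥0∞ :=
  ⨅ (γ : Measure (Space d × Space d)) (_ : γ.map Prod.fst = μ ∧ γ.map Prod.snd = ν),
    (∫⁻ z, ‖z.1 - z.2‖ₑ ^ 2 ∂γ) ^ (1 / 2 : ℝ)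

/-- The real-valued Lebesgue density of (the absolutely continuous part of) `μ`. -/
def density (μ : Measure (Space d)) (x : Space d) : ℝ := (μ.rnDeriv volume x).toReal

/-- The measure `r(x) dx` for a nonnegative function `r`. -/
def densityMeasure (r : Space d → ℝ) : Measure (Space d) :=
  volume.withDensity fun x => ENNReal.ofReal (r x)

open Classical in
/-- The internal energy `ℱ(μ)`: it is `∫ f(μ(x)) dx` if `dμ = μ(x) dx`, and it is extended to all
finite measures by `W₂`-lower semicontinuous relaxation. -/
def internalEnergy (f : ℝ → EReal) (μ : Measure (Space d)) : EReal :=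
  if μ ≪ volume then eIntegral volume fun x => f (density μ x)
  else sInf {L : EReal | ∃ μs : ℕ → Measure (Space d),
    (∀ n, IsFiniteMeasure (μs n) ∧ μs n ≪ volume) ∧
    Tendsto (fun n => wasserstein₂ (μs n) μ) atTop (𝓝 0) ∧
    L = liminf (fun n => eIntegral volume fun x => f (density (μs n) x)) atTop}

open Classical in
/-- The entropy `𝒮(μ) = ∫ μ(x) log μ(x) dx` if `dμ = μ(x) dx`, and `+∞` otherwise. -/
def entropy (μ : Measure (Space d)) : EReal :=
  if μ ≪ volume then
    eIntegral volume fun x => ((density μ x * Real.log (density μ x) : ℝ) : EReal)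
  else ⊤

/-! ### The internal energy density and its regularization -/

/-- The assumptions on the internal energy density `f : ℝ → ℝ ∪ {+∞}` in dimension `d`. -/
structure EnergyAssumption (d : ℕ) (f : ℝ → EReal) : Prop where
  ne_bot : ∀ a, f a ≠ ⊥
  convex : ∀ a b : ℝ, f a < ⊤ → f b < ⊤ → ∀ s : ℝ, 0 ≤ s → s ≤ 1 →
    f (s * a + (1 - s) * b) ≤ (s : EReal) * f a + ((1 - s : ℝ) : EReal) * f b
  lsc : LowerSemicontinuous f
  zero : f 0 = 0
  neg : ∀ a < 0, f a = ⊤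
  dom : (interior {a : ℝ | f a < ⊤}).Nonempty
  coercive : ∃ H : ℝ → ℝ, MonotoneOn H (Ici 0) ∧ ConcaveOn ℝ (Ici 0) H ∧ H 0 = 0 ∧
    ∀ μ : Measure (Space d), IsFiniteMeasure μ → secondMoment μ < ⊤ →
      ((-H (∫ x, (1 + ‖x‖ ^ 2) ∂μ) : ℝ) : EReal) ≤ internalEnergy f μ

/-- The Moreau-Yosida regularization `inf_{b ≥ 0} f(b) + |a - b|² / (2γ)`. -/
def moreau (γ : ℝ) (f : ℝ → EReal) (a : ℝ) : EReal :=
  ⨅ (b : ℝ) (_ : 0 ≤ b), f b + ((|a - b| ^ 2 / (2 * γ) : ℝ) : EReal)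

/-- The (finite) formula for the regularized energy density with parameter `γ = δ(ε)`
on `[0,∞)`. -/
def regDensityReal (γ : ℝ) (f : ℝ → EReal) (a : ℝ) : ℝ :=
  γ / 2 * |a| ^ 2 + (moreau γ f a).toReal - (moreau γ f 0).toReal

open Classical in
/-- The regularized energy density `f_ε`, with `γ = δ(ε)`; it is `+∞` on `(-∞,0)`. -/
def regDensity (γ : ℝ) (f : ℝ → EReal) (a : ℝ) : EReal :=
  if 0 ≤ a then (regDensityReal γ f a : EReal) else ⊤

/-- The derivative `f_ε'` on `[0,∞)`; at `0` it is the derivative from the right. -/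
def regDensityDeriv (γ : ℝ) (f : ℝ → EReal) (a : ℝ) : ℝ :=
  derivWithin (regDensityReal γ f) (Ici 0) a

/-- The assumptions on the regularization parameter `ε ↦ δ(ε)`. -/
structure ParameterAssumption (δ : ℝ → ℝ) : Prop where
  pos : ∀ ε ∈ Ioo (0 : ℝ) 1, 0 < δ ε
  mono : MonotoneOn δ (Ioo 0 1)
  tendsto : Tendsto δ (𝓝[>] 0) (𝓝 0)

/-! ### The mollifier -/

/-- The assumptions on the mollifier profile `φ`. -/
structure MollifierAssumption (φ : Space d → ℝ) : Prop where
  contDiff : ContDiff ℝ 2 φ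
  nonneg : ∀ x, 0 ≤ φ x
  integral_eq_one : ∫ x, φ x = 1
  even : ∀ x, φ (-x) = φ x
  decay : ∃ C > 0, ∃ r : ℝ, max (d : ℝ) 2 < r ∧ ∀ x, x ≠ 0 → φ x ≤ C * ‖x‖ ^ (-r)
  secondMoment : Integrable fun x => ‖x‖ ^ 2 * φ x
  memLp : MemLp φ 1 ∧ MemLp φ ⊤
  memLp_fderiv : MemLp (fderiv ℝ φ) 1 ∧ MemLp (fderiv ℝ φ) ⊤
  memLp_fderiv_fderiv : MemLp (fderiv ℝ (fderiv ℝ φ)) 1 ∧ MemLp (fderiv ℝ (fderiv ℝ φ)) ⊤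

/-- The mollifier `φ_ε(x) = ε^{-d} φ(x / ε)`. -/
def mollifier (φ : Space d → ℝ) (ε : ℝ) (x : Space d) : ℝ := (ε ^ d)⁻¹ * φ (ε⁻¹ • x)

/-- The mollified density `φ_ε * μ`. -/
def smoothed (φ : Space d → ℝ) (ε : ℝ) (μ : Measure (Space d)) (x : Space d) : ℝ :=
  ∫ y, mollifier φ ε (x - y) ∂μ

/-- `q_ε = f_ε'(φ_ε * μ)`, with `γ = δ(ε)`. -/
def potential (f : ℝ → EReal) (φ : Space d → ℝ) (γ ε : ℝ) (μ : Measure (Space d))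
    (x : Space d) : ℝ :=
  regDensityDeriv γ f (smoothed φ ε μ x)

/-- The pressure `p_ε = φ_ε * f_ε'(φ_ε * μ)`, with `γ = δ(ε)`. -/
def pressure (f : ℝ → EReal) (φ : Space d → ℝ) (γ ε : ℝ) (μ : Measure (Space d))
    (x : Space d) : ℝ :=
  ∫ y, mollifier φ ε (x - y) * potential f φ γ ε μ y

/-- The regularized energy `ℱ_ε(μ) = ∫ f_ε(φ_ε * μ)`, with `γ = δ(ε)`. -/
def regEnergy (f : ℝ → EReal) (φ : Space d → ℝ) (γ ε : ℝ) (μ : Measure (Space d)) : EReal :=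
  eIntegral volume fun x => regDensity γ f (smoothed φ ε μ x)

/-! ### Velocity fields and initial data -/

/-- `(|w|² + (div)₊) / (1 + |x|²)` for the values `w` of a vector field and the values `A` of its
derivative, the divergence being the trace of the derivative. -/
def growthQuotient (w : Space d → Space d) (A : Space d → (Space d →L[ℝ] Space d))
    (x : Space d) : ℝ :=
  (‖w x‖ ^ 2 + max (LinearMap.trace ℝ (Space d) (A x : Space d →ₗ[ℝ] Space d)) 0) /
    (1 + ‖x‖ ^ 2)

/-- `A` is the weak (distributional) derivative of `w` on `ℝ^d`. -/
def IsWeakDeriv (w : Space d → Space d) (A : Space d → (Space d →L[ℝ] Space d)) : Prop :=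
  ∀ ψ : Space d → ℝ, ContDiff ℝ ∞ ψ → HasCompactSupport ψ → ∀ e : Space d,
    ∫ x, fderiv ℝ ψ x e • w x = -∫ x, ψ x • A x e

/-- The assumptions on the limiting velocity: `v ∈ L¹_loc([0,∞); W^{1,1}_loc)` and
`(|v|² + (div v)₊) / (1 + |x|²) ∈ L¹_loc([0,∞); L^∞)`. -/
def VelocityAssumption (v : ℝ → Space d → Space d) : Prop :=
  ∃ Dv : ℝ → Space d → (Space d →L[ℝ] Space d),
    (∀ T R : ℝ,
      IntegrableOn (Function.uncurry v) (Icc 0 T ×ˢ Metric.closedBall 0 R) ∧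
      IntegrableOn (Function.uncurry Dv) (Icc 0 T ×ˢ Metric.closedBall 0 R)) ∧
    (∀ᵐ t ∂(volume.restrict (Ici (0 : ℝ))), IsWeakDeriv (v t) (Dv t)) ∧
    ∀ T : ℝ, ∫⁻ t in Icc 0 T, eLpNorm (growthQuotient (v t) (Dv t)) ⊤ volume < ⊤

/-- The assumptions on the limiting initial datum: `ρ⁰ ∈ 𝒫₂` and `ℱ(ρ⁰) + 𝒮(ρ⁰) < ∞`. -/
structure InitialAssumption (f : ℝ → EReal) (μ : Measure (Space d)) : Prop where
  prob : IsProbabilityMeasure μ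
  secondMoment_lt : secondMoment μ < ⊤
  energy : internalEnergy f μ + entropy μ < ⊤

/-- `v ∈ C_c^∞([0,∞) × ℝ^d)`: the restriction to `t ≥ 0` of a function in `C_c^∞(ℝ × ℝ^d)`. -/
def IsTestField (v : ℝ → Space d → Space d) : Prop :=
  ∃ V : ℝ × Space d → Space d, ContDiff ℝ ∞ V ∧ HasCompactSupport V ∧
    ∀ t, 0 ≤ t → ∀ x, v t x = V (t, x)

/-- `r ∈ 𝒫₂ ∩ C_c^∞`, `r` being the density of the probability measure. -/
structure IsTestDensity (r : Space d → ℝ) : Prop where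
  contDiff : ContDiff ℝ ∞ r
  compactSupport : HasCompactSupport r
  nonneg : ∀ x, 0 ≤ r x
  integral_eq_one : ∫ x, r x = 1

/-- The initial densities `r ε = ρ_ε⁰` and velocities `vs ε = v_ε`, `ε ∈ (0,1)`, are well-prepared
for the limiting initial datum `μ₀` and velocity `v`. -/
structure WellPrepared (f : ℝ → EReal) (δ : ℝ → ℝ) (φ : Space d → ℝ)
    (v : ℝ → Space d → Space d) (μ₀ : Measure (Space d))
    (r : ℝ → Space d → ℝ) (vs : ℝ → ℝ → Space d → Space d) : Prop where
  testDensity : ∀ ε ∈ Ioo (0 : ℝ) 1, IsTestDensity (r ε)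
  testField : ∀ ε ∈ Ioo (0 : ℝ) 1, IsTestField (vs ε)
  bound : ∀ T > 0, ∃ C : ℝ, ∀ ε ∈ Ioo (0 : ℝ) 1,
    regEnergy f φ (δ ε) ε (densityMeasure (r ε)) + entropy (densityMeasure (r ε)) +
      (secondMoment (densityMeasure (r ε)) : EReal) +
      ((∫⁻ t in Icc 0 T,
        eLpNorm (growthQuotient (vs ε t) (fderiv ℝ (vs ε t))) ⊤ volume : ℝ≥0∞) : EReal) ≤ C
  tendsto_velocity : ∀ T R : ℝ, Tendsto (fun ε =>
    ∫⁻ z in Icc 0 T ×ˢ Metric.closedBall (0 : Space d) R, ‖vs ε z.1 z.2 - v z.1 z.2‖ₑ)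
    (𝓝[>] 0) (𝓝 0)
  tendsto_initial : Tendsto (fun ε => wasserstein₂ (densityMeasure (r ε)) μ₀) (𝓝[>] 0) (𝓝 0)

/-! ### The regularized equation -/

/-- `ρ ∈ AC²_loc([0,∞); 𝒫₂)`. Only the values `ρ t` with `t ≥ 0` matter. -/
structure IsACCurve (ρ : ℝ → Measure (Space d)) : Prop where
  prob : ∀ t, 0 ≤ t → IsProbabilityMeasure (ρ t)
  secondMoment_lt : ∀ t, 0 ≤ t → secondMoment (ρ t) < ⊤
  ac : ∃ g : ℝ → ℝ, (∀ t, 0 ≤ g t) ∧ (∀ T : ℝ, MemLp g 2 (volume.restrict (Icc 0 T))) ∧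
    ∀ s t, 0 ≤ s → s ≤ t → wasserstein₂ (ρ t) (ρ s) ≤ ENNReal.ofReal (∫ u in s..t, g u)

/-- `ρ ∈ AC²_loc([0,∞); 𝒫₂)` solves `∂ₜρ - ∇·(ρ (∇p_ε + v)) = 0`, `p_ε = φ_ε * f_ε'(φ_ε * ρ)`, in
duality with `C_c^∞((0,∞) × ℝ^d)`, with initial datum `μ₀`; here `γ = δ(ε)`. -/
structure IsSolution (f : ℝ → EReal) (φ : Space d → ℝ) (γ ε : ℝ) (v : ℝ → Space d → Space d)
    (μ₀ : Measure (Space d)) (ρ : ℝ → Measure (Space d)) : Prop where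
  acCurve : IsACCurve ρ
  weak : ∀ ψ : ℝ × Space d → ℝ, ContDiff ℝ ∞ ψ → HasCompactSupport ψ →
    tsupport ψ ⊆ Ioi 0 ×ˢ univ →
    ∫ t in Ioi (0 : ℝ), ∫ x, (deriv (fun s => ψ (s, x)) t -
      inner ℝ (gradient (fun y => ψ (t, y)) x)
        (gradient (pressure f φ γ ε (ρ t)) x + v t x)) ∂(ρ t) = 0
  initial : ρ 0 = μ₀

/-- The product `∇μ_ε · ∇q_ε` at `(t,x)`, where `μ_ε = φ_ε * ρ` and `q_ε = f_ε'(μ_ε)`. -/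
def dissipation (f : ℝ → EReal) (φ : Space d → ℝ) (γ ε : ℝ) (ρ : ℝ → Measure (Space d))
    (z : ℝ × Space d) : ℝ :=
  inner ℝ (gradient (smoothed φ ε (ρ z.1)) z.2) (gradient (potential f φ γ ε (ρ z.1)) z.2)

end NonlocalDiffusion

end

open NonlocalDiffusion

noncomputable section
namespace NonlocalDiffusion
variable {d : ℕ}

/-! ### The internal energy density and its Moreau-Yosida regularization -/

namespace EnergyAssumption

variable {f : ℝ → EReal} {γ : ℝ}

/-! The measure is carried by the drift b = -(∇p + v), and along such a flow the entropy changes at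
the rate -∫ ρ div b. Since the mollifier is even, one copy of it can be moved onto ρ, which gives ∫
ρ Δp = -∫ ∇μ·∇q. Formally, then, S(ρ_t) + ∫₀ᵗ∫ ∇μ·∇q = S(ρ_0) + ∫₀ᵗ∫ ρ div v. The dissipation is
nonnegative because f_ε' is nondecreasing, and div v ≤ N(t)(1 + |x|²) with ∫ N bounded uniformly in
ε, so everything reduces to a uniform bound on second moments.

Moments. The energy inequality `Evolution.energy_sub_le` bounds ∫∫ ρ|b|² by the energy drop plus ∫∫
ρ|v|². The regularized energy is bounded below by an affine function of the second moment
(`EnergyAssumption.exists_le_integral_regDensityReal`), so a Gronwall argument closes the estimate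
(`exists_uniform_moment_bound`). The well-prepared data bound only a sum of quantities of either
sign; `WellPrepared.exists_uniform_bound` separates them.

Entropy. A solution is a priori only a curve of measures, so its entropy cannot be differentiated.
Instead one uses S(ρ) = sup_ψ (∫ ψ dρ - e⁻¹ ∫ e^ψ). A Lipschitz test function is carried backwards
by Euler steps ψ ↦ ψ(x + h b) + h div b - e h, and the change of variables x ↦ x + h b shows that ∫
e^ψ does not increase. Summing the steps yields `DriftCurve.integral_le_of_initial_le`, where the
divergence integral appears as the gain. The resulting bound ∫ ψ dρ_t ≤ K + e⁻¹ ∫ e^ψ for all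
Lipschitz ψ forces a density with an L log L bound (`lintegral_density_abs_log_le`).

For fixed ε the drift is bounded, Lipschitz in space and has a modulus of continuity in time, given
by the increments of a function G. Those constants depend on ε, but they occur only in
discretization errors that vanish in the limit. -/

lemma coe_toReal (hf : EnergyAssumption d f) {a : ℝ} (ha : f a < ⊤) :
    (((f a).toReal : ℝ) : EReal) = f a :=
  EReal.coe_toReal ha.ne (hf.ne_bot a)

lemma zero_lt_top (hf : EnergyAssumption d f) : f 0 < ⊤ := by
  rw [hf.zero]; exact EReal.zero_lt_top

lemma nonneg_of_lt_top (hf : EnergyAssumption d f) {a : ℝ} (ha : f a < ⊤) : 0 ≤ a := by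
  by_contra! h
  exact ha.ne (hf.neg a h)

lemma convex_toReal (hf : EnergyAssumption d f) {a b s : ℝ} (ha : f a < ⊤) (hb : f b < ⊤)
    (h0 : 0 ≤ s) (h1 : s ≤ 1) :
    f (s * a + (1 - s) * b) < ⊤ ∧
      (f (s * a + (1 - s) * b)).toReal ≤ s * (f a).toReal + (1 - s) * (f b).toReal := by
  have h := hf.convex a b ha hb s h0 h1
  rw [← hf.coe_toReal ha, ← hf.coe_toReal hb, ← EReal.coe_mul, ← EReal.coe_mul,
    ← EReal.coe_add] at h
  have h2 : f (s * a + (1 - s) * b) < ⊤ := lt_of_le_of_lt h (EReal.coe_lt_top _)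
  refine ⟨h2, ?_⟩
  rw [← hf.coe_toReal h2] at h
  exact_mod_cast h

/-- Convexity of the energy density, in terms of three points. -/
lemma convex_three (hf : EnergyAssumption d f) {a b c : ℝ} (ha : f a < ⊤) (hc : f c < ⊤)
    (hab : a ≤ b) (hbc : b ≤ c) :
    f b < ⊤ ∧ (c - a) * (f b).toReal ≤ (c - b) * (f a).toReal + (b - a) * (f c).toReal := by
  rcases hab.eq_or_lt with rfl | hab'
  · exact ⟨ha, by simp⟩
  have hca : 0 < c - a := by linarith
  have h := hf.convex_toReal ha hc (s := (c - b) / (c - a)) (div_nonneg (by linarith) hca.le)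
    (by rw [div_le_one hca]; linarith)
  have e : (c - b) / (c - a) * a + (1 - (c - b) / (c - a)) * c = b := by
    field_simp; ring
  rw [e] at h
  refine ⟨h.1, ?_⟩
  have := mul_le_mul_of_nonneg_left h.2 hca.le
  calc _ ≤ _ := this
    _ = _ := by field_simp; ring


/-- Points to the right of an interior point of the domain are positive. They serve as pivots for
chord comparisons with 0 on one side and a far point on the other. -/
lemma exists_pos_lt_top (hf : EnergyAssumption d f) :
    ∃ b₀ b₁ : ℝ, 0 < b₀ ∧ b₀ < b₁ ∧ f b₀ < ⊤ ∧ f b₁ < ⊤ := by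
  obtain ⟨x, hx⟩ := hf.dom
  obtain ⟨e, he, hball⟩ := Metric.isOpen_iff.1 isOpen_interior x hx
  have hmem : ∀ y, |y - x| < e → f y < ⊤ := fun y hy =>
    interior_subset (s := {a : ℝ | f a < ⊤}) (hball (by simpa [Real.dist_eq] using hy))
  have hx0 : 0 ≤ x := hf.nonneg_of_lt_top (hmem x (by simpa using he))
  refine ⟨x + e / 3, x + e / 2, by linarith, by linarith, hmem _ ?_, hmem _ ?_⟩ <;>
  · rw [add_sub_cancel_left, abs_of_pos (by linarith)]; linarith

/-- A convex energy density is bounded below by an affine function. -/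
lemma exists_affine_le (hf : EnergyAssumption d f) :
    ∃ A B : ℝ, 0 ≤ A ∧ 0 ≤ B ∧ ∀ b, f b < ⊤ → -A - B * b ≤ (f b).toReal := by
  obtain ⟨b₀, b₁, h0, h01, hb0, hb1⟩ := hf.exists_pos_lt_top
  set F0 := (f b₀).toReal
  set F1 := (f b₁).toReal
  refine ⟨(|F0| + |F1|) * b₁ / (b₁ - b₀), |F0| / b₀, ?_, by positivity, fun b hb => ?_⟩
  · have : 0 < b₁ - b₀ := by linarith
    have : 0 < b₁ := by linarith
    positivity
  have hbn := hf.nonneg_of_lt_top hb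
  have hd : 0 < b₁ - b₀ := by linarith
  have hA : 0 ≤ (|F0| + |F1|) * b₁ / (b₁ - b₀) := by
    have : 0 < b₁ := by linarith
    positivity
  have hB : 0 ≤ |F0| / b₀ * b := by positivity
  -- Either b₀ lies between 0 and b, or b₀ lies between b and b₁. In both cases the chord through
  -- the outer points lies above the value at b₀, which bounds f b from below.
  rcases le_total b₀ b with h | h
  · have := (hf.convex_three hf.zero_lt_top hb h0.le h).2
    rw [hf.zero] at this
    simp only [sub_zero, EReal.toReal_zero, mul_zero, zero_add] at this
    have h2 : -|F0| * b ≤ b₀ * (f b).toReal := by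
      have := neg_abs_le F0
      nlinarith
    have h3 : -(|F0| / b₀ * b) ≤ (f b).toReal := by
      rw [show -(|F0| / b₀ * b) = (-|F0| * b) / b₀ by ring, div_le_iff₀ h0]
      linarith
    linarith
  · have := (hf.convex_three hb hb1 h h01.le).2
    have h3 : -((|F0| + |F1|) * b₁ / (b₁ - b₀)) ≤ (f b).toReal := by
      rw [← neg_div, div_le_iff₀ hd]
      have e1 := neg_abs_le F0
      have e2 := le_abs_self F1
      have e3 := abs_nonneg F0
      have e4 := abs_nonneg F1
      have e5 : -|F0| * b₁ ≤ (b₁ - b) * F0 := by nlinarith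
      have e6 : (b₀ - b) * F1 ≤ |F1| * b₁ := by nlinarith
      nlinarith
    linarith

/-! ### The Moreau envelope: finiteness, convexity, differentiability. -/

lemma moreau_le (hf : EnergyAssumption d f) (a : ℝ) {b : ℝ} (hb : f b < ⊤) :
    moreau γ f a ≤ (((f b).toReal + |a - b| ^ 2 / (2 * γ) : ℝ) : EReal) := by
  rw [EReal.coe_add, hf.coe_toReal hb]
  exact iInf₂_le b (hf.nonneg_of_lt_top hb)

lemma le_moreau (hf : EnergyAssumption d f) (a : ℝ) {c : ℝ}
    (h : ∀ b, f b < ⊤ → c ≤ (f b).toReal + |a - b| ^ 2 / (2 * γ)) :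
    (c : EReal) ≤ moreau γ f a := by
  refine le_iInf₂ fun b hb => ?_
  rcases eq_or_ne (f b) ⊤ with h' | h'
  · rw [h', EReal.top_add_coe]; exact le_top
  · rw [← hf.coe_toReal (lt_top_iff_ne_top.2 h'), ← EReal.coe_add]
    exact_mod_cast h b (lt_top_iff_ne_top.2 h')

/-- Testing with b = 0 bounds the envelope above. Below, the quadratic penalty beats the affine
minorant of f by completing the square. -/
lemma coe_moreau (hf : EnergyAssumption d f) (hγ : 0 < γ) (a : ℝ) :
    (((moreau γ f a).toReal : ℝ) : EReal) = moreau γ f a := by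
  refine EReal.coe_toReal ?_ ?_
  · exact (lt_of_le_of_lt (hf.moreau_le a hf.zero_lt_top) (EReal.coe_lt_top _)).ne
  · obtain ⟨A, B, hA, hB, h⟩ := hf.exists_affine_le
    refine (lt_of_lt_of_le (EReal.bot_lt_coe (-A - B * |a| - B ^ 2 * γ / 2))
      (hf.le_moreau a fun b hb => ?_)).ne'
    have h1 := h b hb
    have h2 : B * |a - b| ≤ |a - b| ^ 2 / (2 * γ) + B ^ 2 * γ / 2 := by
      have : |a - b| ^ 2 / (2 * γ) + B ^ 2 * γ / 2 - B * |a - b|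
          = (|a - b| - B * γ) ^ 2 / (2 * γ) := by field_simp; ring
      have h3 : 0 ≤ (|a - b| - B * γ) ^ 2 / (2 * γ) := by positivity
      linarith
    have h4 : b ≤ |a| + |a - b| := by
      have := abs_sub_abs_le_abs_sub b a
      rw [abs_sub_comm] at this
      linarith [le_abs_self b]
    nlinarith [mul_le_mul_of_nonneg_left h4 hB]

lemma moreau_toReal_le (hf : EnergyAssumption d f) (hγ : 0 < γ) (a : ℝ) {b : ℝ} (hb : f b < ⊤) :
    (moreau γ f a).toReal ≤ (f b).toReal + |a - b| ^ 2 / (2 * γ) := by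
  have := hf.moreau_le (γ := γ) a hb
  rw [← hf.coe_moreau hγ] at this
  exact_mod_cast this

lemma le_moreau_toReal (hf : EnergyAssumption d f) (hγ : 0 < γ) (a : ℝ) {c : ℝ}
    (h : ∀ b, f b < ⊤ → c ≤ (f b).toReal + |a - b| ^ 2 / (2 * γ)) :
    c ≤ (moreau γ f a).toReal := by
  have := hf.le_moreau a h
  rw [← hf.coe_moreau hγ] at this
  exact_mod_cast this

lemma exists_lt_moreau (hf : EnergyAssumption d f) (hγ : 0 < γ) (a : ℝ) {e : ℝ} (he : 0 < e) :
    ∃ b, f b < ⊤ ∧ (f b).toReal + |a - b| ^ 2 / (2 * γ) < (moreau γ f a).toReal + e := by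
  by_contra! h
  linarith [hf.le_moreau_toReal hγ a h]

/-- The function f(b) + |a - b|²/(2γ) is jointly convex in (a, b), and partial infima of jointly
convex functions are convex. Near-minimizers replace minimizers, at the cost of e. -/
lemma convexOn_moreau (hf : EnergyAssumption d f) (hγ : 0 < γ) :
    ConvexOn ℝ univ fun a => (moreau γ f a).toReal := by
  refine ⟨convex_univ, fun x _ y _ s t hs ht hst => ?_⟩
  obtain rfl : t = 1 - s := by linarith
  refine le_of_forall_pos_le_add fun e he => ?_
  obtain ⟨b, hb, hb'⟩ := hf.exists_lt_moreau hγ x he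
  obtain ⟨c, hc, hc'⟩ := hf.exists_lt_moreau hγ y he
  have h1 := hf.convex_toReal hb hc hs (by linarith)
  have h2 := hf.moreau_toReal_le hγ (s * x + (1 - s) * y) h1.1
  simp only [smul_eq_mul, sq_abs] at *
  have h3 : (s * x + (1 - s) * y - (s * b + (1 - s) * c)) ^ 2 / (2 * γ)
      ≤ s * ((x - b) ^ 2 / (2 * γ)) + (1 - s) * ((y - c) ^ 2 / (2 * γ)) := by
    have : s * ((x - b) ^ 2 / (2 * γ)) + (1 - s) * ((y - c) ^ 2 / (2 * γ)) -
        (s * x + (1 - s) * y - (s * b + (1 - s) * c)) ^ 2 / (2 * γ)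
        = s * (1 - s) * (((x - b) - (y - c)) ^ 2 / (2 * γ)) := by field_simp; ring
    have h4 : 0 ≤ s * (1 - s) * (((x - b) - (y - c)) ^ 2 / (2 * γ)) := by positivity
    linarith
  nlinarith [mul_le_mul_of_nonneg_left hb'.le hs, mul_le_mul_of_nonneg_left hc'.le ht]

/-- After expanding the square, this is a supremum over b of affine functions of a. It is the
semiconcavity half of the regularity of the envelope. -/
lemma convexOn_sub_moreau (hf : EnergyAssumption d f) (hγ : 0 < γ) :
    ConvexOn ℝ univ fun a => a ^ 2 / (2 * γ) - (moreau γ f a).toReal := by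
  refine ⟨convex_univ, fun x _ y _ s t hs ht hst => ?_⟩
  obtain rfl : t = 1 - s := by linarith
  refine le_of_forall_pos_le_add fun e he => ?_
  obtain ⟨b, hb, hb'⟩ := hf.exists_lt_moreau hγ (s * x + (1 - s) * y) he
  have h1 := hf.moreau_toReal_le hγ x hb
  have h2 := hf.moreau_toReal_le hγ y hb
  simp only [smul_eq_mul, sq_abs] at *
  have h3 : s * (x ^ 2 / (2 * γ) - (x - b) ^ 2 / (2 * γ)) +
      (1 - s) * (y ^ 2 / (2 * γ) - (y - b) ^ 2 / (2 * γ)) =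
      (s * x + (1 - s) * y) ^ 2 / (2 * γ) - (s * x + (1 - s) * y - b) ^ 2 / (2 * γ) := by
    field_simp; ring
  nlinarith [mul_le_mul_of_nonneg_left h1 hs, mul_le_mul_of_nonneg_left h2 ht]

/-- Convexity of the envelope orders its left and right derivatives one way, and convexity of
a²/(2γ) minus the envelope orders them the other way, so they agree. -/
lemma differentiable_moreau (hf : EnergyAssumption d f) (hγ : 0 < γ) :
    Differentiable ℝ fun a => (moreau γ f a).toReal := by
  intro x
  set g : ℝ → ℝ := fun a => (moreau γ f a).toReal with hg
  have h1 := hf.convexOn_moreau hγ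
  have h2 := hf.convexOn_sub_moreau hγ
  have hx : x ∈ interior (univ : Set ℝ) := by simp
  have hr := h1.hasDerivWithinAt_rightDeriv_of_mem_interior hx
  have hl := h1.hasDerivWithinAt_leftDeriv_of_mem_interior hx
  have hle := h1.leftDeriv_le_rightDeriv_of_mem_interior hx
  have hle2 := h2.leftDeriv_le_rightDeriv_of_mem_interior hx
  have hsq : HasDerivAt (fun a : ℝ => a ^ 2 / (2 * γ)) (x / γ) x := by
    exact ((hasDerivAt_pow 2 x).div_const (2 * γ)).congr_deriv (by norm_num; field_simp)
  have hr2 := (hsq.hasDerivWithinAt (s := Ioi x)).sub hr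
  have hl2 := (hsq.hasDerivWithinAt (s := Iio x)).sub hl
  have e1 := hr2.derivWithin (uniqueDiffWithinAt_Ioi x)
  have e2 := hl2.derivWithin (uniqueDiffWithinAt_Iio x)
  have e3 : derivWithin g (Ioi x) x ≤ derivWithin g (Iio x) x := by
    have : derivWithin (fun a => a ^ 2 / (2 * γ) - g a) (Iio x) x ≤
      derivWithin (fun a => a ^ 2 / (2 * γ) - g a) (Ioi x) x := hle2
    have e1' : derivWithin (fun a => a ^ 2 / (2 * γ) - g a) (Ioi x) x = _ := e1
    have e2' : derivWithin (fun a => a ^ 2 / (2 * γ) - g a) (Iio x) x = _ := e2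
    rw [e1', e2'] at this
    linarith
  have e4 := le_antisymm hle e3
  rw [e4] at hl
  have := hl.union hr
  rw [Iio_union_Ioi] at this
  exact (hasDerivWithinAt_univ.1 (hasDerivWithinAt_sdiff_singleton.1 (by rwa [← compl_eq_univ_sdiff]))).differentiableAt


/-! ### The regularized density: convexity and Lipschitz derivative. -/

lemma regDensityReal_zero : regDensityReal γ f 0 = 0 := by
  simp [regDensityReal]

lemma hasDerivAt_regDensityReal (hf : EnergyAssumption d f) (hγ : 0 < γ) (a : ℝ) :
    HasDerivAt (regDensityReal γ f) (γ * a + deriv (fun a => (moreau γ f a).toReal) a) a := by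
  have h1 : HasDerivAt (fun a : ℝ => γ / 2 * |a| ^ 2) (γ * a) a := by
    simp only [sq_abs]
    exact ((hasDerivAt_pow 2 a).const_mul (γ / 2)).congr_deriv (by norm_num; ring)
  exact (h1.add (hf.differentiable_moreau hγ a).hasDerivAt).sub_const _

lemma regDensityDeriv_eq (hf : EnergyAssumption d f) (hγ : 0 < γ) {a : ℝ} (ha : 0 ≤ a) :
    regDensityDeriv γ f a = γ * a + deriv (fun a => (moreau γ f a).toReal) a :=
  (hf.hasDerivAt_regDensityReal hγ a).hasDerivWithinAt.derivWithin
    (uniqueDiffOn_Ici 0 a ha)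

lemma hasDerivAt_regDensityDeriv (hf : EnergyAssumption d f) (hγ : 0 < γ) {a : ℝ} (ha : 0 ≤ a) :
    HasDerivAt (regDensityReal γ f) (regDensityDeriv γ f a) a := by
  rw [hf.regDensityDeriv_eq hγ ha]
  exact hf.hasDerivAt_regDensityReal hγ a

lemma continuous_regDensityReal (hf : EnergyAssumption d f) (hγ : 0 < γ) :
    Continuous (regDensityReal γ f) :=
  continuous_iff_continuousAt.2 fun a => (hf.hasDerivAt_regDensityReal hγ a).continuousAt

lemma deriv_moreau_mono (hf : EnergyAssumption d f) (hγ : 0 < γ) {a b : ℝ} (hab : a ≤ b) :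
    deriv (fun a => (moreau γ f a).toReal) a ≤ deriv (fun a => (moreau γ f a).toReal) b :=
  (hf.convexOn_moreau hγ).monotoneOn_deriv (fun x _ => hf.differentiable_moreau hγ x)
    (mem_univ a) (mem_univ b) hab

/-- The derivative of the convex function a²/(2γ) minus the envelope is nondecreasing; with
monotonicity of the derivative this makes it 1/γ-Lipschitz. -/
lemma deriv_moreau_sub_le (hf : EnergyAssumption d f) (hγ : 0 < γ) {a b : ℝ} (hab : a ≤ b) :
    deriv (fun a => (moreau γ f a).toReal) b - deriv (fun a => (moreau γ f a).toReal) a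
      ≤ (b - a) / γ := by
  have hd : ∀ x : ℝ, HasDerivAt (fun a : ℝ => a ^ 2 / (2 * γ) - (moreau γ f a).toReal)
      (x / γ - deriv (fun a => (moreau γ f a).toReal) x) x := fun x => by
    refine HasDerivAt.sub ?_ (hf.differentiable_moreau hγ x).hasDerivAt
    exact ((hasDerivAt_pow 2 x).div_const (2 * γ)).congr_deriv (by norm_num; field_simp)
  have h := (hf.convexOn_sub_moreau hγ).monotoneOn_deriv
    (fun x _ => (hd x).differentiableAt) (mem_univ a) (mem_univ b) hab
  rw [(hd a).deriv, (hd b).deriv] at h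
  rw [sub_div]; linarith

lemma regDensityDeriv_mono (hf : EnergyAssumption d f) (hγ : 0 < γ) {a b : ℝ} (ha : 0 ≤ a)
    (hab : a ≤ b) : regDensityDeriv γ f a ≤ regDensityDeriv γ f b := by
  rw [hf.regDensityDeriv_eq hγ ha, hf.regDensityDeriv_eq hγ (ha.trans hab)]
  have := hf.deriv_moreau_mono hγ hab
  nlinarith

lemma abs_regDensityDeriv_sub_le (hf : EnergyAssumption d f) (hγ : 0 < γ) {a b : ℝ} (ha : 0 ≤ a)
    (hb : 0 ≤ b) :
    |regDensityDeriv γ f a - regDensityDeriv γ f b| ≤ (γ + 1 / γ) * |a - b| := by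
  wlog hab : a ≤ b generalizing a b
  · rw [abs_sub_comm, abs_sub_comm a b]
    exact this hb ha (le_of_not_ge hab)
  rw [abs_sub_comm, abs_sub_comm a b, abs_of_nonneg (sub_nonneg.2 hab),
    abs_of_nonneg (sub_nonneg.2 (hf.regDensityDeriv_mono hγ ha hab)),
    hf.regDensityDeriv_eq hγ ha, hf.regDensityDeriv_eq hγ hb]
  have := hf.deriv_moreau_sub_le hγ hab
  rw [div_eq_mul_inv] at this
  rw [one_div]
  linarith

lemma convexOn_regDensityReal (hf : EnergyAssumption d f) (hγ : 0 < γ) :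
    ConvexOn ℝ univ (regDensityReal γ f) := by
  refine Monotone.convexOn_univ_of_deriv
    (fun x => (hf.hasDerivAt_regDensityReal hγ x).differentiableAt) fun a b hab => ?_
  rw [(hf.hasDerivAt_regDensityReal hγ a).deriv, (hf.hasDerivAt_regDensityReal hγ b).deriv]
  have := hf.deriv_moreau_mono hγ hab
  nlinarith

/-- The tangent inequality for the regularized energy density. -/
lemma regDensityReal_sub_le (hf : EnergyAssumption d f) (hγ : 0 < γ) {a b : ℝ} (ha : 0 ≤ a) :
    regDensityReal γ f a - regDensityReal γ f b ≤ regDensityDeriv γ f a * (a - b) := by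
  have hc := hf.convexOn_regDensityReal hγ
  have hd := hf.hasDerivAt_regDensityDeriv hγ ha
  rcases lt_trichotomy a b with h | rfl | h
  · have := hc.le_slope_of_hasDerivAt (mem_univ a) (mem_univ b) h hd
    rw [slope_def_field, le_div_iff₀ (by linarith)] at this
    linarith
  · simp
  · have := hc.slope_le_of_hasDerivAt (mem_univ b) (mem_univ a) h hd
    rw [slope_def_field, div_le_iff₀ (by linarith)] at this
    linarith

/-! ### Lower bounds on the regularized density. -/

lemma moreau_zero_nonpos (hf : EnergyAssumption d f) (hγ : 0 < γ) :
    (moreau γ f 0).toReal ≤ 0 := by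
  have := hf.moreau_toReal_le hγ 0 hf.zero_lt_top
  simpa [hf.zero] using this

/-- Superadditivity of a convex function vanishing at `0`. -/
lemma superadditive (hf : EnergyAssumption d f) {a b : ℝ} (ha : 0 ≤ a) (hab : a ≤ b)
    (hb : f b < ⊤) :
    f a < ⊤ ∧ f (b - a) < ⊤ ∧ (f a).toReal + (f (b - a)).toReal ≤ (f b).toReal := by
  have h1 := hf.convex_three hf.zero_lt_top hb ha hab
  have h2 := hf.convex_three hf.zero_lt_top hb (sub_nonneg.2 hab) (sub_le_self b ha)
  refine ⟨h1.1, h2.1, ?_⟩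
  rcases (ha.trans hab).eq_or_lt with h | h
  · obtain rfl : a = 0 := le_antisymm (hab.trans h.symm.le) ha
    simp [hf.zero]
  · have e1 := h1.2
    have e2 := h2.2
    rw [hf.zero] at e1 e2
    simp only [sub_zero, EReal.toReal_zero, mul_zero, zero_add] at e1 e2
    nlinarith

/-- The regularized energy density dominates the energy density at a smaller argument. -/
lemma exists_truncation (hf : EnergyAssumption d f) :
    ∃ c : ℝ → ℝ, Measurable c ∧ (∀ a, 0 ≤ a → 0 ≤ c a ∧ c a ≤ a) ∧
      ∀ γ > 0, ∀ a, 0 ≤ a → f (c a) ≤ (regDensityReal γ f a : EReal) := by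
  -- Sufficient conditions on the truncated value c: it minimizes f over the domain up to a and,
  -- unless c = a, over the whole domain.
  have key : ∀ γ > 0, ∀ a, 0 ≤ a → ∀ c, f c < ⊤ →
      (∀ b, f b < ⊤ → b ≤ a → (f c).toReal ≤ (f b).toReal) →
      (c ≠ a → ∀ b, f b < ⊤ → (f c).toReal ≤ (f b).toReal) →
      f c ≤ (regDensityReal γ f a : EReal) := by
    intro γ hγ a ha c hc h1 h2
    rw [← hf.coe_toReal hc]
    have : (f c).toReal + (moreau γ f 0).toReal ≤ (moreau γ f a).toReal := by
      refine hf.le_moreau_toReal hγ a fun b hb => ?_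
      have hz := hf.moreau_zero_nonpos hγ
      have hp : 0 ≤ |a - b| ^ 2 / (2 * γ) := by positivity
      rcases le_total b a with hba | hab
      · linarith [h1 b hb hba]
      -- For c = a and b > a, the shifted competitor b - a in the envelope at 0 has the same
      -- quadratic cost, and superadditivity pays for f(a) + f(b - a). If c ≠ a, global minimality
      -- and nonpositivity of the envelope at 0 suffice.
      · by_cases hca : c = a
        · subst hca
          obtain ⟨-, h4, h5⟩ := hf.superadditive ha hab hb
          have h6 := hf.moreau_toReal_le hγ 0 h4
          rw [zero_sub, abs_neg, ← abs_neg, neg_sub] at h6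
          linarith
        · linarith [h2 hca b hb]
    have h3 : 0 ≤ γ / 2 * |a| ^ 2 := by positivity
    exact_mod_cast (show (f c).toReal ≤ regDensityReal γ f a by
      unfold regDensityReal; linarith)
  -- If f has a minimizer m, truncate at m, since f is nonincreasing before it. Otherwise f is
  -- nonincreasing on all of [0,∞) and no truncation is needed.
  by_cases hmin : ∃ m, f m < ⊤ ∧ ∀ b, f m ≤ f b
  · obtain ⟨m, hm, hmb⟩ := hmin
    have hm0 := hf.nonneg_of_lt_top hm
    have hmb' : ∀ b, f b < ⊤ → (f m).toReal ≤ (f b).toReal := fun b hb => by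
      have := hmb b
      rw [← hf.coe_toReal hm, ← hf.coe_toReal hb] at this
      exact_mod_cast this
    refine ⟨fun a => min a m, by fun_prop, fun a ha => ⟨le_min ha hm0, min_le_left _ _⟩,
      fun γ hγ a ha => ?_⟩
    rcases le_total a m with h | h
    · simp only [min_eq_left h]
      have ha' := (hf.convex_three hf.zero_lt_top hm ha h).1
      refine key γ hγ a ha a ha' (fun b hb hba => ?_) (fun h => (h rfl).elim)
      rcases (hba.trans h).eq_or_lt with h' | h'
      · obtain rfl : a = m := le_antisymm h (h' ▸ hba)
        exact hmb' b hb
      · have := (hf.convex_three hb hm hba h).2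
        have := hmb' b hb
        nlinarith
    · simp only [min_eq_right h]
      exact key γ hγ a ha m hm (fun b hb _ => hmb' b hb) (fun _ => hmb')
  -- If f x < f y with x < y, the minimum over the compact interval [0,y] would be global: by
  -- convexity f cannot return below f x after y.
  · have hanti : ∀ x y, 0 ≤ x → x < y → f x < ⊤ → f y ≤ f x := by
      intro x y hx hxy hxt
      by_contra! hlt
      obtain ⟨m, hm, hmin'⟩ := (hf.lsc.lowerSemicontinuousOn (Icc 0 y)).exists_isMinOn
        (nonempty_Icc.2 (hx.trans hxy.le)) isCompact_Icc
      have hmx : f m ≤ f x := hmin' ⟨hx, hxy.le⟩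
      refine hmin ⟨m, lt_of_le_of_lt hmx hxt, fun b => ?_⟩
      rcases lt_or_ge b 0 with hb | hb
      · rw [hf.neg b hb]; exact le_top
      rcases le_total b y with hby | hby
      · exact hmin' ⟨hb, hby⟩
      refine hmx.trans ?_
      by_contra! hbx
      have h1 := hf.convex_three hxt (hbx.trans hxt) hxy.le hby
      have hbt := hbx.trans hxt
      rw [← hf.coe_toReal hxt, ← hf.coe_toReal h1.1] at hlt
      rw [← hf.coe_toReal hxt, ← hf.coe_toReal hbt] at hbx
      have hlt' : (f x).toReal < (f y).toReal := by exact_mod_cast hlt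
      have hbx' : (f b).toReal < (f x).toReal := by exact_mod_cast hbx
      have := h1.2
      nlinarith
    have htop : ∀ a, 0 ≤ a → f a < ⊤ := fun a ha => by
      rcases ha.eq_or_lt with rfl | h
      · exact hf.zero_lt_top
      · exact lt_of_le_of_lt (hanti 0 a le_rfl h hf.zero_lt_top) hf.zero_lt_top
    refine ⟨id, measurable_id, fun a ha => ⟨ha, le_rfl⟩, fun γ hγ a ha => ?_⟩
    refine key γ hγ a ha a (htop a ha) (fun b hb hba => ?_) (fun h => (h rfl).elim)
    rcases hba.eq_or_lt with rfl | h
    · exact le_rfl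
    · have := hanti b a (hf.nonneg_of_lt_top hb) h hb
      rw [← hf.coe_toReal hb, ← hf.coe_toReal (htop a ha)] at this
      exact_mod_cast this

/-- A linear lower bound on the regularized energy densities, uniform for large parameters. -/
lemma exists_linear_le_regDensityReal (hf : EnergyAssumption d f) {γ₀ : ℝ} (hγ₀ : 0 < γ₀) :
    ∃ K : ℝ, 0 ≤ K ∧ ∀ γ ≥ γ₀, ∀ a, 0 ≤ a → -K * a ≤ regDensityReal γ f a := by
  obtain ⟨b₀, -, h0, -, hb0, -⟩ := hf.exists_pos_lt_top
  -- The first entry makes f lie above a line of slope -k through (b₀, f b₀) to the right of b₀. The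
  -- second gives b₀ ≤ γ k for every γ ≥ γ₀, so the cut-off point γ k used below lies in that
  -- region.
  set k := max (-(f b₀).toReal / b₀) (b₀ / γ₀) with hk
  have hk2 : b₀ ≤ γ₀ * k := by
    have : b₀ / γ₀ ≤ k := le_max_right _ _
    rw [div_le_iff₀ hγ₀] at this; linarith
  have hk0 : 0 < k := lt_of_lt_of_le (by positivity) (le_max_right _ _)
  have hk1 : ∀ b, f b < ⊤ → b₀ ≤ b → (f b₀).toReal - k * (b - b₀) ≤ (f b).toReal := by
    intro b hb hbb
    have h1 := (hf.convex_three hf.zero_lt_top hb h0.le hbb).2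
    rw [hf.zero] at h1
    simp only [sub_zero, EReal.toReal_zero, mul_zero, zero_add] at h1
    have h2 : -(f b₀).toReal / b₀ ≤ k := le_max_left _ _
    rw [div_le_iff₀ h0] at h2
    have h3 : b₀ * ((f b₀).toReal - k * (b - b₀)) ≤ b₀ * (f b).toReal := by nlinarith
    exact le_of_mul_le_mul_left h3 h0
  refine ⟨k, hk0.le, fun γ hγ a ha => ?_⟩
  have hγ0 : 0 < γ := lt_of_lt_of_le hγ₀ hγ
  have hbk : b₀ ≤ γ * k := hk2.trans (mul_le_mul_of_nonneg_right hγ hk0.le)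
  have : (moreau γ f 0).toReal - k * a ≤ (moreau γ f a).toReal := by
    refine hf.le_moreau_toReal hγ0 a fun b hb => ?_
    -- For each b it is enough to exhibit a competitor c for the envelope at 0. The choice is min(b,
    -- max(γ k, b - a)): moving down from b costs at most k per unit in f, by `hmid`, and the
    -- quadratic terms pay for it.
    suffices ∃ c, f c < ⊤ ∧
        (f c).toReal + c ^ 2 / (2 * γ) - k * a ≤ (f b).toReal + (a - b) ^ 2 / (2 * γ) by
      obtain ⟨c, hc, h⟩ := this
      have := hf.moreau_toReal_le hγ0 0 hc
      simp only [zero_sub, abs_neg, sq_abs] at *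
      linarith
    have hmid : ∀ c, b₀ ≤ c → c ≤ b → f c < ⊤ ∧ (f c).toReal ≤ (f b).toReal + k * (b - c) := by
      intro c h1 h2
      have h3 := hf.convex_three hb0 hb h1 h2
      refine ⟨h3.1, ?_⟩
      rcases (h1.trans h2).eq_or_lt with h | h
      · obtain rfl : c = b := le_antisymm h2 (h ▸ h1)
        simp
      · have h4 := hk1 b hb h.le
        have h5 := h3.2
        have h6 : (b - b₀) * (f c).toReal ≤ (b - b₀) * ((f b).toReal + k * (b - c)) := by
          nlinarith
        exact le_of_mul_le_mul_left h6 (by linarith)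
    rcases le_total b (γ * k) with h | h
    · refine ⟨b, hb, ?_⟩
      have e : (a - b) ^ 2 / (2 * γ) - b ^ 2 / (2 * γ) + k * a
        = a * (a + 2 * (γ * k - b)) / (2 * γ) := by field_simp; ring
      have : 0 ≤ a * (a + 2 * (γ * k - b)) / (2 * γ) := by
        have : 0 ≤ a + 2 * (γ * k - b) := by linarith
        positivity
      linarith
    · rcases le_total (b - a) (γ * k) with h' | h'
      · obtain ⟨h1, h2⟩ := hmid (γ * k) hbk h
        refine ⟨γ * k, h1, ?_⟩
        have e : (a - b) ^ 2 / (2 * γ) - (γ * k) ^ 2 / (2 * γ) + k * a - k * (b - γ * k)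
          = (b - a - γ * k) ^ 2 / (2 * γ) := by field_simp; ring
        have : 0 ≤ (b - a - γ * k) ^ 2 / (2 * γ) := by positivity
        linarith
      · obtain ⟨h1, h2⟩ := hmid (b - a) (hbk.trans h') (by linarith)
        refine ⟨b - a, h1, ?_⟩
        have : (b - a) ^ 2 = (a - b) ^ 2 := by ring
        rw [this]
        linarith
  have h3 : 0 ≤ γ / 2 * |a| ^ 2 := by positivity
  unfold regDensityReal
  linarith

end EnergyAssumption
end NonlocalDiffusion

end

noncomputable section
namespace NonlocalDiffusion
variable {d : ℕ}

/-! ### Convolution of an integrable kernel with a bounded Lipschitz function -/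

section Convolution

variable {F : Type*} [NormedAddCommGroup F] [NormedSpace ℝ F]

/-- The convolution `k * q`. -/
def conv (k : Space d → F) (q : Space d → ℝ) (x : Space d) : F := ∫ y, q y • k (x - y)

lemma continuous_of_lipschitz_bound {X Y : Type*} [SeminormedAddCommGroup X]
    [SeminormedAddCommGroup Y] {g : X → Y} {L : ℝ}
    (h : ∀ x y, ‖g x - g y‖ ≤ L * ‖x - y‖) : Continuous g :=
  (LipschitzWith.of_dist_le' (K := L) fun x y => by
    simpa [dist_eq_norm] using h x y).continuous

lemma norm_fderiv_le_of_lipschitz_bound {X Y : Type*} [NormedAddCommGroup X] [NormedSpace ℝ X]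
    [NormedAddCommGroup Y] [NormedSpace ℝ Y] {g : X → Y} {L : ℝ} (hL : 0 ≤ L)
    (h : ∀ x y, ‖g x - g y‖ ≤ L * ‖x - y‖) (x : X) : ‖fderiv ℝ g x‖ ≤ L := by
  have := norm_fderiv_le_of_lipschitz ℝ (f := g) (x₀ := x) (LipschitzWith.of_dist_le' (K := L)
    fun x y => by simpa [dist_eq_norm] using h x y)
  rwa [Real.coe_toNNReal _ hL] at this

lemma lipschitz_bound_of_fderiv_le {X Y : Type*} [NormedAddCommGroup X] [NormedSpace ℝ X]
    [NormedAddCommGroup Y] [NormedSpace ℝ Y] {g : X → Y} {L : ℝ} (hg : Differentiable ℝ g)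
    (h : ∀ x, ‖fderiv ℝ g x‖ ≤ L) (x y : X) : ‖g x - g y‖ ≤ L * ‖x - y‖ :=
  Convex.norm_image_sub_le_of_norm_fderiv_le (fun z _ => hg z) (fun z _ => h z) convex_univ
    (mem_univ y) (mem_univ x)

lemma conv_eq (k : Space d → F) (q : Space d → ℝ) (x : Space d) :
    conv k q x = ∫ y, q (x - y) • k y := by
  unfold conv
  rw [← integral_sub_left_eq_self (fun y => q y • k (x - y)) volume x]
  simp

lemma integrable_smul_of_bound {α : Type*} [MeasurableSpace α] {μ : Measure α} {k : α → F}
    {q : α → ℝ} {Q : ℝ} (hk : Integrable k μ) (hq : AEStronglyMeasurable q μ)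
    (hQ : ∀ x, |q x| ≤ Q) : Integrable (fun y => q y • k y) μ :=
  hk.bdd_smul Q hq (ae_of_all _ hQ)

lemma integrable_conv_integrand {k : Space d → F} {q : Space d → ℝ} {Q : ℝ} (hk : Integrable k)
    (hq : Continuous q) (hQ : ∀ x, |q x| ≤ Q) (x : Space d) :
    Integrable fun y => q y • k (x - y) :=
  integrable_smul_of_bound (hk.comp_sub_left x) hq.aestronglyMeasurable hQ

lemma integrable_conv_integrand' {k : Space d → F} {q : Space d → ℝ} {Q : ℝ} (hk : Integrable k)
    (hq : Continuous q) (hQ : ∀ x, |q x| ≤ Q) (x : Space d) :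
    Integrable fun y => q (x - y) • k y :=
  integrable_smul_of_bound hk (hq.comp (by fun_prop)).aestronglyMeasurable fun y => hQ _

lemma norm_conv_le {k : Space d → F} {q : Space d → ℝ} {Q : ℝ} (hk : Integrable k)
    (hQ : ∀ x, |q x| ≤ Q) (x : Space d) : ‖conv k q x‖ ≤ Q * ∫ y, ‖k y‖ := by
  rw [conv_eq, ← integral_const_mul]
  refine norm_integral_le_of_norm_le (hk.norm.const_mul Q) (ae_of_all _ fun y => ?_)
  rw [norm_smul]
  exact mul_le_mul_of_nonneg_right (hQ _) (norm_nonneg _)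

lemma norm_conv_sub_le {k : Space d → F} {q q' : Space d → ℝ} {Q D : ℝ} (hk : Integrable k)
    (hq : Continuous q) (hQ : ∀ x, |q x| ≤ Q) (hq' : Continuous q') (hQ' : ∀ x, |q' x| ≤ Q)
    (hD : ∀ x, |q x - q' x| ≤ D) (x : Space d) :
    ‖conv k q x - conv k q' x‖ ≤ D * ∫ y, ‖k y‖ := by
  rw [conv_eq, conv_eq, ← integral_sub (integrable_conv_integrand' hk hq hQ x)
    (integrable_conv_integrand' hk hq' hQ' x), ← integral_const_mul]
  refine norm_integral_le_of_norm_le (hk.norm.const_mul D) (ae_of_all _ fun y => ?_)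
  rw [← sub_smul, norm_smul]
  exact mul_le_mul_of_nonneg_right (hD _) (norm_nonneg _)

lemma norm_conv_sub_conv_le {k : Space d → F} {q : Space d → ℝ} {Q L : ℝ} (hk : Integrable k)
    (hQ : ∀ x, |q x| ≤ Q) (hL : ∀ x y, ‖q x - q y‖ ≤ L * ‖x - y‖) (x x' : Space d) :
    ‖conv k q x - conv k q x'‖ ≤ (L * ∫ y, ‖k y‖) * ‖x - x'‖ := by
  have hq := continuous_of_lipschitz_bound hL
  rw [conv_eq, conv_eq, ← integral_sub (integrable_conv_integrand' hk hq hQ x)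
    (integrable_conv_integrand' hk hq hQ x'), mul_right_comm, ← integral_const_mul]
  refine norm_integral_le_of_norm_le (hk.norm.const_mul _) (ae_of_all _ fun y => ?_)
  rw [← sub_smul, norm_smul]
  refine mul_le_mul_of_nonneg_right ((hL _ _).trans_eq ?_) (norm_nonneg _)
  simp

/-- The fundamental theorem of calculus for k along the segment from x to x + h, followed by Fubini.
-/
lemma conv_add_sub_conv [CompleteSpace F] {k : Space d → F} {q : Space d → ℝ} {Q : ℝ}
    (hk : ContDiff ℝ 1 k)
    (hki : Integrable k) (hki' : Integrable (fderiv ℝ k)) (hq : Continuous q)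
    (hQ : ∀ x, |q x| ≤ Q) (x h : Space d) :
    conv k q (x + h) - conv k q x = ∫ t in (0 : ℝ)..1, conv (fderiv ℝ k) q (x + t • h) h := by
  have hdk : Continuous (fderiv ℝ k) := hk.continuous_fderiv one_ne_zero
  have h1 : ∀ y, k (x + h - y) - k (x - y) =
      ∫ t in (0 : ℝ)..1, fderiv ℝ k (x + t • h - y) h := fun y => by
    have hder : ∀ t ∈ uIcc (0 : ℝ) 1, HasDerivAt (fun t : ℝ => k (x + t • h - y))
        (fderiv ℝ k (x + t • h - y) h) t := fun t _ => by
      have h2 : HasDerivAt (fun t : ℝ => x + t • h - y) h t := by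
        simpa using (((hasDerivAt_id t).smul_const h).const_add x).sub_const y
      exact ((hk.differentiable one_ne_zero _).hasFDerivAt).comp_hasDerivAt t h2
    rw [intervalIntegral.integral_eq_sub_of_hasDerivAt hder]
    · simp
    · exact Continuous.intervalIntegrable (by fun_prop) _ _
  unfold conv
  rw [← integral_sub (integrable_conv_integrand hki hq hQ _)
    (integrable_conv_integrand hki hq hQ _)]
  simp_rw [← smul_sub, h1, intervalIntegral.integral_of_le zero_le_one, ← integral_smul]
  rw [integral_integral_swap]
  · refine integral_congr_ae (ae_of_all _ fun t => ?_)
    simp only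
    rw [ContinuousLinearMap.integral_apply (integrable_conv_integrand hki' hq hQ _)]
    rfl
  · have hcont : Continuous fun z : Space d × ℝ => q z.1 • fderiv ℝ k (x + z.2 • h - z.1) h := by
      fun_prop
    change Integrable (fun z : Space d × ℝ => q z.1 • fderiv ℝ k (x + z.2 • h - z.1) h)
      (volume.prod (volume.restrict (Ioc 0 1)))
    rw [integrable_prod_iff' hcont.aestronglyMeasurable]
    have hint : ∀ t : ℝ, Integrable fun y => q y • fderiv ℝ k (x + t • h - y) h := fun t =>
      (integrable_conv_integrand hki' hq hQ (x + t • h)).apply_continuousLinearMap h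
    refine ⟨ae_of_all _ hint, ?_⟩
    refine Integrable.of_bound (C := Q * ‖h‖ * ∫ y, ‖fderiv ℝ k y‖) ?_ (ae_of_all _ fun t => ?_)
    · exact hcont.norm.stronglyMeasurable.integral_prod_left'.aestronglyMeasurable
    · rw [Real.norm_of_nonneg (integral_nonneg fun _ => norm_nonneg _),
        ← integral_sub_left_eq_self (fun y => ‖fderiv ℝ k y‖) volume (x + t • h),
        ← integral_const_mul]
      refine integral_mono (hint t).norm ((hki'.norm.comp_sub_left _).const_mul _) fun y => ?_
      simp only [norm_smul]
      calc ‖q y‖ * ‖fderiv ℝ k (x + t • h - y) h‖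
          ≤ Q * (‖fderiv ℝ k (x + t • h - y)‖ * ‖h‖) :=
            mul_le_mul (hQ y) (ContinuousLinearMap.le_opNorm _ _) (norm_nonneg _)
              ((abs_nonneg _).trans (hQ y))
        _ = _ := by ring

/-- Differentiation of the convolution falls on the kernel. -/
lemma hasFDerivAt_conv [CompleteSpace F] {k : Space d → F} {q : Space d → ℝ} {Q L : ℝ}
    (hk : ContDiff ℝ 1 k) (hki : Integrable k) (hki' : Integrable (fderiv ℝ k))
    (hQ : ∀ x, |q x| ≤ Q) (hL : ∀ x y, ‖q x - q y‖ ≤ L * ‖x - y‖) (x : Space d) :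
    HasFDerivAt (conv k q) (conv (fderiv ℝ k) q x) x := by
  have hq := continuous_of_lipschitz_bound hL
  set M := L * ∫ y, ‖fderiv ℝ k y‖
  have hlip := norm_conv_sub_conv_le (k := fderiv ℝ k) hki' hQ hL
  -- L is not assumed nonnegative. A negative Lipschitz constant is possible only if the space is a
  -- point.
  have hM : 0 ≤ M ∨ ∀ z : Space d, z = 0 := by
    by_cases h : ∀ z : Space d, z = 0
    · exact Or.inr h
    · push Not at h
      obtain ⟨z, hz⟩ := h
      left
      have := (norm_nonneg _).trans (hlip z 0)
      rw [sub_zero] at this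
      exact nonneg_of_mul_nonneg_left this (norm_pos_iff.2 hz)
  have hcont : Continuous (conv (fderiv ℝ k) q) := continuous_of_lipschitz_bound hlip
  rw [hasFDerivAt_iff_isLittleO_nhds_zero]
  -- The Lipschitz continuity of q passes to the convolution with Dk, so the first-order Taylor
  -- remainder is of order ‖h‖².
  refine Asymptotics.IsBigO.trans_isLittleO (g := fun h : Space d => ‖h‖ ^ 2) ?_ ?_
  · refine Asymptotics.IsBigO.of_bound M (Eventually.of_forall fun h => ?_)
    rw [conv_add_sub_conv hk hki hki' hq hQ]
    have e : conv (fderiv ℝ k) q x h = ∫ t in (0 : ℝ)..1, conv (fderiv ℝ k) q x h := by simp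
    rw [e, ← intervalIntegral.integral_sub]
    · have := intervalIntegral.norm_integral_le_of_norm_le_const (a := (0 : ℝ)) (b := 1)
        (f := fun t => conv (fderiv ℝ k) q (x + t • h) h - conv (fderiv ℝ k) q x h)
        (C := M * ‖‖h‖ ^ 2‖) fun t ht => ?_
      · simpa using this
      rw [uIoc_of_le zero_le_one] at ht
      rw [← sub_apply, Real.norm_of_nonneg (by positivity)]
      refine (ContinuousLinearMap.le_opNorm _ _).trans ?_
      rcases hM with hM | hM
      · calc _ ≤ M * ‖x + t • h - x‖ * ‖h‖ :=
              mul_le_mul_of_nonneg_right (hlip _ _) (norm_nonneg _)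
          _ = M * (t * ‖h‖) * ‖h‖ := by
              rw [add_sub_cancel_left, norm_smul, Real.norm_of_nonneg ht.1.le]
          _ ≤ M * (1 * ‖h‖) * ‖h‖ := by gcongr; exact ht.2
          _ = _ := by ring
      · simp [hM h]
    · exact Continuous.intervalIntegrable (by fun_prop) _ _
    · exact Continuous.intervalIntegrable (by fun_prop) _ _
  · exact Asymptotics.isLittleO_norm_pow_id one_lt_two

/-- Integrating a convolution against a finite measure. -/
lemma integral_conv [CompleteSpace F] {k : Space d → F} {q : Space d → ℝ} {Q : ℝ}
    (hk : Continuous k) (hki : Integrable k) (hq : Continuous q) (hQ : ∀ x, |q x| ≤ Q)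
    (μ : Measure (Space d)) [IsFiniteMeasure μ] :
    ∫ y, conv k q y ∂μ = ∫ x, q x • ∫ y, k (y - x) ∂μ := by
  unfold conv
  rw [integral_integral_swap]
  · simp_rw [integral_smul]
  · have hcont : Continuous fun z : Space d × Space d => q z.2 • k (z.1 - z.2) := by
      fun_prop
    change Integrable (fun z : Space d × Space d => q z.2 • k (z.1 - z.2)) (μ.prod volume)
    rw [integrable_prod_iff hcont.aestronglyMeasurable]
    refine ⟨ae_of_all _ fun y => integrable_conv_integrand hki hq hQ y, ?_⟩
    refine Integrable.of_bound (C := Q * ∫ y, ‖k y‖)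
      hcont.norm.stronglyMeasurable.integral_prod_right.aestronglyMeasurable
      (ae_of_all _ fun y => ?_)
    rw [Real.norm_of_nonneg (integral_nonneg fun _ => norm_nonneg _),
      ← integral_sub_left_eq_self (fun y => ‖k y‖) volume y, ← integral_const_mul]
    refine integral_mono (integrable_conv_integrand hki hq hQ y).norm
      ((hki.norm.comp_sub_left _).const_mul _) fun x => ?_
    simp only [norm_smul]
    exact mul_le_mul_of_nonneg_right (hQ x) (norm_nonneg _)

end Convolution

/-! ### Smoothing a measure -/

section Smoothing

variable {F : Type*} [NormedAddCommGroup F] [NormedSpace ℝ F]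

/-- The convolution `k * μ` of a kernel with a measure. -/
def smooth (k : Space d → F) (μ : Measure (Space d)) (x : Space d) : F := ∫ y, k (x - y) ∂μ

variable {μ : Measure (Space d)} [IsProbabilityMeasure μ]

lemma norm_smooth_le {k : Space d → F} {B : ℝ} (hB : ∀ x, ‖k x‖ ≤ B) (x : Space d) :
    ‖smooth k μ x‖ ≤ B := by
  unfold smooth
  simpa using norm_integral_le_of_norm_le_const (μ := μ) (f := fun y => k (x - y))
    (ae_of_all _ fun y => hB (x - y))

lemma integrable_smooth_integrand {F : Type*} [NormedAddCommGroup F] {k : Space d → F} {B : ℝ} (hk : Continuous k)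
    (hB : ∀ x, ‖k x‖ ≤ B) (x : Space d) : Integrable (fun y => k (x - y)) μ :=
  Integrable.of_bound (C := B) (hk.comp (by fun_prop)).aestronglyMeasurable
    (ae_of_all _ fun y => hB _)

lemma hasFDerivAt_smooth {k : Space d → F} {B B' : ℝ} (hk : ContDiff ℝ 1 k)
    (hB : ∀ x, ‖k x‖ ≤ B) (hB' : ∀ x, ‖fderiv ℝ k x‖ ≤ B') (x : Space d) :
    HasFDerivAt (smooth k μ) (smooth (fderiv ℝ k) μ x) x := by
  have hdk : Continuous (fderiv ℝ k) := hk.continuous_fderiv one_ne_zero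
  refine hasFDerivAt_integral_of_dominated_of_fderiv_le (s := univ) (bound := fun _ => B')
    (F' := fun x y => fderiv ℝ k (x - y)) Filter.univ_mem
    (Eventually.of_forall fun x => (hk.continuous.comp (by fun_prop)).aestronglyMeasurable)
    (integrable_smooth_integrand hk.continuous hB x)
    (hdk.comp (by fun_prop)).aestronglyMeasurable
    (ae_of_all _ fun y x _ => hB' _) (integrable_const _) (ae_of_all _ fun y x _ => ?_)
  have := ((hk.differentiable one_ne_zero (x - y)).hasFDerivAt).comp x
    ((hasFDerivAt_id x).sub_const y)
  simpa [Function.comp_def] using this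

lemma norm_smooth_sub_le {k : Space d → F} {B L : ℝ} (hB : ∀ x, ‖k x‖ ≤ B)
    (hL : ∀ x y, ‖k x - k y‖ ≤ L * ‖x - y‖) (x x' : Space d) :
    ‖smooth k μ x - smooth k μ x'‖ ≤ L * ‖x - x'‖ := by
  have hk := continuous_of_lipschitz_bound hL
  unfold smooth
  rw [← integral_sub (integrable_smooth_integrand hk hB x) (integrable_smooth_integrand hk hB x')]
  simpa using norm_integral_le_of_norm_le_const (μ := μ) (f := fun y => k (x - y) - k (x' - y))
    (C := L * ‖x - x'‖) (ae_of_all _ fun y => by simpa using hL (x - y) (x' - y))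

/-- Young's inequality for L¹ convolved with a probability measure: Tonelli and translation
invariance. -/
lemma integrable_smooth {k : Space d → F} (hk : Continuous k) (hki : Integrable k) :
    Integrable (smooth k μ) ∧ ∫ x, ‖smooth k μ x‖ ≤ ∫ x, ‖k x‖ := by
  have hcont : Continuous fun z : Space d × Space d => k (z.1 - z.2) := by fun_prop
  have hint : Integrable (fun z : Space d × Space d => k (z.1 - z.2)) (volume.prod μ) := by
    rw [integrable_prod_iff' hcont.aestronglyMeasurable]
    refine ⟨ae_of_all _ fun y => hki.comp_sub_right y, ?_⟩
    have : ∀ y, ∫ x, ‖k (x - y)‖ = ∫ x, ‖k x‖ := fun y =>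
      integral_sub_right_eq_self (fun x => ‖k x‖) y
    simp only [this]
    exact integrable_const _
  refine ⟨hint.integral_prod_left, ?_⟩
  calc ∫ x, ‖smooth k μ x‖ ≤ ∫ x, ∫ y, ‖k (x - y)‖ ∂μ :=
        integral_mono hint.integral_prod_left.norm hint.norm.integral_prod_left
          fun x => norm_integral_le_integral_norm _
    _ = ∫ y, (∫ x, ‖k (x - y)‖) ∂μ := integral_integral_swap hint.norm
    _ = ∫ x, ‖k x‖ := by
        have : ∀ y, ∫ x, ‖k (x - y)‖ = ∫ x, ‖k x‖ := fun y =>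
          integral_sub_right_eq_self (fun x => ‖k x‖) y
        simp [this]

end Smoothing

end NonlocalDiffusion

end

noncomputable section
namespace NonlocalDiffusion
variable {d : ℕ}

/-! ### The determinant near the identity -/

/-- Differentiability comes from the Leibniz formula. The derivative is then read off along lines
from det(1 + tM) = 1 + t tr M + t² P(t) with P a polynomial. -/
lemma hasFDerivAt_det_one_add (d : ℕ) :
    ∃ D : (Space d →L[ℝ] Space d) →L[ℝ] ℝ,
      HasFDerivAt (fun B : Space d →L[ℝ] Space d => (1 + B).det) D 0 ∧
      ∀ A, D A = LinearMap.trace ℝ (Space d) (A : Space d →ₗ[ℝ] Space d) := by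
  let b := (EuclideanSpace.basisFun (Fin d) ℝ).toBasis
  let M : (Space d →L[ℝ] Space d) →ₗ[ℝ] Matrix (Fin d) (Fin d) ℝ :=
    (LinearMap.toMatrix b b).toLinearMap ∘ₗ ContinuousLinearMap.coeLM ℝ
  have hM : ∀ i j, Differentiable ℝ fun B => M B i j := fun i j => by
    have : Differentiable ℝ (LinearMap.toContinuousLinearMap
      ((LinearMap.proj j ∘ₗ LinearMap.proj i) ∘ₗ M : (Space d →L[ℝ] Space d) →ₗ[ℝ] ℝ)) :=
      ContinuousLinearMap.differentiable _
    exact this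
  have hdet : ∀ B : Space d →L[ℝ] Space d, (1 + B).det = (1 + M B).det := fun B => by
    rw [ContinuousLinearMap.det, ← LinearMap.det_toMatrix b]
    congr 1
    simp [M]
  have hdiff : Differentiable ℝ fun B : Space d →L[ℝ] Space d => (1 + B).det := by
    simp_rw [hdet, Matrix.det_apply]
    refine Differentiable.fun_sum fun σ _ => Differentiable.const_smul ?_ _
    have h1 : ∀ i j, Differentiable ℝ fun B => (1 + M B) i j := fun i j =>
      (differentiable_const _).add (hM i j)
    exact fun B => (HasFDerivAt.finsetProd (g := fun i B => (1 + M B) (σ i) i)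
      fun i _ => (h1 (σ i) i B).hasFDerivAt).differentiableAt
  refine ⟨_, (hdiff 0).hasFDerivAt, fun A => ?_⟩
  have h1 : HasDerivAt (fun t : ℝ => (1 + t • A).det)
      (fderiv ℝ (fun B : Space d →L[ℝ] Space d => (1 + B).det) 0 A) 0 := by
    have h2 : HasDerivAt (fun t : ℝ => t • A) A 0 := by
      simpa using (hasDerivAt_id (0 : ℝ)).smul_const A
    have h3 : HasFDerivAt (fun B : Space d →L[ℝ] Space d => (1 + B).det)
      (fderiv ℝ (fun B : Space d →L[ℝ] Space d => (1 + B).det) 0) ((0 : ℝ) • A) := by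
      exact (zero_smul ℝ A).symm ▸ (hdiff 0).hasFDerivAt
    exact h3.comp_hasDerivAt 0 h2
  have h4 : HasDerivAt (fun t : ℝ => (1 + t • A).det) (M A).trace 0 := by
    have e : (fun t : ℝ => (1 + t • A).det) = fun t => 1 + (M A).trace * t +
        (1 + (Polynomial.X : Polynomial ℝ) • (M A).map Polynomial.C).det.divX.divX.eval t
          * t ^ 2 := by
      ext t
      rw [hdet, map_smul, Matrix.det_one_add_smul]
    rw [e]
    set P := (1 + (Polynomial.X : Polynomial ℝ) • (M A).map Polynomial.C).det.divX.divX
    have h5 := (P.hasDerivAt (0 : ℝ)).mul (hasDerivAt_pow 2 (0 : ℝ))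
    have h6 := (((hasDerivAt_id (0 : ℝ)).const_mul (M A).trace).const_add 1).add h5
    simpa using! h6
  rw [h1.unique h4, LinearMap.trace_eq_matrix_trace ℝ b]
  rfl

/-- log det(1 + B) = tr B + o(‖B‖) at 0, hence the threshold h₀ works for all A in a bounded set at
once. The slack e h, summed over the time steps, is at most e times the length of the time interval.
-/
lemma exists_exp_le_det (d : ℕ) {L e : ℝ} (hL : 0 ≤ L) (he : 0 < e) :
    ∃ h₀ > 0, ∀ h, 0 ≤ h → h ≤ h₀ → ∀ A : Space d →L[ℝ] Space d, ‖A‖ ≤ L →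
      Real.exp (h * LinearMap.trace ℝ (Space d) (A : Space d →ₗ[ℝ] Space d) - e * h)
        ≤ (1 + h • A).det := by
  obtain ⟨D, hD, hDt⟩ := hasFDerivAt_det_one_add d
  have h0 : (1 + (0 : Space d →L[ℝ] Space d)).det = 1 := by
    rw [add_zero]; exact LinearMap.det_id
  have hlog : HasFDerivAt (fun B : Space d →L[ℝ] Space d => Real.log (1 + B).det) D 0 := by
    have := hD.log (by rw [h0]; exact one_ne_zero)
    rw [h0] at this
    simpa using this
  have hpos : ∀ᶠ B in 𝓝 (0 : Space d →L[ℝ] Space d), 0 < (1 + B).det :=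
    hD.continuousAt.eventually_mem (by rw [h0]; exact Ioi_mem_nhds one_pos)
  have hle := (hasFDerivAt_iff_isLittleO_nhds_zero.1 hlog).bound
    (show 0 < e / (L + 1) by positivity)
  obtain ⟨r, hr, hball⟩ := Metric.eventually_nhds_iff.1 (hle.and hpos)
  refine ⟨r / (2 * (L + 1)), by positivity, fun h hh hhr A hA => ?_⟩
  have hnorm : ‖h • A‖ ≤ h * L := by
    rw [norm_smul, Real.norm_of_nonneg hh]; gcongr
  have hlt : ‖h • A‖ < r := by
    refine lt_of_le_of_lt hnorm ?_
    rw [le_div_iff₀ (by positivity)] at hhr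
    nlinarith
  obtain ⟨h1, h2⟩ := hball (by simpa using hlt)
  simp only [zero_add] at h1 h2
  rw [h0, Real.log_one, sub_zero, map_smul, hDt, smul_eq_mul] at h1
  rw [← Real.exp_log h2]
  refine Real.exp_le_exp.2 ?_
  have h3 := (abs_le.1 h1).1
  have h4 : e / (L + 1) * ‖h • A‖ ≤ e * h := by
    calc e / (L + 1) * ‖h • A‖ ≤ e / (L + 1) * (h * (L + 1)) := by
          gcongr
          exact hnorm.trans (by nlinarith)
      _ = e * h := by field_simp
  linarith

/-- Change of variables for a perturbation of the identity. -/
lemma lintegral_comp_le_of_det {b : Space d → Space d} {h L : ℝ} {J : Space d → ℝ≥0∞}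
    (hb : Differentiable ℝ b) (hL : ∀ x y, ‖b x - b y‖ ≤ L * ‖x - y‖) (hh : 0 ≤ h)
    (hhL : h * L < 1) (hJ : ∀ x, J x ≤ ENNReal.ofReal (1 + h • fderiv ℝ b x).det)
    (g : Space d → ℝ≥0∞) :
    ∫⁻ x, J x * g (x + h • b x) ≤ ∫⁻ x, g x := by
  have hd : ∀ x, HasFDerivAt (fun x => x + h • b x) (1 + h • fderiv ℝ b x) x := fun x =>
    (hasFDerivAt_id x).add ((hb x).hasFDerivAt.const_smul h)
  -- h b is a strict contraction, so the identity plus h b is injective. Surjectivity is not needed,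
  -- since the image integral is at most the full one.
  have hinj : Function.Injective fun x => x + h • b x := by
    intro x y hxy
    by_contra hne
    have hpos : 0 < ‖x - y‖ := norm_pos_iff.2 (sub_ne_zero.2 hne)
    have e : x - y = -(h • (b x - b y)) := by
      have : x + h • b x = y + h • b y := hxy
      rw [smul_sub, neg_sub, sub_eq_sub_iff_add_eq_add, this]
      abel
    have : ‖x - y‖ ≤ h * (L * ‖x - y‖) := by
      conv_lhs => rw [e, norm_neg, norm_smul, Real.norm_of_nonneg hh]
      gcongr
      exact hL x y
    nlinarith
  calc ∫⁻ x, J x * g (x + h • b x)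
      ≤ ∫⁻ x in univ, ENNReal.ofReal |(1 + h • fderiv ℝ b x).det| * g (x + h • b x) := by
        rw [Measure.restrict_univ]
        refine lintegral_mono fun x => mul_le_mul_left ((hJ x).trans ?_) _
        exact ENNReal.ofReal_le_ofReal (le_abs_self _)
    _ = ∫⁻ x in (fun x => x + h • b x) '' univ, g x :=
        (lintegral_image_eq_lintegral_abs_det_fderiv_mul volume MeasurableSet.univ
          (fun x _ => (hd x).hasFDerivWithinAt) hinj.injOn g).symm
    _ ≤ ∫⁻ x, g x := setLIntegral_le_lintegral _ _

/-! ### Mollification of Lipschitz functions -/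

/-- A smooth probability density supported in the ball of radius `η`. -/
structure IsBump (κ : Space d → ℝ) (η : ℝ) : Prop where
  contDiff : ContDiff ℝ ∞ κ
  compactSupport : HasCompactSupport κ
  nonneg : ∀ z, 0 ≤ κ z
  integral_eq_one : ∫ z, κ z = 1
  norm_le : ∀ z, κ z ≠ 0 → ‖z‖ ≤ η

lemma exists_isBump (d : ℕ) {η : ℝ} (hη : 0 < η) : ∃ κ : Space d → ℝ, IsBump κ η := by
  let B : ContDiffBump (0 : Space d) := ⟨η / 2, η, by positivity, by linarith⟩
  refine ⟨B.normed volume, B.contDiff_normed, B.hasCompactSupport_normed, B.nonneg_normed,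
    B.integral_normed, fun z hz => ?_⟩
  have : z ∈ Function.support (B.normed volume) := hz
  rw [B.support_normed_eq] at this
  simpa using (mem_ball_zero_iff.1 this).le

/-- The mollification of `ψ` by `κ`. -/
def moll (κ : Space d → ℝ) (ψ : Space d → ℝ) (x : Space d) : ℝ := ∫ z, κ z * ψ (x - z)

namespace IsBump

variable {κ : Space d → ℝ} {η : ℝ} {ψ : Space d → ℝ}

lemma integrable_mul (hκ : IsBump κ η) (hψ : Continuous ψ) : Integrable fun z => κ z * ψ z :=
  (hκ.contDiff.continuous.mul hψ).integrable_of_hasCompactSupport hκ.compactSupport.mul_right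

lemma integrable (hκ : IsBump κ η) : Integrable κ :=
  hκ.contDiff.continuous.integrable_of_hasCompactSupport hκ.compactSupport

lemma radius_nonneg (hκ : IsBump κ η) : 0 ≤ η := by
  by_contra! h
  have : κ = 0 := by
    ext z
    by_contra hz
    linarith [hκ.norm_le z hz, norm_nonneg z]
  have h1 := hκ.integral_eq_one
  simp [this] at h1

lemma abs_integral_le (hκ : IsBump κ η) {g : Space d → ℝ} {D : ℝ}
    (h : ∀ z, ‖z‖ ≤ η → |g z| ≤ D) : |∫ z, κ z * g z| ≤ D := by
  have : ‖∫ z, κ z * g z‖ ≤ ∫ z, κ z * D := by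
    refine norm_integral_le_of_norm_le (hκ.integrable.mul_const D) (ae_of_all _ fun z => ?_)
    rw [norm_mul, Real.norm_of_nonneg (hκ.nonneg z)]
    by_cases hz : κ z = 0
    · simp [hz]
    · exact mul_le_mul_of_nonneg_left (h z (hκ.norm_le z hz)) (hκ.nonneg z)
  rwa [integral_mul_const, hκ.integral_eq_one, one_mul] at this

lemma abs_moll_sub_le (hκ : IsBump κ η) {Λ : ℝ} (hΛ : 0 ≤ Λ)
    (hψ : ∀ x y, ‖ψ x - ψ y‖ ≤ Λ * ‖x - y‖) (x : Space d) : |moll κ ψ x - ψ x| ≤ Λ * η := by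
  have hc := continuous_of_lipschitz_bound hψ
  have e : moll κ ψ x - ψ x = ∫ z, κ z * (ψ (x - z) - ψ x) := by
    simp_rw [mul_sub]
    rw [integral_sub (hκ.integrable_mul (ψ := fun z => ψ (x - z)) (by fun_prop)) (hκ.integrable.mul_const _),
      integral_mul_const, hκ.integral_eq_one, one_mul]
    rfl
  rw [e]
  refine hκ.abs_integral_le fun z hz => ?_
  refine (hψ _ _).trans ?_
  simpa using mul_le_mul_of_nonneg_left hz hΛ

lemma moll_sub_moll (hκ : IsBump κ η) {ψ' : Space d → ℝ} (hψ : Continuous ψ)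
    (hψ' : Continuous ψ') (x x' : Space d) :
    moll κ ψ x - moll κ ψ' x' = ∫ z, κ z * (ψ (x - z) - ψ' (x' - z)) := by
  simp_rw [mul_sub]
  rw [integral_sub (hκ.integrable_mul (ψ := fun z => ψ (x - z)) (by fun_prop))
    (hκ.integrable_mul (ψ := fun z => ψ' (x' - z)) (by fun_prop))]
  rfl

lemma moll_lipschitz (hκ : IsBump κ η) {Λ : ℝ}
    (hψ : ∀ x y, ‖ψ x - ψ y‖ ≤ Λ * ‖x - y‖) (x y : Space d) :
    ‖moll κ ψ x - moll κ ψ y‖ ≤ Λ * ‖x - y‖ := by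
  have hc := continuous_of_lipschitz_bound hψ
  rw [hκ.moll_sub_moll hc hc]
  refine hκ.abs_integral_le fun z _ => ?_
  simpa using hψ (x - z) (y - z)

lemma contDiff_moll (hκ : IsBump κ η) (hψ : Continuous ψ) : ContDiff ℝ ∞ (moll κ ψ) :=
  HasCompactSupport.contDiff_convolution_left (n := ⊤) (ContinuousLinearMap.lsmul ℝ ℝ)
    hκ.compactSupport hκ.contDiff (hψ.locallyIntegrable (μ := volume))

/-- The difference of the two derivatives is the derivative of the mollification of the translation
difference u ↦ ψ(u + w) - ψ(u), which is bounded by Λ‖w‖. Letting the derivative fall on κ gives the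
bound. K depends on κ alone, so it survives iteration over ψ. -/
lemma exists_fderiv_moll_lipschitz (hκ : IsBump κ η) : ∃ K : ℝ, 0 ≤ K ∧
    ∀ (ψ : Space d → ℝ) (Λ : ℝ), 0 ≤ Λ → (∀ x y, ‖ψ x - ψ y‖ ≤ Λ * ‖x - y‖) →
      ∀ x y, ‖fderiv ℝ (moll κ ψ) x - fderiv ℝ (moll κ ψ) y‖ ≤ Λ * K * ‖x - y‖ := by
  refine ⟨∫ y, ‖fderiv ℝ κ y‖, integral_nonneg fun _ => norm_nonneg _,
    fun ψ Λ hΛ hψ x y => ?_⟩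
  have hc := continuous_of_lipschitz_bound hψ
  set w := x - y
  set q : Space d → ℝ := fun u => ψ (u + w) - ψ u
  have hqb : ∀ u, |q u| ≤ Λ * ‖w‖ := fun u => by simpa [q] using hψ (u + w) u
  have hqc : Continuous q := by fun_prop
  have hqL : ∀ u v, ‖q u - q v‖ ≤ (2 * Λ) * ‖u - v‖ := fun u v => by
    have h1 := hψ (u + w) (v + w)
    have h2 := hψ u v
    rw [add_sub_add_right_eq_sub] at h1
    have e : q u - q v = (ψ (u + w) - ψ (v + w)) - (ψ u - ψ v) := by simp [q]; ring
    rw [e]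
    refine (norm_sub_le _ _).trans ?_
    linarith
  have hd := hasFDerivAt_conv (hκ.contDiff.of_le (by exact_mod_cast le_top)) hκ.integrable
    ((hκ.contDiff.continuous_fderiv (by simp)).integrable_of_hasCompactSupport
      (hκ.compactSupport.fderiv ℝ)) hqb hqL y
  have hdm : ∀ u, HasFDerivAt (moll κ ψ) (fderiv ℝ (moll κ ψ) u) u := fun u =>
    ((hκ.contDiff_moll hc).differentiable (by simp) u).hasFDerivAt
  have hd2 : HasFDerivAt (conv κ q) (fderiv ℝ (moll κ ψ) x - fderiv ℝ (moll κ ψ) y) y := by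
    have e : conv κ q = fun u => moll κ ψ (u + w) - moll κ ψ u := by
      ext u
      rw [hκ.moll_sub_moll hc hc, conv_eq]
      refine integral_congr_ae (ae_of_all _ fun z => ?_)
      simp only [q, smul_eq_mul]
      rw [mul_comm, sub_add_eq_add_sub]
    rw [e]
    have h1 : HasFDerivAt (fun u => moll κ ψ (u + w)) (fderiv ℝ (moll κ ψ) x) y := by
      have h2 := hdm (y + w)
      rw [show y + w = x by simp [w]] at h2
      have h3 : HasFDerivAt (fun u => u + w) (ContinuousLinearMap.id ℝ (Space d)) y :=
        (hasFDerivAt_id y).add_const w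
      have h4 : HasFDerivAt (moll κ ψ) (fderiv ℝ (moll κ ψ) x) (y + w) := by
        rw [show y + w = x by simp [w]]; exact hdm x
      simpa [Function.comp_def] using h4.comp y h3
    exact h1.sub (hdm y)
  rw [hd2.unique hd]
  refine (norm_conv_le ((hκ.contDiff.continuous_fderiv
    (by simp)).integrable_of_hasCompactSupport (hκ.compactSupport.fderiv ℝ)) hqb y).trans_eq ?_
  ring

/-- The difference moll κ ψ - ψ is an average of ψ(· - z) - ψ over ‖z‖ ≤ η, and each of these is
Mη-Lipschitz because Dψ is M-Lipschitz. Hence so is the difference. -/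
lemma norm_fderiv_moll_sub_le (hκ : IsBump κ η) {Λ M : ℝ} (hM : 0 ≤ M)
    (hψd : Differentiable ℝ ψ) (hψ : ∀ x y, ‖ψ x - ψ y‖ ≤ Λ * ‖x - y‖)
    (hψ' : ∀ x y, ‖fderiv ℝ ψ x - fderiv ℝ ψ y‖ ≤ M * ‖x - y‖) (x : Space d) :
    ‖fderiv ℝ (moll κ ψ) x - fderiv ℝ ψ x‖ ≤ M * η := by
  have hc := continuous_of_lipschitz_bound hψ
  have hdm := (hκ.contDiff_moll hc).differentiable (by simp)
  rw [← fderiv_sub (hdm x) (hψd x)]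
  refine norm_fderiv_le_of_lipschitz_bound (mul_nonneg hM hκ.radius_nonneg) (fun u v => ?_) x
  have e : (moll κ ψ - ψ) u - (moll κ ψ - ψ) v =
      ∫ z, κ z * ((ψ (u - z) - ψ u) - (ψ (v - z) - ψ v)) := by
    have h1 : (moll κ ψ - ψ) u - (moll κ ψ - ψ) v =
      (moll κ ψ u - moll κ ψ v) - (ψ u - ψ v) * ∫ z, κ z := by
      rw [hκ.integral_eq_one]; simp; ring
    rw [h1, hκ.moll_sub_moll hc hc, ← integral_const_mul, ← integral_sub]
    · refine integral_congr_ae (ae_of_all _ fun z => ?_)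
      simp only; ring
    · exact hκ.integrable_mul (by fun_prop)
    · exact hκ.integrable.const_mul _
  rw [e]
  refine hκ.abs_integral_le fun z hz => ?_
  have hdiff : ∀ y, HasFDerivAt (fun y => ψ (y - z) - ψ y)
      (fderiv ℝ ψ (y - z) - fderiv ℝ ψ y) y := fun y => by
    have h1 := (hψd (y - z)).hasFDerivAt.comp y ((hasFDerivAt_id y).sub_const z)
    have h2 := h1.sub (hψd y).hasFDerivAt
    simpa [Function.comp_def] using! h2
  refine lipschitz_bound_of_fderiv_le (g := fun y => ψ (y - z) - ψ y)
    (fun y => (hdiff y).differentiableAt) (fun y => ?_) u v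
  rw [(hdiff y).fderiv]
  refine (hψ' _ _).trans ?_
  simpa using mul_le_mul_of_nonneg_left hz hM

/-- Mollification almost commutes with a perturbation of the identity. -/
lemma abs_moll_comp_sub_le (hκ : IsBump κ η) {Λ L h : ℝ} {b : Space d → Space d} (hΛ : 0 ≤ Λ)
    (hL0 : 0 ≤ L) (hh : 0 ≤ h) (hψ : ∀ x y, ‖ψ x - ψ y‖ ≤ Λ * ‖x - y‖)
    (hb : ∀ x y, ‖b x - b y‖ ≤ L * ‖x - y‖) (x : Space d) :
    |moll κ (fun y => ψ (y + h • b y)) x - moll κ ψ (x + h • b x)| ≤ Λ * (h * (L * η)) := by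
  have hc := continuous_of_lipschitz_bound hψ
  have hbc := continuous_of_lipschitz_bound hb
  rw [hκ.moll_sub_moll (ψ := fun y => ψ (y + h • b y)) (by fun_prop) hc]
  refine hκ.abs_integral_le fun z hz => (hψ _ _).trans ?_
  gcongr
  rw [show x - z + h • b (x - z) - (x + h • b x - z) = h • (b (x - z) - b x) by
    rw [smul_sub]; abel, norm_smul, Real.norm_of_nonneg hh]
  gcongr
  refine (hb _ _).trans ?_
  gcongr
  simpa using hz

end IsBump

end NonlocalDiffusion

end

noncomputable section
namespace NonlocalDiffusion
variable {d : ℕ}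

/-! ### Curves of measures transported by a Lipschitz drift -/

lemma continuousOn_of_modulus {m G : ℝ → ℝ} {T K : ℝ} (hG : ContinuousOn G (Icc 0 T))
    (h : ∀ s t, 0 ≤ s → s ≤ t → t ≤ T → |m t - m s| ≤ K * (G t - G s)) :
    ContinuousOn m (Icc 0 T) := by
  have h' : ∀ s ∈ Icc 0 T, ∀ t ∈ Icc 0 T, |m t - m s| ≤ |K| * |G t - G s| := by
    intro s hs t ht
    rw [← abs_mul]
    rcases le_total s t with hst | hst
    · exact (h s t hs.1 hst ht.2).trans (le_abs_self _)
    · rw [abs_sub_comm]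
      refine (h t s ht.1 hst hs.2).trans ((neg_le_abs _).trans' ?_)
      linarith
  intro s hs
  have h1 : Tendsto (fun t => |K| * |G t - G s|) (𝓝[Icc 0 T] s) (𝓝 0) := by
    have : ContinuousWithinAt (fun t => |K| * |G t - G s|) (Icc 0 T) s :=
      continuousWithinAt_const.mul ((hG s hs).sub continuousWithinAt_const).abs
    rw [ContinuousWithinAt] at this
    simpa only [sub_self, abs_zero, mul_zero] using this
  rw [ContinuousWithinAt, tendsto_iff_norm_sub_tendsto_zero]
  refine squeeze_zero' (Eventually.of_forall fun _ => norm_nonneg _) ?_ h1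
  filter_upwards [self_mem_nhdsWithin] with t ht
  exact h' s hs t ht

/-- The error of the left-endpoint rectangle rule. It has the form (step) × (increment of G), which
sums over a partition to at most mesh × total increment and therefore tends to 0. -/
lemma abs_intervalIntegral_sub_mul_le {m G : ℝ → ℝ} {T K : ℝ} (hG : ContinuousOn G (Icc 0 T))
    (hGm : ∀ s t, 0 ≤ s → s ≤ t → t ≤ T → G s ≤ G t) (hK : 0 ≤ K)
    (h : ∀ s t, 0 ≤ s → s ≤ t → t ≤ T → |m t - m s| ≤ K * (G t - G s)) {s t : ℝ} (hs : 0 ≤ s)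
    (hst : s ≤ t) (ht : t ≤ T) :
    |(∫ u in s..t, m u) - (t - s) * m s| ≤ (t - s) * (K * (G t - G s)) := by
  have hm := continuousOn_of_modulus hG h
  have hi : IntervalIntegrable m volume s t :=
    (hm.mono (by rw [uIcc_of_le hst]; exact Icc_subset_Icc hs ht)).intervalIntegrable
  have e : (t - s) * m s = ∫ _ in s..t, m s := by simp
  rw [e, ← intervalIntegral.integral_sub hi intervalIntegrable_const]
  have := intervalIntegral.norm_integral_le_of_norm_le_const (a := s) (b := t)
    (f := fun u => m u - m s) (C := K * (G t - G s)) fun u hu => ?_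
  · rw [abs_of_nonneg (sub_nonneg.2 hst), mul_comm] at this
    exact this
  · rw [uIoc_of_le hst] at hu
    refine (h s u hs hu.1.le (hu.2.trans ht)).trans ?_
    have := hGm u t (hs.trans hu.1.le) hu.2 ht
    gcongr

/-- `μ` and `ν` are at distance at most `c` in duality with Lipschitz functions. -/
def LipClose (μ ν : Measure (Space d)) (c : ℝ) : Prop :=
  ∀ (ψ : Space d → ℝ) (Λ : ℝ), 0 ≤ Λ → (∀ x y, ‖ψ x - ψ y‖ ≤ Λ * ‖x - y‖) →
    |∫ x, ψ x ∂μ - ∫ x, ψ x ∂ν| ≤ Λ * c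

/-- A curve `ρ` of probability measures on `[0,T]` and a drift `b`, which is bounded by `B` and
`L`-Lipschitz; the modulus of continuity in time is controlled by the increments of a continuous
function `G`. -/
structure LipDrift (T : ℝ) (ρ : ℝ → Measure (Space d)) (b : ℝ → Space d → Space d)
    (G : ℝ → ℝ) (B L C : ℝ) : Prop where
  B_nonneg : 0 ≤ B
  L_nonneg : 0 ≤ L
  C_nonneg : 0 ≤ C
  prob : ∀ t ∈ Icc 0 T, IsProbabilityMeasure (ρ t)
  moment : ∀ t ∈ Icc 0 T, Integrable (fun x => ‖x‖) (ρ t)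
  sub_le : ∀ s t, 0 ≤ s → s ≤ t → t ≤ T → t - s ≤ G t - G s
  cont : ContinuousOn G (Icc 0 T)
  transport : ∀ s t, 0 ≤ s → s ≤ t → t ≤ T → LipClose (ρ t) (ρ s) (G t - G s)
  bound : ∀ t ∈ Icc 0 T, ∀ x, ‖b t x‖ ≤ B
  lip : ∀ t ∈ Icc 0 T, ∀ x y, ‖b t x - b t y‖ ≤ L * ‖x - y‖
  time : ∀ s t, 0 ≤ s → s ≤ t → t ≤ T → ∀ x, ‖b t x - b s x‖ ≤ C * (G t - G s)

/-- A curve `ρ` of probability measures on `[0,T]` transported by the drift `b`. -/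
structure DriftCurve (T : ℝ) (ρ : ℝ → Measure (Space d)) (b : ℝ → Space d → Space d)
    (G : ℝ → ℝ) (B L C : ℝ) : Prop extends LipDrift T ρ b G B L C where
  weak : ∀ s t, 0 ≤ s → s ≤ t → t ≤ T → ∀ (ψ : Space d → ℝ) (Λ : ℝ), ContDiff ℝ ∞ ψ → 0 ≤ Λ →
    (∀ x y, ‖ψ x - ψ y‖ ≤ Λ * ‖x - y‖) →
    ∫ x, ψ x ∂(ρ t) - ∫ x, ψ x ∂(ρ s) = ∫ u in s..t, ∫ x, fderiv ℝ ψ x (b u x) ∂(ρ u)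

lemma abs_integral_sub_integral_le_of_forall {α : Type*} [MeasurableSpace α] {μ : Measure α}
    [IsProbabilityMeasure μ] {f g : α → ℝ} {c : ℝ} (hf : Integrable f μ) (hg : Integrable g μ)
    (h : ∀ x, |f x - g x| ≤ c) : |∫ x, f x ∂μ - ∫ x, g x ∂μ| ≤ c := by
  rw [← integral_sub hf hg]
  simpa using norm_integral_le_of_norm_le_const (μ := μ) (f := fun x => f x - g x)
    (ae_of_all _ h)

lemma integrable_of_lipschitz_bound {F : Type*} [NormedAddCommGroup F]
    {μ : Measure (Space d)} [IsProbabilityMeasure μ]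
    (hμ : Integrable (fun x => ‖x‖) μ) {ψ : Space d → F} {Λ : ℝ}
    (hψ : ∀ x y, ‖ψ x - ψ y‖ ≤ Λ * ‖x - y‖) : Integrable ψ μ := by
  refine Integrable.mono' (g := fun x => ‖ψ 0‖ + Λ * ‖x‖) ((integrable_const _).add
    (hμ.const_mul _)) (continuous_of_lipschitz_bound hψ).aestronglyMeasurable
    (ae_of_all _ fun x => ?_)
  have h1 := hψ x 0
  rw [sub_zero] at h1
  have h2 := norm_sub_norm_le (ψ x) (ψ 0)
  linarith

/-- If an `F`-valued field is bounded and Lipschitz and so is a field of functionals, then so is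
their pairing. -/
lemma norm_apply_sub_apply_le {D : Space d → Space d →L[ℝ] ℝ} {w : Space d → Space d}
    {Λ M B L : ℝ} (hD : ∀ x, ‖D x‖ ≤ Λ) (hD' : ∀ x y, ‖D x - D y‖ ≤ M * ‖x - y‖) (hΛ : 0 ≤ Λ)
    (hw : ∀ x, ‖w x‖ ≤ B) (hw' : ∀ x y, ‖w x - w y‖ ≤ L * ‖x - y‖) (x y : Space d) :
    ‖D x (w x) - D y (w y)‖ ≤ (M * B + Λ * L) * ‖x - y‖ := by
  have e : D x (w x) - D y (w y) = (D x - D y) (w x) + D y (w x - w y) := by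
    simp
  rw [e]
  refine (norm_add_le _ _).trans ?_
  have h1 : ‖(D x - D y) (w x)‖ ≤ (M * ‖x - y‖) * B :=
    (ContinuousLinearMap.le_opNorm _ _).trans (mul_le_mul (hD' x y) (hw x) (norm_nonneg _)
      ((norm_nonneg _).trans (hD' x y)))
  have h2 : ‖D y (w x - w y)‖ ≤ Λ * (L * ‖x - y‖) :=
    (ContinuousLinearMap.le_opNorm _ _).trans (mul_le_mul (hD y) (hw' x y) (norm_nonneg _) hΛ)
  linarith

namespace LipDrift

variable {T : ℝ} {ρ : ℝ → Measure (Space d)} {b : ℝ → Space d → Space d}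
    {G : ℝ → ℝ} {B L C : ℝ}

lemma mono (D : LipDrift T ρ b G B L C) (s t : ℝ) (hs : 0 ≤ s) (hst : s ≤ t) (ht : t ≤ T) :
    G s ≤ G t := by
  linarith [D.sub_le s t hs hst ht]

lemma integrable (D : LipDrift T ρ b G B L C) {t : ℝ} (ht : t ∈ Icc 0 T) {ψ : Space d → ℝ}
    {Λ : ℝ} (hψ : ∀ x y, ‖ψ x - ψ y‖ ≤ Λ * ‖x - y‖) : Integrable ψ (ρ t) :=
  have := D.prob t ht
  integrable_of_lipschitz_bound (D.moment t ht) hψ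

/-- Vary the integrand at fixed measure, then the measure at fixed integrand. This produces all
moduli of continuity in time. -/
lemma abs_integral_sub_integral_le (D : LipDrift T ρ b G B L C) {F : ℝ → Space d → ℝ} {Λ K : ℝ}
    (hΛ : 0 ≤ Λ) (hF : ∀ t ∈ Icc 0 T, ∀ x y, ‖F t x - F t y‖ ≤ Λ * ‖x - y‖)
    (hFt : ∀ s t, 0 ≤ s → s ≤ t → t ≤ T → ∀ x, ‖F t x - F s x‖ ≤ K * (G t - G s))
    (s t : ℝ) (hs : 0 ≤ s) (hst : s ≤ t) (ht : t ≤ T) :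
    |∫ x, F t x ∂(ρ t) - ∫ x, F s x ∂(ρ s)| ≤ (Λ + K) * (G t - G s) := by
  have hsT : s ∈ Icc 0 T := ⟨hs, hst.trans ht⟩
  have htT : t ∈ Icc 0 T := ⟨hs.trans hst, ht⟩
  have := D.prob t htT
  have h1 := D.transport s t hs hst ht (F s) Λ hΛ (hF s hsT)
  have h2 := abs_integral_sub_integral_le_of_forall (D.integrable htT (hF t htT))
    (D.integrable htT (hF s hsT)) (hFt s t hs hst ht)
  rw [abs_le] at *
  constructor <;> linarith [h1.1, h1.2, h2.1, h2.2]

lemma pairing_lipschitz (D : LipDrift T ρ b G B L C) {ψ : Space d → ℝ} {Λ M : ℝ} (hΛ : 0 ≤ Λ)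
    (hψ : ∀ x y, ‖ψ x - ψ y‖ ≤ Λ * ‖x - y‖)
    (hψ' : ∀ x y, ‖fderiv ℝ ψ x - fderiv ℝ ψ y‖ ≤ M * ‖x - y‖) {t : ℝ} (ht : t ∈ Icc 0 T)
    (x y : Space d) :
    ‖fderiv ℝ ψ x (b t x) - fderiv ℝ ψ y (b t y)‖ ≤ (M * B + Λ * L) * ‖x - y‖ :=
  norm_apply_sub_apply_le (norm_fderiv_le_of_lipschitz_bound hΛ hψ) hψ' hΛ (D.bound t ht)
    (D.lip t ht) x y

lemma abs_pairing_sub_le (D : LipDrift T ρ b G B L C) {ψ : Space d → ℝ} {Λ M : ℝ} (hΛ : 0 ≤ Λ)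
    (hM : 0 ≤ M) (hψ : ∀ x y, ‖ψ x - ψ y‖ ≤ Λ * ‖x - y‖)
    (hψ' : ∀ x y, ‖fderiv ℝ ψ x - fderiv ℝ ψ y‖ ≤ M * ‖x - y‖) (s t : ℝ) (hs : 0 ≤ s)
    (hst : s ≤ t) (ht : t ≤ T) :
    |∫ x, fderiv ℝ ψ x (b t x) ∂(ρ t) - ∫ x, fderiv ℝ ψ x (b s x) ∂(ρ s)| ≤
      ((M * B + Λ * L) + Λ * C) * (G t - G s) := by
  have hB := D.B_nonneg
  have hL := D.L_nonneg
  refine D.abs_integral_sub_integral_le (F := fun t x => fderiv ℝ ψ x (b t x)) (by positivity)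
    (fun t ht => D.pairing_lipschitz hΛ hψ hψ' ht) (fun s t hs hst ht x => ?_) s t hs hst ht
  rw [← map_sub, mul_assoc]
  exact (ContinuousLinearMap.le_opNorm _ _).trans (mul_le_mul
    (norm_fderiv_le_of_lipschitz_bound hΛ hψ x) (D.time s t hs hst ht x) (norm_nonneg _) hΛ)

end LipDrift

/-! ### Testing with Lipschitz gradients, and the Euler step. -/

namespace DriftCurve

variable {T : ℝ} {ρ : ℝ → Measure (Space d)} {b : ℝ → Space d → Space d}
    {G : ℝ → ℝ} {B L C : ℝ}

/-- The weak equation for test functions with bounded Lipschitz gradient. -/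
lemma weak_of_lipschitz_fderiv (D : DriftCurve T ρ b G B L C) {ψ : Space d → ℝ} {Λ M : ℝ}
    (hΛ : 0 ≤ Λ) (hM : 0 ≤ M) (hd : Differentiable ℝ ψ)
    (hψ : ∀ x y, ‖ψ x - ψ y‖ ≤ Λ * ‖x - y‖)
    (hψ' : ∀ x y, ‖fderiv ℝ ψ x - fderiv ℝ ψ y‖ ≤ M * ‖x - y‖) {s t : ℝ} (hs : 0 ≤ s)
    (hst : s ≤ t) (ht : t ≤ T) :
    ∫ x, ψ x ∂(ρ t) - ∫ x, ψ x ∂(ρ s) = ∫ u in s..t, ∫ x, fderiv ℝ ψ x (b u x) ∂(ρ u) := by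
  have hsT : s ∈ Icc 0 T := ⟨hs, hst.trans ht⟩
  have htT : t ∈ Icc 0 T := ⟨hs.trans hst, ht⟩
  refine eq_of_forall_dist_le fun e he => ?_
  -- Mollifying ψ at scale η costs Λη at each endpoint and Mη B per unit time in the pairing with
  -- the drift; K collects the three errors.
  set K := 2 * Λ + (t - s) * (M * B) with hK
  have hB := D.B_nonneg
  have hts : 0 ≤ t - s := sub_nonneg.2 hst
  have hK0 : 0 ≤ K := by positivity
  obtain ⟨κ, hκ⟩ := exists_isBump d (η := e / (K + 1)) (by positivity)
  set η := e / (K + 1) with hη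
  have hη0 : 0 ≤ η := hκ.radius_nonneg
  obtain ⟨K', hK', hmoll⟩ := hκ.exists_fderiv_moll_lipschitz
  have hcont : Continuous ψ := continuous_of_lipschitz_bound hψ
  have hml := hκ.moll_lipschitz hψ
  have hml' := hmoll ψ Λ hΛ hψ
  have hw := D.weak s t hs hst ht (moll κ ψ) Λ (hκ.contDiff_moll hcont) hΛ hml
  have key : ∀ u ∈ Icc 0 T, |∫ x, moll κ ψ x ∂(ρ u) - ∫ x, ψ x ∂(ρ u)| ≤ Λ * η := by
    intro u hu
    have := D.prob u hu
    exact abs_integral_sub_integral_le_of_forall (D.integrable hu hml) (D.integrable hu hψ)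
      (hκ.abs_moll_sub_le hΛ hψ)
  have hc1 := continuousOn_of_modulus D.cont (D.abs_pairing_sub_le hΛ hM hψ hψ')
  have hc2 := continuousOn_of_modulus D.cont
    (D.abs_pairing_sub_le hΛ (mul_nonneg hΛ hK') hml hml')
  have hsub : uIcc s t ⊆ Icc 0 T := by rw [uIcc_of_le hst]; exact Icc_subset_Icc hs ht
  have h3 : |(∫ u in s..t, ∫ x, fderiv ℝ (moll κ ψ) x (b u x) ∂(ρ u)) -
      ∫ u in s..t, ∫ x, fderiv ℝ ψ x (b u x) ∂(ρ u)| ≤ (t - s) * (M * B) * η := by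
    rw [← intervalIntegral.integral_sub (hc2.mono hsub).intervalIntegrable
      (hc1.mono hsub).intervalIntegrable]
    have := intervalIntegral.norm_integral_le_of_norm_le_const (a := s) (b := t)
      (f := fun u => (∫ x, fderiv ℝ (moll κ ψ) x (b u x) ∂(ρ u)) -
        ∫ x, fderiv ℝ ψ x (b u x) ∂(ρ u)) (C := M * η * B) fun u hu => ?_
    · rw [abs_of_nonneg hts] at this
      refine this.trans_eq (by ring)
    · rw [uIoc_of_le hst] at hu
      have huT : u ∈ Icc 0 T := ⟨hs.trans hu.1.le, hu.2.trans ht⟩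
      have := D.prob u huT
      refine abs_integral_sub_integral_le_of_forall
        (D.integrable huT (D.pairing_lipschitz hΛ hml hml' huT))
        (D.integrable huT (D.pairing_lipschitz hΛ hψ hψ' huT)) fun x => ?_
      rw [← sub_apply]
      exact (ContinuousLinearMap.le_opNorm _ _).trans (mul_le_mul
        (hκ.norm_fderiv_moll_sub_le hM hd hψ hψ' x) (D.bound u huT x) (norm_nonneg _)
        (by positivity))
  have h1 := key s hsT
  have h2 := key t htT
  have h4 : K * η ≤ e := by
    rw [hη, mul_div_assoc', div_le_iff₀ (by positivity)]
    nlinarith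
  rw [Real.dist_eq]
  rw [abs_le] at *
  constructor <;> nlinarith [h1.1, h1.2, h2.1, h2.2, h3.1, h3.2]

/-- One explicit Euler step. -/
lemma abs_integral_sub_integral_comp_le (D : DriftCurve T ρ b G B L C) {ψ : Space d → ℝ} {Λ M : ℝ}
    (hΛ : 0 ≤ Λ) (hM : 0 ≤ M) (hd : Differentiable ℝ ψ)
    (hψ : ∀ x y, ‖ψ x - ψ y‖ ≤ Λ * ‖x - y‖)
    (hψ' : ∀ x y, ‖fderiv ℝ ψ x - fderiv ℝ ψ y‖ ≤ M * ‖x - y‖) {s t : ℝ} (hs : 0 ≤ s)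
    (hst : s ≤ t) (ht : t ≤ T) :
    |∫ x, ψ x ∂(ρ t) - ∫ x, ψ (x + (t - s) • b s x) ∂(ρ s)| ≤
      (t - s) * ((M * B + Λ * L + Λ * C + M * B ^ 2) * (G t - G s)) := by
  have hsT : s ∈ Icc 0 T := ⟨hs, hst.trans ht⟩
  have := D.prob s hsT
  have hB := D.B_nonneg
  have hL := D.L_nonneg
  have hC := D.C_nonneg
  have hts : 0 ≤ t - s := sub_nonneg.2 hst
  have h1 := D.weak_of_lipschitz_fderiv hΛ hM hd hψ hψ' hs hst ht
  have h2 := abs_intervalIntegral_sub_mul_le D.cont D.mono (by positivity)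
    (D.abs_pairing_sub_le hΛ hM hψ hψ') hs hst ht
  have hcomp : ∀ x y, ‖ψ (x + (t - s) • b s x) - ψ (y + (t - s) • b s y)‖ ≤
      Λ * (1 + (t - s) * L) * ‖x - y‖ := fun x y => by
    refine (hψ _ _).trans ?_
    rw [mul_assoc]
    gcongr
    rw [add_sub_add_comm, ← smul_sub]
    refine (norm_add_le _ _).trans ?_
    rw [norm_smul, Real.norm_of_nonneg hts, add_mul, one_mul, mul_assoc]
    gcongr
    exact D.lip s hsT x y
  -- The second-order Taylor remainder along the Euler displacement. One factor t - s is traded for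
  -- G t - G s, so that it has the same shape as the quadrature error.
  have htay : ∀ x, ‖ψ (x + (t - s) • b s x) - ψ x - (t - s) * fderiv ℝ ψ x (b s x)‖ ≤
      (t - s) * (M * B ^ 2 * (G t - G s)) := fun x => by
    set w := (t - s) • b s x with hw
    have hwn : ‖w‖ ≤ (t - s) * B := by
      rw [hw, norm_smul, Real.norm_of_nonneg hts]
      exact mul_le_mul_of_nonneg_left (D.bound s hsT x) hts
    have := Convex.norm_image_sub_le_of_norm_fderiv_le' (f := ψ) (φ := fderiv ℝ ψ x)
      (s := Metric.closedBall x ‖w‖) (C := M * ‖w‖) (x := x) (y := x + w) (𝕜 := ℝ)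
      (fun z _ => hd z) (fun z hz => ?_) (convex_closedBall _ _)
      (Metric.mem_closedBall_self (norm_nonneg _)) (by simp)
    · rw [add_sub_cancel_left] at this
      have e : fderiv ℝ ψ x w = (t - s) * fderiv ℝ ψ x (b s x) := by simp [hw]
      rw [e] at this
      refine this.trans ?_
      have h3 := D.sub_le s t hs hst ht
      calc M * ‖w‖ * ‖w‖ ≤ M * ((t - s) * B) * ((t - s) * B) := by gcongr
        _ = (t - s) * (M * B ^ 2 * (t - s)) := by ring
        _ ≤ _ := by gcongr
    · refine (hψ' z x).trans ?_
      gcongr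
      simpa [dist_eq_norm] using hz
  have hi1 := D.integrable hsT hcomp
  have hi2 := D.integrable hsT hψ
  have hi3 := D.integrable hsT (D.pairing_lipschitz hΛ hψ hψ' hsT)
  have h4 : |∫ x, ψ (x + (t - s) • b s x) ∂(ρ s) - ∫ x, ψ x ∂(ρ s) -
      (t - s) * ∫ x, fderiv ℝ ψ x (b s x) ∂(ρ s)| ≤ (t - s) * (M * B ^ 2 * (G t - G s)) := by
    rw [← integral_const_mul, ← integral_sub hi1 hi2]
    exact abs_integral_sub_integral_le_of_forall (hi1.sub hi2) (hi3.const_mul _) htay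
  rw [← h1] at h2
  rw [abs_le] at *
  constructor <;> nlinarith [h2.1, h2.2, h4.1, h4.2]

end DriftCurve

end NonlocalDiffusion

end

noncomputable section
namespace NonlocalDiffusion
variable {d : ℕ}

/-! ### The entropy inequality in dual form -/

/-- The divergence of a vector field, the trace of its derivative. -/
def divergence (w : Space d → Space d) (x : Space d) : ℝ :=
  LinearMap.trace ℝ (Space d) (fderiv ℝ w x : Space d →ₗ[ℝ] Space d)

lemma integral_add_mul_sub {α : Type*} [MeasurableSpace α] {μ : Measure α}
    [IsProbabilityMeasure μ] {f g : α → ℝ} (hf : Integrable f μ) (hg : Integrable g μ) (h c : ℝ) :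
    ∫ x, (f x + (h * g x - c)) ∂μ = ∫ x, f x ∂μ + (h * ∫ x, g x ∂μ - c) := by
  have h1 : Integrable (fun x => h * g x - c) μ := (hg.const_mul h).sub (integrable_const c)
  rw [integral_add hf h1, integral_sub (hg.const_mul h) (integrable_const c), integral_const_mul]
  simp

lemma IsBump.moll_add_mul_sub {κ : Space d → ℝ} {η : ℝ} (hκ : IsBump κ η) {ψ g : Space d → ℝ}
    (hψ : Continuous ψ) (hg : Continuous g) (h c : ℝ) (x : Space d) :
    moll κ (fun x => ψ x + (h * g x - c)) x = moll κ ψ x + (h * moll κ g x - c) := by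
  have h1 : Integrable fun z => κ z * ψ (x - z) :=
    hκ.integrable_mul (ψ := fun z => ψ (x - z)) (by fun_prop)
  have h2 : Integrable fun z => κ z * g (x - z) :=
    hκ.integrable_mul (ψ := fun z => g (x - z)) (by fun_prop)
  have h3 : Integrable fun z => h * (κ z * g (x - z)) - κ z * c :=
    (h2.const_mul h).sub (hκ.integrable.mul_const c)
  have e : ∀ z, κ z * (ψ (x - z) + (h * g (x - z) - c)) =
      κ z * ψ (x - z) + (h * (κ z * g (x - z)) - κ z * c) := fun z => by ring
  unfold moll
  simp_rw [e]
  rw [integral_add h1 h3, integral_sub (h2.const_mul h) (hκ.integrable.mul_const c),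
    integral_const_mul, integral_mul_const, hκ.integral_eq_one, one_mul]

namespace DriftCurve

variable {T : ℝ} {ρ : ℝ → Measure (Space d)} {b : ℝ → Space d → Space d}
    {G : ℝ → ℝ} {B L C L' C' : ℝ}

lemma abs_integral_divergence_sub_le (D : DriftCurve T ρ b G B L C) (hL' : 0 ≤ L')
    (hdiv : ∀ t ∈ Icc 0 T, ∀ x y,
      ‖divergence (b t) x - divergence (b t) y‖ ≤ L' * ‖x - y‖)
    (hdivt : ∀ s t, 0 ≤ s → s ≤ t → t ≤ T → ∀ x,
      ‖divergence (b t) x - divergence (b s) x‖ ≤ C' * (G t - G s)) (s t : ℝ) (hs : 0 ≤ s)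
    (hst : s ≤ t) (ht : t ≤ T) :
    |∫ x, divergence (b t) x ∂(ρ t) - ∫ x, divergence (b s) x ∂(ρ s)| ≤
      (L' + C') * (G t - G s) :=
  D.abs_integral_sub_integral_le (F := fun t => divergence (b t)) hL' hdiv hdivt s t hs hst ht

/-- One step of the discrete dual evolution of test functions. -/
lemma entropy_step (D : DriftCurve T ρ b G B L C) (hL' : 0 ≤ L') (hC' : 0 ≤ C')
    (hd : ∀ t ∈ Icc 0 T, Differentiable ℝ (b t))
    (hdiv : ∀ t ∈ Icc 0 T, ∀ x y,
      ‖divergence (b t) x - divergence (b t) y‖ ≤ L' * ‖x - y‖)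
    (hdivt : ∀ s t, 0 ≤ s → s ≤ t → t ≤ T → ∀ x,
      ‖divergence (b t) x - divergence (b s) x‖ ≤ C' * (G t - G s))
    {κ : Space d → ℝ} {η K e h₀ : ℝ} (hκ : IsBump κ η) (hK : 0 ≤ K)
    (hmoll : ∀ (ψ : Space d → ℝ) (Λ : ℝ), 0 ≤ Λ → (∀ x y, ‖ψ x - ψ y‖ ≤ Λ * ‖x - y‖) →
      ∀ x y, ‖fderiv ℝ (moll κ ψ) x - fderiv ℝ (moll κ ψ) y‖ ≤ Λ * K * ‖x - y‖)
    (hdet : ∀ h, 0 ≤ h → h ≤ h₀ → ∀ A : Space d →L[ℝ] Space d, ‖A‖ ≤ L →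
      Real.exp (h * LinearMap.trace ℝ (Space d) (A : Space d →ₗ[ℝ] Space d) - e * h)
        ≤ (1 + h • A).det)
    {s t : ℝ} (hs : 0 ≤ s) (hst : s ≤ t) (ht : t ≤ T) (hh₀ : t - s ≤ h₀)
    (hhL : (t - s) * L < 1) {ψ : Space d → ℝ} {Λ : ℝ} (hΛ : 0 ≤ Λ)
    (hψ : ∀ x y, ‖ψ x - ψ y‖ ≤ Λ * ‖x - y‖) :
    ∃ ψ' : Space d → ℝ,
      (∀ x y, ‖ψ' x - ψ' y‖ ≤ (Λ * (1 + (t - s) * L) + (t - s) * L') * ‖x - y‖) ∧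
      ∫⁻ x, ENNReal.ofReal (Real.exp (ψ' x)) ≤ ∫⁻ x, ENNReal.ofReal (Real.exp (ψ x)) ∧
      ∫ x, moll κ ψ x ∂(ρ t) ≤ ∫ x, moll κ ψ' x ∂(ρ s)
        - (∫ u in s..t, ∫ x, divergence (b u) x ∂(ρ u))
        + (t - s) * (e + (Λ * L + L') * η)
        + (t - s) * ((Λ * (K * B + L + C + K * B ^ 2) + (L' + C')) * (G t - G s)) := by
  have hsT : s ∈ Icc 0 T := ⟨hs, hst.trans ht⟩
  have htT : t ∈ Icc 0 T := ⟨hs.trans hst, ht⟩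
  have := D.prob s hsT
  have hB := D.B_nonneg
  have hL := D.L_nonneg
  have hC := D.C_nonneg
  have hη := hκ.radius_nonneg
  set h := t - s with hh
  have hh0 : 0 ≤ h := sub_nonneg.2 hst
  have hcψ := continuous_of_lipschitz_bound hψ
  have hcb := continuous_of_lipschitz_bound (D.lip s hsT)
  have hcd := continuous_of_lipschitz_bound (hdiv s hsT)
  have hcomp : ∀ x y, ‖ψ (x + h • b s x) - ψ (y + h • b s y)‖ ≤
      Λ * (1 + h * L) * ‖x - y‖ := fun x y => by
    refine (hψ _ _).trans ?_
    rw [mul_assoc]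
    gcongr
    rw [add_sub_add_comm, ← smul_sub]
    refine (norm_add_le _ _).trans ?_
    rw [norm_smul, Real.norm_of_nonneg hh0, add_mul, one_mul, mul_assoc]
    gcongr
    exact D.lip s hsT x y
  -- The pull-back of ψ by the Euler map, plus the logarithm of an approximate Jacobian, minus the
  -- slack e h that makes it a true lower bound for the Jacobian. Its exponential is therefore
  -- controlled by a change of variables.
  refine ⟨fun x => ψ (x + h • b s x) + (h * divergence (b s) x - e * h), fun x y => ?_, ?_, ?_⟩
  · have e1 : ψ (x + h • b s x) + (h * divergence (b s) x - e * h) -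
        (ψ (y + h • b s y) + (h * divergence (b s) y - e * h)) =
        (ψ (x + h • b s x) - ψ (y + h • b s y)) +
          h * (divergence (b s) x - divergence (b s) y) := by ring
    rw [e1]
    refine (norm_add_le _ _).trans ?_
    rw [norm_mul, Real.norm_of_nonneg hh0, add_mul, mul_assoc h]
    gcongr
    · exact hcomp x y
    · exact hdiv s hsT x y
  · refine le_trans (le_of_eq ?_) (lintegral_comp_le_of_det (h := h)
      (J := fun x => ENNReal.ofReal (Real.exp (h * divergence (b s) x - e * h)))
      (hd s hsT) (D.lip s hsT) hh0 hhL (fun x => ENNReal.ofReal_le_ofReal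
        (hdet h hh0 hh₀ _ (norm_fderiv_le_of_lipschitz_bound hL (D.lip s hsT) x)))
      (fun x => ENNReal.ofReal (Real.exp (ψ x))))
    refine lintegral_congr fun x => ?_
    rw [← ENNReal.ofReal_mul (Real.exp_pos _).le, ← Real.exp_add, add_comm]
  -- The Euler step needs test functions with Lipschitz gradient, hence is applied to the
  -- mollification of ψ. Three further errors arise: commuting the mollifier with the Euler map,
  -- mollifying the divergence, and the rectangle rule for the divergence integral.
  · have hml := hκ.moll_lipschitz hψ
    have h1 := D.abs_integral_sub_integral_comp_le hΛ (mul_nonneg hΛ hK)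
      ((hκ.contDiff_moll hcψ).differentiable (by simp)) hml (hmoll ψ Λ hΛ hψ) hs hst ht
    rw [← hh] at h1
    have hcomp' : ∀ x y, ‖moll κ ψ (x + h • b s x) - moll κ ψ (y + h • b s y)‖ ≤
        Λ * (1 + h * L) * ‖x - y‖ := fun x y => by
      refine (hml _ _).trans ?_
      rw [mul_assoc]
      gcongr
      rw [add_sub_add_comm, ← smul_sub]
      refine (norm_add_le _ _).trans ?_
      rw [norm_smul, Real.norm_of_nonneg hh0, add_mul, one_mul, mul_assoc]
      gcongr
      exact D.lip s hsT x y
    have hm1 := hκ.moll_lipschitz hcomp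
    have hm2 := hκ.moll_lipschitz (hdiv s hsT)
    have h2 := abs_integral_sub_integral_le_of_forall (D.integrable hsT hm1)
      (D.integrable hsT hcomp') (hκ.abs_moll_comp_sub_le hΛ hL hh0 hψ (D.lip s hsT))
    have h3 := abs_integral_sub_integral_le_of_forall (D.integrable hsT hm2)
      (D.integrable hsT (hdiv s hsT)) (hκ.abs_moll_sub_le hL' (hdiv s hsT))
    have h4 := abs_intervalIntegral_sub_mul_le D.cont D.mono (by positivity)
      (D.abs_integral_divergence_sub_le hL' hdiv hdivt) hs hst ht
    rw [← hh] at h4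
    have h5 : ∫ x, moll κ (fun x => ψ (x + h • b s x) + (h * divergence (b s) x - e * h)) x ∂(ρ s)
        = ∫ x, moll κ (fun x => ψ (x + h • b s x)) x ∂(ρ s)
          + (h * ∫ x, moll κ (divergence (b s)) x ∂(ρ s) - e * h) := by
      simp_rw [hκ.moll_add_mul_sub (ψ := fun x => ψ (x + h • b s x)) (g := divergence (b s))
        (by fun_prop) hcd]
      exact integral_add_mul_sub (D.integrable hsT hm1) (D.integrable hsT hm2) _ _
    rw [h5]
    have h6 : h * (∫ x, divergence (b s) x ∂(ρ s)) - h * (L' * η) ≤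
        h * ∫ x, moll κ (divergence (b s)) x ∂(ρ s) := by
      rw [← mul_sub]
      exact mul_le_mul_of_nonneg_left (by linarith [(abs_le.1 h3).1]) hh0
    have h7 := (abs_le.1 h1).2
    have h8 := (abs_le.1 h2).1
    have h9 := (abs_le.1 h4).2
    nlinarith


set_option maxHeartbeats 800000 in
/-- The entropy inequality in dual form. -/
theorem integral_le_of_initial_le (D : DriftCurve T ρ b G B L C) (hT : 0 ≤ T) (hL' : 0 ≤ L')
    (hC' : 0 ≤ C') (hd : ∀ t ∈ Icc 0 T, Differentiable ℝ (b t))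
    (hdiv : ∀ t ∈ Icc 0 T, ∀ x y,
      ‖divergence (b t) x - divergence (b t) y‖ ≤ L' * ‖x - y‖)
    (hdivt : ∀ s t, 0 ≤ s → s ≤ t → t ≤ T → ∀ x,
      ‖divergence (b t) x - divergence (b s) x‖ ≤ C' * (G t - G s))
    {ψ : Space d → ℝ} {Λ Y : ℝ} (hΛ : 0 ≤ Λ) (hψ : ∀ x y, ‖ψ x - ψ y‖ ≤ Λ * ‖x - y‖)
    (hY : ∀ (ψ' : Space d → ℝ) (Λ' : ℝ), (∀ x y, ‖ψ' x - ψ' y‖ ≤ Λ' * ‖x - y‖) →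
      ∫⁻ x, ENNReal.ofReal (Real.exp (ψ' x)) ≤ ∫⁻ x, ENNReal.ofReal (Real.exp (ψ x)) →
      ∫ x, ψ' x ∂(ρ 0) ≤ Y) :
    ∫ x, ψ x ∂(ρ T) ≤ Y - ∫ u in 0..T, ∫ x, divergence (b u) x ∂(ρ u) := by
  have hB := D.B_nonneg
  have hL := D.L_nonneg
  have hC := D.C_nonneg
  set M := max L L' with hM
  have hM0 : 0 ≤ M := hL.trans (le_max_left _ _)
  -- One step sends the Lipschitz constant Λ to Λ(1 + hL) + hL', so Λ + 1 grows at most by the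
  -- factor 1 + hM. Over total time T this gives exp(TM), independently of the number of steps.
  set Λ' := (Λ + 1) * Real.exp (T * M) with hΛ'
  have hΛ'0 : 0 ≤ Λ' := by positivity
  have h0T : (0 : ℝ) ∈ Icc 0 T := ⟨le_rfl, hT⟩
  have hTT : T ∈ Icc 0 T := ⟨hT, le_rfl⟩
  have hcd : ContinuousOn (fun u => ∫ x, divergence (b u) x ∂(ρ u)) (Icc 0 T) :=
    continuousOn_of_modulus D.cont (D.abs_integral_divergence_sub_le hL' hdiv hdivt)
  have hint : ∀ s ∈ Icc 0 T, ∀ t ∈ Icc 0 T,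
      IntervalIntegrable (fun u => ∫ x, divergence (b u) x ∂(ρ u)) volume s t := fun s hs t ht =>
    (hcd.mono (by
      rw [uIcc]; exact Icc_subset_Icc (le_inf hs.1 ht.1) (sup_le hs.2 ht.2))).intervalIntegrable
  -- the discrete estimate for a fixed mollifier
  have main : ∀ e > 0, ∀ (κ : Space d → ℝ) (η : ℝ), IsBump κ η →
      ∫ x, ψ x ∂(ρ T) ≤ Y - (∫ u in 0..T, ∫ x, divergence (b u) x ∂(ρ u)) + 2 * Λ' * η +
        T * (e + (Λ' * L + L') * η) := by
    intro e he κ η hκ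
    have hη := hκ.radius_nonneg
    obtain ⟨K, hK, hmoll⟩ := hκ.exists_fderiv_moll_lipschitz
    obtain ⟨h₀, hh₀, hdet⟩ := exists_exp_le_det d hL he
    set E1 := e + (Λ' * L + L') * η with hE1
    set E2 := Λ' * (K * B + L + C + K * B ^ 2) + (L' + C') with hE2
    have hE20 : 0 ≤ E2 := by positivity
    -- Going back k steps from time k h. The bound Λ' on all intermediate Lipschitz constants keeps
    -- E1 and E2 the same at every step.
    have step : ∀ h, 0 ≤ h → h ≤ h₀ → h * L < 1 → ∀ k : ℕ, k * h ≤ T →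
        ∀ (ψ : Space d → ℝ) (Λ : ℝ), 0 ≤ Λ → (∀ x y, ‖ψ x - ψ y‖ ≤ Λ * ‖x - y‖) →
        (Λ + 1) * (1 + h * M) ^ k ≤ Λ' → ∃ ψ' : Space d → ℝ,
          (∀ x y, ‖ψ' x - ψ' y‖ ≤ Λ' * ‖x - y‖) ∧
          ∫⁻ x, ENNReal.ofReal (Real.exp (ψ' x)) ≤ ∫⁻ x, ENNReal.ofReal (Real.exp (ψ x)) ∧
          ∫ x, moll κ ψ x ∂(ρ (k * h)) ≤ ∫ x, moll κ ψ' x ∂(ρ 0)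
            - (∫ u in 0..(k * h), ∫ x, divergence (b u) x ∂(ρ u))
            + (k * h) * E1 + h * (E2 * (G (k * h) - G 0)) := by
      intro h hh hhh₀ hhL k
      induction k with
      | zero =>
        intro _ ψ Λ hΛ hψ hΛΛ
        refine ⟨ψ, fun x y => (hψ x y).trans ?_, le_rfl, by simp⟩
        simp only [pow_zero, mul_one] at hΛΛ
        gcongr
        linarith
      | succ k ih =>
        intro hkT ψ Λ hΛ hψ hΛΛ
        push_cast at hkT ⊢
        have hks : (k : ℝ) * h ≤ (k + 1) * h := by nlinarith
        have hk0 : 0 ≤ (k : ℝ) * h := by positivity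
        have hsT : (k : ℝ) * h ∈ Icc 0 T := ⟨hk0, hks.trans hkT⟩
        have htT : ((k : ℝ) + 1) * h ∈ Icc 0 T := ⟨hk0.trans hks, hkT⟩
        have e1 : ((k : ℝ) + 1) * h - k * h = h := by ring
        obtain ⟨ψ₁, hψ₁, hexp₁, hle₁⟩ := D.entropy_step hL' hC' hd hdiv hdivt hκ hK hmoll hdet
          hk0 hks hkT (by rw [e1]; exact hhh₀) (by rw [e1]; exact hhL) hΛ hψ
        rw [e1] at hψ₁ hle₁
        have hΛk : Λ + 1 ≤ Λ' := by
          refine le_trans ?_ hΛΛ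
          exact le_mul_of_one_le_right (by positivity) (one_le_pow₀ (by nlinarith))
        obtain ⟨ψ₂, hψ₂, hexp₂, hle₂⟩ := ih (hks.trans hkT) ψ₁ _ (by positivity) hψ₁ (by
          refine le_trans ?_ hΛΛ
          rw [pow_succ', ← mul_assoc]
          gcongr
          have h1 : h * L ≤ h * M := mul_le_mul_of_nonneg_left (le_max_left _ _) hh
          have h2 : h * L' ≤ h * M := mul_le_mul_of_nonneg_left (le_max_right _ _) hh
          nlinarith)
        refine ⟨ψ₂, hψ₂, hexp₂.trans hexp₁, ?_⟩
        rw [← intervalIntegral.integral_add_adjacent_intervals (hint _ h0T _ hsT)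
          (hint _ hsT _ htT)]
        have hG1 := D.mono _ _ hk0 hks hkT
        have b1 : h * (e + (Λ * L + L') * η) ≤ h * E1 := by
          rw [hE1]; gcongr; linarith
        have b2 : h * ((Λ * (K * B + L + C + K * B ^ 2) + (L' + C')) *
            (G ((k + 1) * h) - G (k * h))) ≤ h * (E2 * (G ((k + 1) * h) - G (k * h))) := by
          rw [hE2]
          have : 0 ≤ G ((k + 1) * h) - G (k * h) := by linarith
          gcongr
          linarith
        have e2 : ((k : ℝ) + 1) * h * E1 = k * h * E1 + h * E1 := by ring
        have e3 : h * (E2 * (G ((k + 1) * h) - G 0)) =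
            h * (E2 * (G (k * h) - G 0)) + h * (E2 * (G ((k + 1) * h) - G (k * h))) := by ring
        rw [e2, e3]
        linarith only [hle₁, hle₂, b1, b2]
    -- With κ fixed the number n of steps goes to infinity. This removes E2, which involves the
    -- constant K of the mollifier and may blow up as η → 0.
    have key : ∀ᶠ n : ℕ in atTop, ∫ x, ψ x ∂(ρ T) ≤ (Y -
        (∫ u in 0..T, ∫ x, divergence (b u) x ∂(ρ u)) + 2 * Λ' * η + T * E1) +
        T / n * (E2 * (G T - G 0)) := by
      have ht : Tendsto (fun n : ℕ => T / (n : ℝ)) atTop (𝓝 0) :=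
        tendsto_const_div_atTop_nhds_zero_nat T
      have ht2 : Tendsto (fun n : ℕ => T / (n : ℝ) * L) atTop (𝓝 0) := by
        simpa using ht.mul_const L
      filter_upwards [ht.eventually (gt_mem_nhds hh₀), ht2.eventually (gt_mem_nhds one_pos),
        eventually_gt_atTop 0] with n hn1 hn2 hn0
      have hn : (0 : ℝ) < n := by exact_mod_cast hn0
      have hnT : (n : ℝ) * (T / n) = T := by field_simp
      obtain ⟨ψ', hψ', hexp, hle⟩ := step (T / n) (by positivity) hn1.le hn2 n hnT.le ψ Λ hΛ hψ (by
        rw [hΛ']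
        gcongr
        have h1 : 1 + T / n * M ≤ Real.exp (T / n * M) := by
          linarith [Real.add_one_le_exp (T / n * M)]
        calc (1 + T / n * M) ^ n ≤ Real.exp (T / n * M) ^ n := by gcongr
          _ = Real.exp (T * M) := by
            rw [← Real.exp_nat_mul, ← mul_assoc, hnT])
      rw [hnT] at hle
      have := D.prob 0 h0T
      have := D.prob T hTT
      have h2 := abs_integral_sub_integral_le_of_forall (D.integrable h0T (hκ.moll_lipschitz hψ'))
        (D.integrable h0T hψ') (hκ.abs_moll_sub_le hΛ'0 hψ')
      have h3 := abs_integral_sub_integral_le_of_forall (D.integrable hTT (hκ.moll_lipschitz hψ))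
        (D.integrable hTT hψ) (hκ.abs_moll_sub_le hΛ hψ)
      have h4 := hY ψ' Λ' hψ' hexp
      have h5 : Λ * η ≤ Λ' * η := by
        refine mul_le_mul_of_nonneg_right ?_ hη
        have : 1 ≤ Real.exp (T * M) := Real.one_le_exp (by positivity)
        nlinarith
      linarith only [hle, h4, h5, (abs_le.1 h2).2, (abs_le.1 h3).1]
    refine ge_of_tendsto ?_ key
    have ht : Tendsto (fun n : ℕ => T / (n : ℝ)) atTop (𝓝 0) :=
      tendsto_const_div_atTop_nhds_zero_nat T
    simpa using (ht.mul_const (E2 * (G T - G 0))).const_add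
      (Y - (∫ u in 0..T, ∫ x, divergence (b u) x ∂(ρ u)) + 2 * Λ' * η + T * E1)
  refine le_of_forall_pos_le_add fun e he => ?_
  -- Only now is the mollification width sent to zero together with the slack in the determinant
  -- bound. N adds up the coefficients of the remaining errors, which no longer involve K.
  set N := 2 * Λ' + T * (Λ' * L + L') + T + 1 with hN
  have hN0 : 0 < N := by positivity
  obtain ⟨κ, hκ⟩ := exists_isBump d (η := e / N) (by positivity)
  refine (main (e / N) (by positivity) κ _ hκ).trans ?_
  have : 2 * Λ' * (e / N) + T * (e / N + (Λ' * L + L') * (e / N)) ≤ e := by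
    have h1 : 2 * Λ' * (e / N) + T * (e / N + (Λ' * L + L') * (e / N)) = (N - 1) * (e / N) := by
      rw [hN]; ring
    rw [h1]
    calc (N - 1) * (e / N) ≤ N * (e / N) := by gcongr; linarith
      _ = e := by field_simp
  linarith

end DriftCurve

end NonlocalDiffusion

end

noncomputable section
namespace NonlocalDiffusion
variable {d : ℕ}

/-! ### From the dual entropy bound to densities -/

/-- A logarithmic weight with `exp (-logWeight)` integrable. -/
def logWeight (x : Space d) : ℝ := (d + 1) * Real.log (1 + ‖x‖)

lemma logWeight_nonneg (x : Space d) : 0 ≤ logWeight x := by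
  have : 0 ≤ Real.log (1 + ‖x‖) := Real.log_nonneg (by linarith [norm_nonneg x])
  unfold logWeight; positivity

lemma logWeight_le (x : Space d) : logWeight x ≤ (d + 1) * ‖x‖ := by
  unfold logWeight
  gcongr
  have := Real.log_le_sub_one_of_pos (show 0 < 1 + ‖x‖ by positivity)
  linarith

lemma log_sub_log_le {a b : ℝ} (ha : 1 ≤ a) (hb : 1 ≤ b) : Real.log a - Real.log b ≤ |a - b| := by
  have ha0 : 0 < a := by linarith
  have hb0 : 0 < b := by linarith
  rw [← Real.log_div ha0.ne' hb0.ne']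
  have h1 := Real.log_le_sub_one_of_pos (div_pos ha0 hb0)
  have h2 : a / b - 1 ≤ |a - b| := by
    rw [div_sub_one hb0.ne', div_le_iff₀ hb0]
    nlinarith [le_abs_self (a - b), abs_nonneg (a - b)]
  linarith

lemma logWeight_lipschitz (x y : Space d) :
    ‖logWeight x - logWeight y‖ ≤ (d + 1) * ‖x - y‖ := by
  unfold logWeight
  rw [← mul_sub, norm_mul, Real.norm_of_nonneg (by positivity : (0 : ℝ) ≤ d + 1)]
  gcongr
  have hx : 1 ≤ 1 + ‖x‖ := by linarith [norm_nonneg x]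
  have hy : 1 ≤ 1 + ‖y‖ := by linarith [norm_nonneg y]
  have h1 := log_sub_log_le hx hy
  have h2 := log_sub_log_le hy hx
  rw [abs_sub_comm] at h2
  have h3 : |1 + ‖x‖ - (1 + ‖y‖)| ≤ ‖x - y‖ := by
    rw [add_sub_add_left_eq_sub]; exact abs_norm_sub_norm_le x y
  rw [Real.norm_eq_abs, abs_le]
  constructor <;> linarith

lemma continuous_logWeight : Continuous (logWeight : Space d → ℝ) :=
  continuous_of_lipschitz_bound logWeight_lipschitz

lemma integrable_exp_neg_logWeight :
    Integrable fun x : Space d => Real.exp (-logWeight x) := by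
  have h := integrable_one_add_norm (E := Space d) (μ := volume) (r := d + 1) (by simp)
  refine h.congr (ae_of_all _ fun x => ?_)
  simp only [logWeight]
  rw [Real.rpow_def_of_pos (by positivity)]
  ring_nf

/-- Lipschitz functions approximate bounded measurable functions. -/
lemma exists_lipschitz_approx {μ : Measure (Space d)} [IsFiniteMeasure μ] {θ : Space d → ℝ}
    (hθ : Measurable θ) {M : ℝ} (hM : ∀ x, |θ x| ≤ M) {e : ℝ} (he : 0 < e) :
    ∃ (θ' : Space d → ℝ) (Λ : ℝ), 0 ≤ Λ ∧ (∀ x y, ‖θ' x - θ' y‖ ≤ Λ * ‖x - y‖) ∧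
      (∀ x, |θ' x| ≤ M) ∧ ∫ x, |θ' x - θ x| ∂μ ≤ e := by
  have hi : Integrable θ μ := Integrable.of_bound hθ.aestronglyMeasurable M (ae_of_all _ hM)
  obtain ⟨g, hgc, hgd, hg⟩ := (memLp_one_iff_integrable.2 hi).exist_eLpNorm_sub_le
    ENNReal.one_ne_top le_rfl he
  have hM0 : 0 ≤ M := (abs_nonneg _).trans (hM 0)
  obtain ⟨Λ, hΛ⟩ := hgd.lipschitzWith_of_hasCompactSupport hgc (by simp)
  -- Truncation to [-M, M] is 1-Lipschitz and fixes θ, so it keeps both the Lipschitz bound and the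
  -- L¹ error of the approximant.
  have hclamp : ∀ a b : ℝ, |max (-M) (min M a) - max (-M) (min M b)| ≤ |a - b| := fun a b => by
    have h1 := abs_max_sub_max_le_max (-M) (min M a) (-M) (min M b)
    have h2 := abs_min_sub_min_le_max M a M b
    simp only [sub_self, abs_zero, abs_nonneg, sup_of_le_right] at h1 h2
    exact h1.trans h2
  have hid : ∀ a : ℝ, |a| ≤ M → max (-M) (min M a) = a := fun a ha => by
    rw [min_eq_right (abs_le.1 ha).2, max_eq_right (abs_le.1 ha).1]
  refine ⟨fun x => max (-M) (min M (g x)), Λ, Λ.2, fun x y => ?_, fun x => ?_, ?_⟩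
  · refine (hclamp _ _).trans ?_
    simpa [dist_eq_norm] using hΛ.dist_le_mul x y
  · exact abs_le.2 ⟨le_max_left _ _, max_le (by linarith) (min_le_left _ _)⟩
  · have hgi : Integrable g μ := hgd.continuous.integrable_of_hasCompactSupport hgc
    calc ∫ x, |max (-M) (min M (g x)) - θ x| ∂μ ≤ ∫ x, |θ x - g x| ∂μ := by
          refine integral_mono_of_nonneg (ae_of_all _ fun x => abs_nonneg _) (hi.sub hgi).abs
            (ae_of_all _ fun x => ?_)
          have := hclamp (g x) (θ x)
          rw [hid _ (hM x), abs_sub_comm (g x)] at this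
          exact this
      _ ≤ e := by
          rw [eLpNorm_one_eq_lintegral_enorm] at hg
          have h1 := ofReal_integral_norm_eq_lintegral_enorm (hi.sub hgi)
          rw [← h1] at hg
          exact (ENNReal.ofReal_le_ofReal_iff he.le).1 hg

lemma abs_exp_sub_exp_le {a b M : ℝ} (ha : a ≤ M) (hb : b ≤ M) :
    |Real.exp a - Real.exp b| ≤ Real.exp M * |a - b| := by
  have := Convex.norm_image_sub_le_of_norm_deriv_le (f := Real.exp) (s := Iic M)
    (C := Real.exp M) (x := b) (y := a) (fun x _ => Real.differentiableAt_exp)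
    (fun x hx => by
      rw [Real.deriv_exp, Real.norm_of_nonneg (Real.exp_pos _).le]
      exact Real.exp_le_exp.2 hx) (convex_Iic M) hb ha
  simpa using this

section

variable {ρ : Measure (Space d)} [IsProbabilityMeasure ρ] {K : ℝ}

lemma integrable_logWeight (hmom : Integrable (fun x => ‖x‖) ρ) : Integrable logWeight ρ :=
  integrable_of_lipschitz_bound hmom logWeight_lipschitz

lemma integrable_exp_sub_logWeight {θ : Space d → ℝ} (hθ : Measurable θ) {M : ℝ}
    (hM : ∀ x, |θ x| ≤ M) : Integrable fun x => Real.exp (θ x - logWeight x) := by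
  refine Integrable.mono' (integrable_exp_neg_logWeight.const_mul (Real.exp M))
    (Real.measurable_exp.comp (hθ.sub continuous_logWeight.measurable)).aestronglyMeasurable
    (ae_of_all _ fun x => ?_)
  rw [Real.norm_of_nonneg (Real.exp_pos _).le, sub_eq_add_neg, Real.exp_add]
  gcongr
  exact (abs_le.1 (hM x)).2

/-- The dual entropy bound extends from Lipschitz functions to bounded measurable functions. -/
lemma dual_bound_of_measurable (hmom : Integrable (fun x => ‖x‖) ρ)
    (h : ∀ (ψ : Space d → ℝ) (Λ : ℝ), 0 ≤ Λ → (∀ x y, ‖ψ x - ψ y‖ ≤ Λ * ‖x - y‖) →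
      Integrable (fun x => Real.exp (ψ x)) →
      ∫ x, ψ x ∂ρ ≤ K + Real.exp (-1) * ∫ x, Real.exp (ψ x))
    {θ : Space d → ℝ} (hθ : Measurable θ) {M : ℝ} (hM : ∀ x, |θ x| ≤ M) :
    ∫ x, (θ x - logWeight x) ∂ρ ≤
      K + Real.exp (-1) * ∫ x, Real.exp (θ x - logWeight x) := by
  let m : Measure (Space d) :=
    volume.withDensity fun x => ENNReal.ofReal (Real.exp (-logWeight x))
  have hmeas : Measurable fun x : Space d => ENNReal.ofReal (Real.exp (-logWeight x)) :=
    (Real.measurable_exp.comp continuous_logWeight.measurable.neg).ennreal_ofReal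
  have hm : IsFiniteMeasure m :=
    isFiniteMeasure_withDensity_ofReal integrable_exp_neg_logWeight.2
  have hw := integrable_logWeight hmom
  refine le_of_forall_pos_le_add fun e he => ?_
  set N := 1 + Real.exp (-1) * Real.exp M with hN
  have hN0 : 0 < N := by positivity
  -- Approximating in L¹ of ρ + e^{-w} dx, with w the weight, controls both sides of the inequality
  -- at once: the left side sees ρ and, on bounded sets of values, the exponential integral sees the
  -- weighted Lebesgue measure.
  obtain ⟨θ', Λ, hΛ, hLip, hM', hle⟩ := exists_lipschitz_approx (μ := ρ + m) hθ hM
    (e := e / N) (by positivity)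
  have hθ' : Measurable θ' := (continuous_of_lipschitz_bound hLip).measurable
  have hiρ : ∀ (μ : Measure (Space d)) [IsFiniteMeasure μ], Integrable (fun x => |θ' x - θ x|) μ :=
    fun μ _ => Integrable.of_bound (hθ'.sub hθ).abs.aestronglyMeasurable (M + M)
      (ae_of_all _ fun x => by
        rw [Real.norm_eq_abs, abs_abs]
        exact (abs_sub _ _).trans (add_le_add (hM' x) (hM x)))
  rw [integral_add_measure (hiρ ρ) (hiρ m)] at hle
  have h1 : ∫ x, |θ' x - θ x| ∂ρ ≤ e / N := by
    have : 0 ≤ ∫ x, |θ' x - θ x| ∂m := integral_nonneg fun _ => abs_nonneg _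
    linarith
  have h2 : ∫ x, |θ' x - θ x| * Real.exp (-logWeight x) ≤ e / N := by
    have h3 : 0 ≤ ∫ x, |θ' x - θ x| ∂ρ := integral_nonneg fun _ => abs_nonneg _
    have h4 : ∫ x, |θ' x - θ x| ∂m = ∫ x, |θ' x - θ x| * Real.exp (-logWeight x) := by
      rw [integral_withDensity_eq_integral_toReal_smul hmeas (by simp)]
      refine integral_congr_ae (ae_of_all _ fun x => ?_)
      simp [ENNReal.toReal_ofReal (Real.exp_pos _).le, mul_comm]
    linarith
  have hLip' : ∀ x y, ‖(θ' x - logWeight x) - (θ' y - logWeight y)‖ ≤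
      (Λ + (d + 1)) * ‖x - y‖ := fun x y => by
    rw [sub_sub_sub_comm, add_mul]
    exact (norm_sub_le _ _).trans (add_le_add (hLip x y) (logWeight_lipschitz x y))
  have h3 := h (fun x => θ' x - logWeight x) _ (by positivity) hLip'
    (integrable_exp_sub_logWeight hθ' hM')
  have hbd : ∀ {f : Space d → ℝ}, Measurable f → (∀ x, |f x| ≤ M) → Integrable f ρ :=
    fun hf hfM => Integrable.of_bound hf.aestronglyMeasurable M (ae_of_all _ hfM)
  have h4 : ∫ x, (θ x - logWeight x) ∂ρ ≤ ∫ x, (θ' x - logWeight x) ∂ρ + e / N := by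
    rw [integral_sub (hbd hθ hM) hw, integral_sub (hbd hθ' hM') hw]
    have h5 : ∫ x, θ x ∂ρ - ∫ x, θ' x ∂ρ ≤ ∫ x, |θ' x - θ x| ∂ρ := by
      rw [← integral_sub (hbd hθ hM) (hbd hθ' hM')]
      refine integral_mono ((hbd hθ hM).sub (hbd hθ' hM')) (hiρ ρ) fun x => ?_
      simp only
      rw [abs_sub_comm]; exact le_abs_self _
    linarith
  have h5 : (∫ x, Real.exp (θ' x - logWeight x)) ≤ (∫ x, Real.exp (θ x - logWeight x)) +
      Real.exp M * (e / N) := by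
    have hi1 := integrable_exp_sub_logWeight hθ' hM'
    have hi2 := integrable_exp_sub_logWeight hθ hM
    have hi3 : Integrable fun x => Real.exp M * (|θ' x - θ x| * Real.exp (-logWeight x)) := by
      refine Integrable.const_mul ?_ _
      refine Integrable.bdd_mul (c := M + M) integrable_exp_neg_logWeight
        (hθ'.sub hθ).abs.aestronglyMeasurable (ae_of_all _ fun x => ?_)
      rw [Real.norm_eq_abs, abs_abs]
      exact (abs_sub _ _).trans (add_le_add (hM' x) (hM x))
    have h6 : (∫ x, Real.exp (θ' x - logWeight x)) - (∫ x, Real.exp (θ x - logWeight x)) ≤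
        ∫ x, Real.exp M * (|θ' x - θ x| * Real.exp (-logWeight x)) := by
      rw [← integral_sub hi1 hi2]
      refine integral_mono (hi1.sub hi2) hi3 fun x => ?_
      simp only
      have h7 := (le_abs_self _).trans (abs_exp_sub_exp_le (abs_le.1 (hM' x)).2 (abs_le.1 (hM x)).2)
      rw [sub_eq_add_neg (θ' x), sub_eq_add_neg (θ x), Real.exp_add, Real.exp_add, ← sub_mul,
        ← mul_assoc]
      exact mul_le_mul_of_nonneg_right h7 (Real.exp_pos _).le
    rw [integral_const_mul] at h6
    have := mul_le_mul_of_nonneg_left h2 (Real.exp_pos M).le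
    linarith
  have h6 := mul_le_mul_of_nonneg_left h5 (Real.exp_pos (-1)).le
  have h7 : e / N + Real.exp (-1) * (Real.exp M * (e / N)) = e := by
    have : e / N + Real.exp (-1) * (Real.exp M * (e / N)) = N * (e / N) := by rw [hN]; ring
    rw [this]; field_simp
  linarith

/-- Test with n times the indicator of a Lebesgue null set A. The exponential integral does not see
A, so n ρ(A) stays bounded as n grows. -/
lemma absolutelyContinuous_of_dual_bound (hmom : Integrable (fun x => ‖x‖) ρ)
    (h : ∀ (ψ : Space d → ℝ) (Λ : ℝ), 0 ≤ Λ → (∀ x y, ‖ψ x - ψ y‖ ≤ Λ * ‖x - y‖) →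
      Integrable (fun x => Real.exp (ψ x)) →
      ∫ x, ψ x ∂ρ ≤ K + Real.exp (-1) * ∫ x, Real.exp (ψ x)) : ρ ≪ volume := by
  refine Measure.AbsolutelyContinuous.mk fun A hA hA0 => ?_
  have hw := integrable_logWeight hmom
  set c := K + Real.exp (-1) * (∫ x : Space d, Real.exp (-logWeight x)) +
    ∫ x, logWeight x ∂ρ with hc
  have key : ∀ n : ℕ, (n : ℝ) * ρ.real A ≤ c := by
    intro n
    have hmeas : Measurable (A.indicator fun _ => (n : ℝ)) := measurable_const.indicator hA
    have hb : ∀ x, |A.indicator (fun _ => (n : ℝ)) x| ≤ n := fun x => by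
      by_cases hx : x ∈ A <;> simp [hx]
    have h1 := dual_bound_of_measurable hmom h hmeas hb
    rw [integral_sub (Integrable.of_bound hmeas.aestronglyMeasurable n (ae_of_all _ hb)) hw,
      integral_indicator_const _ hA] at h1
    have h2 : ∫ x, Real.exp (A.indicator (fun _ => (n : ℝ)) x - logWeight x) =
        ∫ x : Space d, Real.exp (-logWeight x) := by
      refine integral_congr_ae ?_
      have : ∀ᵐ x : Space d, x ∉ A := measure_eq_zero_iff_ae_notMem.1 hA0
      filter_upwards [this] with x hx
      simp [hx]
    rw [h2, smul_eq_mul] at h1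
    linarith [mul_comm (n : ℝ) (ρ.real A)]
  have h0 : ρ.real A = 0 := by
    by_contra hne
    have hpos : 0 < ρ.real A := lt_of_le_of_ne measureReal_nonneg (Ne.symm hne)
    obtain ⟨n, hn⟩ := exists_nat_gt (c / ρ.real A)
    rw [div_lt_iff₀ hpos] at hn
    linarith [key n]
  exact (measureReal_eq_zero_iff).1 h0

/-- The truncated relative entropy density `v (1 + c) - e ^ c` is bounded below by `-1` if `c` lies
between `0` and `log v`. -/
lemma neg_one_le_mul_sub_exp {v c : ℝ} (hv : 0 < v) (hc : 0 ≤ c ∧ c ≤ Real.log v ∨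
    c ≤ 0 ∧ Real.log v ≤ c) : -1 ≤ v * (1 + c) - Real.exp c := by
  rcases hc with ⟨h0, h1⟩ | ⟨h0, h1⟩
  · have h2 : Real.exp c ≤ v := by rwa [← Real.le_log_iff_exp_le hv]
    nlinarith
  · have h2 : v ≤ Real.exp c := by rwa [← Real.log_le_iff_le_exp hv]
    have h3 : Real.exp c * (1 - c) ≤ 1 := by
      have h4 : 1 - c ≤ Real.exp (-c) := by linarith [Real.add_one_le_exp (-c)]
      calc Real.exp c * (1 - c) ≤ Real.exp c * Real.exp (-c) := by gcongr
        _ = 1 := by rw [← Real.exp_add]; simp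
    have h5 : v * c ≥ Real.exp c * c := by nlinarith
    nlinarith

/-- For v < 1 the two sides differ through -2 v log v, and -v log v ≤ 1 - v. -/
lemma mul_abs_log_le {v : ℝ} (hv : 0 ≤ v) : v * |Real.log v| ≤ v * Real.log v + 2 := by
  rcases hv.eq_or_lt with rfl | hv
  · simp
  rcases le_total 0 (Real.log v) with h | h
  · rw [abs_of_nonneg h]; linarith
  · rw [abs_of_nonpos h]
    have := Real.add_one_le_exp (-Real.log v)
    rw [Real.exp_neg, Real.exp_log hv] at this
    have h2 := mul_le_mul_of_nonneg_left this hv.le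
    rw [mul_inv_cancel₀ hv.ne'] at h2
    nlinarith

/-- A dual entropy bound gives absolute continuity with an `L log L` bound on the density. -/
theorem lintegral_density_abs_log_le (hmom : Integrable (fun x => ‖x‖) ρ)
    (h : ∀ (ψ : Space d → ℝ) (Λ : ℝ), 0 ≤ Λ → (∀ x y, ‖ψ x - ψ y‖ ≤ Λ * ‖x - y‖) →
      Integrable (fun x => Real.exp (ψ x)) →
      ∫ x, ψ x ∂ρ ≤ K + Real.exp (-1) * ∫ x, Real.exp (ψ x)) :
    ∫⁻ x, ENNReal.ofReal (density ρ x * |Real.log (density ρ x)|) ≤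
      ENNReal.ofReal (K + 3 * (∫ x : Space d, Real.exp (-logWeight x)) +
        2 * ∫ x, logWeight x ∂ρ) := by
  have hac := absolutelyContinuous_of_dual_bound hmom h
  have hw := integrable_logWeight hmom
  set g := density ρ with hg
  have hgm : Measurable g := (Measure.measurable_rnDeriv ρ volume).ennreal_toReal
  have hg0 : ∀ x, 0 ≤ g x := fun x => ENNReal.toReal_nonneg
  have hgi : Integrable g := Measure.integrable_toReal_rnDeriv
  have hgint : ∀ {f : Space d → ℝ}, Integrable f ρ →
      Integrable (fun x => g x * f x) ∧ ∫ x, g x * f x = ∫ x, f x ∂ρ := fun hf =>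
    ⟨(integrable_rnDeriv_smul_iff hac).2 hf, integral_toReal_rnDeriv_mul hac⟩
  set v : Space d → ℝ := fun x => g x * Real.exp (logWeight x) with hv
  have hwm := (continuous_logWeight (d := d)).measurable
  have hvm : Measurable v := hgm.mul (Real.measurable_exp.comp hwm)
  have hv0 : ∀ x, 0 ≤ v x := fun x => mul_nonneg (hg0 x) (Real.exp_pos _).le
  -- v is the density of ρ relative to e^{-w} dx. The optimal test function in the dual bound is 1 +
  -- log v, here truncated to be bounded.
  set c : ℕ → Space d → ℝ := fun n x => max (-n) (min n (Real.log (v x))) with hc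
  have hcm : ∀ n, Measurable (c n) := fun n =>
    measurable_const.max (measurable_const.min (Real.measurable_log.comp hvm))
  have hcb : ∀ n x, |c n x| ≤ n := fun n x =>
    abs_le.2 ⟨le_max_left _ _, max_le (by linarith [(Nat.cast_nonneg n : (0 : ℝ) ≤ n)])
      (min_le_left _ _)⟩
  have hc1 : ∀ n x, 0 ≤ c n x ∧ c n x ≤ Real.log (v x) ∨ c n x ≤ 0 ∧ Real.log (v x) ≤ c n x := by
    intro n x
    have hn : (0 : ℝ) ≤ n := Nat.cast_nonneg n
    rcases le_total 0 (Real.log (v x)) with hl | hl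
    · left
      exact ⟨le_max_of_le_right (le_min hn hl), max_le (by linarith) (min_le_right _ _)⟩
    · right
      refine ⟨max_le (by linarith) ((min_le_right _ _).trans hl), ?_⟩
      simp only [hc]
      rw [min_eq_right (hl.trans hn)]
      exact le_max_right _ _
  -- The integrand of the dual bound, made nonnegative so that Fatou applies. The term 3 e^{-w}
  -- covers both the lower bound -1 of the truncated relative entropy and the 2 lost in passing from
  -- v log v to v |log v|; the term g w pays for replacing log v by log g.
  set F : ℕ → Space d → ℝ := fun n x =>
    Real.exp (-logWeight x) * (v x * (1 + c n x) - Real.exp (c n x)) +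
      3 * Real.exp (-logWeight x) + g x * logWeight x with hF
  have hgv : ∀ x, Real.exp (-logWeight x) * v x = g x := fun x => by
    simp only [hv]
    rw [mul_comm, mul_assoc, ← Real.exp_add]; simp
  have hF0 : ∀ n x, 0 ≤ F n x := by
    intro n x
    have h1 : -1 ≤ v x * (1 + c n x) - Real.exp (c n x) := by
      rcases (hv0 x).eq_or_lt with h0 | h0
      · have : c n x = 0 := by
          simp only [hc]; rw [← h0]; simp
        rw [this, ← h0]; simp
      · exact neg_one_le_mul_sub_exp h0 (hc1 n x)
    have h2 := mul_nonneg (hg0 x) (logWeight_nonneg x)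
    have h3 := Real.exp_pos (-logWeight x)
    simp only [hF]
    nlinarith
  have hFm : ∀ n, Measurable (F n) := fun n =>
    (((Real.measurable_exp.comp hwm.neg).mul ((hvm.mul ((hcm n).const_add 1)).sub
      (Real.measurable_exp.comp (hcm n)))).add
      ((Real.measurable_exp.comp hwm.neg).const_mul 3)).add (hgm.mul hwm)
  have hFint : ∀ n, ∫⁻ x, ENNReal.ofReal (F n x) ≤ ENNReal.ofReal
      (K + 3 * (∫ x : Space d, Real.exp (-logWeight x)) + 2 * ∫ x, logWeight x ∂ρ) := by
    intro n
    have hθm : Measurable fun x => 1 + c n x := (hcm n).const_add 1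
    have hθb : ∀ x, |1 + c n x| ≤ 1 + n := fun x =>
      (abs_add_le _ _).trans (by rw [abs_one]; linarith [hcb n x])
    have h1 := dual_bound_of_measurable hmom h hθm hθb
    have hθi : Integrable (fun x => 1 + c n x) ρ :=
      Integrable.of_bound hθm.aestronglyMeasurable _ (ae_of_all _ hθb)
    rw [integral_sub hθi hw] at h1
    obtain ⟨i1, e1⟩ := hgint hθi
    obtain ⟨i2, e2⟩ := hgint hw
    have i3 := integrable_exp_sub_logWeight (hcm n) (hcb n)
    have i4 := (integrable_exp_neg_logWeight (d := d)).const_mul 3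
    have e3 : Real.exp (-1) * ∫ x, Real.exp (1 + c n x - logWeight x) =
        ∫ x, Real.exp (c n x - logWeight x) := by
      rw [← integral_const_mul]
      refine integral_congr_ae (ae_of_all _ fun x => ?_)
      simp only
      rw [← Real.exp_add]; ring_nf
    rw [e3] at h1
    have eF : ∀ x, F n x = ((g x * (1 + c n x) - Real.exp (c n x - logWeight x)) +
        3 * Real.exp (-logWeight x)) + g x * logWeight x := fun x => by
      simp only [hF]
      rw [mul_sub, ← mul_assoc, hgv, sub_eq_add_neg (c n x), Real.exp_add (c n x),
        mul_comm (Real.exp (c n x))]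
    have i5 : Integrable fun x => (g x * (1 + c n x) - Real.exp (c n x - logWeight x)) +
        3 * Real.exp (-logWeight x) := (i1.sub i3).add i4
    have i6 : Integrable fun x => g x * (1 + c n x) - Real.exp (c n x - logWeight x) := i1.sub i3
    have hi : Integrable (F n) := by
      rw [show F n = _ from funext eF]
      exact i5.add i2
    rw [← ofReal_integral_eq_lintegral_ofReal hi (ae_of_all _ (hF0 n))]
    refine ENNReal.ofReal_le_ofReal ?_
    simp_rw [eF]
    rw [integral_add i5 i2, integral_add i6 i4, integral_sub i1 i3, e1, e2, integral_const_mul]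
    linarith
  -- At a fixed point the truncation becomes inactive for large n, and the exponential then cancels
  -- against v.
  have hlim : ∀ x, ENNReal.ofReal (g x * |Real.log (g x)|) ≤
      liminf (fun n => ENNReal.ofReal (F n x)) atTop := by
    intro x
    refine le_liminf_of_le (by isBoundedDefault) ?_
    obtain ⟨N, hN⟩ := exists_nat_ge |Real.log (v x)|
    filter_upwards [eventually_ge_atTop N] with n hn
    refine ENNReal.ofReal_le_ofReal ?_
    have hn' : |Real.log (v x)| ≤ n := hN.trans (by exact_mod_cast hn)
    have hcn : c n x = Real.log (v x) := by
      simp only [hc]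
      rw [min_eq_right (abs_le.1 hn').2, max_eq_right (abs_le.1 hn').1]
    rcases (hg0 x).eq_or_lt with h0 | h0
    · rw [← h0, zero_mul]; exact hF0 n x
    have hvpos : 0 < v x := mul_pos h0 (Real.exp_pos _)
    have hlog : Real.log (v x) = Real.log (g x) + logWeight x := by
      simp only [hv]
      rw [Real.log_mul h0.ne' (Real.exp_pos _).ne', Real.log_exp]
    have h1 : |Real.log (g x)| ≤ |Real.log (v x)| + logWeight x := by
      have : Real.log (g x) = Real.log (v x) - logWeight x := by linarith
      rw [this]
      refine (abs_sub _ _).trans ?_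
      rw [abs_of_nonneg (logWeight_nonneg x)]
    have h2 := mul_abs_log_le hvpos.le
    have h3 := mul_le_mul_of_nonneg_left h2 (Real.exp_pos (-logWeight x)).le
    have h4 := mul_le_mul_of_nonneg_left h1 h0.le
    simp only [hF, hcn, Real.exp_log hvpos]
    have e1 : Real.exp (-logWeight x) * (v x * |Real.log (v x)|) = g x * |Real.log (v x)| := by
      rw [← mul_assoc, hgv]
    rw [e1] at h3
    have h5 := Real.exp_pos (-logWeight x)
    nlinarith
  calc ∫⁻ x, ENNReal.ofReal (g x * |Real.log (g x)|)
      ≤ ∫⁻ x, liminf (fun n => ENNReal.ofReal (F n x)) atTop := lintegral_mono hlim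
    _ ≤ liminf (fun n => ∫⁻ x, ENNReal.ofReal (F n x)) atTop :=
        lintegral_liminf_le fun n => (hFm n).ennreal_ofReal
    _ ≤ _ := by
        refine (liminf_le_liminf (Eventually.of_forall hFint)).trans ?_
        simp

end

end NonlocalDiffusion

end

noncomputable section
namespace NonlocalDiffusion
set_option maxSynthPendingDepth 3
variable {d : ℕ}

/-! ### Smooth kernels -/

/-- The properties of the mollifiers that enter the estimates. -/
structure SmoothKernel (k : Space d → ℝ) (B : ℝ) : Prop where
  contDiff : ContDiff ℝ 2 k
  nonneg : ∀ x, 0 ≤ k x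
  even : ∀ x, k (-x) = k x
  integral_eq_one : ∫ x, k x = 1
  integrable_fderiv : Integrable (fderiv ℝ k)
  integrable_fderiv_fderiv : Integrable (fderiv ℝ (fderiv ℝ k))
  bound : ∀ x, ‖k x‖ ≤ B
  bound_fderiv : ∀ x, ‖fderiv ℝ k x‖ ≤ B
  bound_fderiv_fderiv : ∀ x, ‖fderiv ℝ (fderiv ℝ k) x‖ ≤ B
  integrable_sq : Integrable fun x => ‖x‖ ^ 2 * k x

/-- The essential bound holds on a closed set of full measure, which is dense and hence everything.
-/
lemma norm_le_toReal_eLpNorm_top {F : Type*} [NormedAddCommGroup F] {g : Space d → F}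
    (hg : Continuous g) (h : eLpNorm g ⊤ volume ≠ ⊤) (x : Space d) :
    ‖g x‖ ≤ (eLpNorm g ⊤ volume).toReal := by
  have h1 : ∀ᵐ x, ‖g x‖ ≤ (eLpNorm g ⊤ volume).toReal := by
    filter_upwards [ae_le_eLpNormEssSup (f := g) (μ := volume)] with x hx
    rw [← eLpNorm_exponent_top] at hx
    have := ENNReal.toReal_mono h hx
    simpa using this
  have h2 : IsClosed {x | ‖g x‖ ≤ (eLpNorm g ⊤ volume).toReal} :=
    isClosed_le hg.norm continuous_const
  have h3 := Measure.dense_of_ae h1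
  rw [dense_iff_closure_eq, h2.closure_eq] at h3
  have h4 : x ∈ {x | ‖g x‖ ≤ (eLpNorm g ⊤ volume).toReal} := h3.symm ▸ mem_univ x
  exact h4

lemma exists_bound_of_memLp_top {F : Type*} [NormedAddCommGroup F] {g : Space d → F}
    (hg : Continuous g) (h : MemLp g ⊤) : ∃ B, ∀ x, ‖g x‖ ≤ B :=
  ⟨_, norm_le_toReal_eLpNorm_top hg h.2.ne⟩

lemma fderiv_smul_comp_smul {F : Type*} [NormedAddCommGroup F] [NormedSpace ℝ F]
    {g : Space d → F} (hg : Differentiable ℝ g) (c a : ℝ) :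
    fderiv ℝ (fun x => c • g (a • x)) = fun x => (c * a) • fderiv ℝ g (a • x) := by
  funext x
  have h1 : HasFDerivAt (fun x : Space d => a • x) (a • ContinuousLinearMap.id ℝ (Space d)) x :=
    (hasFDerivAt_id x).const_smul a
  have h2 := (((hg (a • x)).hasFDerivAt.comp x h1).const_smul c).fderiv
  refine h2.trans ?_
  ext y
  simp [mul_smul]

lemma mollifier_eq (φ : Space d → ℝ) (ε : ℝ) :
    mollifier φ ε = fun x => (ε ^ d)⁻¹ • φ (ε⁻¹ • x) := rfl

lemma MollifierAssumption.smoothKernel {φ : Space d → ℝ} (hφ : MollifierAssumption φ) {ε : ℝ}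
    (hε : 0 < ε) : ∃ B, SmoothKernel (mollifier φ ε) B ∧
      ∫ x, ‖x‖ ^ 2 * mollifier φ ε x = ε ^ 2 * ∫ x, ‖x‖ ^ 2 * φ x := by
  have hc1 : ContDiff ℝ 1 (fderiv ℝ φ) := hφ.contDiff.fderiv_right (by norm_num)
  have hd1 := fderiv_smul_comp_smul (hφ.contDiff.differentiable (by norm_num)) (ε ^ d)⁻¹ ε⁻¹
  have hd2 := fderiv_smul_comp_smul (hc1.differentiable one_ne_zero) ((ε ^ d)⁻¹ * ε⁻¹) ε⁻¹
  obtain ⟨B0, hB0⟩ := exists_bound_of_memLp_top hφ.contDiff.continuous hφ.memLp.2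
  obtain ⟨B1, hB1⟩ := exists_bound_of_memLp_top hc1.continuous hφ.memLp_fderiv.2
  obtain ⟨B2, hB2⟩ := exists_bound_of_memLp_top (hc1.continuous_fderiv one_ne_zero)
    hφ.memLp_fderiv_fderiv.2
  have hε' : ε⁻¹ ≠ 0 := inv_ne_zero hε.ne'
  have hb : ∀ {F : Type} [NormedAddCommGroup F] [NormedSpace ℝ F] (c b : ℝ) (z : F), ‖z‖ ≤ b →
      ‖c • z‖ ≤ |c| * b := fun c b z hz => by
    rw [norm_smul, Real.norm_eq_abs]; gcongr
  have hsq : ∀ x : Space d, ‖x‖ ^ 2 * mollifier φ ε x =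
      (ε ^ 2 * (ε ^ d)⁻¹) * (‖ε⁻¹ • x‖ ^ 2 * φ (ε⁻¹ • x)) := fun x => by
    rw [norm_smul, mul_pow, norm_inv, Real.norm_of_nonneg hε.le]
    simp only [mollifier]
    field_simp
  set c0 := |(ε ^ d)⁻¹| * B0
  set c1 := |(ε ^ d)⁻¹ * ε⁻¹| * B1
  set c2 := |(ε ^ d)⁻¹ * ε⁻¹ * ε⁻¹| * B2
  refine ⟨max c0 (max c1 c2), ⟨?_, ?_, ?_, ?_, ?_, ?_, ?_, ?_, ?_, ?_⟩, ?_⟩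
  · rw [mollifier_eq]
    have h : ContDiff ℝ 2 fun x : Space d => ε⁻¹ • x := contDiff_id.const_smul ε⁻¹
    exact contDiff_const.mul (hφ.contDiff.comp h)
  · exact fun x => mul_nonneg (by positivity) (hφ.nonneg _)
  · intro x
    simp [mollifier, hφ.even]
  · simp only [mollifier]
    rw [integral_const_mul, Measure.integral_comp_inv_smul_of_nonneg _ _ hε.le,
      hφ.integral_eq_one]
    simp only [finrank_euclideanSpace, Fintype.card_fin, smul_eq_mul, mul_one]
    exact inv_mul_cancel₀ (by positivity)
  · rw [mollifier_eq, hd1]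
    exact ((memLp_one_iff_integrable.1 hφ.memLp_fderiv.1).comp_smul hε').smul ((ε ^ d)⁻¹ * ε⁻¹)
  · rw [mollifier_eq, hd1, hd2]
    exact ((memLp_one_iff_integrable.1 hφ.memLp_fderiv_fderiv.1).comp_smul hε').smul
      ((ε ^ d)⁻¹ * ε⁻¹ * ε⁻¹)
  · exact fun x => (hb _ _ _ (hB0 _)).trans (le_max_left _ _)
  · intro x
    rw [mollifier_eq, hd1]
    exact (hb _ _ _ (hB1 _)).trans ((le_max_left _ _).trans (le_max_right _ _))
  · intro x
    rw [mollifier_eq, hd1, hd2]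
    exact (hb _ _ _ (hB2 _)).trans ((le_max_right _ _).trans (le_max_right _ _))
  · rw [funext hsq]
    exact (hφ.secondMoment.comp_smul hε').const_mul _
  · simp_rw [hsq]
    rw [integral_const_mul, Measure.integral_comp_inv_smul_of_nonneg
      (f := fun x => ‖x‖ ^ 2 * φ x) _ hε.le]
    simp only [finrank_euclideanSpace, Fintype.card_fin, smul_eq_mul]
    rw [mul_assoc, inv_mul_cancel_left₀ (by positivity)]

namespace SmoothKernel

variable {k : Space d → ℝ} {B : ℝ}

lemma bound_nonneg (hk : SmoothKernel k B) : 0 ≤ B := (norm_nonneg _).trans (hk.bound 0)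

lemma integrable (hk : SmoothKernel k B) : Integrable k :=
  Integrable.of_integral_ne_zero (by rw [hk.integral_eq_one]; exact one_ne_zero)

lemma contDiff_one (hk : SmoothKernel k B) : ContDiff ℝ 1 k := hk.contDiff.of_le (by norm_num)

lemma contDiff_fderiv (hk : SmoothKernel k B) : ContDiff ℝ 1 (fderiv ℝ k) :=
  hk.contDiff.fderiv_right (by norm_num)

lemma lipschitz (hk : SmoothKernel k B) (x y : Space d) : ‖k x - k y‖ ≤ B * ‖x - y‖ :=
  lipschitz_bound_of_fderiv_le (hk.contDiff_one.differentiable one_ne_zero) hk.bound_fderiv x y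

lemma integral_norm (hk : SmoothKernel k B) : ∫ x, ‖k x‖ = 1 := by
  rw [← hk.integral_eq_one]
  exact integral_congr_ae (ae_of_all _ fun x => Real.norm_of_nonneg (hk.nonneg x))

variable {μ ν : Measure (Space d)}

lemma smooth_nonneg (hk : SmoothKernel k B) (x : Space d) : 0 ≤ smooth k μ x :=
  integral_nonneg fun _ => hk.nonneg _

lemma smooth_lipschitz [IsProbabilityMeasure μ] (hk : SmoothKernel k B) (x y : Space d) :
    ‖smooth k μ x - smooth k μ y‖ ≤ B * ‖x - y‖ :=
  norm_smooth_sub_le hk.bound hk.lipschitz x y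

/-- The function y ↦ k(x - y) is itself an admissible Lipschitz test function. In this way
continuity of the curve in measure becomes uniform continuity of the smoothed density in time. -/
lemma abs_smooth_sub_le (hk : SmoothKernel k B) {c : ℝ} (h : LipClose μ ν c) (x : Space d) :
    |smooth k μ x - smooth k ν x| ≤ B * c := by
  refine h (fun y => k (x - y)) B hk.bound_nonneg fun y z => ?_
  refine (hk.lipschitz _ _).trans_eq ?_
  rw [sub_sub_sub_cancel_left, norm_sub_rev]

end SmoothKernel

/-! ### The nonlocal pressure -/

/-- The values of a function `F'` of the smoothed measure. -/
def chemical (k : Space d → ℝ) (F' : ℝ → ℝ) (μ : Measure (Space d)) (x : Space d) : ℝ :=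
  F' (smooth k μ x)

lemma pressure_eq_conv (f : ℝ → EReal) (φ : Space d → ℝ) (γ ε : ℝ) (μ : Measure (Space d)) :
    pressure f φ γ ε μ =
      conv (mollifier φ ε) (chemical (mollifier φ ε) (regDensityDeriv γ f) μ) := by
  funext x
  refine integral_congr_ae (ae_of_all _ fun y => ?_)
  exact mul_comm _ _

namespace SmoothKernel

variable {k : Space d → ℝ} {B : ℝ} {F' : ℝ → ℝ} {Γ : ℝ}
  {μ ν : Measure (Space d)}

lemma abs_chemical_sub_le (hk : SmoothKernel k B) (hΓ : 0 ≤ Γ)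
    (hF : ∀ a b, 0 ≤ a → 0 ≤ b → |F' a - F' b| ≤ Γ * |a - b|) {c : ℝ} (h : LipClose μ ν c)
    (x : Space d) : |chemical k F' μ x - chemical k F' ν x| ≤ Γ * B * c := by
  refine (hF _ _ (hk.smooth_nonneg x) (hk.smooth_nonneg x)).trans ?_
  rw [mul_assoc]
  exact mul_le_mul_of_nonneg_left (hk.abs_smooth_sub_le h x) hΓ

variable [IsProbabilityMeasure μ]

lemma abs_chemical_le (hk : SmoothKernel k B) (hΓ : 0 ≤ Γ)
    (hF : ∀ a b, 0 ≤ a → 0 ≤ b → |F' a - F' b| ≤ Γ * |a - b|) (x : Space d) :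
    |chemical k F' μ x| ≤ |F' 0| + Γ * B := by
  have h1 := hF _ 0 (hk.smooth_nonneg (μ := μ) x) le_rfl
  have h2 := norm_smooth_le (μ := μ) hk.bound x
  rw [sub_zero] at h1
  have h3 := abs_sub_abs_le_abs_sub (F' (smooth k μ x)) (F' 0)
  have h4 := mul_le_mul_of_nonneg_left h2 hΓ
  rw [Real.norm_eq_abs] at h4
  unfold chemical
  linarith

lemma chemical_lipschitz (hk : SmoothKernel k B) (hΓ : 0 ≤ Γ)
    (hF : ∀ a b, 0 ≤ a → 0 ≤ b → |F' a - F' b| ≤ Γ * |a - b|) (x y : Space d) :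
    ‖chemical k F' μ x - chemical k F' μ y‖ ≤ (Γ * B) * ‖x - y‖ := by
  refine (hF _ _ (hk.smooth_nonneg x) (hk.smooth_nonneg y)).trans ?_
  rw [mul_assoc]
  exact mul_le_mul_of_nonneg_left (hk.smooth_lipschitz x y) hΓ

lemma continuous_chemical (hk : SmoothKernel k B) (hΓ : 0 ≤ Γ)
    (hF : ∀ a b, 0 ≤ a → 0 ≤ b → |F' a - F' b| ≤ Γ * |a - b|) : Continuous (chemical k F' μ) :=
  continuous_of_lipschitz_bound (hk.chemical_lipschitz hΓ hF)

lemma hasFDerivAt_conv_chemical (hk : SmoothKernel k B) (hΓ : 0 ≤ Γ)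
    (hF : ∀ a b, 0 ≤ a → 0 ≤ b → |F' a - F' b| ≤ Γ * |a - b|) (x : Space d) :
    HasFDerivAt (conv k (chemical k F' μ)) (conv (fderiv ℝ k) (chemical k F' μ) x) x :=
  hasFDerivAt_conv hk.contDiff_one hk.integrable hk.integrable_fderiv
    (hk.abs_chemical_le hΓ hF) (hk.chemical_lipschitz hΓ hF) x

lemma fderiv_conv_chemical (hk : SmoothKernel k B) (hΓ : 0 ≤ Γ)
    (hF : ∀ a b, 0 ≤ a → 0 ≤ b → |F' a - F' b| ≤ Γ * |a - b|) :
    fderiv ℝ (conv k (chemical k F' μ)) = conv (fderiv ℝ k) (chemical k F' μ) :=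
  funext fun x => (hk.hasFDerivAt_conv_chemical hΓ hF x).fderiv

lemma hasFDerivAt_conv_fderiv_chemical (hk : SmoothKernel k B) (hΓ : 0 ≤ Γ)
    (hF : ∀ a b, 0 ≤ a → 0 ≤ b → |F' a - F' b| ≤ Γ * |a - b|) (x : Space d) :
    HasFDerivAt (conv (fderiv ℝ k) (chemical k F' μ))
      (conv (fderiv ℝ (fderiv ℝ k)) (chemical k F' μ) x) x :=
  hasFDerivAt_conv hk.contDiff_fderiv hk.integrable_fderiv hk.integrable_fderiv_fderiv
    (hk.abs_chemical_le hΓ hF) (hk.chemical_lipschitz hΓ hF) x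

end SmoothKernel

/-! ### Gradients and divergences -/

/-- The Riesz map on `ℝ^d`. -/
def rieszMap (d : ℕ) : (Space d →L[ℝ] ℝ) →L[ℝ] Space d :=
  LinearMap.mkContinuous
    { toFun := fun A => (InnerProductSpace.toDual ℝ (Space d)).symm A
      map_add' := fun A A' => by simp
      map_smul' := fun c A => by simp } 1 fun A => by simp

lemma gradient_eq (g : Space d → ℝ) (x : Space d) : gradient g x = rieszMap d (fderiv ℝ g x) := rfl

lemma norm_rieszMap (A : Space d →L[ℝ] ℝ) : ‖rieszMap d A‖ = ‖A‖ :=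
  LinearIsometryEquiv.norm_map _ A

lemma inner_rieszMap (A : Space d →L[ℝ] ℝ) (y : Space d) : inner ℝ (rieszMap d A) y = A y :=
  InnerProductSpace.toDual_symm_apply

/-- The trace as a continuous linear functional. -/
def traceL (d : ℕ) : (Space d →L[ℝ] Space d) →L[ℝ] ℝ :=
  LinearMap.toContinuousLinearMap
    ((LinearMap.trace ℝ (Space d)) ∘ₗ (ContinuousLinearMap.coeLM ℝ))

lemma divergence_eq (w : Space d → Space d) (x : Space d) :
    divergence w x = traceL d (fderiv ℝ w x) := rfl

end NonlocalDiffusion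

end

noncomputable section
namespace NonlocalDiffusion
variable {d : ℕ}

/-! ### Wasserstein distance and moments -/

lemma integrable_norm_sq {μ : Measure (Space d)} (h : secondMoment μ < ⊤) :
    Integrable (fun x => ‖x‖ ^ 2) μ := by
  refine ⟨(continuous_norm.pow 2).aestronglyMeasurable, ?_⟩
  rw [hasFiniteIntegral_iff_enorm]
  simpa [secondMoment, enorm_pow] using h

lemma integrable_norm {μ : Measure (Space d)} [IsFiniteMeasure μ] (h : secondMoment μ < ⊤) :
    Integrable (fun x => ‖x‖) μ := by
  refine Integrable.mono' ((integrable_const 1).add (integrable_norm_sq h))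
    continuous_norm.aestronglyMeasurable (ae_of_all _ fun x => ?_)
  simp only [norm_norm, Pi.add_apply]
  nlinarith [sq_nonneg (‖x‖ - 1)]

lemma ofReal_integral_norm_sq {μ : Measure (Space d)} (h : secondMoment μ < ⊤) :
    ENNReal.ofReal (∫ x, ‖x‖ ^ 2 ∂μ) = secondMoment μ := by
  rw [ofReal_integral_eq_lintegral_ofReal (integrable_norm_sq h)
    (ae_of_all _ fun x => by positivity)]
  refine lintegral_congr fun x => ?_
  rw [ENNReal.ofReal_pow (norm_nonneg _), ofReal_norm]

lemma exists_plan {μ ν : Measure (Space d)} {r : ℝ≥0∞} (h : wasserstein₂ μ ν < r) :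
    ∃ γ : Measure (Space d × Space d), γ.map Prod.fst = μ ∧ γ.map Prod.snd = ν ∧
      (∫⁻ z, ‖z.1 - z.2‖ₑ ^ 2 ∂γ) ^ (1 / 2 : ℝ) < r := by
  unfold wasserstein₂ at h
  simp only [iInf_lt_iff] at h
  obtain ⟨γ, hγ, hr⟩ := h
  exact ⟨γ, hγ.1, hγ.2, hr⟩

lemma isProbabilityMeasure_of_map_fst {μ : Measure (Space d)} [IsProbabilityMeasure μ]
    {γ : Measure (Space d × Space d)} (h : γ.map Prod.fst = μ) : IsProbabilityMeasure γ := by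
  refine ⟨?_⟩
  have := measure_univ (μ := μ)
  rwa [← h, Measure.map_apply measurable_fst MeasurableSet.univ, preimage_univ] at this

/-- A nearly optimal plan for the quadratic cost has, by Jensen, no larger linear cost, and
Lipschitz functions are integrated against the plan. The excess e' absorbs the fact that the infimum
need not be attained. -/
lemma lipClose_of_wasserstein₂_le {μ ν : Measure (Space d)} [IsProbabilityMeasure μ]
    [IsProbabilityMeasure ν] (hμ : Integrable (fun x => ‖x‖) μ)
    (hν : Integrable (fun x => ‖x‖) ν) {r : ℝ} (hr : 0 ≤ r)
    (h : wasserstein₂ μ ν ≤ ENNReal.ofReal r) : LipClose μ ν r := by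
  intro ψ Λ hΛ hψ
  refine le_of_forall_pos_le_add fun e he => ?_
  set e' := e / (Λ + 1) with he'
  have he'0 : 0 < e' := by positivity
  obtain ⟨γ, h1, h2, h3⟩ := exists_plan (h.trans_lt
    ((ENNReal.ofReal_lt_ofReal_iff (by linarith)).2 (lt_add_of_pos_right r he'0)))
  have hγ : IsProbabilityMeasure γ := isProbabilityMeasure_of_map_fst h1
  have hc := continuous_of_lipschitz_bound hψ
  have hiμ := integrable_of_lipschitz_bound hμ hψ
  have hiν := integrable_of_lipschitz_bound hν hψ
  have e1 : ∫ x, ψ x ∂μ = ∫ z, ψ z.1 ∂γ := by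
    rw [← h1, integral_map measurable_fst.aemeasurable hc.aestronglyMeasurable]
  have e2 : ∫ x, ψ x ∂ν = ∫ z, ψ z.2 ∂γ := by
    rw [← h2, integral_map measurable_snd.aemeasurable hc.aestronglyMeasurable]
  have i1 : Integrable (fun z : Space d × Space d => ψ z.1) γ := by
    rw [← h1] at hiμ
    exact hiμ.comp_measurable measurable_fst
  have i2 : Integrable (fun z : Space d × Space d => ψ z.2) γ := by
    rw [← h2] at hiν
    exact hiν.comp_measurable measurable_snd
  have hcost : ∫⁻ z, ‖z.1 - z.2‖ₑ ∂γ ≤ ENNReal.ofReal (r + e') := by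
    refine le_trans ?_ h3.le
    have := eLpNorm_le_eLpNorm_of_exponent_le (μ := γ) (p := 1) (q := 2)
      (f := fun z : Space d × Space d => z.1 - z.2) (by norm_num)
      (continuous_fst.sub continuous_snd).aestronglyMeasurable
    rw [eLpNorm_one_eq_lintegral_enorm, eLpNorm_eq_lintegral_rpow_enorm_toReal (by norm_num)
      (by norm_num)] at this
    simpa using this
  rw [e1, e2, ← integral_sub i1 i2, ← Real.norm_eq_abs]
  have h4 : ENNReal.ofReal ‖∫ z, (ψ z.1 - ψ z.2) ∂γ‖ ≤ ENNReal.ofReal (Λ * (r + e')) := by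
    calc ENNReal.ofReal ‖∫ z, (ψ z.1 - ψ z.2) ∂γ‖ ≤ ∫⁻ z, ENNReal.ofReal ‖ψ z.1 - ψ z.2‖ ∂γ := by
          rw [ofReal_norm]
          simp_rw [ofReal_norm]
          exact enorm_integral_le_lintegral_enorm _
      _ ≤ ∫⁻ z, ENNReal.ofReal Λ * ‖z.1 - z.2‖ₑ ∂γ := by
          refine lintegral_mono fun z => ?_
          rw [← ofReal_norm, ← ENNReal.ofReal_mul hΛ]
          exact ENNReal.ofReal_le_ofReal (hψ _ _)
      _ = ENNReal.ofReal Λ * ∫⁻ z, ‖z.1 - z.2‖ₑ ∂γ :=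
          lintegral_const_mul _ (measurable_fst.sub measurable_snd).enorm
      _ ≤ ENNReal.ofReal (Λ * (r + e')) := by
          rw [ENNReal.ofReal_mul hΛ]; gcongr
  have h5 := (ENNReal.ofReal_le_ofReal_iff (by positivity)).1 h4
  have h6 : Λ * e' ≤ e := by
    rw [he', ← mul_div_assoc, div_le_iff₀ (by positivity)]
    nlinarith
  rw [mul_add] at h5
  linarith

/-- The second moment is controlled along the Wasserstein distance. -/
lemma secondMoment_le_of_wasserstein₂_lt {μ ν : Measure (Space d)}
    (h : wasserstein₂ μ ν < 1) : secondMoment μ ≤ 2 * secondMoment ν + 2 := by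
  obtain ⟨γ, h1, h2, h3⟩ := exists_plan h
  have hcost : ∫⁻ z, ‖z.1 - z.2‖ₑ ^ 2 ∂γ ≤ 1 := by
    by_contra! hlt
    exact absurd h3 (not_lt.2 (ENNReal.one_le_rpow hlt.le (by norm_num)))
  have e1 : secondMoment μ = ∫⁻ z, ‖z.1‖ₑ ^ 2 ∂γ := by
    rw [← h1, secondMoment, lintegral_map (by fun_prop) measurable_fst]
  have e2 : secondMoment ν = ∫⁻ z, ‖z.2‖ₑ ^ 2 ∂γ := by
    rw [← h2, secondMoment, lintegral_map (by fun_prop) measurable_snd]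
  rw [e1, e2]
  calc ∫⁻ z, ‖z.1‖ₑ ^ 2 ∂γ ≤ ∫⁻ z, (2 * ‖z.2‖ₑ ^ 2 + 2 * ‖z.1 - z.2‖ₑ ^ 2) ∂γ := by
        refine lintegral_mono fun z => ?_
        have h4 : ‖z.1‖ ^ 2 ≤ 2 * ‖z.2‖ ^ 2 + 2 * ‖z.1 - z.2‖ ^ 2 := by
          have : ‖z.1‖ ≤ ‖z.2‖ + ‖z.1 - z.2‖ := norm_le_norm_add_norm_sub' _ _
          nlinarith [norm_nonneg z.1, sq_nonneg (‖z.2‖ - ‖z.1 - z.2‖)]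
        have h5 := ENNReal.ofReal_le_ofReal h4
        rw [ENNReal.ofReal_add (by positivity) (by positivity), ENNReal.ofReal_mul (by norm_num),
          ENNReal.ofReal_mul (by norm_num), ENNReal.ofReal_pow (norm_nonneg _),
          ENNReal.ofReal_pow (norm_nonneg _), ENNReal.ofReal_pow (norm_nonneg _)] at h5
        simpa [ofReal_norm] using h5
    _ = 2 * ∫⁻ z, ‖z.2‖ₑ ^ 2 ∂γ + 2 * ∫⁻ z, ‖z.1 - z.2‖ₑ ^ 2 ∂γ := by
        rw [lintegral_add_left (by fun_prop), lintegral_const_mul _ (by fun_prop),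
          lintegral_const_mul _ (by fun_prop)]
    _ ≤ 2 * ∫⁻ z, ‖z.2‖ₑ ^ 2 ∂γ + 2 := by
        gcongr
        calc (2 : ℝ≥0∞) * _ ≤ 2 * 1 := by gcongr
          _ = 2 := mul_one _

/-! ### From compactly supported to Lipschitz test functions -/

/-- It is enough to test the continuity equation with compactly supported functions. -/
lemma LipDrift.driftCurve {T : ℝ} {ρ : ℝ → Measure (Space d)} {b : ℝ → Space d → Space d}
    {G : ℝ → ℝ} {B L C : ℝ} (D : LipDrift T ρ b G B L C)
    (h : ∀ s t, 0 ≤ s → s ≤ t → t ≤ T → ∀ ζ : Space d → ℝ, ContDiff ℝ ∞ ζ → HasCompactSupport ζ →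
      ∫ x, ζ x ∂(ρ t) - ∫ x, ζ x ∂(ρ s) = ∫ u in s..t, ∫ x, fderiv ℝ ζ x (b u x) ∂(ρ u)) :
    DriftCurve T ρ b G B L C := by
  refine { D with weak := fun s t hs hst ht ψ Λ hψ hΛ hLip => ?_ }
  have hB := D.B_nonneg
  have hsT : s ∈ Icc 0 T := ⟨hs, hst.trans ht⟩
  have htT : t ∈ Icc 0 T := ⟨hs.trans hst, ht⟩
  let χ : ContDiffBump (0 : Space d) := ⟨1, 2, one_pos, one_lt_two⟩
  have hχc : ContDiff ℝ ∞ χ := χ.contDiff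
  obtain ⟨c, hc⟩ := (hχc.continuous_fderiv (by simp)).bounded_above_of_compact_support
    (χ.hasCompactSupport.fderiv ℝ)
  have hc0 : 0 ≤ c := (norm_nonneg _).trans (hc 0)
  let a : ℕ → ℝ := fun n => ((n : ℝ) + 1)⁻¹
  have ha0 : ∀ n, 0 < a n := fun n => by positivity
  have ha1 : ∀ n, a n ≤ 1 := fun n => inv_le_one_of_one_le₀ (by
    have : (0 : ℝ) ≤ n := n.cast_nonneg
    linarith)
  have halim : Tendsto a atTop (𝓝 0) := by
    simpa [a, one_div] using tendsto_one_div_add_atTop_nhds_zero_nat (𝕜 := ℝ)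
  let ζ : ℕ → Space d → ℝ := fun n x => χ (a n • x) * ψ x
  have hζc : ∀ n, ContDiff ℝ ∞ (ζ n) := fun n => by
    have h1 : ContDiff ℝ ∞ fun x : Space d => a n • x := contDiff_id.const_smul (a n)
    exact (hχc.comp h1).mul hψ
  have hζs : ∀ n, HasCompactSupport (ζ n) := fun n => by
    have h1 : HasCompactSupport fun x : Space d => χ (a n • x) :=
      χ.hasCompactSupport.comp_smul (ha0 n).ne'
    exact h1.mul_right
  have hψd : Differentiable ℝ ψ := hψ.differentiable (by simp)
  have hζd : ∀ n x, fderiv ℝ (ζ n) x =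
      χ (a n • x) • fderiv ℝ ψ x + (ψ x * a n) • fderiv ℝ χ (a n • x) := fun n x => by
    have h1 : HasFDerivAt (fun x : Space d => a n • x)
        (a n • ContinuousLinearMap.id ℝ (Space d)) x := (hasFDerivAt_id x).const_smul (a n)
    have h2 := ((hχc.differentiable (by simp) (a n • x)).hasFDerivAt.comp x h1).mul
      (hψd x).hasFDerivAt
    refine h2.fderiv.trans ?_
    ext y
    simp [mul_assoc]
  have hlim1 : ∀ x : Space d, Tendsto (fun n => a n • x) atTop (𝓝 0) := fun x => by
    simpa using halim.smul_const x
  have hχlim : ∀ x : Space d, Tendsto (fun n => χ (a n • x)) atTop (𝓝 1) := fun x => by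
    have := (hχc.continuous.tendsto 0).comp (hlim1 x)
    rwa [χ.one_of_mem_closedBall (by simp [χ])] at this
  have hζlim : ∀ x, Tendsto (fun n => ζ n x) atTop (𝓝 (ψ x)) := fun x => by
    simpa using (hχlim x).mul_const (ψ x)
  have hζdlim : ∀ x, Tendsto (fun n => fderiv ℝ (ζ n) x) atTop (𝓝 (fderiv ℝ ψ x)) := fun x => by
    simp_rw [hζd]
    have h1 := (hχlim x).smul_const (fderiv ℝ ψ x)
    have h2 : Tendsto (fun n => ψ x * a n) atTop (𝓝 0) := by simpa using halim.const_mul (ψ x)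
    have h3 := h2.smul (((hχc.continuous_fderiv (by simp)).tendsto 0).comp (hlim1 x))
    simpa using h1.add h3
  have hχle : ∀ x, |χ x| ≤ 1 := fun x => by
    rw [abs_of_nonneg χ.nonneg]; exact χ.le_one
  -- Gradient bound for the cut-off functions, uniform in n. The derivative of the cut-off is of
  -- size a n and lives where a n ‖x‖ ≤ 2, which compensates the linear growth of ψ; this is what
  -- dominated convergence needs.
  set Λ' := Λ + (|ψ 0| + 2 * Λ) * c with hΛ'
  have hζdb : ∀ n x, ‖fderiv ℝ (ζ n) x‖ ≤ Λ' := fun n x => by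
    rw [hζd]
    refine (norm_add_le _ _).trans (add_le_add ?_ ?_)
    · rw [norm_smul]
      calc _ ≤ 1 * Λ := mul_le_mul (hχle _) (norm_fderiv_le_of_lipschitz_bound hΛ hLip x)
            (norm_nonneg _) zero_le_one
        _ = Λ := one_mul _
    · rw [norm_smul]
      by_cases hx : a n • x ∈ Metric.closedBall (0 : Space d) 2
      · refine mul_le_mul ?_ (hc _) (norm_nonneg _) (by positivity)
        rw [mem_closedBall_zero_iff, norm_smul, Real.norm_of_nonneg (ha0 n).le] at hx
        rw [norm_mul, Real.norm_of_nonneg (ha0 n).le]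
        have h1 := hLip x 0
        rw [sub_zero] at h1
        have h2 := norm_sub_norm_le (ψ x) (ψ 0)
        have h3 : ‖ψ x‖ ≤ |ψ 0| + Λ * ‖x‖ := by rw [← Real.norm_eq_abs]; linarith
        calc ‖ψ x‖ * a n ≤ (|ψ 0| + Λ * ‖x‖) * a n :=
              mul_le_mul_of_nonneg_right h3 (ha0 n).le
          _ = |ψ 0| * a n + Λ * (a n * ‖x‖) := by ring
          _ ≤ |ψ 0| * 1 + Λ * 2 := by
              gcongr
              exact ha1 n
          _ = |ψ 0| + 2 * Λ := by ring
      · have h0 : fderiv ℝ χ (a n • x) = 0 := by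
          refine image_eq_zero_of_notMem_tsupport fun hmem => hx ?_
          have := tsupport_fderiv_subset ℝ hmem
          rwa [χ.tsupport_eq] at this
        rw [h0, norm_zero, mul_zero]
        positivity
  have hΛ'0 : 0 ≤ Λ' := by positivity
  have hleft : ∀ u ∈ Icc 0 T, Tendsto (fun n => ∫ x, ζ n x ∂(ρ u)) atTop (𝓝 (∫ x, ψ x ∂(ρ u))) :=
    fun u hu => by
      refine tendsto_integral_of_dominated_convergence (fun x => ‖ψ x‖)
        (fun n => (hζc n).continuous.aestronglyMeasurable) (D.integrable hu hLip).norm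
        (fun n => ae_of_all _ fun x => ?_) (ae_of_all _ hζlim)
      simp only [ζ, norm_mul]
      exact mul_le_of_le_one_left (norm_nonneg _) (hχle _)
  have hbc : ∀ u ∈ Icc 0 T, Continuous (b u) := fun u hu =>
    continuous_of_lipschitz_bound (D.lip u hu)
  have hpair : ∀ n x, ∀ u ∈ Icc 0 T, ‖fderiv ℝ (ζ n) x (b u x)‖ ≤ Λ' * B := fun n x u hu =>
    (ContinuousLinearMap.le_opNorm _ _).trans
      (mul_le_mul (hζdb n x) (D.bound u hu x) (norm_nonneg _) hΛ'0)
  have hin : ∀ u ∈ Icc 0 T, Tendsto (fun n => ∫ x, fderiv ℝ (ζ n) x (b u x) ∂(ρ u)) atTop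
      (𝓝 (∫ x, fderiv ℝ ψ x (b u x) ∂(ρ u))) := fun u hu => by
    have := D.prob u hu
    refine tendsto_integral_of_dominated_convergence (fun _ => Λ' * B)
      (fun n => (((hζc n).continuous_fderiv (by simp)).clm_apply (hbc u hu)).aestronglyMeasurable)
      (integrable_const _) (fun n => ae_of_all _ fun x => hpair n x u hu)
      (ae_of_all _ fun x => ?_)
    exact ((ContinuousLinearMap.apply ℝ ℝ (b u x)).continuous.tendsto _).comp (hζdlim x)
  have hright : Tendsto (fun n => ∫ u in s..t, ∫ x, fderiv ℝ (ζ n) x (b u x) ∂(ρ u)) atTop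
      (𝓝 (∫ u in s..t, ∫ x, fderiv ℝ ψ x (b u x) ∂(ρ u))) := by
    have hsub : ∀ u ∈ uIoc s t, u ∈ Icc 0 T := fun u hu => by
      rw [uIoc_of_le hst] at hu
      exact ⟨hs.trans hu.1.le, hu.2.trans ht⟩
    refine intervalIntegral.tendsto_integral_filter_of_dominated_convergence (fun _ => Λ' * B)
      (Eventually.of_forall fun n => ?_) (Eventually.of_forall fun n => ae_of_all _ fun u hu => ?_)
      intervalIntegrable_const (ae_of_all _ fun u hu => hin u (hsub u hu))
    -- The second-derivative bound depends on n. It is used only to know that the pairing is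
    -- continuous, hence measurable, in time.
    · have hd2 : ContDiff ℝ 1 (fderiv ℝ (ζ n)) := (hζc n).fderiv_right (by
        exact WithTop.coe_le_coe.2 le_top)
      obtain ⟨M, hM⟩ := (hd2.continuous_fderiv one_ne_zero).bounded_above_of_compact_support
        (((hζs n).fderiv ℝ).fderiv ℝ)
      have hM0 : 0 ≤ M := (norm_nonneg _).trans (hM 0)
      have hmod := D.abs_pairing_sub_le hΛ'0 hM0
        (lipschitz_bound_of_fderiv_le ((hζc n).differentiable (by simp)) (hζdb n))
        (lipschitz_bound_of_fderiv_le (hd2.differentiable one_ne_zero) hM)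
      exact ((continuousOn_of_modulus D.cont hmod).mono hsub).aestronglyMeasurable
        measurableSet_uIoc
    · have := D.prob u (hsub u hu)
      simpa using norm_integral_le_of_norm_le_const (μ := ρ u)
        (ae_of_all _ fun x => hpair n x u (hsub u hu))
  refine tendsto_nhds_unique ((hleft t htT).sub (hleft s hsT)) ?_
  refine hright.congr fun n => ?_
  exact (h s t hs hst ht (ζ n) (hζc n) (hζs n)).symm

end NonlocalDiffusion

end

noncomputable section
namespace NonlocalDiffusion
variable {d : ℕ}
set_option maxSynthPendingDepth 3

/-! ### Weak derivatives in time -/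

lemma continuous_deriv_smoothTransition : Continuous (deriv Real.smoothTransition) :=
  (Real.smoothTransition.contDiff (n := 1)).continuous_deriv le_rfl

lemma deriv_smoothTransition_of_notMem {u : ℝ} (hu : u ∉ Icc (0 : ℝ) 1) :
    deriv Real.smoothTransition u = 0 := by
  rcases not_and_or.1 hu with h | h
  · have : Real.smoothTransition =ᶠ[𝓝 u] fun _ => 0 := by
      filter_upwards [Iio_mem_nhds (not_le.1 h)] with x hx
      exact Real.smoothTransition.zero_of_nonpos (le_of_lt hx)
    rw [this.deriv_eq, deriv_const]
  · have : Real.smoothTransition =ᶠ[𝓝 u] fun _ => 1 := by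
      filter_upwards [Ioi_mem_nhds (not_le.1 h)] with x hx
      exact Real.smoothTransition.one_of_one_le (le_of_lt hx)
    rw [this.deriv_eq, deriv_const]

lemma integral_deriv_smoothTransition : ∫ u, deriv Real.smoothTransition u = 1 := by
  rw [← setIntegral_eq_integral_of_forall_compl_eq_zero
    (fun u hu => deriv_smoothTransition_of_notMem hu), integral_Icc_eq_integral_Ioc,
    ← intervalIntegral.integral_of_le zero_le_one, intervalIntegral.integral_deriv_eq_sub]
  · simp
  · exact fun x _ => (Real.smoothTransition.contDiff (n := 1)).differentiable one_ne_zero x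
  · exact continuous_deriv_smoothTransition.intervalIntegrable _ _

/-- A continuous function on `ℝ` is constant on `(0,∞)` if its weak derivative vanishes there. -/
lemma eq_of_forall_integral_deriv_mul {h : ℝ → ℝ} (hc : Continuous h)
    (hw : ∀ η : ℝ → ℝ, ContDiff ℝ ∞ η → HasCompactSupport η → tsupport η ⊆ Ioi 0 →
      ∫ t, deriv η t * h t = 0) {s t : ℝ} (hs : 0 < s) (hst : s ≤ t) : h s = h t := by
  set S := Real.smoothTransition
  have hSc : ContDiff ℝ ∞ S := Real.smoothTransition.contDiff
  have hS0 : ∀ y ≤ 0, S y = 0 := fun y => Real.smoothTransition.zero_of_nonpos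
  have hS1 : ∀ y, 1 ≤ y → S y = 1 := fun y => Real.smoothTransition.one_of_one_le
  -- A weighted average of h over [a, a + r]. It equals h a at r = 0 and depends continuously on r,
  -- so the conclusion follows from equality of averages for r > 0.
  let Φ : ℝ → ℝ → ℝ := fun a r => ∫ u in Icc 0 1, deriv S u * h (a + r * u)
  have hΦc : ∀ a, Continuous (Φ a) := fun a => by
    refine continuous_parametric_integral_of_continuous ?_ isCompact_Icc
    have := continuous_deriv_smoothTransition
    exact (this.comp continuous_snd).mul (hc.comp (by fun_prop))
  have hΦ0 : ∀ a, Φ a 0 = h a := fun a => by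
    simp only [Φ, zero_mul, add_zero]
    rw [integral_mul_const, setIntegral_eq_integral_of_forall_compl_eq_zero
      (fun u hu => deriv_smoothTransition_of_notMem hu), integral_deriv_smoothTransition, one_mul]
  have hΦr : ∀ a r, 0 < r → ∫ x, (r⁻¹ * deriv S (r⁻¹ * (x - a))) * h x = Φ a r := fun a r hr => by
    have e1 : Φ a r = ∫ u, deriv S u * h (a + r * u) :=
      setIntegral_eq_integral_of_forall_compl_eq_zero fun u hu => by
        rw [deriv_smoothTransition_of_notMem hu, zero_mul]
    have e2 := Measure.integral_comp_mul_left (fun u => deriv S u * h (a + r * u)) r⁻¹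
    have e3 := integral_sub_right_eq_self
      (fun x => deriv S (r⁻¹ * x) * h (a + r * (r⁻¹ * x))) a (μ := volume)
    rw [e1]
    rw [inv_inv, abs_of_pos hr] at e2
    calc ∫ x, (r⁻¹ * deriv S (r⁻¹ * (x - a))) * h x
        = r⁻¹ * ∫ x, deriv S (r⁻¹ * (x - a)) * h (a + r * (r⁻¹ * (x - a))) := by
          rw [← integral_const_mul]
          refine integral_congr_ae (ae_of_all _ fun x => ?_)
          simp only
          rw [mul_inv_cancel_left₀ hr.ne', add_sub_cancel, mul_assoc]
      _ = ∫ u, deriv S u * h (a + r * u) := by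
          rw [e3, e2, smul_eq_mul, inv_mul_cancel_left₀ hr.ne']
  have hΦi : ∀ a r, 0 < r → Integrable fun x => (r⁻¹ * deriv S (r⁻¹ * (x - a))) * h x :=
    fun a r hr => by
      have hd := continuous_deriv_smoothTransition
      refine Continuous.integrable_of_hasCompactSupport
        ((continuous_const.mul (hd.comp (by fun_prop))).mul hc) ?_
      refine HasCompactSupport.intro (isCompact_Icc (a := a) (b := a + r)) fun x hx => ?_
      have : r⁻¹ * (x - a) ∉ Icc (0 : ℝ) 1 := fun hmem => hx (by
        rw [mem_Icc, inv_mul_le_iff₀ hr] at hmem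
        constructor
        · have := nonneg_of_mul_nonneg_right hmem.1 (inv_pos.2 hr)
          linarith
        · linarith [hmem.2])
      rw [deriv_smoothTransition_of_notMem this, mul_zero, zero_mul]
  have heq : ∀ r, 0 < r → Φ s r = Φ t r := fun r hr => by
    -- A smoothed indicator of the interval from s to t. Its derivative is the difference of the two
    -- averaging kernels, and its support stays in [s, t + r], away from 0.
    let η : ℝ → ℝ := fun x => S (r⁻¹ * (x - s)) - S (r⁻¹ * (x - t))
    have hlin : ∀ a, ContDiff ℝ ∞ fun x : ℝ => r⁻¹ * (x - a) := fun a => by fun_prop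
    have hη : ContDiff ℝ ∞ η := (hSc.comp (hlin s)).sub (hSc.comp (hlin t))
    have hz : ∀ x ∉ Icc s (t + r), η x = 0 := fun x hx => by
      rcases not_and_or.1 hx with hx | hx
      · rw [not_le] at hx
        simp only [η]
        rw [hS0, hS0, sub_zero]
        · exact mul_nonpos_of_nonneg_of_nonpos (inv_pos.2 hr).le (by linarith)
        · exact mul_nonpos_of_nonneg_of_nonpos (inv_pos.2 hr).le (by linarith)
      · rw [not_le] at hx
        simp only [η]
        rw [hS1, hS1, sub_self]
        · rw [le_inv_mul_iff₀ hr]; linarith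
        · rw [le_inv_mul_iff₀ hr]; linarith
    have hsupp : tsupport η ⊆ Icc s (t + r) :=
      closure_minimal (fun x hx => by_contra fun h => hx (hz x h)) isClosed_Icc
    have hd : ∀ x, deriv η x =
        r⁻¹ * deriv S (r⁻¹ * (x - s)) - r⁻¹ * deriv S (r⁻¹ * (x - t)) := fun x => by
      have h1 : ∀ a, HasDerivAt (fun x => S (r⁻¹ * (x - a)))
          (r⁻¹ * deriv S (r⁻¹ * (x - a))) x := fun a => by
        have h2 : HasDerivAt (fun x => r⁻¹ * (x - a)) r⁻¹ x := by
          simpa using ((hasDerivAt_id x).sub_const a).const_mul r⁻¹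
        have h3 := (hSc.differentiable (by simp) (r⁻¹ * (x - a))).hasDerivAt.comp x h2
        rwa [mul_comm] at h3
      exact ((h1 s).sub (h1 t)).deriv
    have h0 := hw η hη (HasCompactSupport.intro isCompact_Icc hz)
      (hsupp.trans fun x hx => hs.trans_le hx.1)
    simp_rw [hd, sub_mul] at h0
    rw [integral_sub (hΦi s r hr) (hΦi t r hr), hΦr s r hr, hΦr t r hr] at h0
    linarith
  have hcl : IsClosed {r | Φ s r = Φ t r} := isClosed_eq (hΦc s) (hΦc t)
  have h0 : (0 : ℝ) ∈ closure (Ioi (0 : ℝ)) := by rw [closure_Ioi]; exact self_mem_Ici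
  have := closure_minimal (fun r hr => heq r hr) hcl h0
  rw [← hΦ0 s, ← hΦ0 t]
  exact this

/-- A continuous function with continuous weak derivative is a primitive. -/
lemma sub_eq_integral_of_weak_deriv {m w : ℝ → ℝ} (hm : ContinuousOn m (Ici 0))
    (hw : ContinuousOn w (Ici 0))
    (h : ∀ η : ℝ → ℝ, ContDiff ℝ ∞ η → HasCompactSupport η → tsupport η ⊆ Ioi 0 →
      ∫ t in Ioi 0, (deriv η t * m t + η t * w t) = 0) {s t : ℝ} (hs : 0 ≤ s) (hst : s ≤ t) :
    m t - m s = ∫ u in s..t, w u := by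
  let m' : ℝ → ℝ := fun t => m (max t 0)
  let w' : ℝ → ℝ := fun t => w (max t 0)
  have hmax : Continuous fun t : ℝ => max t 0 := by fun_prop
  have hm' : Continuous m' := hm.comp_continuous hmax fun t => mem_Ici.2 (le_max_right _ _)
  have hw' : Continuous w' := hw.comp_continuous hmax fun t => mem_Ici.2 (le_max_right _ _)
  -- Subtracting a primitive of w leaves a continuous function with vanishing weak derivative. The
  -- extensions by `max t 0` make everything continuous on the whole line.
  let W : ℝ → ℝ := fun t => ∫ u in 0..t, w' u
  have hW : ∀ t, HasDerivAt W (w' t) t := fun t =>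
    intervalIntegral.integral_hasDerivAt_right (hw'.intervalIntegrable _ _)
      (hw'.stronglyMeasurableAtFilter _ _) hw'.continuousAt
  have hWc : Continuous W := continuous_iff_continuousAt.2 fun t => (hW t).continuousAt
  have key : ∀ s t, 0 < s → s ≤ t → m' s - W s = m' t - W t := fun s t hs hst => by
    refine eq_of_forall_integral_deriv_mul (hm'.sub hWc) (fun η hη hηs hη0 => ?_) hs hst
    have hdc : Continuous (deriv η) := hη.continuous_deriv (by simp)
    have i1 : Integrable fun t => deriv η t * m' t :=
      (hdc.mul hm').integrable_of_hasCompactSupport hηs.deriv.mul_right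
    have i2 : Integrable fun t => deriv η t * W t :=
      (hdc.mul hWc).integrable_of_hasCompactSupport hηs.deriv.mul_right
    have i3 : Integrable fun t => η t * w' t :=
      (hη.continuous.mul hw').integrable_of_hasCompactSupport hηs.mul_right
    have i4 : Integrable fun t => η t * W t :=
      (hη.continuous.mul hWc).integrable_of_hasCompactSupport hηs.mul_right
    have e1 : ∫ t, η t * w' t = -∫ t, deriv η t * W t :=
      integral_mul_deriv_eq_deriv_mul_of_integrable
        (fun x _ => (hη.differentiable (by simp) x).hasDerivAt) (fun x _ => hW x) i3 i2 i4
    have e2 : ∫ t, (deriv η t * m' t + η t * w' t) = 0 := by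
      rw [← h η hη hηs hη0, ← setIntegral_eq_integral_of_forall_compl_eq_zero (s := Ioi 0)]
      · refine setIntegral_congr_fun measurableSet_Ioi fun t ht => ?_
        simp only [m', w', max_eq_left (le_of_lt (mem_Ioi.1 ht))]
      · intro x hx
        have h1 : x ∉ tsupport η := fun h => hx (hη0 h)
        have h2 : deriv η x = 0 := by
          by_contra hne
          exact h1 (support_deriv_subset hne)
        rw [image_eq_zero_of_notMem_tsupport h1, h2]
        simp
    rw [integral_add i1 i3, e1] at e2
    change ∫ t, deriv η t * (m' t - W t) = 0
    simp_rw [mul_sub]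
    rw [integral_sub i1 i2]
    linarith
  -- The weak formulation only sees positive times; s = 0 is reached by continuity.
  have key' : m' s - W s = m' t - W t := by
    rcases hst.eq_or_lt with rfl | hlt
    · rfl
    · have hc : IsClosed {s | m' s - W s = m' t - W t} :=
        isClosed_eq (hm'.sub hWc) continuous_const
      have hmem : s ∈ closure (Ioo s t) := by
        rw [closure_Ioo hlt.ne]; exact left_mem_Icc.2 hst
      exact closure_minimal (fun r hr => key r t (hs.trans_lt hr.1) hr.2.le) hc hmem
  have e3 : W t - W s = ∫ u in s..t, w' u :=
    intervalIntegral.integral_interval_sub_left (hw'.intervalIntegrable _ _)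
      (hw'.intervalIntegrable _ _)
  have e4 : ∫ u in s..t, w' u = ∫ u in s..t, w u := by
    refine intervalIntegral.integral_congr fun u hu => ?_
    rw [uIcc_of_le hst] at hu
    simp only [w', max_eq_left (hs.trans hu.1)]
  have e5 : m' t = m t := by simp only [m', max_eq_left (hs.trans hst)]
  have e6 : m' s = m s := by simp only [m', max_eq_left hs]
  rw [← e4, ← e3, ← e5, ← e6]
  linarith

end NonlocalDiffusion

end

noncomputable section
namespace NonlocalDiffusion
variable {d : ℕ}
set_option maxSynthPendingDepth 3

/-! ### The regularized evolution -/

lemma exists_bound_lipschitz_of_hasCompactSupport {E F : Type*} [NormedAddCommGroup E]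
    [NormedSpace ℝ E] [NormedAddCommGroup F] [NormedSpace ℝ F] {g : E → F}
    (hg : ContDiff ℝ 1 g) (hs : HasCompactSupport g) :
    ∃ M, 0 ≤ M ∧ (∀ z, ‖g z‖ ≤ M) ∧ ∀ z z', ‖g z - g z'‖ ≤ M * ‖z - z'‖ := by
  obtain ⟨M0, h0⟩ := hg.continuous.bounded_above_of_compact_support hs
  obtain ⟨M1, h1⟩ := (hg.continuous_fderiv one_ne_zero).bounded_above_of_compact_support
    (hs.fderiv ℝ)
  refine ⟨max M0 M1, (norm_nonneg _).trans ((h0 0).trans (le_max_left _ _)),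
    fun z => (h0 z).trans (le_max_left _ _), ?_⟩
  exact lipschitz_bound_of_fderiv_le (hg.differentiable one_ne_zero)
    fun x => (h1 x).trans (le_max_right _ _)

/-- The drift `-(∇p + v)` of the regularized equation. -/
def drift (k : Space d → ℝ) (F' : ℝ → ℝ) (V : ℝ × Space d → Space d) (ρ : ℝ → Measure (Space d))
    (t : ℝ) (x : Space d) : Space d :=
  -(rieszMap d (conv (fderiv ℝ k) (chemical k F' (ρ t)) x) + V (t, x))

/-- A solution `ρ` of the regularized equation for the kernel `k`, the derivative `F'` of the
energy density and the velocity field `V`, with a modulus `G` for the continuity in time. -/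
structure Evolution (k : Space d → ℝ) (B : ℝ) (F' : ℝ → ℝ) (Γ : ℝ) (V : ℝ × Space d → Space d)
    (ρ : ℝ → Measure (Space d)) (G : ℝ → ℝ) : Prop where
  kernel : SmoothKernel k B
  lip_nonneg : 0 ≤ Γ
  lip : ∀ a b, 0 ≤ a → 0 ≤ b → |F' a - F' b| ≤ Γ * |a - b|
  field_contDiff : ContDiff ℝ ∞ V
  field_support : HasCompactSupport V
  prob : ∀ t, 0 ≤ t → IsProbabilityMeasure (ρ t)
  secondMoment_lt : ∀ t, 0 ≤ t → secondMoment (ρ t) < ⊤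
  sub_le : ∀ s t, 0 ≤ s → s ≤ t → t - s ≤ G t - G s
  cont : ∀ T, ContinuousOn G (Icc 0 T)
  transport : ∀ s t, 0 ≤ s → s ≤ t → LipClose (ρ t) (ρ s) (G t - G s)
  weak : ∀ (η : ℝ → ℝ) (ζ : Space d → ℝ), ContDiff ℝ ∞ η → HasCompactSupport η →
    tsupport η ⊆ Ioi 0 → ContDiff ℝ ∞ ζ → HasCompactSupport ζ →
    ∫ t in Ioi 0, (deriv η t * ∫ x, ζ x ∂(ρ t) +
      η t * ∫ x, fderiv ℝ ζ x (drift k F' V ρ t x) ∂(ρ t)) = 0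

/-- The Laplacian in terms of the second derivative. -/
def laplaceL (d : ℕ) : (Space d →L[ℝ] Space d →L[ℝ] ℝ) →L[ℝ] ℝ :=
  (traceL d).comp (ContinuousLinearMap.compL ℝ (Space d) (Space d →L[ℝ] ℝ) (Space d) (rieszMap d))

/-- The divergence in space of a time-dependent field. -/
def spaceDiv (V : ℝ × Space d → Space d) (z : ℝ × Space d) : ℝ :=
  traceL d ((fderiv ℝ V z).comp (ContinuousLinearMap.inr ℝ ℝ (Space d)))

lemma exists_bound_lipschitz_spaceDiv {V : ℝ × Space d → Space d} (hV : ContDiff ℝ ∞ V)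
    (hVs : HasCompactSupport V) : ∃ M, 0 ≤ M ∧ (∀ z, ‖spaceDiv V z‖ ≤ M) ∧
      ∀ z z', ‖spaceDiv V z - spaceDiv V z'‖ ≤ M * ‖z - z'‖ := by
  have h1 : ContDiff ℝ 1 (fderiv ℝ V) := hV.fderiv_right (by
    exact WithTop.coe_le_coe.2 le_top)
  let Θ : (ℝ × Space d →L[ℝ] Space d) →L[ℝ] ℝ := (traceL d).comp
    ((ContinuousLinearMap.compL ℝ (Space d) (ℝ × Space d) (Space d)).flip
      (ContinuousLinearMap.inr ℝ ℝ (Space d)))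
  exact exists_bound_lipschitz_of_hasCompactSupport (g := fun z => Θ (fderiv ℝ V z))
    (Θ.contDiff.comp h1) ((hVs.fderiv ℝ).comp_left (map_zero Θ))

lemma continuousOn_Ici_of_Icc {m : ℝ → ℝ} (h : ∀ T, ContinuousOn m (Icc 0 T)) :
    ContinuousOn m (Ici 0) := by
  intro t ht
  have h1 := h (t + 1) t ⟨ht, by linarith⟩
  refine h1.mono_of_mem_nhdsWithin ?_
  refine mem_nhdsWithin.2 ⟨Iio (t + 1), isOpen_Iio, by simp, fun x hx => ⟨hx.2, le_of_lt hx.1⟩⟩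

namespace Evolution

variable {k : Space d → ℝ} {B : ℝ} {F' : ℝ → ℝ} {Γ : ℝ} {V : ℝ × Space d → Space d}
    {ρ : ℝ → Measure (Space d)} {G : ℝ → ℝ}

/-- All derivatives fall on the kernel, so its L¹ norms multiplied by sup and Lipschitz bounds on
the chemical potential suffice. The constants degenerate as the kernel concentrates, but they are
only used qualitatively. -/
lemma exists_lipDrift (E : Evolution k B F' Γ V ρ G) :
    ∃ B' L C, ∀ T, LipDrift T ρ (drift k F' V ρ) G B' L C := by
  obtain ⟨M, hM0, hM, hML⟩ := exists_bound_lipschitz_of_hasCompactSupport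
    (E.field_contDiff.of_le (by simp)) E.field_support
  have hB := E.kernel.bound_nonneg
  have hΓ := E.lip_nonneg
  set J := ∫ y, ‖fderiv ℝ k y‖ with hJ
  have hJ0 : 0 ≤ J := integral_nonneg fun _ => norm_nonneg _
  set Q := |F' 0| + Γ * B with hQ
  refine ⟨Q * J + M, Γ * B * J + M, Γ * B * J + M, fun T => ?_⟩
  have hp : ∀ t ∈ Icc 0 T, IsProbabilityMeasure (ρ t) := fun t ht => E.prob t ht.1
  refine ⟨by positivity, by positivity, by positivity, hp,
    fun t ht => have := hp t ht; integrable_norm (E.secondMoment_lt t ht.1),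
    fun s t hs hst _ => E.sub_le s t hs hst, E.cont T, fun s t hs hst _ => E.transport s t hs hst,
    fun t ht x => ?_, fun t ht x y => ?_, fun s t hs hst ht x => ?_⟩
  · have := hp t ht
    unfold drift
    rw [norm_neg]
    refine (norm_add_le _ _).trans (add_le_add ?_ (hM _))
    rw [norm_rieszMap]
    exact norm_conv_le E.kernel.integrable_fderiv (E.kernel.abs_chemical_le hΓ E.lip) x
  · have := hp t ht
    unfold drift
    rw [neg_sub_neg, ← norm_neg, neg_sub, add_sub_add_comm, ← map_sub, add_mul]
    refine (norm_add_le _ _).trans (add_le_add ?_ ((hML _ _).trans_eq ?_))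
    · rw [norm_rieszMap]
      exact norm_conv_sub_conv_le E.kernel.integrable_fderiv
        (E.kernel.abs_chemical_le hΓ E.lip) (E.kernel.chemical_lipschitz hΓ E.lip) x y
    · simp
  · have := hp t ⟨hs.trans hst, ht⟩
    have := hp s ⟨hs, hst.trans ht⟩
    unfold drift
    rw [neg_sub_neg, ← norm_neg, neg_sub, add_sub_add_comm, ← map_sub, add_mul]
    refine (norm_add_le _ _).trans (add_le_add ?_ ((hML _ _).trans ?_))
    · rw [norm_rieszMap]
      refine (norm_conv_sub_le E.kernel.integrable_fderiv (E.kernel.continuous_chemical hΓ E.lip)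
        (E.kernel.abs_chemical_le hΓ E.lip) (E.kernel.continuous_chemical hΓ E.lip)
        (E.kernel.abs_chemical_le hΓ E.lip)
        (E.kernel.abs_chemical_sub_le hΓ E.lip (E.transport s t hs hst)) x).trans_eq ?_
      ring
    · have h1 := E.sub_le s t hs hst
      have h2 : ‖(t, x) - (s, x)‖ = t - s := by
        simp [abs_of_nonneg (sub_nonneg.2 hst), hst]
      rw [h2]
      gcongr

/-- Product test functions identify the weak time derivative of ∫ ζ dρ_t. Both this function and its
derivative are continuous in time, so the increment is the integral. -/
lemma driftCurve (E : Evolution k B F' Γ V ρ G) {T B' L C : ℝ}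
    (hD : ∀ T, LipDrift T ρ (drift k F' V ρ) G B' L C) :
    DriftCurve T ρ (drift k F' V ρ) G B' L C := by
  refine (hD T).driftCurve fun s t hs hst ht ζ hζ hζs => ?_
  obtain ⟨M0, hM0, hM, hML⟩ := exists_bound_lipschitz_of_hasCompactSupport
    (hζ.of_le (by simp)) hζs
  have hd2 : ContDiff ℝ 1 (fderiv ℝ ζ) := hζ.fderiv_right (by
    exact WithTop.coe_le_coe.2 le_top)
  obtain ⟨M1, hM1, hM', hML'⟩ := exists_bound_lipschitz_of_hasCompactSupport hd2 (hζs.fderiv ℝ)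
  refine sub_eq_integral_of_weak_deriv (m := fun t => ∫ x, ζ x ∂(ρ t)) ?_ ?_
    (fun η hη hηs hη0 => E.weak η ζ hη hηs hη0 hζ hζs) hs hst
  · exact continuousOn_Ici_of_Icc fun T => continuousOn_of_modulus (E.cont T)
      fun s t hs hst ht => E.transport s t hs hst ζ M0 hM0 hML
  · exact continuousOn_Ici_of_Icc fun T => continuousOn_of_modulus (E.cont T)
      ((hD T).abs_pairing_sub_le hM0 hM1 hML hML')

lemma hasFDerivAt_drift (E : Evolution k B F' Γ V ρ G) {t : ℝ} (ht : 0 ≤ t) (x : Space d) :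
    HasFDerivAt (drift k F' V ρ t)
      (-((rieszMap d).comp (conv (fderiv ℝ (fderiv ℝ k)) (chemical k F' (ρ t)) x) +
        (fderiv ℝ V (t, x)).comp (ContinuousLinearMap.inr ℝ ℝ (Space d)))) x := by
  have := E.prob t ht
  have h1 := (rieszMap d).hasFDerivAt.comp x
    (E.kernel.hasFDerivAt_conv_fderiv_chemical (μ := ρ t) E.lip_nonneg E.lip x)
  have h2 : HasFDerivAt (fun x : Space d => (t, x)) (ContinuousLinearMap.inr ℝ ℝ (Space d)) x :=
    hasFDerivAt_prodMk_right t x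
  have h3 := (E.field_contDiff.differentiable (by simp) (t, x)).hasFDerivAt.comp x h2
  exact (h1.add h3).neg

lemma divergence_drift (E : Evolution k B F' Γ V ρ G) {t : ℝ} (ht : 0 ≤ t) (x : Space d) :
    divergence (drift k F' V ρ t) x =
      -(laplaceL d (conv (fderiv ℝ (fderiv ℝ k)) (chemical k F' (ρ t)) x) +
        spaceDiv V (t, x)) := by
  rw [divergence_eq, (E.hasFDerivAt_drift ht x).fderiv, map_neg, map_add]
  rfl

lemma exists_spaceDiv_bound (E : Evolution k B F' Γ V ρ G) :
    ∃ M, 0 ≤ M ∧ (∀ z, ‖spaceDiv V z‖ ≤ M) ∧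
      ∀ z z', ‖spaceDiv V z - spaceDiv V z'‖ ≤ M * ‖z - z'‖ :=
  exists_bound_lipschitz_spaceDiv E.field_contDiff E.field_support

/-- The backward test functions contain div b, so div b must itself be Lipschitz in space. This is
where two integrable derivatives of the kernel are used. -/
lemma exists_divergence_bound (E : Evolution k B F' Γ V ρ G) :
    ∃ L C, 0 ≤ L ∧ 0 ≤ C ∧ (∀ t, 0 ≤ t → ∀ x y, ‖divergence (drift k F' V ρ t) x -
        divergence (drift k F' V ρ t) y‖ ≤ L * ‖x - y‖) ∧
      ∀ s t, 0 ≤ s → s ≤ t → ∀ x, ‖divergence (drift k F' V ρ t) x -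
        divergence (drift k F' V ρ s) x‖ ≤ C * (G t - G s) := by
  obtain ⟨M, hM0, hM, hML⟩ := E.exists_spaceDiv_bound
  have hB := E.kernel.bound_nonneg
  have hΓ := E.lip_nonneg
  set J := ∫ y, ‖fderiv ℝ (fderiv ℝ k) y‖ with hJ
  have hJ0 : 0 ≤ J := integral_nonneg fun _ => norm_nonneg _
  refine ⟨‖laplaceL d‖ * (Γ * B * J) + M, ‖laplaceL d‖ * (Γ * B * J) + M, by positivity,
    by positivity, fun t ht x y => ?_, fun s t hs hst x => ?_⟩
  · have := E.prob t ht
    rw [E.divergence_drift ht, E.divergence_drift ht, neg_sub_neg, ← norm_neg, neg_sub,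
      add_sub_add_comm, ← map_sub, add_mul]
    refine (norm_add_le _ _).trans (add_le_add ?_ ((hML _ _).trans_eq ?_))
    · refine ((laplaceL d).le_opNorm _).trans ?_
      rw [mul_assoc]
      gcongr
      exact norm_conv_sub_conv_le E.kernel.integrable_fderiv_fderiv
        (E.kernel.abs_chemical_le hΓ E.lip) (E.kernel.chemical_lipschitz hΓ E.lip) x y
    · simp
  · have := E.prob s hs
    have := E.prob t (hs.trans hst)
    rw [E.divergence_drift hs, E.divergence_drift (hs.trans hst), neg_sub_neg, ← norm_neg, neg_sub,
      add_sub_add_comm, ← map_sub, add_mul]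
    refine (norm_add_le _ _).trans (add_le_add ?_ ((hML _ _).trans ?_))
    · refine ((laplaceL d).le_opNorm _).trans ?_
      rw [mul_assoc]
      gcongr
      refine (norm_conv_sub_le E.kernel.integrable_fderiv_fderiv
        (E.kernel.continuous_chemical hΓ E.lip)
        (E.kernel.abs_chemical_le hΓ E.lip) (E.kernel.continuous_chemical hΓ E.lip)
        (E.kernel.abs_chemical_le hΓ E.lip)
        (E.kernel.abs_chemical_sub_le hΓ E.lip (E.transport s t hs hst)) x).trans_eq ?_
      ring
    · have h1 := E.sub_le s t hs hst
      have h2 : ‖(t, x) - (s, x)‖ = t - s := by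
        simp [abs_of_nonneg (sub_nonneg.2 hst), hst]
      rw [h2]
      gcongr

end Evolution

lemma inner_gradient (g : Space d → ℝ) (x y : Space d) :
    inner ℝ (gradient g x) y = fderiv ℝ g x y := by
  rw [gradient_eq, inner_rieszMap]

/-- Solutions of the regularized equation are evolutions in the above sense. -/
lemma IsSolution.exists_evolution {f : ℝ → EReal} (hf : EnergyAssumption d f)
    {φ : Space d → ℝ} {γ ε : ℝ} (hγ : 0 < γ) {B : ℝ} (hk : SmoothKernel (mollifier φ ε) B)
    {v : ℝ → Space d → Space d} {V : ℝ × Space d → Space d} (hV : ContDiff ℝ ∞ V)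
    (hVs : HasCompactSupport V) (hVv : ∀ t, 0 ≤ t → ∀ x, v t x = V (t, x))
    {μ₀ : Measure (Space d)} {ρ : ℝ → Measure (Space d)} (h : IsSolution f φ γ ε v μ₀ ρ) :
    ∃ G, Evolution (mollifier φ ε) B (regDensityDeriv γ f) (γ + 1 / γ) V ρ G := by
  obtain ⟨g, hg0, hg, hgW⟩ := h.acCurve.ac
  have hgi : ∀ T : ℝ, IntegrableOn g (Icc 0 T) := fun T => (hg T).integrable one_le_two
  have hgii : ∀ s t, 0 ≤ s → 0 ≤ t → IntervalIntegrable g volume s t := fun s t hs ht => by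
    refine ((hgi (max s t)).mono_set ?_).intervalIntegrable
    exact Icc_subset_Icc (le_min hs ht) le_rfl
  have hΓ : 0 ≤ γ + 1 / γ := by positivity
  have hlip : ∀ a b, 0 ≤ a → 0 ≤ b →
      |regDensityDeriv γ f a - regDensityDeriv γ f b| ≤ (γ + 1 / γ) * |a - b| :=
    fun a b ha hb => hf.abs_regDensityDeriv_sub_le hγ ha hb
  have hsub : ∀ s t, 0 ≤ s → s ≤ t →
      (t + ∫ u in 0..t, g u) - (s + ∫ u in 0..s, g u) = (t - s) + ∫ u in s..t, g u := by
    intro s t hs hst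
    have := intervalIntegral.integral_interval_sub_left (hgii 0 t le_rfl (hs.trans hst))
      (hgii 0 s le_rfl hs)
    linarith
  have hnn : ∀ s t, s ≤ t → 0 ≤ ∫ u in s..t, g u := fun s t hst =>
    intervalIntegral.integral_nonneg hst fun u _ => hg0 u
  -- The primitive of the metric speed controls the Wasserstein increments; the added t lets the
  -- same G also dominate plain time increments, as needed for V and for the Taylor remainders.
  refine ⟨fun t => t + ∫ u in 0..t, g u, hk, hΓ, hlip, hV, hVs, h.acCurve.prob,
    h.acCurve.secondMoment_lt, fun s t hs hst => ?_, fun T => ?_, fun s t hs hst => ?_, ?_⟩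
  · rw [hsub s t hs hst]
    linarith [hnn s t hst]
  · refine continuousOn_id.add ?_
    rcases le_total 0 T with hT | hT
    · have := intervalIntegral.continuousOn_primitive_interval (μ := volume) (f := g) (a := 0)
        (b := T) (by rw [uIcc_of_le hT]; exact hgi T)
      rwa [uIcc_of_le hT] at this
    · exact (Subsingleton.continuousOn (fun x hx y hy => by
        linarith [hx.1, hx.2, hy.1, hy.2, le_antisymm (hx.2.trans hT) hx.1,
          le_antisymm (hy.2.trans hT) hy.1]) _)
  · have := h.acCurve.prob s hs
    have := h.acCurve.prob t (hs.trans hst)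
    have h1 := lipClose_of_wasserstein₂_le
      (integrable_norm (h.acCurve.secondMoment_lt t (hs.trans hst)))
      (integrable_norm (h.acCurve.secondMoment_lt s hs)) (hnn s t hst) (hgW s t hs hst)
    intro ψ Λ hΛ hψ
    refine (h1 ψ Λ hΛ hψ).trans ?_
    rw [hsub s t hs hst]
    gcongr
    linarith
  · intro η ζ hη hηs hη0 hζ hζs
    have hΨc : ContDiff ℝ ∞ fun z : ℝ × Space d => η z.1 * ζ z.2 :=
      (hη.comp contDiff_fst).mul (hζ.comp contDiff_snd)
    have hcl : IsClosed (tsupport η ×ˢ tsupport ζ) :=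
      (isClosed_tsupport η).prod (isClosed_tsupport ζ)
    have hsub' : tsupport (fun z : ℝ × Space d => η z.1 * ζ z.2) ⊆ tsupport η ×ˢ tsupport ζ := by
      refine closure_minimal (fun z hz => ?_) hcl
      exact ⟨subset_tsupport _ (left_ne_zero_of_mul hz), subset_tsupport _ (right_ne_zero_of_mul hz)⟩
    have hw := h.weak (fun z => η z.1 * ζ z.2) hΨc
      ((IsCompact.prod hηs hζs).of_isClosed_subset (isClosed_tsupport _) hsub')
      (hsub'.trans (prod_mono hη0 (subset_univ _)))
    refine Eq.trans ?_ hw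
    refine setIntegral_congr_fun measurableSet_Ioi fun t ht => ?_
    have ht0 : 0 ≤ t := le_of_lt ht
    have := h.acCurve.prob t ht0
    have hζd : Differentiable ℝ ζ := hζ.differentiable (by simp)
    have e1 : ∀ x, deriv (fun s => η s * ζ x) t = deriv η t * ζ x := fun x =>
      deriv_mul_const (hη.differentiable (by simp) t) _
    have e2 : ∀ x, inner ℝ (gradient (fun y => η t * ζ y) x)
        (gradient (pressure f φ γ ε (ρ t)) x + v t x) =
        -(η t * fderiv ℝ ζ x (drift (mollifier φ ε) (regDensityDeriv γ f) V ρ t x)) := fun x => by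
      rw [inner_gradient, fderiv_const_mul (hζd x), gradient_eq, pressure_eq_conv,
        hk.fderiv_conv_chemical hΓ hlip, hVv t ht0]
      simp only [drift, map_neg, map_add, smul_apply, smul_eq_mul]
      ring
    simp only [e1, e2, sub_neg_eq_add]
    obtain ⟨M, hM0, hM, hML⟩ := exists_bound_lipschitz_of_hasCompactSupport
      (hζ.of_le (by simp)) hζs
    obtain ⟨M', hM0', hM', hML'⟩ := exists_bound_lipschitz_of_hasCompactSupport
      (hV.of_le (by simp)) hVs
    have hdc : Continuous (drift (mollifier φ ε) (regDensityDeriv γ f) V ρ t) := by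
      have h1 : Continuous (conv (fderiv ℝ (mollifier φ ε))
          (chemical (mollifier φ ε) (regDensityDeriv γ f) (ρ t))) :=
        continuous_iff_continuousAt.2 fun x =>
          (hk.hasFDerivAt_conv_fderiv_chemical hΓ hlip x).continuousAt
      have h2 := hV.continuous
      unfold drift
      fun_prop
    have hdb : ∀ x, ‖drift (mollifier φ ε) (regDensityDeriv γ f) V ρ t x‖ ≤
        (|regDensityDeriv γ f 0| + (γ + 1 / γ) * B) *
          (∫ y, ‖fderiv ℝ (mollifier φ ε) y‖) + M' := fun x => by
      unfold drift
      rw [norm_neg]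
      refine (norm_add_le _ _).trans (add_le_add ?_ (hM' _))
      rw [norm_rieszMap]
      exact norm_conv_le hk.integrable_fderiv (hk.abs_chemical_le hΓ hlip) x
    have i1 : Integrable ζ (ρ t) := Integrable.of_bound hζ.continuous.aestronglyMeasurable M
      (ae_of_all _ hM)
    have i2 : Integrable (fun x => fderiv ℝ ζ x
        (drift (mollifier φ ε) (regDensityDeriv γ f) V ρ t x)) (ρ t) :=
      Integrable.of_bound ((hζ.continuous_fderiv (by simp)).clm_apply hdc).aestronglyMeasurable _
        (ae_of_all _ fun x => (ContinuousLinearMap.le_opNorm _ _).trans (mul_le_mul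
          (norm_fderiv_le_of_lipschitz_bound hM0 hML x) (hdb x) (norm_nonneg _) hM0))
    rw [integral_add (i1.const_mul _) (i2.const_mul _), integral_const_mul, integral_const_mul]

end NonlocalDiffusion

end

noncomputable section
namespace NonlocalDiffusion
variable {d : ℕ}
set_option maxSynthPendingDepth 3

/-! ### The dissipation -/

lemma exists_cutoff (d : ℕ) : ∃ (c : ℝ) (θ : ℕ → Space d → ℝ), 0 ≤ c ∧
    (∀ n, ContDiff ℝ ∞ (θ n)) ∧ (∀ n, HasCompactSupport (θ n)) ∧ (∀ n x, |θ n x| ≤ 1) ∧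
    (∀ n x, ‖fderiv ℝ (θ n) x‖ ≤ c) ∧ (∀ x, Tendsto (fun n => θ n x) atTop (𝓝 1)) ∧
    ∀ x, Tendsto (fun n => fderiv ℝ (θ n) x) atTop (𝓝 0) := by
  let χ : ContDiffBump (0 : Space d) := ⟨1, 2, one_pos, one_lt_two⟩
  have hχc : ContDiff ℝ ∞ χ := χ.contDiff
  obtain ⟨c, hc⟩ := (hχc.continuous_fderiv (by simp)).bounded_above_of_compact_support
    (χ.hasCompactSupport.fderiv ℝ)
  have hc0 : 0 ≤ c := (norm_nonneg _).trans (hc 0)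
  let a : ℕ → ℝ := fun n => ((n : ℝ) + 1)⁻¹
  have ha0 : ∀ n, 0 < a n := fun n => by positivity
  have ha1 : ∀ n, a n ≤ 1 := fun n => inv_le_one_of_one_le₀ (by
    have : (0 : ℝ) ≤ n := n.cast_nonneg
    linarith)
  have halim : Tendsto a atTop (𝓝 0) := by
    simpa [a, one_div] using tendsto_one_div_add_atTop_nhds_zero_nat (𝕜 := ℝ)
  have hlim1 : ∀ x : Space d, Tendsto (fun n => a n • x) atTop (𝓝 0) := fun x => by
    simpa using halim.smul_const x
  have hd : ∀ n x, fderiv ℝ (fun x : Space d => χ (a n • x)) x =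
      a n • fderiv ℝ χ (a n • x) := fun n x => by
    simpa using congr_fun
      (fderiv_smul_comp_smul (g := χ) (hχc.differentiable (by simp)) 1 (a n)) x
  have hdb : ∀ n x, ‖fderiv ℝ (fun x : Space d => χ (a n • x)) x‖ ≤ a n * c := fun n x => by
    rw [hd, norm_smul, Real.norm_of_nonneg (ha0 n).le]
    have := ha0 n
    gcongr
    exact hc _
  refine ⟨c, fun n x => χ (a n • x), hc0, fun n => ?_, fun n => ?_, fun n x => ?_, fun n x => ?_,
    fun x => ?_, fun x => ?_⟩
  · have h1 : ContDiff ℝ ∞ fun x : Space d => a n • x := contDiff_id.const_smul (a n)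
    exact hχc.comp h1
  · exact χ.hasCompactSupport.comp_smul (ha0 n).ne'
  · rw [abs_of_nonneg χ.nonneg]; exact χ.le_one
  · exact (hdb n x).trans (mul_le_of_le_one_left hc0 (ha1 n))
  · have := (hχc.continuous.tendsto 0).comp (hlim1 x)
    rwa [χ.one_of_mem_closedBall (by simp [χ])] at this
  · refine squeeze_zero_norm (hdb · x) ?_
    simpa using halim.mul_const c

lemma lipschitzWith_of_bound {X Y : Type*} [SeminormedAddCommGroup X] [SeminormedAddCommGroup Y]
    {g : X → Y} {L : ℝ} (hL : 0 ≤ L) (h : ∀ x y, ‖g x - g y‖ ≤ L * ‖x - y‖) :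
    LipschitzWith ⟨L, hL⟩ g :=
  LipschitzWith.of_dist_le_mul fun x y => by
    rw [dist_eq_norm, dist_eq_norm]; exact h x y

/-- Integration by parts for a bounded Lipschitz function. -/
lemma integral_mul_fderiv_of_lipschitz {q g : Space d → ℝ} {Q L : ℝ} (hL : 0 ≤ L)
    (hQ : ∀ x, |q x| ≤ Q) (hq : ∀ x y, ‖q x - q y‖ ≤ L * ‖x - y‖) (hg : ContDiff ℝ 1 g)
    (hgi : Integrable g) (hgi' : Integrable (fderiv ℝ g)) (e : Space d) :
    ∫ x, q x * fderiv ℝ g x e = -∫ x, fderiv ℝ q x e * g x := by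
  obtain ⟨c, θ, hc, hθ, hθs, hθb, hθd, hlim, hlimd⟩ := exists_cutoff d
  have hqL := lipschitzWith_of_bound hL hq
  have hqc := continuous_of_lipschitz_bound hq
  have hgd := hg.differentiable one_ne_zero
  have hQ0 : 0 ≤ Q := (abs_nonneg _).trans (hQ 0)
  have hd : ∀ n x, HasFDerivAt (fun x => θ n x * g x)
      (θ n x • fderiv ℝ g x + g x • fderiv ℝ (θ n) x) x := fun n x =>
    ((hθ n).differentiable (by simp) x).hasFDerivAt.mul (hgd x).hasFDerivAt
  -- Integration by parts for Lipschitz functions requires compact support in one factor, supplied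
  -- by the cut-off. By Rademacher, line derivatives of q agree with its Fréchet derivative almost
  -- everywhere.
  have key : ∀ n, ∫ x, fderiv ℝ q x e * (θ n x * g x) =
      -∫ x, (θ n x * fderiv ℝ g x e + g x * fderiv ℝ (θ n) x e) * q x := fun n => by
    have hcs : HasCompactSupport fun x => θ n x * g x := (hθs n).mul_right
    have hc1 : ContDiff ℝ 1 fun x => θ n x * g x := ((hθ n).of_le (by simp)).mul hg
    obtain ⟨M, hM0, hM, hML⟩ := exists_bound_lipschitz_of_hasCompactSupport hc1 hcs
    have h1 := hqL.integral_lineDeriv_mul_eq (μ := volume) (lipschitzWith_of_bound hM0 hML) hcs e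
    have e1 : ∫ x, lineDeriv ℝ q x e * (θ n x * g x) = ∫ x, fderiv ℝ q x e * (θ n x * g x) := by
      refine integral_congr_ae ?_
      filter_upwards [hqL.ae_differentiableAt] with x hx
      rw [hx.lineDeriv_eq_fderiv]
    rw [← e1, h1, ← integral_neg]
    refine integral_congr_ae (ae_of_all _ fun x => ?_)
    simp only
    rw [(hd n x).differentiableAt.lineDeriv_eq_fderiv, (hd n x).fderiv]
    simp only [map_neg, add_apply, smul_apply, smul_eq_mul]
    ring
  have hqm : Measurable fun x => fderiv ℝ q x e := measurable_fderiv_apply_const ℝ q e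
  have hqb : ∀ x, |fderiv ℝ q x e| ≤ L * ‖e‖ := fun x =>
    (ContinuousLinearMap.le_opNorm _ _).trans
      (mul_le_mul_of_nonneg_right (norm_fderiv_le_of_lipschitz_bound hL hq x) (norm_nonneg _))
  have hgdc := hg.continuous_fderiv one_ne_zero
  have hleft : Tendsto (fun n => ∫ x, fderiv ℝ q x e * (θ n x * g x)) atTop
      (𝓝 (∫ x, fderiv ℝ q x e * g x)) := by
    refine tendsto_integral_of_dominated_convergence (fun x => (L * ‖e‖) * ‖g x‖)
      (fun n => (hqm.mul ((hθ n).continuous.mul hg.continuous).measurable).aestronglyMeasurable)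
      (hgi.norm.const_mul _) (fun n => ae_of_all _ fun x => ?_) (ae_of_all _ fun x => ?_)
    · rw [norm_mul, norm_mul]
      exact mul_le_mul (hqb x) (mul_le_of_le_one_left (norm_nonneg _) (hθb n x)) (by positivity)
        (by positivity)
    · simpa using ((hlim x).mul_const (g x)).const_mul (fderiv ℝ q x e)
  have hright : Tendsto (fun n => ∫ x, (θ n x * fderiv ℝ g x e + g x * fderiv ℝ (θ n) x e) * q x)
      atTop (𝓝 (∫ x, q x * fderiv ℝ g x e)) := by
    refine tendsto_integral_of_dominated_convergence
      (fun x => (‖fderiv ℝ g x‖ * ‖e‖ + ‖g x‖ * (c * ‖e‖)) * Q) (fun n => ?_)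
      (((hgi'.norm.mul_const _).add (hgi.norm.mul_const _)).mul_const _)
      (fun n => ae_of_all _ fun x => ?_) (ae_of_all _ fun x => ?_)
    · have h1 := (hθ n).continuous_fderiv (by simp)
      have h2 := (hθ n).continuous
      have h3 := hg.continuous
      exact Continuous.aestronglyMeasurable (by fun_prop)
    · rw [norm_mul]
      refine mul_le_mul ((norm_add_le _ _).trans (add_le_add ?_ ?_)) (hQ x) (abs_nonneg _)
        (by positivity)
      · rw [norm_mul]
        exact (mul_le_of_le_one_left (norm_nonneg _) (hθb n x)).trans
          (ContinuousLinearMap.le_opNorm _ _)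
      · rw [norm_mul]
        gcongr
        exact (ContinuousLinearMap.le_opNorm _ _).trans
          (mul_le_mul_of_nonneg_right (hθd n x) (norm_nonneg _))
    · have h1 := (hlim x).mul_const (fderiv ℝ g x e)
      have h2 := (((ContinuousLinearMap.apply ℝ ℝ e).continuous.tendsto _).comp
        (hlimd x)).const_mul (g x)
      have h3 := (h1.add h2).mul_const (q x)
      simpa [mul_comm (q x)] using h3
  have h1 := hright.neg
  simp_rw [← key] at h1
  rw [tendsto_nhds_unique hleft h1, neg_neg]

lemma laplaceL_eq (A : Space d →L[ℝ] Space d →L[ℝ] ℝ) :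
    laplaceL d A = ∑ i, A (EuclideanSpace.basisFun (Fin d) ℝ i)
      (EuclideanSpace.basisFun (Fin d) ℝ i) := by
  change LinearMap.trace ℝ (Space d) ((rieszMap d).comp A : Space d →ₗ[ℝ] Space d) = _
  rw [LinearMap.trace_eq_sum_inner _ (EuclideanSpace.basisFun (Fin d) ℝ)]
  refine Finset.sum_congr rfl fun i _ => ?_
  rw [real_inner_comm]
  exact inner_rieszMap _ _

lemma inner_rieszMap_rieszMap (A A' : Space d →L[ℝ] ℝ) :
    inner ℝ (rieszMap d A) (rieszMap d A') = ∑ i, A (EuclideanSpace.basisFun (Fin d) ℝ i) *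
      A' (EuclideanSpace.basisFun (Fin d) ℝ i) := by
  rw [← OrthonormalBasis.sum_inner_mul_inner (EuclideanSpace.basisFun (Fin d) ℝ)]
  refine Finset.sum_congr rfl fun i _ => ?_
  rw [inner_rieszMap, real_inner_comm, inner_rieszMap]

/-- Each derivative flips the parity sign σ, so two derivatives of an even kernel are again even. -/
lemma fderiv_comp_neg_of_even {F : Type*} [NormedAddCommGroup F] [NormedSpace ℝ F]
    {g : Space d → F} (hg : Differentiable ℝ g) {σ : ℝ} (h : ∀ x, g (-x) = σ • g x) (x : Space d) :
    fderiv ℝ g (-x) = (-σ) • fderiv ℝ g x := by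
  have h1 := fderiv_smul_comp_smul hg 1 (-1)
  simp only [one_smul, neg_one_smul, one_mul, h] at h1
  have h2 := congr_fun h1 x
  rw [fderiv_fun_const_smul (hg x)] at h2
  rw [neg_smul, h2, neg_neg]

/-- The dissipation at a fixed time. -/
def dissipationAt (k : Space d → ℝ) (F' : ℝ → ℝ) (μ : Measure (Space d)) (x : Space d) : ℝ :=
  inner ℝ (rieszMap d (fderiv ℝ (smooth k μ) x)) (rieszMap d (fderiv ℝ (chemical k F' μ) x))

/-- No chain rule is available, since F' need not be differentiable. Along w = ∇μ the smoothed
density increases to first order, so a negative derivative of q in that direction would contradict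
monotonicity of F'. Where q is not differentiable its `fderiv` is 0 by convention. -/
lemma SmoothKernel.dissipationAt_nonneg {k : Space d → ℝ} {B : ℝ} (hk : SmoothKernel k B)
    {F' : ℝ → ℝ} (hF : ∀ a b, 0 ≤ a → a ≤ b → F' a ≤ F' b) (μ : Measure (Space d))
    [IsProbabilityMeasure μ] (x : Space d) : 0 ≤ dissipationAt k F' μ x := by
  unfold dissipationAt
  by_cases hq : DifferentiableAt ℝ (chemical k F' μ) x
  swap
  · rw [fderiv_zero_of_not_differentiableAt hq]; simp
  set w := rieszMap d (fderiv ℝ (smooth k μ) x) with hw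
  have hμ : DifferentiableAt ℝ (smooth k μ) x :=
    (hasFDerivAt_smooth hk.contDiff_one hk.bound hk.bound_fderiv x).differentiableAt
  rw [real_inner_comm, inner_rieszMap]
  by_contra! hneg
  have hw0 : 0 < fderiv ℝ (smooth k μ) x w := by
    rw [← inner_rieszMap, ← hw, real_inner_self_eq_norm_sq]
    have : w ≠ 0 := fun h => by rw [h, map_zero] at hneg; exact lt_irrefl _ hneg
    positivity
  have hline : HasDerivAt (fun t : ℝ => x + t • w) w 0 := by
    simpa using ((hasDerivAt_id (0 : ℝ)).smul_const w).const_add x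
  have h1 : HasDerivAt (fun t : ℝ => smooth k μ (x + t • w)) (fderiv ℝ (smooth k μ) x w) 0 :=
    HasFDerivAt.comp_hasDerivAt (x := (0 : ℝ)) (f := fun t : ℝ => x + t • w)
      (l := smooth k μ) (by simpa using hμ.hasFDerivAt) hline
  have h2 : HasDerivAt (fun t : ℝ => chemical k F' μ (x + t • w))
      (fderiv ℝ (chemical k F' μ) x w) 0 :=
    HasFDerivAt.comp_hasDerivAt (x := (0 : ℝ)) (f := fun t : ℝ => x + t • w)
      (l := chemical k F' μ) (by simpa using hq.hasFDerivAt) hline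
  have e1 := (hasDerivAt_iff_tendsto_slope.1 h1).eventually (lt_mem_nhds hw0)
  have e2 := (hasDerivAt_iff_tendsto_slope.1 h2).eventually (gt_mem_nhds hneg)
  have hle : 𝓝[>] (0 : ℝ) ≤ 𝓝[≠] 0 := nhdsWithin_mono _ fun y hy => ne_of_gt hy
  obtain ⟨t, ⟨ht1, ht2⟩, ht0⟩ := (((e1.and e2).filter_mono hle).and self_mem_nhdsWithin).exists
  simp only [slope_def_field, zero_smul, add_zero, sub_zero] at ht1 ht2
  have h3 : smooth k μ x < smooth k μ (x + t • w) := by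
    have := (div_pos_iff_of_pos_right ht0).1 ht1
    linarith
  have h4 : chemical k F' μ (x + t • w) < chemical k F' μ x := by
    rw [div_lt_iff₀ ht0, zero_mul] at ht2
    linarith
  exact absurd (hF _ _ (hk.smooth_nonneg x) h3.le) (not_le.2 h4)

section

variable {k : Space d → ℝ} {B : ℝ} {F' : ℝ → ℝ} {Γ : ℝ} {μ : Measure (Space d)}
  [IsProbabilityMeasure μ]

lemma SmoothKernel.fderiv_smooth (hk : SmoothKernel k B) :
    fderiv ℝ (smooth k μ) = smooth (fderiv ℝ k) μ :=
  funext fun x => (hasFDerivAt_smooth hk.contDiff_one hk.bound hk.bound_fderiv x).fderiv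

lemma SmoothKernel.fderiv_smooth_fderiv (hk : SmoothKernel k B) :
    fderiv ℝ (smooth (fderiv ℝ k) μ) = smooth (fderiv ℝ (fderiv ℝ k)) μ :=
  funext fun x =>
    (hasFDerivAt_smooth hk.contDiff_fderiv hk.bound_fderiv hk.bound_fderiv_fderiv x).fderiv

lemma continuous_smooth {F : Type*} [NormedAddCommGroup F] [NormedSpace ℝ F] {k : Space d → F}
    (hk : Continuous k) (hB : ∀ x, ‖k x‖ ≤ B) : Continuous (smooth k μ) :=
  continuous_of_dominated (bound := fun _ => B)
    (fun x => (hk.comp (by fun_prop)).aestronglyMeasurable) (fun x => ae_of_all _ fun y => hB _)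
    (integrable_const _) (ae_of_all _ fun y => by fun_prop)

/-- ∇μ is integrable by Young's inequality, and ∇q is bounded by the Lipschitz constant of q. -/
lemma SmoothKernel.integrable_dissipationAt (hk : SmoothKernel k B) (hΓ : 0 ≤ Γ)
    (hF : ∀ a b, 0 ≤ a → 0 ≤ b → |F' a - F' b| ≤ Γ * |a - b|) :
    Integrable (dissipationAt k F' μ) := by
  have hB := hk.bound_nonneg
  have h1 := (integrable_smooth (μ := μ) (hk.contDiff_one.continuous_fderiv one_ne_zero)
    hk.integrable_fderiv).1
  refine Integrable.mono' (h1.norm.mul_const (Γ * B)) ?_ (ae_of_all _ fun x => ?_)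
  · have h2 : Measurable fun x => rieszMap d (fderiv ℝ (smooth k μ) x) :=
      (rieszMap d).continuous.measurable.comp (measurable_fderiv ℝ _)
    have h3 : Measurable fun x => rieszMap d (fderiv ℝ (chemical k F' μ) x) :=
      (rieszMap d).continuous.measurable.comp (measurable_fderiv ℝ _)
    exact (h2.inner h3).aestronglyMeasurable
  · refine (norm_inner_le_norm _ _).trans ?_
    rw [norm_rieszMap, norm_rieszMap, hk.fderiv_smooth]
    gcongr
    exact norm_fderiv_le_of_lipschitz_bound (by positivity) (hk.chemical_lipschitz hΓ hF) x

/-- The mean of the Laplacian of the pressure is minus the total dissipation. -/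
lemma SmoothKernel.integral_laplace_conv (hk : SmoothKernel k B) (hΓ : 0 ≤ Γ)
    (hF : ∀ a b, 0 ≤ a → 0 ≤ b → |F' a - F' b| ≤ Γ * |a - b|) :
    ∫ x, laplaceL d (conv (fderiv ℝ (fderiv ℝ k)) (chemical k F' μ) x) ∂μ =
      -∫ x, dissipationAt k F' μ x := by
  have hB := hk.bound_nonneg
  set q := chemical k F' μ with hq
  have hQ := hk.abs_chemical_le (μ := μ) hΓ hF
  have hqL := hk.chemical_lipschitz (μ := μ) hΓ hF
  have hqc := hk.continuous_chemical (μ := μ) hΓ hF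
  have hdc : Continuous (fderiv ℝ (fderiv ℝ k)) := hk.contDiff_fderiv.continuous_fderiv one_ne_zero
  set l : Space d → ℝ := fun y => laplaceL d (fderiv ℝ (fderiv ℝ k) y) with hl
  have hlc : Continuous l := (laplaceL d).continuous.comp hdc
  have hli : Integrable l := (laplaceL d).integrable_comp hk.integrable_fderiv_fderiv
  have hleven : ∀ y, l (-y) = l y := fun y => by
    have h1 := fderiv_comp_neg_of_even (hk.contDiff_one.differentiable one_ne_zero) (σ := 1)
      (fun x => by rw [hk.even, one_smul])
    have h2 := fderiv_comp_neg_of_even (hk.contDiff_fderiv.differentiable one_ne_zero) h1 y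
    simp only [hl]
    rw [h2, neg_neg, one_smul]
  -- The chain is ∫ (Δk * q) dρ = ∫ q (Δk * ρ) = ∫ q Δμ = -∫ ∇q·∇μ. Evenness of Δk is used in the
  -- first equality, and the last is the integration by parts above, one coordinate at a time.
  have e1 : ∀ x, laplaceL d (conv (fderiv ℝ (fderiv ℝ k)) q x) = conv l q x := fun x => by
    unfold conv
    rw [← ContinuousLinearMap.integral_comp_comm _
      (integrable_conv_integrand hk.integrable_fderiv_fderiv hqc hQ x)]
    simp [hl, hq]
  simp_rw [e1]
  rw [integral_conv hlc hli hqc hQ μ]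
  have e2 : ∀ x, ∫ y, l (y - x) ∂μ = laplaceL d (fderiv ℝ (fderiv ℝ (smooth k μ)) x) := fun x => by
    rw [hk.fderiv_smooth, hk.fderiv_smooth_fderiv]
    unfold smooth
    rw [← ContinuousLinearMap.integral_comp_comm _
      (integrable_smooth_integrand hdc hk.bound_fderiv_fderiv x)]
    refine integral_congr_ae (ae_of_all _ fun y => ?_)
    simp only
    rw [← hleven, neg_sub]
  have hc1 : ContDiff ℝ 1 (fderiv ℝ (smooth k μ)) := by
    rw [hk.fderiv_smooth, contDiff_one_iff_fderiv, hk.fderiv_smooth_fderiv]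
    exact ⟨fun x => (hasFDerivAt_smooth hk.contDiff_fderiv hk.bound_fderiv
      hk.bound_fderiv_fderiv x).differentiableAt, continuous_smooth hdc hk.bound_fderiv_fderiv⟩
  have hi1 : Integrable (fderiv ℝ (smooth k μ)) := by
    rw [hk.fderiv_smooth]
    exact (integrable_smooth (hk.contDiff_one.continuous_fderiv one_ne_zero)
      hk.integrable_fderiv).1
  have hi2 : Integrable (fderiv ℝ (fderiv ℝ (smooth k μ))) := by
    rw [hk.fderiv_smooth, hk.fderiv_smooth_fderiv]
    exact (integrable_smooth hdc hk.integrable_fderiv_fderiv).1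
  let e : Fin d → Space d := fun i => EuclideanSpace.basisFun (Fin d) ℝ i
  let g : Fin d → Space d → ℝ := fun i x => fderiv ℝ (smooth k μ) x (e i)
  have hgf : ∀ i x, HasFDerivAt (g i)
      ((ContinuousLinearMap.apply ℝ ℝ (e i)).comp (fderiv ℝ (fderiv ℝ (smooth k μ)) x)) x :=
    fun i x => (ContinuousLinearMap.apply ℝ ℝ (e i)).hasFDerivAt.comp x
      (hc1.differentiable one_ne_zero x).hasFDerivAt
  have hgd : ∀ i x, fderiv ℝ (g i) x =
      (ContinuousLinearMap.apply ℝ ℝ (e i)).comp (fderiv ℝ (fderiv ℝ (smooth k μ)) x) :=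
    fun i x => (hgf i x).fderiv
  have hgi' : ∀ i, Integrable (fderiv ℝ (g i)) := fun i => by
    rw [show fderiv ℝ (g i) = _ from funext (hgd i)]
    exact (ContinuousLinearMap.compL ℝ (Space d) (Space d →L[ℝ] ℝ) ℝ
      (ContinuousLinearMap.apply ℝ ℝ (e i))).integrable_comp hi2
  have hgc : ∀ i, ContDiff ℝ 1 (g i) := fun i =>
    (ContinuousLinearMap.apply ℝ ℝ (e i)).contDiff.comp hc1
  have hgi : ∀ i, Integrable (g i) := fun i =>
    (ContinuousLinearMap.apply ℝ ℝ (e i)).integrable_comp hi1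
  have hparts := fun i => integral_mul_fderiv_of_lipschitz (by positivity) hQ hqL (hgc i) (hgi i)
    (hgi' i) (e i)
  have hqd : ∀ i, Integrable fun x => fderiv ℝ q x (e i) * g i x := fun i =>
    (hgi i).bdd_mul (c := Γ * B * ‖e i‖) (measurable_fderiv_apply_const ℝ q _).aestronglyMeasurable
      (ae_of_all _ fun x => (ContinuousLinearMap.le_opNorm _ _).trans
        (mul_le_mul_of_nonneg_right (norm_fderiv_le_of_lipschitz_bound (by positivity) hqL x)
          (norm_nonneg _)))
  have hqg : ∀ i, Integrable fun x => q x * fderiv ℝ (g i) x (e i) := fun i =>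
    ((ContinuousLinearMap.apply ℝ ℝ (e i)).integrable_comp (hgi' i)).bdd_mul (c := |F' 0| + Γ * B)
      hqc.aestronglyMeasurable (ae_of_all _ hQ)
  calc ∫ x, q x • ∫ y, l (y - x) ∂μ = ∫ x, ∑ i, q x * fderiv ℝ (g i) x (e i) := by
        refine integral_congr_ae (ae_of_all _ fun x => ?_)
        simp only
        rw [e2, laplaceL_eq, smul_eq_mul, Finset.mul_sum]
        refine Finset.sum_congr rfl fun i _ => ?_
        rw [hgd]
        rfl
    _ = ∑ i, -∫ x, fderiv ℝ q x (e i) * g i x := by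
        rw [integral_finsetSum _ fun i _ => hqg i]
        exact Finset.sum_congr rfl fun i _ => hparts i
    _ = -∫ x, ∑ i, fderiv ℝ q x (e i) * g i x := by
        rw [integral_finsetSum _ fun i _ => hqd i, Finset.sum_neg_distrib]
    _ = -∫ x, dissipationAt k F' μ x := by
        congr 1
        refine integral_congr_ae (ae_of_all _ fun x => ?_)
        simp only [dissipationAt]
        rw [real_inner_comm, inner_rieszMap_rieszMap]

end

end NonlocalDiffusion

end

noncomputable section
namespace NonlocalDiffusion
variable {d : ℕ}
set_option maxSynthPendingDepth 3

/-! ### The dissipation in space and time -/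

namespace Evolution

variable {k : Space d → ℝ} {B : ℝ} {F' : ℝ → ℝ} {Γ : ℝ} {V : ℝ × Space d → Space d}
    {ρ : ℝ → Measure (Space d)} {G : ℝ → ℝ}

lemma abs_smooth_sub_le (E : Evolution k B F' Γ V ρ G) {s t : ℝ} (hs : 0 ≤ s) (ht : 0 ≤ t)
    (x : Space d) : |smooth k (ρ s) x - smooth k (ρ t) x| ≤ B * |G s - G t| := by
  have hB := E.kernel.bound_nonneg
  rcases le_total s t with h | h
  · rw [abs_sub_comm, abs_sub_comm (G s)]
    refine (E.kernel.abs_smooth_sub_le (E.transport s t hs h) x).trans ?_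
    gcongr
    exact le_abs_self _
  · refine (E.kernel.abs_smooth_sub_le (E.transport t s ht h) x).trans ?_
    gcongr
    exact le_abs_self _

lemma continuous_modulus (E : Evolution k B F' Γ V ρ G) : Continuous fun s => G (max s 0) :=
  (continuousOn_Ici_of_Icc E.cont).comp_continuous (by fun_prop) fun _ =>
    mem_Ici.2 (le_max_right _ _)

lemma continuous_uncurry_of_modulus (E : Evolution k B F' Γ V ρ G) {h : ℝ → Space d → ℝ} {K : ℝ}
    (hK : 0 ≤ K) (hx : ∀ s, 0 ≤ s → ∀ x y, ‖h s x - h s y‖ ≤ K * ‖x - y‖)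
    (ht : ∀ s t, 0 ≤ s → 0 ≤ t → ∀ x, |h s x - h t x| ≤ K * |G s - G t|) :
    Continuous (Function.uncurry fun s x => h (max s 0) x) := by
  refine continuous_prod_of_continuous_lipschitzWith' _ ⟨K, hK⟩ (fun s => ?_) (fun x => ?_)
  · exact lipschitzWith_of_bound hK (hx _ (le_max_right _ _))
  · refine continuous_iff_continuousAt.2 fun s => tendsto_iff_norm_sub_tendsto_zero.2 ?_
    refine squeeze_zero_norm (a := fun t => K * |G (max t 0) - G (max s 0)|) (fun t => ?_) ?_
    · rw [norm_norm]
      exact ht _ _ (le_max_right _ _) (le_max_right _ _) x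
    · have h1 := ((E.continuous_modulus.sub
        (continuous_const (y := G (max s 0)))).abs.const_mul K).tendsto s
      simpa using h1

lemma continuous_smooth_uncurry (E : Evolution k B F' Γ V ρ G) :
    Continuous (Function.uncurry fun s x => smooth k (ρ (max s 0)) x) :=
  E.continuous_uncurry_of_modulus (h := fun s x => smooth k (ρ s) x) E.kernel.bound_nonneg
    (fun s hs => have := E.prob s hs; E.kernel.smooth_lipschitz)
    fun _ _ hs ht x => E.abs_smooth_sub_le hs ht x

lemma continuous_chemical_uncurry (E : Evolution k B F' Γ V ρ G) :
    Continuous (Function.uncurry fun s x => chemical k F' (ρ (max s 0)) x) := by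
  have hΓ := E.lip_nonneg
  refine E.continuous_uncurry_of_modulus (h := fun s x => chemical k F' (ρ s) x)
    (mul_nonneg hΓ E.kernel.bound_nonneg)
    (fun s hs => have := E.prob s hs; E.kernel.chemical_lipschitz hΓ E.lip) fun s t hs ht x => ?_
  refine (E.lip _ _ (E.kernel.smooth_nonneg x) (E.kernel.smooth_nonneg x)).trans ?_
  rw [mul_assoc]
  gcongr
  exact E.abs_smooth_sub_le hs ht x

/-- Derivatives with a parameter are jointly measurable for a jointly continuous function. Freezing
the curve at negative times by `max` provides that continuity, as nothing is assumed about ρ there.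
-/
lemma measurable_dissipationAt (E : Evolution k B F' Γ V ρ G) :
    Measurable fun z : ℝ × Space d => dissipationAt k F' (ρ (max z.1 0)) z.2 := by
  have h1 := (rieszMap d).continuous.measurable.comp
    (measurable_fderiv_with_param ℝ E.continuous_smooth_uncurry)
  have h2 := (rieszMap d).continuous.measurable.comp
    (measurable_fderiv_with_param ℝ E.continuous_chemical_uncurry)
  exact h1.inner h2

/-- The total dissipation at a given time. -/
lemma integral_dissipationAt (E : Evolution k B F' Γ V ρ G) {t : ℝ} (ht : 0 ≤ t) :
    ∫ x, divergence (drift k F' V ρ t) x ∂(ρ t) =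
      (∫ x, dissipationAt k F' (ρ t) x) - ∫ x, spaceDiv V (t, x) ∂(ρ t) := by
  have := E.prob t ht
  obtain ⟨M, hM0, hM, hML⟩ := E.exists_spaceDiv_bound
  have hsc : Continuous fun x => spaceDiv V (t, x) :=
    (continuous_of_lipschitz_bound hML).comp (by fun_prop)
  have i1 : Integrable (fun x => spaceDiv V (t, x)) (ρ t) :=
    Integrable.of_bound hsc.aestronglyMeasurable M (ae_of_all _ fun x => hM _)
  have hc : Continuous fun x => laplaceL d (conv (fderiv ℝ (fderiv ℝ k))
      (chemical k F' (ρ t)) x) := by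
    refine (laplaceL d).continuous.comp (continuous_of_lipschitz_bound
      (norm_conv_sub_conv_le E.kernel.integrable_fderiv_fderiv
        (E.kernel.abs_chemical_le E.lip_nonneg E.lip)
        (E.kernel.chemical_lipschitz E.lip_nonneg E.lip)))
  have i2 : Integrable (fun x => laplaceL d (conv (fderiv ℝ (fderiv ℝ k))
      (chemical k F' (ρ t)) x)) (ρ t) :=
    Integrable.of_bound hc.aestronglyMeasurable _ (ae_of_all _ fun x =>
      ((laplaceL d).le_opNorm _).trans (mul_le_mul_of_nonneg_left
        (norm_conv_le E.kernel.integrable_fderiv_fderiv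
          (E.kernel.abs_chemical_le E.lip_nonneg E.lip) x) (norm_nonneg _)))
  simp_rw [E.divergence_drift ht]
  rw [integral_neg, integral_add i2 i1, E.kernel.integral_laplace_conv E.lip_nonneg E.lip]
  ring

lemma continuousOn_integral_divergence (E : Evolution k B F' Γ V ρ G) (T : ℝ) :
    ContinuousOn (fun t => ∫ x, divergence (drift k F' V ρ t) x ∂(ρ t)) (Icc 0 T) := by
  obtain ⟨B', L, C, hD⟩ := E.exists_lipDrift
  obtain ⟨L', C', hL', hC', hdiv, hdivt⟩ := E.exists_divergence_bound
  exact continuousOn_of_modulus (E.cont T) ((hD T).abs_integral_sub_integral_le hL'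
    (fun t ht => hdiv t ht.1) fun s t hs hst _ => hdivt s t hs hst)

lemma continuousOn_integral_spaceDiv (E : Evolution k B F' Γ V ρ G) (T : ℝ) :
    ContinuousOn (fun t => ∫ x, spaceDiv V (t, x) ∂(ρ t)) (Icc 0 T) := by
  obtain ⟨B', L, C, hD⟩ := E.exists_lipDrift
  obtain ⟨M, hM0, hM, hML⟩ := E.exists_spaceDiv_bound
  refine continuousOn_of_modulus (E.cont T) ((hD T).abs_integral_sub_integral_le (K := M) hM0
    (fun t ht x y => (hML _ _).trans_eq (by simp)) fun s t hs hst _ x => (hML _ _).trans ?_)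
  have h1 := E.sub_le s t hs hst
  have h2 : ‖(t, x) - (s, x)‖ = t - s := by
    simp [abs_of_nonneg (sub_nonneg.2 hst), hst]
  rw [h2]
  gcongr

/-- The total dissipation is the mean divergence of the drift plus that of V, each of which has a
modulus in time; ∇q itself is not controlled in time. -/
lemma continuousOn_integral_dissipationAt (E : Evolution k B F' Γ V ρ G) (T : ℝ) :
    ContinuousOn (fun t => ∫ x, dissipationAt k F' (ρ t) x) (Icc 0 T) :=
  ((E.continuousOn_integral_divergence T).add (E.continuousOn_integral_spaceDiv T)).congr
    fun t ht => by
      rw [Pi.add_apply, E.integral_dissipationAt ht.1]; ring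

lemma intervalIntegrable_of_continuousOn_Icc {m : ℝ → ℝ} {T : ℝ} (hT : 0 ≤ T)
    (hm : ContinuousOn m (Icc 0 T)) : IntervalIntegrable m volume 0 T :=
  (hm.mono (by rw [uIcc_of_le hT])).intervalIntegrable

lemma aestronglyMeasurable_dissipation (E : Evolution k B F' Γ V ρ G) (T : ℝ) :
    AEStronglyMeasurable (fun z : ℝ × Space d => dissipationAt k F' (ρ z.1) z.2)
      (volume.restrict (Icc 0 T ×ˢ univ)) := by
  refine E.measurable_dissipationAt.aestronglyMeasurable.congr ?_
  filter_upwards [ae_restrict_mem (measurableSet_Icc.prod MeasurableSet.univ)] with z hz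
  rw [max_eq_left hz.1.1]

lemma eLpNorm_dissipation (E : Evolution k B F' Γ V ρ G)
    (hF : ∀ a b, 0 ≤ a → a ≤ b → F' a ≤ F' b) {T : ℝ} (hT : 0 ≤ T) :
    eLpNorm (fun z : ℝ × Space d => dissipationAt k F' (ρ z.1) z.2) 1
      (volume.restrict (Icc 0 T ×ˢ univ)) =
      ENNReal.ofReal (∫ t in 0..T, ∫ x, dissipationAt k F' (ρ t) x) := by
  have hnn : ∀ t, 0 ≤ t → ∀ x, 0 ≤ dissipationAt k F' (ρ t) x := fun t ht x =>
    have := E.prob t ht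
    E.kernel.dissipationAt_nonneg hF (ρ t) x
  have hc := E.continuousOn_integral_dissipationAt T
  rw [eLpNorm_one_eq_lintegral_enorm, Measure.volume_eq_prod, ← Measure.prod_restrict,
    Measure.restrict_univ, intervalIntegral.integral_of_le hT, ← integral_Icc_eq_integral_Ioc,
    ofReal_integral_eq_lintegral_ofReal (hc.integrableOn_compact isCompact_Icc)]
  · rw [lintegral_prod]
    · refine setLIntegral_congr_fun measurableSet_Icc fun t ht => ?_
      have := E.prob t ht.1
      simp only
      rw [ofReal_integral_eq_lintegral_ofReal
        (E.kernel.integrable_dissipationAt E.lip_nonneg E.lip) (ae_of_all _ (hnn t ht.1))]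
      exact lintegral_congr fun x => by rw [← ofReal_norm, Real.norm_of_nonneg (hnn t ht.1 x)]
    · have := (E.aestronglyMeasurable_dissipation T).enorm
      rwa [Measure.volume_eq_prod, ← Measure.prod_restrict, Measure.restrict_univ] at this
  · filter_upwards [ae_restrict_mem measurableSet_Icc] with t ht
    exact integral_nonneg (hnn t ht.1)

/-- The entropy dissipation inequality, in dual form. -/
theorem integral_le_of_initial_le (E : Evolution k B F' Γ V ρ G) {T : ℝ} (hT : 0 ≤ T)
    {ψ : Space d → ℝ} {Λ Y : ℝ} (hΛ : 0 ≤ Λ) (hψ : ∀ x y, ‖ψ x - ψ y‖ ≤ Λ * ‖x - y‖)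
    (hY : ∀ (ψ' : Space d → ℝ) (Λ' : ℝ), (∀ x y, ‖ψ' x - ψ' y‖ ≤ Λ' * ‖x - y‖) →
      ∫⁻ x, ENNReal.ofReal (Real.exp (ψ' x)) ≤ ∫⁻ x, ENNReal.ofReal (Real.exp (ψ x)) →
      ∫ x, ψ' x ∂(ρ 0) ≤ Y) :
    ∫ x, ψ x ∂(ρ T) ≤ Y - (∫ t in 0..T, ∫ x, dissipationAt k F' (ρ t) x) +
      ∫ t in 0..T, ∫ x, spaceDiv V (t, x) ∂(ρ t) := by
  obtain ⟨B', L, C, hD⟩ := E.exists_lipDrift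
  obtain ⟨L', C', hL', hC', hdiv, hdivt⟩ := E.exists_divergence_bound
  have h := (E.driftCurve hD (T := T)).integral_le_of_initial_le hT hL' hC'
    (fun t ht x => (E.hasFDerivAt_drift ht.1 x).differentiableAt) (fun t ht => hdiv t ht.1)
    (fun s t hs hst _ => hdivt s t hs hst) hΛ hψ hY
  have e : ∫ t in 0..T, ∫ x, divergence (drift k F' V ρ t) x ∂(ρ t) =
      (∫ t in 0..T, ∫ x, dissipationAt k F' (ρ t) x) -
        ∫ t in 0..T, ∫ x, spaceDiv V (t, x) ∂(ρ t) := by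
    rw [← intervalIntegral.integral_sub
      (intervalIntegrable_of_continuousOn_Icc hT (E.continuousOn_integral_dissipationAt T))
      (intervalIntegrable_of_continuousOn_Icc hT (E.continuousOn_integral_spaceDiv T))]
    refine intervalIntegral.integral_congr fun t ht => ?_
    rw [uIcc_of_le hT] at ht
    exact E.integral_dissipationAt ht.1
  rw [e] at h
  linarith

end Evolution

end NonlocalDiffusion

end

noncomputable section
namespace NonlocalDiffusion
variable {d : ℕ}
set_option maxSynthPendingDepth 3

/-! ### The energy inequality -/

/-- A bounded field, Lipschitz in space, with modulus of continuity `G` in time. -/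
structure ModulusField {F : Type*} [NormedAddCommGroup F] (G : ℝ → ℝ) (w : ℝ → Space d → F)
    (M : ℝ) : Prop where
  nonneg : 0 ≤ M
  bound : ∀ t, 0 ≤ t → ∀ x, ‖w t x‖ ≤ M
  lip : ∀ t, 0 ≤ t → ∀ x y, ‖w t x - w t y‖ ≤ M * ‖x - y‖
  time : ∀ s t, 0 ≤ s → s ≤ t → ∀ x, ‖w t x - w s x‖ ≤ M * (G t - G s)

lemma norm_apply_sub_apply_le' {A A' : Space d →L[ℝ] ℝ} {y y' : Space d} {M M' c : ℝ}
    (h1 : ‖A - A'‖ ≤ M * c) (h2 : ‖A'‖ ≤ M) (h3 : ‖y‖ ≤ M') (h4 : ‖y - y'‖ ≤ M' * c) :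
    ‖A y - A' y'‖ ≤ (2 * M * M') * c := by
  have e : A y - A' y' = (A - A') y + A' (y - y') := by simp
  have h5 := (ContinuousLinearMap.le_opNorm (A - A') y).trans
    (mul_le_mul h1 h3 (norm_nonneg _) ((norm_nonneg _).trans h1))
  have h6 := (ContinuousLinearMap.le_opNorm A' (y - y')).trans
    (mul_le_mul h2 h4 (norm_nonneg _) ((norm_nonneg _).trans h2))
  rw [e]
  refine (norm_add_le _ _).trans ((add_le_add h5 h6).trans_eq ?_)
  ring

lemma abs_norm_sq_sub_norm_sq_le {F : Type*} [NormedAddCommGroup F] {y y' : F} {M c : ℝ}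
    (h1 : ‖y‖ ≤ M) (h2 : ‖y'‖ ≤ M) (h3 : ‖y - y'‖ ≤ M * c) :
    ‖‖y‖ ^ 2 - ‖y'‖ ^ 2‖ ≤ (2 * M * M) * c := by
  have e : ‖y‖ ^ 2 - ‖y'‖ ^ 2 = (‖y‖ - ‖y'‖) * (‖y‖ + ‖y'‖) := by ring
  rw [e, norm_mul, Real.norm_of_nonneg (by positivity : 0 ≤ ‖y‖ + ‖y'‖)]
  have h4 : ‖‖y‖ - ‖y'‖‖ ≤ M * c := (abs_norm_sub_norm_le _ _).trans h3
  calc _ ≤ (M * c) * (M + M) :=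
        mul_le_mul h4 (add_le_add h1 h2) (by positivity) ((norm_nonneg _).trans h4)
    _ = (2 * M * M) * c := by ring

namespace ModulusField

variable {G : ℝ → ℝ} {M M' : ℝ}

lemma apply {A : ℝ → Space d → Space d →L[ℝ] ℝ} {w : ℝ → Space d → Space d}
    (hA : ModulusField G A M) (hw : ModulusField G w M') :
    ModulusField G (fun t x => A t x (w t x)) (2 * M * M') := by
  have h1 := hA.nonneg
  have h2 := hw.nonneg
  refine ⟨by positivity, fun t ht x => ?_, fun t ht x y => ?_, fun s t hs hst x => ?_⟩
  · refine (ContinuousLinearMap.le_opNorm _ _).trans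
      ((mul_le_mul (hA.bound t ht x) (hw.bound t ht x) (norm_nonneg _) h1).trans ?_)
    nlinarith [mul_nonneg h1 h2]
  · exact norm_apply_sub_apply_le' (hA.lip t ht x y) (hA.bound t ht y) (hw.bound t ht x)
      (hw.lip t ht x y)
  · exact norm_apply_sub_apply_le' (hA.time s t hs hst x) (hA.bound s hs x)
      (hw.bound t (hs.trans hst) x) (hw.time s t hs hst x)

lemma norm_sq {F : Type*} [NormedAddCommGroup F] {w : ℝ → Space d → F}
    (hw : ModulusField G w M) : ModulusField G (fun t x => ‖w t x‖ ^ 2) (2 * M * M) := by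
  have h1 := hw.nonneg
  refine ⟨by positivity, fun t ht x => ?_, fun t ht x y => ?_, fun s t hs hst x => ?_⟩
  · have := hw.bound t ht x
    rw [Real.norm_of_nonneg (by positivity)]
    nlinarith [norm_nonneg (w t x)]
  · exact abs_norm_sq_sub_norm_sq_le (hw.bound t ht x) (hw.bound t ht y) (hw.lip t ht x y)
  · exact abs_norm_sq_sub_norm_sq_le (hw.bound t (hs.trans hst) x) (hw.bound s hs x)
      (hw.time s t hs hst x)

end ModulusField

/-- A function whose increments are of higher order is nonincreasing. -/
lemma le_of_increment_le {a G : ℝ → ℝ} {T K : ℝ} (hT : 0 ≤ T)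
    (h : ∀ s t, 0 ≤ s → s ≤ t → t ≤ T → a t - a s ≤ (t - s) * (K * (G t - G s))) :
    a T ≤ a 0 := by
  -- On a uniform partition the second-order errors telescope in G, leaving mesh × total increment.
  have key : ∀ n : ℕ, a T - a 0 ≤ T / (n + 1) * (K * (G T - G 0)) := fun n => by
    have hn : (0 : ℝ) < n + 1 := by positivity
    let τ : ℕ → ℝ := fun i => i * (T / (n + 1))
    have hτ : ∀ i, i ≤ n → a (τ (i + 1)) - a (τ i) ≤
        T / (n + 1) * (K * (G (τ (i + 1)) - G (τ i))) := fun i hi => by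
      have hstep : τ (i + 1) - τ i = T / (n + 1) := by simp only [τ]; push_cast; ring
      have h0 : 0 ≤ T / (n + 1) := by positivity
      have h1 : τ (i + 1) ≤ T := by
        have : ((i : ℝ) + 1) ≤ n + 1 := by exact_mod_cast Nat.succ_le_succ hi
        calc τ (i + 1) = ((i : ℝ) + 1) * (T / (n + 1)) := by simp only [τ]; push_cast; ring
          _ ≤ (n + 1) * (T / (n + 1)) := by gcongr
          _ = T := by field_simp
      have := h (τ i) (τ (i + 1)) (by positivity) (by linarith) h1
      rwa [hstep] at this
    have hsum : ∀ m, m ≤ n + 1 → a (τ m) - a (τ 0) ≤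
        T / (n + 1) * (K * (G (τ m) - G (τ 0))) := fun m => by
      induction m with
      | zero => intro _; simp
      | succ m ih =>
        intro hm
        have h1 := ih (by omega)
        have h2 := hτ m (by omega)
        have h3 : T / (n + 1) * (K * (G (τ (m + 1)) - G (τ 0))) =
          T / (n + 1) * (K * (G (τ m) - G (τ 0))) +
            T / (n + 1) * (K * (G (τ (m + 1)) - G (τ m))) := by ring
        linarith
    have e0 : τ 0 = 0 := by simp [τ]
    have e1 : τ (n + 1) = T := by simp only [τ]; push_cast; field_simp
    simpa [e0, e1] using hsum (n + 1) le_rfl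
  have hlim : Tendsto (fun n : ℕ => T / ((n : ℝ) + 1) * (K * (G T - G 0))) atTop (𝓝 0) := by
    have := (tendsto_one_div_add_atTop_nhds_zero_nat (𝕜 := ℝ)).const_mul (T * (K * (G T - G 0)))
    rw [mul_zero] at this
    exact this.congr fun n => by ring
  linarith [ge_of_tendsto' hlim key]

/-- The tangent inequalities between 0 and a give |F(a)| ≤ c·a for a in the range of the smoothed
density, which is integrable. -/
lemma SmoothKernel.integrable_energy {k : Space d → ℝ} {B : ℝ} {F F' : ℝ → ℝ} {Γ : ℝ}
    {μ : Measure (Space d)} [IsProbabilityMeasure μ] (hk : SmoothKernel k B) (hΓ : 0 ≤ Γ)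
    (hlip : ∀ a b, 0 ≤ a → 0 ≤ b → |F' a - F' b| ≤ Γ * |a - b|) (hFc : Continuous F)
    (hF0 : F 0 = 0) (hF : ∀ a b, 0 ≤ a → 0 ≤ b → F a - F b ≤ F' a * (a - b)) :
    Integrable fun x => F (smooth k μ x) := by
  have hi : Integrable (smooth k μ) := (integrable_smooth hk.contDiff.continuous hk.integrable).1
  refine Integrable.mono' (hi.const_mul (|F' 0| + Γ * B))
    (hFc.comp (continuous_of_lipschitz_bound hk.smooth_lipschitz)).aestronglyMeasurable
    (ae_of_all _ fun x => ?_)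
  have h0 := hk.smooth_nonneg (μ := μ) x
  have h1 := hF _ 0 h0 le_rfl
  have h2 := hF 0 _ le_rfl h0
  have h3 : |F' (smooth k μ x)| ≤ |F' 0| + Γ * B := hk.abs_chemical_le (μ := μ) hΓ hlip x
  have h4 : |F' 0| ≤ |F' 0| + Γ * B := by
    have := mul_nonneg hΓ hk.bound_nonneg
    linarith
  rw [hF0] at h1 h2
  have h5 := mul_le_mul_of_nonneg_right ((le_abs_self _).trans h3) h0
  have h6 := mul_le_mul_of_nonneg_right ((neg_abs_le (F' 0)).trans' (neg_le_neg h4)) h0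
  rw [Real.norm_eq_abs, abs_le]
  constructor <;> linarith

namespace Evolution

variable {k : Space d → ℝ} {B : ℝ} {F F' : ℝ → ℝ} {Γ : ℝ} {V : ℝ × Space d → Space d}
    {ρ : ℝ → Measure (Space d)} {G : ℝ → ℝ}

lemma exists_modulusField_pressure (E : Evolution k B F' Γ V ρ G) :
    ∃ M, ModulusField G (fun t => conv (fderiv ℝ k) (chemical k F' (ρ t))) M := by
  have hB := E.kernel.bound_nonneg
  have hΓ := E.lip_nonneg
  set J := ∫ y, ‖fderiv ℝ k y‖ with hJ
  have hJ0 : 0 ≤ J := integral_nonneg fun _ => norm_nonneg _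
  set Q := |F' 0| + Γ * B with hQ
  refine ⟨max (Q * J) (Γ * B * J), le_max_of_le_left (by positivity), fun t ht x => ?_,
    fun t ht x y => ?_, fun s t hs hst x => ?_⟩
  · have := E.prob t ht
    exact (norm_conv_le E.kernel.integrable_fderiv (E.kernel.abs_chemical_le hΓ E.lip) x).trans
      (le_max_left _ _)
  · have := E.prob t ht
    exact (norm_conv_sub_conv_le E.kernel.integrable_fderiv
      (E.kernel.abs_chemical_le hΓ E.lip) (E.kernel.chemical_lipschitz hΓ E.lip) x y).trans
      (mul_le_mul_of_nonneg_right (le_max_right _ _) (norm_nonneg _))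
  · have := E.prob s hs
    have := E.prob t (hs.trans hst)
    have h0 : 0 ≤ G t - G s := (sub_nonneg.2 hst).trans (E.sub_le s t hs hst)
    refine (norm_conv_sub_le E.kernel.integrable_fderiv (E.kernel.continuous_chemical hΓ E.lip)
      (E.kernel.abs_chemical_le hΓ E.lip) (E.kernel.continuous_chemical hΓ E.lip)
      (E.kernel.abs_chemical_le hΓ E.lip)
      (E.kernel.abs_chemical_sub_le hΓ E.lip (E.transport s t hs hst)) x).trans ?_
    calc Γ * B * (G t - G s) * J = (Γ * B * J) * (G t - G s) := by ring
      _ ≤ _ := mul_le_mul_of_nonneg_right (le_max_right _ _) h0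

lemma exists_modulusField_velocity (E : Evolution k B F' Γ V ρ G) :
    ∃ M, ModulusField G (fun t x => V (t, x)) M := by
  obtain ⟨M, hM0, hM, hML⟩ := exists_bound_lipschitz_of_hasCompactSupport
    (E.field_contDiff.of_le (by simp)) E.field_support
  refine ⟨M, hM0, fun t _ x => hM _, fun t _ x y => (hML _ _).trans_eq (by simp),
    fun s t hs hst x => (hML _ _).trans ?_⟩
  have h1 := E.sub_le s t hs hst
  have h2 : ‖(t, x) - (s, x)‖ = t - s := by
    simp [abs_of_nonneg (sub_nonneg.2 hst), hst]
  rw [h2]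
  gcongr

lemma exists_modulusField_drift (E : Evolution k B F' Γ V ρ G) :
    ∃ M, ModulusField G (drift k F' V ρ) M := by
  obtain ⟨M, L, C, hD⟩ := E.exists_lipDrift
  refine ⟨max M (max L C), (hD 0).B_nonneg.trans (le_max_left _ _), fun t ht x => ?_,
    fun t ht x y => ?_, fun s t hs hst x => ?_⟩
  · exact ((hD t).bound t ⟨ht, le_rfl⟩ x).trans (le_max_left _ _)
  · exact ((hD t).lip t ⟨ht, le_rfl⟩ x y).trans (mul_le_mul_of_nonneg_right
      ((le_max_left _ _).trans (le_max_right _ _)) (norm_nonneg _))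
  · exact ((hD t).time s t hs hst le_rfl x).trans (mul_le_mul_of_nonneg_right
      ((le_max_right _ _).trans (le_max_right _ _))
      ((sub_nonneg.2 hst).trans (E.sub_le s t hs hst)))

lemma integrable_of_modulusField (E : Evolution k B F' Γ V ρ G) {w : ℝ → Space d → ℝ} {M : ℝ}
    (hw : ModulusField G w M) {t : ℝ} (ht : 0 ≤ t) : Integrable (w t) (ρ t) :=
  have := E.prob t ht
  integrable_of_lipschitz_bound (integrable_norm (E.secondMoment_lt t ht)) (hw.lip t ht)

lemma continuousOn_integral (E : Evolution k B F' Γ V ρ G) {w : ℝ → Space d → ℝ} {M : ℝ}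
    (hw : ModulusField G w M) (T : ℝ) :
    ContinuousOn (fun t => ∫ x, w t x ∂(ρ t)) (Icc 0 T) := by
  obtain ⟨B', L, C, hD⟩ := E.exists_lipDrift
  exact continuousOn_of_modulus (E.cont T) ((hD T).abs_integral_sub_integral_le hw.nonneg
    (fun t ht => hw.lip t ht.1) fun s t hs hst _ => hw.time s t hs hst)

lemma integral_conv_chemical (E : Evolution k B F' Γ V ρ G) {s t : ℝ} (hs : 0 ≤ s) (ht : 0 ≤ t) :
    ∫ x, conv k (chemical k F' (ρ t)) x ∂(ρ s) =
      ∫ x, chemical k F' (ρ t) x * smooth k (ρ s) x := by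
  have := E.prob s hs
  have := E.prob t ht
  rw [integral_conv E.kernel.contDiff.continuous E.kernel.integrable
    (E.kernel.continuous_chemical E.lip_nonneg E.lip) (E.kernel.abs_chemical_le E.lip_nonneg E.lip)]
  refine integral_congr_ae (ae_of_all _ fun x => ?_)
  simp only [smul_eq_mul, smooth]
  congr 1
  refine integral_congr_ae (ae_of_all _ fun y => ?_)
  simp only
  rw [← E.kernel.even, neg_sub]

lemma integrable_smooth_kernel (E : Evolution k B F' Γ V ρ G) {t : ℝ} (ht : 0 ≤ t) :
    Integrable (smooth k (ρ t)) := by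
  have := E.prob t ht
  exact (integrable_smooth E.kernel.contDiff.continuous E.kernel.integrable).1

lemma integrable_energy (E : Evolution k B F' Γ V ρ G) (hFc : Continuous F) (hF0 : F 0 = 0)
    (hF : ∀ a b, 0 ≤ a → 0 ≤ b → F a - F b ≤ F' a * (a - b)) {t : ℝ} (ht : 0 ≤ t) :
    Integrable fun x => F (smooth k (ρ t) x) :=
  have := E.prob t ht
  E.kernel.integrable_energy E.lip_nonneg E.lip hFc hF0 hF

/-- The energy is dissipated at the rate of the work of the drift against the pressure. -/
theorem energy_sub_le (E : Evolution k B F' Γ V ρ G) (hFc : Continuous F) (hF0 : F 0 = 0)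
    (hF : ∀ a b, 0 ≤ a → 0 ≤ b → F a - F b ≤ F' a * (a - b)) {T : ℝ} (hT : 0 ≤ T) :
    (∫ x, F (smooth k (ρ T) x)) - (∫ x, F (smooth k (ρ 0) x)) ≤
      ∫ t in 0..T, ∫ x, conv (fderiv ℝ k) (chemical k F' (ρ t)) x (drift k F' V ρ t x) ∂(ρ t) := by
  obtain ⟨M, hP⟩ := E.exists_modulusField_pressure
  obtain ⟨M', hb⟩ := E.exists_modulusField_drift
  obtain ⟨B', L, C, hD⟩ := E.exists_lipDrift
  have hΓ := E.lip_nonneg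
  set w : ℝ → ℝ := fun t =>
    ∫ x, conv (fderiv ℝ k) (chemical k F' (ρ t)) x (drift k F' V ρ t x) ∂(ρ t) with hw
  have hwc : ContinuousOn w (Icc 0 T) := E.continuousOn_integral (hP.apply hb) T
  have hwi : ∀ s ∈ Icc 0 T, ∀ t ∈ Icc 0 T, IntervalIntegrable w volume s t := fun s hs t ht =>
    (hwc.mono (by
      rw [uIcc]; exact Icc_subset_Icc (le_inf hs.1 ht.1) (sup_le hs.2 ht.2))).intervalIntegrable
  have h0T : (0 : ℝ) ∈ Icc 0 T := ⟨le_rfl, hT⟩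
  -- The energy minus the accumulated work has increments bounded by (step) × (increment of G),
  -- hence does not increase.
  have key := le_of_increment_le (a := fun t => (∫ x, F (smooth k (ρ t) x)) - ∫ u in 0..t, w u)
    (G := G) (K := M * M') hT fun s t hs hst ht => by
    have hsT : s ∈ Icc 0 T := ⟨hs, hst.trans ht⟩
    have htT : t ∈ Icc 0 T := ⟨hs.trans hst, ht⟩
    have := E.prob s hs
    have := E.prob t htT.1
    have e1 : (∫ u in 0..t, w u) - ∫ u in 0..s, w u = ∫ u in s..t, w u :=
      intervalIntegral.integral_interval_sub_left (hwi 0 h0T t htT) (hwi 0 h0T s hsT)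
    have hq : ∀ r, 0 ≤ r → Integrable fun x => chemical k F' (ρ t) x * smooth k (ρ r) x :=
      fun r hr => (E.integrable_smooth_kernel hr).bdd_mul (c := |F' 0| + Γ * B)
        (E.kernel.continuous_chemical hΓ E.lip).aestronglyMeasurable
        (ae_of_all _ (E.kernel.abs_chemical_le hΓ E.lip))
    -- The tangent inequality at the later time t. Moving the kernel across turns ∫ q_t (μ_t - μ_s)
    -- into the increment of ∫ p_t dρ with the pressure frozen at time t.
    have e2 : (∫ x, F (smooth k (ρ t) x)) - (∫ x, F (smooth k (ρ s) x)) ≤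
        ∫ x, conv k (chemical k F' (ρ t)) x ∂(ρ t) -
          ∫ x, conv k (chemical k F' (ρ t)) x ∂(ρ s) := by
      rw [E.integral_conv_chemical htT.1 htT.1, E.integral_conv_chemical hs htT.1,
        ← integral_sub (E.integrable_energy hFc hF0 hF htT.1) (E.integrable_energy hFc hF0 hF hs),
        ← integral_sub (hq t htT.1) (hq s hs)]
      refine integral_mono ((E.integrable_energy hFc hF0 hF htT.1).sub
        (E.integrable_energy hFc hF0 hF hs)) ((hq t htT.1).sub (hq s hs)) fun x => ?_
      simp only
      rw [← mul_sub]
      exact hF _ _ (E.kernel.smooth_nonneg x) (E.kernel.smooth_nonneg x)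
    have hpd : Differentiable ℝ (conv k (chemical k F' (ρ t))) := fun x =>
      (E.kernel.hasFDerivAt_conv_chemical hΓ E.lip x).differentiableAt
    have hpf := E.kernel.fderiv_conv_chemical (μ := ρ t) hΓ E.lip
    have hpL : ∀ x y, ‖conv k (chemical k F' (ρ t)) x - conv k (chemical k F' (ρ t)) y‖ ≤
        M * ‖x - y‖ := lipschitz_bound_of_fderiv_le hpd fun x => by
      rw [hpf]; exact hP.bound t htT.1 x
    have hpL' : ∀ x y, ‖fderiv ℝ (conv k (chemical k F' (ρ t))) x -
        fderiv ℝ (conv k (chemical k F' (ρ t))) y‖ ≤ M * ‖x - y‖ := fun x y => by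
      rw [hpf]; exact hP.lip t htT.1 x y
    have e3 := (E.driftCurve hD (T := T)).weak_of_lipschitz_fderiv hP.nonneg hP.nonneg hpd hpL hpL'
      hs hst ht
    rw [e3] at e2
    have hc1 := continuousOn_of_modulus (E.cont T)
      ((hD T).abs_pairing_sub_le hP.nonneg hP.nonneg hpL hpL')
    have hi1 : IntervalIntegrable (fun u => ∫ x, fderiv ℝ (conv k (chemical k F' (ρ t))) x
        (drift k F' V ρ u x) ∂(ρ u)) volume s t :=
      (hc1.mono (by rw [uIcc_of_le hst]; exact Icc_subset_Icc hs ht)).intervalIntegrable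
    -- Unfreezing the pressure costs its modulus in time multiplied by the bound on the drift.
    have e4 : (∫ u in s..t, ∫ x, fderiv ℝ (conv k (chemical k F' (ρ t))) x
        (drift k F' V ρ u x) ∂(ρ u)) - (∫ u in s..t, w u) ≤ (t - s) * (M * M' * (G t - G s)) := by
      rw [← intervalIntegral.integral_sub hi1 (hwi s hsT t htT)]
      have h5 : ∀ u ∈ Icc s t, (∫ x, fderiv ℝ (conv k (chemical k F' (ρ t))) x
          (drift k F' V ρ u x) ∂(ρ u)) - w u ≤ M * M' * (G t - G s) := fun u hu => by
        have hu0 : 0 ≤ u := hs.trans hu.1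
        have := E.prob u hu0
        have hGu : G s ≤ G u := by linarith [E.sub_le s u hs hu.1, hu.1]
        refine (le_abs_self _).trans (abs_integral_sub_integral_le_of_forall ?_
          (E.integrable_of_modulusField (hP.apply hb) hu0) fun x => ?_)
        · exact (hD T).integrable ⟨hu0, hu.2.trans ht⟩
            ((hD T).pairing_lipschitz hP.nonneg hpL hpL' ⟨hu0, hu.2.trans ht⟩)
        · rw [hpf]
          refine (ContinuousLinearMap.le_opNorm (conv (fderiv ℝ k) (chemical k F' (ρ t)) x -
            conv (fderiv ℝ k) (chemical k F' (ρ u)) x) (drift k F' V ρ u x)).trans ?_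
          calc _ ≤ (M * (G t - G u)) * M' := mul_le_mul (hP.time u t hu0 hu.2 x)
                (hb.bound u hu0 x) (norm_nonneg _) ((norm_nonneg _).trans
                  (hP.time u t hu0 hu.2 x))
            _ = (M * M') * (G t - G u) := by ring
            _ ≤ _ := mul_le_mul_of_nonneg_left (by linarith)
                (mul_nonneg hP.nonneg hb.nonneg)
      have h6 := intervalIntegral.integral_mono_on hst (hi1.sub (hwi s hsT t htT))
        intervalIntegrable_const h5
      rwa [intervalIntegral.integral_const, smul_eq_mul] at h6
    linarith
  simp only [intervalIntegral.integral_same, sub_zero] at key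
  linarith

end Evolution

end NonlocalDiffusion

end

noncomputable section
namespace NonlocalDiffusion
variable {d : ℕ}
set_option maxSynthPendingDepth 3

/-! ### Moments -/

/-- A form of Gronwall's inequality. -/
lemma le_two_pow_mul_of_le_integral {m K : ℝ → ℝ} {T c : ℝ} (hc : 0 ≤ c)
    (hK : ContinuousOn K (Icc 0 T)) (hK0 : ∀ t ∈ Icc 0 T, 0 ≤ K t) (hm0 : ∀ t ∈ Icc 0 T, 0 ≤ m t)
    (hi : IntegrableOn (fun t => K t * m t) (Icc 0 T))
    (h : ∀ t ∈ Icc 0 T, m t ≤ c + ∫ u in 0..t, K u * m u) (n : ℕ) :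
    ∀ t ∈ Icc 0 T, ∫ u in 0..t, K u ≤ n / 2 → m t ≤ 2 ^ n * c := by
  set y : ℝ → ℝ := fun t => c + ∫ u in 0..t, K u * m u with hy
  have hii : ∀ s ∈ Icc 0 T, ∀ t ∈ Icc 0 T,
      IntervalIntegrable (fun t => K t * m t) volume s t := fun s hs t ht =>
    (hi.mono_set (by
      rw [uIcc]; exact Icc_subset_Icc (le_inf hs.1 ht.1) (sup_le hs.2 ht.2))).intervalIntegrable
  have hKi : ∀ s ∈ Icc 0 T, ∀ t ∈ Icc 0 T, IntervalIntegrable K volume s t := fun s hs t ht =>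
    (hK.mono (by
      rw [uIcc]; exact Icc_subset_Icc (le_inf hs.1 ht.1) (sup_le hs.2 ht.2))).intervalIntegrable
  have hsub : ∀ s ∈ Icc 0 T, ∀ t ∈ Icc 0 T, y t - y s = ∫ u in s..t, K u * m u :=
    fun s hs t ht => by
      have h0 : (0 : ℝ) ∈ Icc 0 T := ⟨le_rfl, hs.1.trans hs.2⟩
      rw [← intervalIntegral.integral_interval_sub_left (hii 0 h0 t ht) (hii 0 h0 s hs)]
      simp only [hy]; ring
  have hmono : ∀ s ∈ Icc 0 T, ∀ t ∈ Icc 0 T, s ≤ t → y s ≤ y t := fun s hs t ht hst => by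
    have h1 : 0 ≤ ∫ u in s..t, K u * m u := intervalIntegral.integral_nonneg hst fun u hu =>
      have hu' : u ∈ Icc 0 T := ⟨hs.1.trans hu.1, hu.2.trans ht.2⟩
      mul_nonneg (hK0 u hu') (hm0 u hu')
    linarith [hsub s hs t ht]
  have hstep : ∀ s ∈ Icc 0 T, ∀ t ∈ Icc 0 T, s ≤ t →
      y t - y s ≤ (∫ u in s..t, K u) * y t := fun s hs t ht hst => by
    rw [hsub s hs t ht, ← intervalIntegral.integral_mul_const]
    refine intervalIntegral.integral_mono_on hst (hii s hs t ht)
      ((hKi s hs t ht).mul_const _) fun u hu => ?_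
    have hu' : u ∈ Icc 0 T := ⟨hs.1.trans hu.1, hu.2.trans ht.2⟩
    exact mul_le_mul_of_nonneg_left ((h u hu').trans (hmono u hu' t ht hu.2)) (hK0 u hu')
  have hypos : ∀ t ∈ Icc 0 T, 0 ≤ y t := fun t ht => (hm0 t ht).trans (h t ht)
  -- y at most doubles whenever ∫ K grows by 1/2, since then y t - y s ≤ y t / 2. The induction is
  -- on the number of such halves, so no differential inequality is needed.
  suffices H : ∀ n : ℕ, ∀ t ∈ Icc 0 T, ∫ u in 0..t, K u ≤ n / 2 → y t ≤ 2 ^ n * c from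
    fun t ht htn => (h t ht).trans (H n t ht htn)
  intro n
  induction n with
  | zero =>
    intro t ht htn
    have h0 : (0 : ℝ) ∈ Icc 0 T := ⟨le_rfl, ht.1.trans ht.2⟩
    have h1 := hstep 0 h0 t ht ht.1
    have h2 : y 0 = c := by simp [hy]
    have h3 : (∫ u in 0..t, K u) * y t ≤ 0 :=
      mul_nonpos_of_nonpos_of_nonneg (by simpa using htn) (hypos t ht)
    simp only [pow_zero, one_mul]
    linarith
  | succ n ih =>
    intro t ht htn
    have h0 : (0 : ℝ) ∈ Icc 0 T := ⟨le_rfl, ht.1.trans ht.2⟩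
    rcases le_total (∫ u in 0..t, K u) (n / 2) with hle | hle
    · refine (ih t ht hle).trans ?_
      rw [pow_succ]
      nlinarith [mul_nonneg (pow_nonneg (zero_le_two : (0 : ℝ) ≤ 2) n) hc]
    · have hcont : ContinuousOn (fun r => ∫ u in 0..r, K u) (Icc 0 t) := by
        have := intervalIntegral.continuousOn_primitive_interval (μ := volume) (f := K) (a := 0)
          (b := t) (by
            rw [uIcc_of_le ht.1]
            exact (hK.mono (Icc_subset_Icc le_rfl ht.2)).integrableOn_compact isCompact_Icc)
        rwa [uIcc_of_le ht.1] at this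
      -- The intermediate value theorem finds the time at which ∫ K has reached n/2.
      obtain ⟨s, hs, hsn⟩ := intermediate_value_Icc ht.1 hcont
        (show (n : ℝ) / 2 ∈ Icc _ _ from ⟨by simp only [intervalIntegral.integral_same]; positivity, hle⟩)
      simp only at hsn
      have hsT : s ∈ Icc 0 T := ⟨hs.1, hs.2.trans ht.2⟩
      have h1 := hstep s hsT t ht hs.2
      have h2 := ih s hsT hsn.le
      have h3 := intervalIntegral.integral_interval_sub_left (hKi 0 h0 t ht) (hKi 0 h0 s hsT)
      have h4 : ∫ u in s..t, K u ≤ 1 / 2 := by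
        push_cast at htn
        linarith
      have h5 := mul_le_mul_of_nonneg_right h4 (hypos t ht)
      rw [pow_succ]
      linarith

/-- Bounded Lipschitz approximations of `|x|²`. -/
def momentTest (s : ℝ) (x : Space d) : ℝ := ‖x‖ ^ 2 / (1 + s * ‖x‖ ^ 2)

section

variable {s : ℝ}

lemma one_le_one_add_mul_sq (hs : 0 ≤ s) (x : Space d) : 1 ≤ 1 + s * ‖x‖ ^ 2 := by
  have : 0 ≤ s * ‖x‖ ^ 2 := by positivity
  linarith

lemma momentTest_nonneg (hs : 0 ≤ s) (x : Space d) : 0 ≤ momentTest s x :=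
  div_nonneg (by positivity) (by linarith [one_le_one_add_mul_sq hs x])

lemma momentTest_le (hs : 0 ≤ s) (x : Space d) : momentTest s x ≤ ‖x‖ ^ 2 :=
  div_le_self (by positivity) (one_le_one_add_mul_sq hs x)

lemma hasFDerivAt_momentTest (hs : 0 ≤ s) (x : Space d) :
    HasFDerivAt (momentTest s) ((2 / (1 + s * ‖x‖ ^ 2) ^ 2) • innerSL ℝ x) x := by
  have h0 : 1 + s * ‖x‖ ^ 2 ≠ 0 := by linarith [one_le_one_add_mul_sq hs x]
  have h1 : HasDerivAt (fun r : ℝ => r / (1 + s * r)) (1 / (1 + s * ‖x‖ ^ 2) ^ 2) (‖x‖ ^ 2) := by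
    have h2 : HasDerivAt (fun r : ℝ => 1 + s * r) s (‖x‖ ^ 2) := by
      simpa using ((hasDerivAt_id (‖x‖ ^ 2)).const_mul s).const_add 1
    refine ((hasDerivAt_id (‖x‖ ^ 2)).div h2 h0).congr_deriv ?_
    simp only [id_eq]
    ring
  have h2 := h1.comp_hasFDerivAt x (hasStrictFDerivAt_norm_sq x).hasFDerivAt
  refine h2.congr_fderiv ?_
  ext y
  simp
  ring

lemma fderiv_momentTest (hs : 0 ≤ s) (x : Space d) :
    fderiv ℝ (momentTest s) x = innerSL ℝ ((2 / (1 + s * ‖x‖ ^ 2) ^ 2) • x) := by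
  rw [(hasFDerivAt_momentTest hs x).fderiv]
  simp

lemma contDiff_momentTest (hs : 0 ≤ s) : ContDiff ℝ ∞ (momentTest s : Space d → ℝ) :=
  (contDiff_norm_sq ℝ).div (contDiff_const.add (contDiff_const.mul (contDiff_norm_sq ℝ)))
    fun x => by linarith [one_le_one_add_mul_sq hs x]

lemma norm_fderiv_momentTest_le (hs : 0 < s) (hs1 : s ≤ 1) (x : Space d) :
    ‖fderiv ℝ (momentTest s) x‖ ≤ 2 / s := by
  have h1 := one_le_one_add_mul_sq hs.le x
  rw [fderiv_momentTest hs.le, innerSL_apply_norm, norm_smul, Real.norm_of_nonneg (by positivity),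
    div_mul_eq_mul_div, div_le_div_iff₀ (by positivity) hs]
  have h2 : s * ‖x‖ ≤ 1 + s * ‖x‖ ^ 2 := by nlinarith [sq_nonneg (‖x‖ - 1), norm_nonneg x]
  nlinarith

lemma fderiv_momentTest_lipschitz (hs : 0 ≤ s) (x y : Space d) :
    ‖fderiv ℝ (momentTest s) x - fderiv ℝ (momentTest s) y‖ ≤ 14 * ‖x - y‖ := by
  set a := 1 + s * ‖x‖ ^ 2 with ha
  set b := 1 + s * ‖y‖ ^ 2 with hb
  have ha1 : 1 ≤ a := one_le_one_add_mul_sq hs x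
  have hb1 : 1 ≤ b := one_le_one_add_mul_sq hs y
  rw [fderiv_momentTest hs, fderiv_momentTest hs, ← map_sub, innerSL_apply_norm, ← ha, ← hb]
  -- The gradient is 2x/a². Its variation splits into that of x, contributing 2, and that of the
  -- factor 1/a², contributing 12, both uniformly in s.
  have e : (2 / a ^ 2) • x - (2 / b ^ 2) • y =
      (2 / a ^ 2) • (x - y) + (2 / a ^ 2 - 2 / b ^ 2) • y := by
    rw [smul_sub, sub_smul]; abel
  have h1 : ‖(2 / a ^ 2) • (x - y)‖ ≤ 2 * ‖x - y‖ := by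
    rw [norm_smul, Real.norm_of_nonneg (by positivity)]
    gcongr
    exact div_le_self (by norm_num) (one_le_pow₀ ha1)
  have h2 : ‖(2 / a ^ 2 - 2 / b ^ 2) • y‖ ≤ 12 * ‖x - y‖ := by
    rw [norm_smul, Real.norm_eq_abs]
    have hxy : |‖y‖ - ‖x‖| ≤ ‖x - y‖ := by
      rw [norm_sub_rev]; exact abs_norm_sub_norm_le y x
    have e2 : 2 / a ^ 2 - 2 / b ^ 2 =
        (‖y‖ - ‖x‖) * (2 * s * (‖x‖ + ‖y‖) * (a + b) / (a ^ 2 * b ^ 2)) := by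
      have : b - a = s * (‖y‖ - ‖x‖) * (‖x‖ + ‖y‖) := by rw [ha, hb]; ring
      have h3 : 2 / a ^ 2 - 2 / b ^ 2 = 2 * (b - a) * (a + b) / (a ^ 2 * b ^ 2) := by
        field_simp
        ring
      rw [h3, this]; ring
    have h3 : 0 ≤ 2 * s * (‖x‖ + ‖y‖) * (a + b) / (a ^ 2 * b ^ 2) := by positivity
    rw [e2, abs_mul, abs_of_nonneg h3, mul_assoc, mul_comm]
    refine mul_le_mul ?_ hxy (abs_nonneg _) (by norm_num)
    rw [div_mul_eq_mul_div, div_le_iff₀ (by positivity)]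
    have h4 : s * (‖x‖ * ‖y‖ + ‖y‖ ^ 2) ≤ 3 / 2 * (a + b) := by
      have : s * (‖x‖ * ‖y‖) ≤ s * ((‖x‖ ^ 2 + ‖y‖ ^ 2) / 2) := by
        gcongr
        nlinarith [sq_nonneg (‖x‖ - ‖y‖)]
      nlinarith
    have h5 : a + b ≤ 2 * (a * b) := by nlinarith
    calc 2 * s * (‖x‖ + ‖y‖) * (a + b) * ‖y‖
        = (s * (‖x‖ * ‖y‖ + ‖y‖ ^ 2)) * (2 * (a + b)) := by ring
      _ ≤ (3 / 2 * (a + b)) * (2 * (a + b)) := by gcongr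
      _ = 3 * ((a + b) * (a + b)) := by ring
      _ ≤ 3 * ((2 * (a * b)) * (2 * (a * b))) := by gcongr
      _ = 12 * (a ^ 2 * b ^ 2) := by ring
  rw [e]
  refine (norm_add_le _ _).trans ((add_le_add h1 h2).trans_eq ?_)
  ring

/-- Young's inequality together with (‖x‖/a²)² ≤ ‖x‖²/a, valid since a = 1 + s‖x‖² ≥ 1. The right
side involves only the truncated moment again, uniformly in s. -/
lemma fderiv_momentTest_apply_le (hs : 0 ≤ s) {l : ℝ} (hl : 0 < l) (x w : Space d) :
    fderiv ℝ (momentTest s) x w ≤ l⁻¹ * momentTest s x + l * ‖w‖ ^ 2 := by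
  set a := 1 + s * ‖x‖ ^ 2 with ha
  have ha1 : 1 ≤ a := one_le_one_add_mul_sq hs x
  have h1 : fderiv ℝ (momentTest s) x w ≤ 2 * (‖x‖ / a ^ 2) * ‖w‖ := by
    rw [fderiv_momentTest hs, innerSL_apply_apply, real_inner_smul_left, ← ha]
    calc 2 / a ^ 2 * inner ℝ x w ≤ 2 / a ^ 2 * (‖x‖ * ‖w‖) := by
          gcongr
          exact real_inner_le_norm _ _
      _ = _ := by ring
  have h2 : (‖x‖ / a ^ 2) ^ 2 ≤ momentTest s x := by
    unfold momentTest
    rw [← ha, div_pow, div_le_div_iff₀ (by positivity) (by positivity)]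
    gcongr
    calc a ≤ a ^ 4 := le_self_pow₀ ha1 (by norm_num)
      _ = (a ^ 2) ^ 2 := by ring
  have h3 : 2 * (‖x‖ / a ^ 2) * ‖w‖ ≤ l⁻¹ * (‖x‖ / a ^ 2) ^ 2 + l * ‖w‖ ^ 2 := by
    have h4 : 0 ≤ l⁻¹ * (‖x‖ / a ^ 2 - l * ‖w‖) ^ 2 := by positivity
    have h5 : l⁻¹ * (‖x‖ / a ^ 2 - l * ‖w‖) ^ 2 =
        l⁻¹ * (‖x‖ / a ^ 2) ^ 2 + l * ‖w‖ ^ 2 - 2 * (‖x‖ / a ^ 2) * ‖w‖ := by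
      field_simp
      ring
    linarith
  have h6 := mul_le_mul_of_nonneg_left h2 (inv_pos.2 hl).le
  linarith

end

/-! ### Moment estimates along the evolution. -/

namespace Evolution

variable {k : Space d → ℝ} {B : ℝ} {F F' : ℝ → ℝ} {Γ : ℝ} {V : ℝ × Space d → Space d}
    {ρ : ℝ → Measure (Space d)} {G : ℝ → ℝ}

lemma continuousOn_integral_momentTest (E : Evolution k B F' Γ V ρ G) {s : ℝ} (hs : 0 < s)
    (hs1 : s ≤ 1) (T : ℝ) : ContinuousOn (fun t => ∫ x, momentTest s x ∂(ρ t)) (Icc 0 T) :=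
  continuousOn_of_modulus (E.cont T) fun r t hr hrt _ => E.transport r t hr hrt _ (2 / s)
    (by positivity) (lipschitz_bound_of_fderiv_le ((contDiff_momentTest hs.le).differentiable
      (by simp)) (norm_fderiv_momentTest_le hs hs1))

lemma integral_momentTest_le (E : Evolution k B F' Γ V ρ G) {s : ℝ} (hs : 0 < s) (hs1 : s ≤ 1)
    {l : ℝ} (hl : 0 < l) {T : ℝ} (hT : 0 ≤ T) :
    ∫ x, momentTest s x ∂(ρ T) ≤ ∫ x, momentTest s x ∂(ρ 0) +
      ∫ t in 0..T, (l⁻¹ * ∫ x, momentTest s x ∂(ρ t) +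
        l * ∫ x, ‖drift k F' V ρ t x‖ ^ 2 ∂(ρ t)) := by
  obtain ⟨M, hb⟩ := E.exists_modulusField_drift
  obtain ⟨B', L, C, hD⟩ := E.exists_lipDrift
  have hd : Differentiable ℝ (momentTest s : Space d → ℝ) :=
    (contDiff_momentTest hs.le).differentiable (by simp)
  have hL : ∀ x y : Space d, ‖momentTest s x - momentTest s y‖ ≤ 2 / s * ‖x - y‖ :=
    lipschitz_bound_of_fderiv_le hd (norm_fderiv_momentTest_le hs hs1)
  have hL' := fderiv_momentTest_lipschitz (d := d) hs.le
  have hw := (E.driftCurve hD (T := T)).weak 0 T le_rfl hT le_rfl _ _ (contDiff_momentTest hs.le)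
    (by positivity) hL
  have hc1 := continuousOn_of_modulus (E.cont T)
    ((hD T).abs_pairing_sub_le (by positivity) (by norm_num) hL hL')
  have hc2 : ContinuousOn (fun t => l⁻¹ * ∫ x, momentTest s x ∂(ρ t) +
      l * ∫ x, ‖drift k F' V ρ t x‖ ^ 2 ∂(ρ t)) (Icc 0 T) :=
    (continuousOn_const.mul (E.continuousOn_integral_momentTest hs hs1 T)).add
      (continuousOn_const.mul (E.continuousOn_integral hb.norm_sq T))
  have hmono := intervalIntegral.integral_mono_on hT
    (intervalIntegrable_of_continuousOn_Icc hT hc1) (intervalIntegrable_of_continuousOn_Icc hT hc2)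
    fun t ht => by
      have i1 := (hD T).integrable ht hL
      have i2 := E.integrable_of_modulusField hb.norm_sq ht.1
      rw [← integral_const_mul, ← integral_const_mul,
        ← integral_add (i1.const_mul _) (i2.const_mul _)]
      exact integral_mono ((hD T).integrable ht ((hD T).pairing_lipschitz (by positivity) hL hL' ht))
        ((i1.const_mul _).add (i2.const_mul _)) fun x => fderiv_momentTest_apply_le hs.le hl x _
  linarith

lemma tendsto_integral_momentTest {μ : Measure (Space d)} [IsProbabilityMeasure μ]
    (hμ : secondMoment μ < ⊤) :
    Tendsto (fun n : ℕ => ∫ x, momentTest (1 / ((n : ℝ) + 1)) x ∂μ) atTop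
      (𝓝 (∫ x, ‖x‖ ^ 2 ∂μ)) := by
  refine tendsto_integral_of_dominated_convergence (fun x => ‖x‖ ^ 2)
    (fun n => (contDiff_momentTest (by positivity)).continuous.aestronglyMeasurable)
    (integrable_norm_sq hμ) (fun n => ae_of_all _ fun x => ?_) (ae_of_all _ fun x => ?_)
  · rw [Real.norm_of_nonneg (momentTest_nonneg (by positivity) x)]
    exact momentTest_le (by positivity) x
  · have h1 := ((tendsto_one_div_add_atTop_nhds_zero_nat (𝕜 := ℝ)).mul_const
      (‖x‖ ^ 2)).const_add 1
    have h2 : Tendsto (fun n : ℕ => ‖x‖ ^ 2 / (1 + 1 / ((n : ℝ) + 1) * ‖x‖ ^ 2)) atTop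
        (𝓝 (‖x‖ ^ 2 / (1 + 0 * ‖x‖ ^ 2))) := tendsto_const_nhds.div h1 (by simp)
    simpa [momentTest] using h2

/-- The second moments are bounded and measurable in time. -/
lemma exists_moment_le (E : Evolution k B F' Γ V ρ G) {T : ℝ} (hT : 0 ≤ T) :
    ∃ R, ∀ t ∈ Icc 0 T, ∀ s, 0 < s → s ≤ 1 → ∫ x, momentTest s x ∂(ρ t) ≤ R := by
  obtain ⟨M, hb⟩ := E.exists_modulusField_drift
  have hM := hb.nonneg
  set c := ∫ x, ‖x‖ ^ 2 ∂(ρ 0) + T * (2 * M * M) with hc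
  have hc0 : 0 ≤ c := by
    have : 0 ≤ ∫ x, ‖x‖ ^ 2 ∂(ρ 0) := integral_nonneg fun x => by positivity
    positivity
  obtain ⟨n, hn⟩ := exists_nat_ge (2 * T)
  refine ⟨2 ^ n * c, fun t ht s hs hs1 => ?_⟩
  have hcont := E.continuousOn_integral_momentTest hs hs1 T
  have hnn : ∀ t, 0 ≤ ∫ x, momentTest s x ∂(ρ t) := fun t =>
    integral_nonneg fun x => momentTest_nonneg hs.le x
  -- Gronwall with constant rate 1 and the crude bound on the drift. The result is uniform in s but
  -- not in ε; it only provides domination and integrability below.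
  refine le_two_pow_mul_of_le_integral (m := fun t => ∫ x, momentTest s x ∂(ρ t))
    (K := fun _ => 1) hc0 continuousOn_const (fun _ _ => zero_le_one) (fun t _ => hnn t) ?_
    (fun t ht => ?_) n t ht ?_
  · simpa using hcont.integrableOn_compact isCompact_Icc
  · have h1 := E.integral_momentTest_le hs hs1 one_pos ht.1
    have := E.prob 0 le_rfl
    have h2 : ∫ x, momentTest s x ∂(ρ 0) ≤ ∫ x, ‖x‖ ^ 2 ∂(ρ 0) :=
      integral_mono_of_nonneg (ae_of_all _ fun x => momentTest_nonneg hs.le x)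
        (integrable_norm_sq (E.secondMoment_lt 0 le_rfl)) (ae_of_all _ fun x => momentTest_le hs.le x)
    have hsub : Icc 0 t ⊆ Icc 0 T := Icc_subset_Icc le_rfl ht.2
    have i1 := intervalIntegrable_of_continuousOn_Icc ht.1 (hcont.mono hsub)
    have i2 := intervalIntegrable_of_continuousOn_Icc ht.1 (E.continuousOn_integral hb.norm_sq t)
    simp only [inv_one, one_mul] at h1 ⊢
    rw [intervalIntegral.integral_add i1 i2] at h1
    have h3 : ∫ u in 0..t, ∫ x, ‖drift k F' V ρ u x‖ ^ 2 ∂(ρ u) ≤ t * (2 * M * M) := by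
      have h4 := intervalIntegral.integral_mono_on ht.1 i2
        (intervalIntegrable_const (c := 2 * M * M)) fun u hu => by
          have := E.prob u hu.1
          have h5 := norm_integral_le_of_norm_le_const (μ := ρ u)
            (ae_of_all _ fun x => hb.norm_sq.bound u hu.1 x)
          simp only [probReal_univ, mul_one] at h5
          exact (le_abs_self _).trans h5
      rwa [intervalIntegral.integral_const, sub_zero, smul_eq_mul] at h4
    have h6 : t * (2 * M * M) ≤ T * (2 * M * M) :=
      mul_le_mul_of_nonneg_right ht.2 (by positivity)
    linarith
  · simp only [intervalIntegral.integral_const, smul_eq_mul, mul_one, sub_zero]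
    linarith [ht.2]

lemma moment_bounded (E : Evolution k B F' Γ V ρ G) {T : ℝ} (hT : 0 ≤ T) :
    ∃ R, ∀ t ∈ Icc 0 T, ∫ x, ‖x‖ ^ 2 ∂(ρ t) ≤ R := by
  obtain ⟨R, hR⟩ := E.exists_moment_le hT
  refine ⟨R, fun t ht => ?_⟩
  have := E.prob t ht.1
  exact le_of_tendsto' (tendsto_integral_momentTest (E.secondMoment_lt t ht.1)) fun n =>
    hR t ht _ (by positivity) (by
      rw [div_le_one (by positivity)]
      have : (0 : ℝ) ≤ n := n.cast_nonneg
      linarith)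

/-- The second moment is a pointwise limit of the continuous truncated moments; its own continuity
in time is not needed. -/
lemma aestronglyMeasurable_moment (E : Evolution k B F' Γ V ρ G) (T : ℝ) :
    AEStronglyMeasurable (fun t => ∫ x, ‖x‖ ^ 2 ∂(ρ t)) (volume.restrict (Icc 0 T)) := by
  refine aestronglyMeasurable_of_tendsto_ae atTop
    (f := fun (n : ℕ) t => ∫ x, momentTest (1 / ((n : ℝ) + 1)) x ∂(ρ t)) (fun n => ?_) ?_
  · refine (E.continuousOn_integral_momentTest (by positivity) ?_ T).aestronglyMeasurable
      measurableSet_Icc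
    rw [div_le_one (by positivity)]
    have : (0 : ℝ) ≤ n := n.cast_nonneg
    linarith
  · filter_upwards [ae_restrict_mem measurableSet_Icc] with t ht
    have := E.prob t ht.1
    exact tendsto_integral_momentTest (E.secondMoment_lt t ht.1)

lemma integrableOn_mul_moment (E : Evolution k B F' Γ V ρ G) {T : ℝ} (hT : 0 ≤ T) {K : ℝ → ℝ}
    (hK : ContinuousOn K (Icc 0 T)) :
    IntegrableOn (fun t => K t * ∫ x, ‖x‖ ^ 2 ∂(ρ t)) (Icc 0 T) := by
  obtain ⟨R, hR⟩ := E.moment_bounded hT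
  refine (hK.integrableOn_compact isCompact_Icc).mul_bdd (c := R)
    (E.aestronglyMeasurable_moment T) ?_
  filter_upwards [ae_restrict_mem measurableSet_Icc] with t ht
  rw [Real.norm_of_nonneg (integral_nonneg fun x => by positivity)]
  exact hR t ht

/-- The truncated estimate with s → 0. The weight l is left free, to be tuned when the drift is
bounded through the energy. -/
lemma moment_le (E : Evolution k B F' Γ V ρ G) {l : ℝ} (hl : 0 < l) {T : ℝ} (hT : 0 ≤ T) :
    ∫ x, ‖x‖ ^ 2 ∂(ρ T) ≤ ∫ x, ‖x‖ ^ 2 ∂(ρ 0) + l⁻¹ * (∫ t in 0..T, ∫ x, ‖x‖ ^ 2 ∂(ρ t)) +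
      l * ∫ t in 0..T, ∫ x, ‖drift k F' V ρ t x‖ ^ 2 ∂(ρ t) := by
  obtain ⟨M, hb⟩ := E.exists_modulusField_drift
  obtain ⟨R, hR⟩ := E.exists_moment_le hT
  have hs : ∀ n : ℕ, 0 < 1 / ((n : ℝ) + 1) := fun n => by positivity
  have hs1 : ∀ n : ℕ, 1 / ((n : ℝ) + 1) ≤ 1 := fun n => by
    rw [div_le_one (by positivity)]
    have : (0 : ℝ) ≤ n := n.cast_nonneg
    linarith
  have hp0 := E.prob 0 le_rfl
  have hpT := E.prob T hT
  have h1 : Tendsto (fun n : ℕ => ∫ t in 0..T, ∫ x, momentTest (1 / ((n : ℝ) + 1)) x ∂(ρ t)) atTop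
      (𝓝 (∫ t in 0..T, ∫ x, ‖x‖ ^ 2 ∂(ρ t))) := by
    refine intervalIntegral.tendsto_integral_filter_of_dominated_convergence (fun _ => R)
      (Eventually.of_forall fun n => ?_) (Eventually.of_forall fun n => ae_of_all _ fun u hu => ?_)
      intervalIntegrable_const (ae_of_all _ fun u hu => ?_)
    · rw [uIoc_of_le hT]
      exact ((E.continuousOn_integral_momentTest (hs n) (hs1 n) T).mono
        Ioc_subset_Icc_self).aestronglyMeasurable measurableSet_Ioc
    · rw [uIoc_of_le hT] at hu
      rw [Real.norm_of_nonneg (integral_nonneg fun x => momentTest_nonneg (hs n).le x)]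
      exact hR u ⟨hu.1.le, hu.2⟩ _ (hs n) (hs1 n)
    · rw [uIoc_of_le hT] at hu
      have := E.prob u hu.1.le
      exact tendsto_integral_momentTest (E.secondMoment_lt u hu.1.le)
  have h2 := tendsto_integral_momentTest (E.secondMoment_lt T hT)
  have h3 := tendsto_integral_momentTest (E.secondMoment_lt 0 le_rfl)
  refine le_of_tendsto_of_tendsto' h2 ((h3.add (h1.const_mul l⁻¹)).add_const _) fun n => ?_
  have h4 := E.integral_momentTest_le (hs n) (hs1 n) hl hT
  rw [intervalIntegral.integral_add, intervalIntegral.integral_const_mul,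
    intervalIntegral.integral_const_mul] at h4
  · linarith
  · exact (intervalIntegrable_of_continuousOn_Icc hT
      (E.continuousOn_integral_momentTest (hs n) (hs1 n) T)).const_mul _
  · exact (intervalIntegrable_of_continuousOn_Icc hT
      (E.continuousOn_integral hb.norm_sq T)).const_mul _

/-- Pointwise |∇p + v|² ≤ 4|v|² + 4 ∇p·(∇p + v), the difference being 3|∇p|² + 2∇p·v + 3|v|² ≥ 0.
The last product is the rate of energy loss. -/
lemma integral_norm_drift_sq_le (E : Evolution k B F' Γ V ρ G) (hFc : Continuous F)
    (hF0 : F 0 = 0) (hF : ∀ a b, 0 ≤ a → 0 ≤ b → F a - F b ≤ F' a * (a - b)) {T : ℝ}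
    (hT : 0 ≤ T) :
    ∫ t in 0..T, ∫ x, ‖drift k F' V ρ t x‖ ^ 2 ∂(ρ t) ≤
      4 * ((∫ x, F (smooth k (ρ 0) x)) - (∫ x, F (smooth k (ρ T) x))) +
        4 * ∫ t in 0..T, ∫ x, ‖V (t, x)‖ ^ 2 ∂(ρ t) := by
  obtain ⟨M1, hb⟩ := E.exists_modulusField_drift
  obtain ⟨M2, hP⟩ := E.exists_modulusField_pressure
  obtain ⟨M3, hV⟩ := E.exists_modulusField_velocity
  have h1 := E.energy_sub_le hFc hF0 hF hT
  have i1 := intervalIntegrable_of_continuousOn_Icc hT (E.continuousOn_integral hb.norm_sq T)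
  have i2 := intervalIntegrable_of_continuousOn_Icc hT (E.continuousOn_integral (hP.apply hb) T)
  have i3 := intervalIntegrable_of_continuousOn_Icc hT (E.continuousOn_integral hV.norm_sq T)
  have h2 := intervalIntegral.integral_mono_on hT i1 ((i3.const_mul 4).sub (i2.const_mul 4))
    fun t ht => by
      have j1 := E.integrable_of_modulusField hb.norm_sq ht.1
      have j2 := E.integrable_of_modulusField (hP.apply hb) ht.1
      have j3 := E.integrable_of_modulusField hV.norm_sq ht.1
      rw [← integral_const_mul, ← integral_const_mul,
        ← integral_sub (j3.const_mul _) (j2.const_mul _)]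
      refine integral_mono j1 ((j3.const_mul _).sub (j2.const_mul _)) fun x => ?_
      simp only [drift, norm_neg, map_neg, map_add]
      set A := conv (fderiv ℝ k) (chemical k F' (ρ t)) x
      have e1 : A (rieszMap d A) = ‖A‖ ^ 2 := by
        rw [← inner_rieszMap, real_inner_self_eq_norm_sq, norm_rieszMap]
      have e2 : ‖rieszMap d A + V (t, x)‖ ^ 2 = ‖A‖ ^ 2 + 2 * A (V (t, x)) + ‖V (t, x)‖ ^ 2 := by
        rw [norm_add_sq_real, inner_rieszMap, norm_rieszMap]
      have e3 : |A (V (t, x))| ≤ ‖A‖ * ‖V (t, x)‖ := A.le_opNorm _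
      rw [e1, e2]
      nlinarith [abs_le.1 e3, sq_nonneg (‖A‖ - ‖V (t, x)‖), sq_nonneg (‖A‖)]
  rw [intervalIntegral.integral_sub (i3.const_mul 4) (i2.const_mul 4),
    intervalIntegral.integral_const_mul, intervalIntegral.integral_const_mul] at h2
  linarith

end Evolution

/-- A uniform bound for the second moments. -/
theorem exists_uniform_moment_bound {T a₀ c₀ m₀ E₀ A : ℝ} (hT : 0 ≤ T) (ha₀ : 0 ≤ a₀)
    (hc₀ : 0 ≤ c₀) (hm₀ : 0 ≤ m₀) (hE₀ : 0 ≤ E₀) (hA : 0 ≤ A) :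
    ∃ C, ∀ (k : Space d → ℝ) (B : ℝ) (F F' : ℝ → ℝ) (Γ : ℝ) (V : ℝ × Space d → Space d)
      (ρ : ℝ → Measure (Space d)) (G N : ℝ → ℝ), Evolution k B F' Γ V ρ G →
      Continuous F → F 0 = 0 → (∀ a b, 0 ≤ a → 0 ≤ b → F a - F b ≤ F' a * (a - b)) →
      (∀ t ∈ Icc 0 T, -(a₀ + c₀ * ∫ x, ‖x‖ ^ 2 ∂(ρ t)) ≤ ∫ x, F (smooth k (ρ t) x)) →
      ∫ x, ‖x‖ ^ 2 ∂(ρ 0) ≤ m₀ → ∫ x, F (smooth k (ρ 0) x) ≤ E₀ →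
      ContinuousOn N (Icc 0 T) → (∀ t ∈ Icc 0 T, 0 ≤ N t) →
      (∀ t ∈ Icc 0 T, ∀ x, ‖V (t, x)‖ ^ 2 ≤ N t * (1 + ‖x‖ ^ 2)) → ∫ t in 0..T, N t ≤ A →
      ∀ t ∈ Icc 0 T, ∫ x, ‖x‖ ^ 2 ∂(ρ t) ≤ C := by
  -- n/2 dominates the integral over [0,T] of the Gronwall rate 16(c₀ + 1) + N.
  obtain ⟨n, hn⟩ := exists_nat_ge (2 * (16 * (c₀ + 1) * T + A))
  refine ⟨2 ^ n * (2 * m₀ + E₀ + a₀ + A), ?_⟩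
  intro k B F F' Γ V ρ G N E hFc hF0 hF hlow hm hE hNc hN0 hNV hNA
  set m : ℝ → ℝ := fun t => ∫ x, ‖x‖ ^ 2 ∂(ρ t) with hmdef
  have hm0 : ∀ t, 0 ≤ m t := fun t => integral_nonneg fun x => by positivity
  obtain ⟨M, hV⟩ := E.exists_modulusField_velocity
  have hKc : ContinuousOn (fun t => 16 * (c₀ + 1) + N t) (Icc 0 T) := continuousOn_const.add hNc
  have hNi : ∀ t ∈ Icc 0 T, IntervalIntegrable N volume 0 t := fun t ht =>
    Evolution.intervalIntegrable_of_continuousOn_Icc ht.1 (hNc.mono (Icc_subset_Icc le_rfl ht.2))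
  have hNle : ∀ t ∈ Icc 0 T, ∫ u in 0..t, N u ≤ A := fun t ht => by
    refine le_trans ?_ hNA
    refine intervalIntegral.integral_mono_interval le_rfl ht.1 ht.2 ?_ (hNi T ⟨hT, le_rfl⟩)
    filter_upwards [ae_restrict_mem measurableSet_Ioc] with u hu
    exact hN0 u ⟨hu.1.le, hu.2⟩
  refine fun t ht => le_two_pow_mul_of_le_integral (K := fun t => 16 * (c₀ + 1) + N t) (by positivity)
    hKc (fun t ht => add_nonneg (by positivity) (hN0 t ht)) (fun t _ => hm0 t)
    (E.integrableOn_mul_moment hT hKc) (fun t ht => ?_) n t ht ?_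
  · have hiN : IntervalIntegrable (fun u => N u * m u) volume 0 t :=
      ((E.integrableOn_mul_moment hT hNc).mono_set (by
        rw [uIcc_of_le ht.1]; exact Icc_subset_Icc le_rfl ht.2)).intervalIntegrable
    have him : IntervalIntegrable m volume 0 t := by
      have := (E.integrableOn_mul_moment hT (continuousOn_const (c := (1 : ℝ)))).mono_set
        (show uIcc 0 t ⊆ Icc 0 T by rw [uIcc_of_le ht.1]; exact Icc_subset_Icc le_rfl ht.2)
      simpa using this.intervalIntegrable
    -- The energy at time t may be as low as -(a₀ + c₀ m(t)). With this l one has 4 l c₀ ≤ 1/2, so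
    -- that contribution is absorbed by the left side; doubling the inequality then produces the
    -- rate 16(c₀ + 1) and the constant 2m₀ + E₀ + a₀ + A.
    set l : ℝ := (8 * (c₀ + 1))⁻¹ with hl
    have hl0 : 0 < l := by positivity
    have h1 := E.moment_le hl0 ht.1
    have h2 := E.integral_norm_drift_sq_le hFc hF0 hF ht.1
    have h3 := hlow t ht
    have h4 : ∫ u in 0..t, ∫ x, ‖V (u, x)‖ ^ 2 ∂(ρ u) ≤ ∫ u in 0..t, (N u + N u * m u) := by
      refine intervalIntegral.integral_mono_on ht.1
        (Evolution.intervalIntegrable_of_continuousOn_Icc ht.1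
          (E.continuousOn_integral hV.norm_sq t)) ((hNi t ht).add hiN) fun u hu => ?_
      have := E.prob u hu.1
      have i1 := integrable_norm_sq (E.secondMoment_lt u hu.1)
      have h5 := integral_mono (E.integrable_of_modulusField hV.norm_sq hu.1)
        (((integrable_const (1 : ℝ)).add i1).const_mul (N u)) fun x =>
          hNV u ⟨hu.1, hu.2.trans ht.2⟩ x
      have h6 : ∫ x, N u * (1 + ‖x‖ ^ 2) ∂(ρ u) = N u + N u * m u := by
        rw [integral_const_mul, integral_add (integrable_const _) i1]
        simp [hmdef, mul_add]
      exact h5.trans_eq h6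
    rw [intervalIntegral.integral_add (hNi t ht) hiN] at h4
    have h5 := hNle t ht
    have e1 : ∫ u in 0..t, (16 * (c₀ + 1) + N u) * m u =
        16 * (c₀ + 1) * (∫ u in 0..t, m u) + ∫ u in 0..t, N u * m u := by
      rw [← intervalIntegral.integral_const_mul, ← intervalIntegral.integral_add (him.const_mul _) hiN]
      simp_rw [add_mul]
    have hlinv : l⁻¹ = 8 * (c₀ + 1) := by rw [hl, inv_inv]
    have hl8 : 8 * l ≤ 1 := by
      rw [hl, ← div_eq_mul_inv, div_le_one (by positivity)]; linarith
    have hlc : 4 * l * c₀ ≤ 1 / 2 := by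
      rw [hl]
      have : (0 : ℝ) < 8 * (c₀ + 1) := by positivity
      rw [mul_comm 4, mul_assoc, inv_mul_le_iff₀ this]
      linarith
    have h6 := mul_le_mul_of_nonneg_left h2 hl0.le
    have hNm : 0 ≤ ∫ u in 0..t, N u * m u := intervalIntegral.integral_nonneg ht.1 fun u hu =>
      mul_nonneg (hN0 u ⟨hu.1, hu.2.trans ht.2⟩) (hm0 u)
    have hN' : 0 ≤ ∫ u in 0..t, N u := intervalIntegral.integral_nonneg ht.1 fun u hu =>
      hN0 u ⟨hu.1, hu.2.trans ht.2⟩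
    rw [hlinv] at h1
    rw [e1]
    have h7 : l * (4 * ((∫ x, F (smooth k (ρ 0) x)) - (∫ x, F (smooth k (ρ t) x))) +
        4 * ∫ u in 0..t, ∫ x, ‖V (u, x)‖ ^ 2 ∂(ρ u)) ≤
        l * (4 * (E₀ + (a₀ + c₀ * m t)) + 4 * ((∫ u in 0..t, N u) + ∫ u in 0..t, N u * m u)) := by
      refine mul_le_mul_of_nonneg_left ?_ hl0.le
      linarith
    have h8 : l * (4 * (E₀ + (a₀ + c₀ * m t)) +
        4 * ((∫ u in 0..t, N u) + ∫ u in 0..t, N u * m u)) =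
        (8 * l) * ((E₀ + a₀ + (∫ u in 0..t, N u) + ∫ u in 0..t, N u * m u) / 2) +
          (4 * l * c₀) * m t := by ring
    have h9 : (8 * l) * ((E₀ + a₀ + (∫ u in 0..t, N u) + ∫ u in 0..t, N u * m u) / 2) ≤
        1 * ((E₀ + a₀ + (∫ u in 0..t, N u) + ∫ u in 0..t, N u * m u) / 2) :=
      mul_le_mul_of_nonneg_right hl8 (by positivity)
    have h10 := mul_le_mul_of_nonneg_right hlc (hm0 t)
    simp only [hmdef] at *
    linarith
  · have h1 := hNle t ht
    rw [intervalIntegral.integral_add intervalIntegrable_const (hNi t ht)]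
    have h2 : 16 * (c₀ + 1) * t ≤ 16 * (c₀ + 1) * T :=
      mul_le_mul_of_nonneg_left ht.2 (by positivity)
    simp only [intervalIntegral.integral_const, smul_eq_mul, sub_zero]
    linarith

end NonlocalDiffusion

end

noncomputable section
namespace NonlocalDiffusion
variable {d : ℕ}
set_option maxSynthPendingDepth 3

/-! ### Extended-real integrals -/

lemma eIntegral_coe {α : Type*} [MeasurableSpace α] {μ : Measure α} {g : α → ℝ}
    (hg : Integrable g μ) : eIntegral μ (fun x => (g x : EReal)) = ((∫ x, g x ∂μ : ℝ) : EReal) := by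
  have h1 : ∫⁻ x, ENNReal.ofReal (g x) ∂μ ≠ ⊤ := hg.lintegral_lt_top.ne
  have h2 : ∫⁻ x, ENNReal.ofReal (-g x) ∂μ ≠ ⊤ := hg.neg.lintegral_lt_top.ne
  have h3 : ∀ x, (-(g x : EReal)).toENNReal = ENNReal.ofReal (-g x) := fun x => by
    rw [← EReal.coe_neg, EReal.real_coe_toENNReal]
  unfold eIntegral
  simp only [h3, EReal.real_coe_toENNReal]
  rw [integral_eq_lintegral_pos_part_sub_lintegral_neg_part hg, EReal.coe_sub,
    EReal.coe_ennreal_toReal h1, EReal.coe_ennreal_toReal h2]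

lemma eIntegral_mono_ae {α : Type*} [MeasurableSpace α] {μ : Measure α} {g h : α → EReal}
    (hgh : g ≤ᵐ[μ] h) : eIntegral μ g ≤ eIntegral μ h := by
  refine EReal.sub_le_sub (EReal.coe_ennreal_le_coe_ennreal_iff.2 (lintegral_mono_ae ?_))
    (EReal.coe_ennreal_le_coe_ennreal_iff.2 (lintegral_mono_ae ?_))
  · filter_upwards [hgh] with x hx using EReal.toENNReal_le_toENNReal hx
  · filter_upwards [hgh] with x hx using
      EReal.toENNReal_le_toENNReal (EReal.neg_le_neg_iff.2 hx)

lemma eIntegral_congr_ae {α : Type*} [MeasurableSpace α] {μ : Measure α} {g h : α → EReal}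
    (hgh : g =ᵐ[μ] h) : eIntegral μ g = eIntegral μ h :=
  le_antisymm (eIntegral_mono_ae hgh.le) (eIntegral_mono_ae hgh.symm.le)

/-! ### Measures with a density -/

lemma density_densityMeasure {g : Space d → ℝ} (hg : Measurable g) (hg0 : ∀ x, 0 ≤ g x) :
    density (densityMeasure g) =ᵐ[volume] g := by
  filter_upwards [Measure.rnDeriv_withDensity volume hg.ennreal_ofReal] with x hx
  unfold density densityMeasure
  rw [hx, ENNReal.toReal_ofReal (hg0 x)]

lemma densityMeasure_absolutelyContinuous (g : Space d → ℝ) : densityMeasure g ≪ volume :=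
  withDensity_absolutelyContinuous _ _

lemma internalEnergy_densityMeasure (f : ℝ → EReal) {g : Space d → ℝ} (hg : Measurable g)
    (hg0 : ∀ x, 0 ≤ g x) :
    internalEnergy f (densityMeasure g) = eIntegral volume fun x => f (g x) := by
  unfold internalEnergy
  rw [if_pos (densityMeasure_absolutelyContinuous g)]
  refine eIntegral_congr_ae ?_
  filter_upwards [density_densityMeasure hg hg0] with x hx
  rw [hx]

lemma entropy_densityMeasure {g : Space d → ℝ} (hg : Measurable g) (hg0 : ∀ x, 0 ≤ g x)
    (hi : Integrable fun x => g x * Real.log (g x)) :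
    entropy (densityMeasure g) = ((∫ x, g x * Real.log (g x) : ℝ) : EReal) := by
  unfold entropy
  rw [if_pos (densityMeasure_absolutelyContinuous g), ← eIntegral_coe hi]
  refine eIntegral_congr_ae ?_
  filter_upwards [density_densityMeasure hg hg0] with x hx
  rw [hx]

lemma integral_densityMeasure {g : Space d → ℝ} (hg : Measurable g) (hg0 : ∀ x, 0 ≤ g x)
    (ψ : Space d → ℝ) : ∫ x, ψ x ∂(densityMeasure g) = ∫ x, g x * ψ x := by
  unfold densityMeasure
  rw [integral_withDensity_eq_integral_toReal_smul hg.ennreal_ofReal (by simp)]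
  refine integral_congr_ae (Eventually.of_forall fun x => ?_)
  simp only [ENNReal.toReal_ofReal (hg0 x), smul_eq_mul]

lemma densityMeasure_mono {g h : Space d → ℝ} (hgh : ∀ x, g x ≤ h x) :
    densityMeasure g ≤ densityMeasure h :=
  withDensity_mono (Eventually.of_forall fun x => ENNReal.ofReal_le_ofReal (hgh x))

/-! ### The mollified measure -/

namespace SmoothKernel

variable {k : Space d → ℝ} {B : ℝ} {μ : Measure (Space d)} [IsProbabilityMeasure μ]

lemma continuous_smooth (hk : SmoothKernel k B) : Continuous (smooth k μ) :=
  continuous_of_lipschitz_bound hk.smooth_lipschitz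

lemma ofReal_smooth (hk : SmoothKernel k B) (x : Space d) :
    ENNReal.ofReal (smooth k μ x) = ∫⁻ y, ENNReal.ofReal (k (x - y)) ∂μ :=
  ofReal_integral_eq_lintegral_ofReal
    (integrable_smooth_integrand hk.contDiff.continuous hk.bound x)
    (Eventually.of_forall fun _ => hk.nonneg _)

/-- k * μ is the law of an independent sum: Tonelli and a translation. Mass and second moment follow
without differentiating anything. -/
lemma lintegral_densityMeasure_smooth (hk : SmoothKernel k B) {ψ : Space d → ℝ≥0∞}
    (hψ : Measurable ψ) : ∫⁻ x, ψ x ∂(densityMeasure (smooth k μ)) =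
      ∫⁻ y, (∫⁻ z, ENNReal.ofReal (k z) * ψ (z + y)) ∂μ := by
  have hkm : Measurable fun z => ENNReal.ofReal (k z) :=
    hk.contDiff.continuous.measurable.ennreal_ofReal
  unfold densityMeasure
  rw [lintegral_withDensity_eq_lintegral_mul _ hk.continuous_smooth.measurable.ennreal_ofReal hψ]
  simp only [Pi.mul_apply, hk.ofReal_smooth]
  have h1 : ∀ x, (∫⁻ y, ENNReal.ofReal (k (x - y)) ∂μ) * ψ x =
      ∫⁻ y, ENNReal.ofReal (k (x - y)) * ψ x ∂μ := fun x =>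
    (lintegral_mul_const _ (hkm.comp (measurable_const.sub measurable_id))).symm
  simp only [h1]
  rw [lintegral_lintegral_swap]
  · refine lintegral_congr fun y => ?_
    rw [← lintegral_add_right_eq_self _ y]
    simp only [add_sub_cancel_right]
  · exact ((hkm.comp (measurable_fst.sub measurable_snd)).mul (hψ.comp measurable_fst)).aemeasurable

lemma lintegral_ofReal (hk : SmoothKernel k B) : ∫⁻ z, ENNReal.ofReal (k z) = 1 := by
  rw [← ofReal_integral_eq_lintegral_ofReal hk.integrable (Eventually.of_forall hk.nonneg),
    hk.integral_eq_one, ENNReal.ofReal_one]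

lemma densityMeasure_smooth_univ (hk : SmoothKernel k B) :
    densityMeasure (smooth k μ) univ = 1 := by
  have h := hk.lintegral_densityMeasure_smooth (μ := μ) (ψ := fun _ => 1) measurable_const
  simpa [hk.lintegral_ofReal] using h

lemma secondMoment_densityMeasure_smooth_le (hk : SmoothKernel k B) :
    secondMoment (densityMeasure (smooth k μ)) ≤
      2 * ENNReal.ofReal (∫ x, ‖x‖ ^ 2 * k x) + 2 * secondMoment μ := by
  unfold secondMoment
  have hkm : Measurable fun z => ENNReal.ofReal (k z) :=
    hk.contDiff.continuous.measurable.ennreal_ofReal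
  rw [hk.lintegral_densityMeasure_smooth (by fun_prop)]
  have h1 : ∀ z y : Space d, ‖z + y‖ₑ ^ 2 ≤ 2 * ‖z‖ₑ ^ 2 + 2 * ‖y‖ₑ ^ 2 := fun z y => by
    have h2 : ‖z + y‖ ^ 2 ≤ 2 * ‖z‖ ^ 2 + 2 * ‖y‖ ^ 2 := by
      have := norm_add_le z y
      nlinarith [sq_nonneg (‖z‖ - ‖y‖), norm_nonneg (z + y), norm_nonneg z, norm_nonneg y]
    have h3 := ENNReal.ofReal_le_ofReal h2
    rw [ENNReal.ofReal_add (by positivity) (by positivity), ENNReal.ofReal_mul (by norm_num),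
      ENNReal.ofReal_mul (by norm_num), ENNReal.ofReal_pow (norm_nonneg _),
      ENNReal.ofReal_pow (norm_nonneg _), ENNReal.ofReal_pow (norm_nonneg _), ofReal_norm,
      ofReal_norm, ofReal_norm, ENNReal.ofReal_ofNat] at h3
    exact h3
  have h4 : ∫⁻ z, ENNReal.ofReal (k z) * ‖z‖ₑ ^ 2 = ENNReal.ofReal (∫ x, ‖x‖ ^ 2 * k x) := by
    rw [ofReal_integral_eq_lintegral_ofReal hk.integrable_sq
      (Eventually.of_forall fun x => mul_nonneg (sq_nonneg _) (hk.nonneg x))]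
    refine lintegral_congr fun x => ?_
    rw [ENNReal.ofReal_mul (sq_nonneg _), ENNReal.ofReal_pow (norm_nonneg _), ofReal_norm, mul_comm]
  have h5 : ∀ y : Space d, ∫⁻ z, ENNReal.ofReal (k z) * ‖z + y‖ₑ ^ 2 ≤
      2 * ENNReal.ofReal (∫ x, ‖x‖ ^ 2 * k x) + 2 * ‖y‖ₑ ^ 2 := fun y => calc
    ∫⁻ z, ENNReal.ofReal (k z) * ‖z + y‖ₑ ^ 2
        ≤ ∫⁻ z, (2 * (ENNReal.ofReal (k z) * ‖z‖ₑ ^ 2) +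
            ENNReal.ofReal (k z) * (2 * ‖y‖ₑ ^ 2)) := by
          refine lintegral_mono fun z => ?_
          refine (mul_le_mul_right (h1 z y) _).trans (le_of_eq ?_)
          ring
    _ = 2 * ENNReal.ofReal (∫ x, ‖x‖ ^ 2 * k x) + 2 * ‖y‖ₑ ^ 2 := by
          rw [lintegral_add_right _ (hkm.mul_const _), lintegral_mul_const _ hkm,
            hk.lintegral_ofReal, one_mul, lintegral_const_mul _ (by fun_prop), h4]
  refine (lintegral_mono h5).trans (le_of_eq ?_)
  rw [lintegral_add_left measurable_const, lintegral_const, measure_univ, mul_one,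
    lintegral_const_mul _ (by fun_prop)]

end SmoothKernel

/-! ### Lower bounds for the energy -/

/-- Monotonicity for y ≤ 1, and for y ≥ 1 concavity along the segment from 0 to y. This turns the
abstract lower bound on the energy into one affine in the moment. -/
lemma le_mul_of_concaveOn {H : ℝ → ℝ} (hm : MonotoneOn H (Ici 0)) (hc : ConcaveOn ℝ (Ici 0) H)
    (h0 : H 0 = 0) {y : ℝ} (hy : 0 ≤ y) : H y ≤ H 1 * (1 + y) := by
  have h1 : 0 ≤ H 1 := h0 ▸ hm (mem_Ici.2 le_rfl) (mem_Ici.2 zero_le_one) zero_le_one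
  rcases le_total y 1 with h | h
  · have := hm (mem_Ici.2 hy) (mem_Ici.2 zero_le_one) h
    nlinarith
  · have hy0 : 0 < y := by linarith
    have h2 := hc.2 (mem_Ici.2 hy) (mem_Ici.2 le_rfl) (by positivity : 0 ≤ y⁻¹)
      (sub_nonneg.2 (inv_le_one_of_one_le₀ h)) (by ring)
    rw [h0] at h2
    simp only [smul_eq_mul, mul_zero, add_zero, inv_mul_cancel₀ hy0.ne'] at h2
    have h3 : H y ≤ H 1 * y := by
      rw [inv_mul_le_iff₀ hy0] at h2
      linarith
    linarith

lemma EnergyAssumption.integrable_regDensityReal {f : ℝ → EReal} (hf : EnergyAssumption d f)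
    {γ : ℝ} (hγ : 0 < γ) {k : Space d → ℝ} {B : ℝ} (hk : SmoothKernel k B)
    (μ : Measure (Space d)) [IsProbabilityMeasure μ] :
    Integrable fun x => regDensityReal γ f (smooth k μ x) :=
  hk.integrable_energy (F' := regDensityDeriv γ f) (Γ := γ + 1 / γ) (by positivity)
    (fun a b ha hb => hf.abs_regDensityDeriv_sub_le hγ ha hb)
    (hf.continuous_regDensityReal hγ) regDensityReal_zero
    fun a b ha _ => hf.regDensityReal_sub_le hγ ha

/-- Coercivity is known for f, not for its regularizations. The truncation c satisfies f(c(a)) ≤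
f_ε(a) and c(a) ≤ a, so the coercivity hypothesis applies to c(μ_ε) dx. This measure may have lost
mass, which is why finite measures rather than probabilities matter, but its moment is at most that
of μ_ε. None of the constants depend on γ or on k beyond its second moment. -/
theorem EnergyAssumption.exists_le_integral_regDensityReal {f : ℝ → EReal}
    (hf : EnergyAssumption d f) {κ : ℝ} (hκ : 0 ≤ κ) :
    ∃ a₀ c₀ : ℝ, 0 ≤ a₀ ∧ 0 ≤ c₀ ∧ ∀ (γ : ℝ) (k : Space d → ℝ) (B : ℝ) (μ : Measure (Space d)),
      0 < γ → SmoothKernel k B → ∫ x, ‖x‖ ^ 2 * k x ≤ κ → IsProbabilityMeasure μ →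
      secondMoment μ < ⊤ →
      -(a₀ + c₀ * ∫ x, ‖x‖ ^ 2 ∂μ) ≤ ∫ x, regDensityReal γ f (smooth k μ x) := by
  obtain ⟨H, hHm, hHc, hH0, hH⟩ := hf.coercive
  obtain ⟨c, hcm, hc, hcf⟩ := hf.exists_truncation
  have hH1 : 0 ≤ H 1 := hH0 ▸ hHm (mem_Ici.2 le_rfl) (mem_Ici.2 zero_le_one) zero_le_one
  refine ⟨H 1 * (2 + 2 * κ), H 1 * 2, by positivity, by positivity,
    fun γ k B μ hγ hk hkκ hμ hμ2 => ?_⟩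
  have hi : Integrable fun x => regDensityReal γ f (smooth k μ x) :=
    hf.integrable_regDensityReal hγ hk μ
  set g : Space d → ℝ := fun x => c (smooth k μ x) with hg
  have hgm : Measurable g := hcm.comp hk.continuous_smooth.measurable
  have hg0 : ∀ x, 0 ≤ g x := fun x => (hc _ (hk.smooth_nonneg x)).1
  have hle : densityMeasure g ≤ densityMeasure (smooth k μ) :=
    densityMeasure_mono fun x => (hc _ (hk.smooth_nonneg x)).2
  have hmass : densityMeasure g univ ≤ 1 := (hle univ).trans hk.densityMeasure_smooth_univ.le
  have hfin : IsFiniteMeasure (densityMeasure g) := ⟨hmass.trans_lt ENNReal.one_lt_top⟩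
  have hκ' : 0 ≤ ∫ x, ‖x‖ ^ 2 * k x :=
    integral_nonneg fun x => mul_nonneg (sq_nonneg _) (hk.nonneg x)
  have hm0 : 0 ≤ ∫ x, ‖x‖ ^ 2 ∂μ := integral_nonneg fun x => sq_nonneg _
  have hsm : secondMoment (densityMeasure g) ≤
      ENNReal.ofReal (2 * κ + 2 * ∫ x, ‖x‖ ^ 2 ∂μ) := by
    refine (lintegral_mono' hle le_rfl).trans
      (hk.secondMoment_densityMeasure_smooth_le.trans ?_)
    rw [ENNReal.ofReal_add (by positivity) (by positivity), ENNReal.ofReal_mul (by norm_num),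
      ENNReal.ofReal_mul (by norm_num), ofReal_integral_norm_sq hμ2, ENNReal.ofReal_ofNat]
    gcongr
  have hsm' := hsm.trans_lt ENNReal.ofReal_lt_top
  have hy : ∫ x, (1 + ‖x‖ ^ 2) ∂(densityMeasure g) ≤ 1 + (2 * κ + 2 * ∫ x, ‖x‖ ^ 2 ∂μ) := by
    rw [integral_add (integrable_const _) (integrable_norm_sq hsm')]
    refine add_le_add ?_ ?_
    · simp only [integral_const, smul_eq_mul, mul_one]
      exact ENNReal.toReal_le_of_le_ofReal zero_le_one (by simpa using hmass)
    · rw [← ofReal_integral_norm_sq hsm'] at hsm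
      exact (ENNReal.ofReal_le_ofReal_iff (by positivity)).1 hsm
  have hy0 : 0 ≤ ∫ x, (1 + ‖x‖ ^ 2) ∂(densityMeasure g) := integral_nonneg fun x => by positivity
  have h1 := hH (densityMeasure g) hfin hsm'
  rw [internalEnergy_densityMeasure f hgm hg0] at h1
  have h2 : eIntegral volume (fun x => f (g x)) ≤
      ((∫ x, regDensityReal γ f (smooth k μ x) : ℝ) : EReal) := by
    rw [← eIntegral_coe hi]
    exact eIntegral_mono_ae (Eventually.of_forall fun x => hcf γ hγ _ (hk.smooth_nonneg x))
  have h3 := EReal.coe_le_coe_iff.1 (h1.trans h2)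
  have h4 := le_mul_of_concaveOn hHm hHc hH0 hy0
  nlinarith

end NonlocalDiffusion

end

noncomputable section
namespace NonlocalDiffusion
variable {d : ℕ}
set_option maxSynthPendingDepth 3

/-! ### Regularized energy and entropy of smooth data -/

lemma regEnergy_eq {f : ℝ → EReal} (hf : EnergyAssumption d f) {φ : Space d → ℝ} {γ ε B : ℝ}
    (hγ : 0 < γ) (hk : SmoothKernel (mollifier φ ε) B) (μ : Measure (Space d))
    [IsProbabilityMeasure μ] : regEnergy f φ γ ε μ =
      ((∫ x, regDensityReal γ f (smooth (mollifier φ ε) μ x) : ℝ) : EReal) := by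
  rw [← eIntegral_coe (hf.integrable_regDensityReal hγ hk μ)]
  refine eIntegral_congr_ae (Eventually.of_forall fun x => ?_)
  exact if_pos (hk.smooth_nonneg x)

/-- Young's inequality for the conjugate pair a log a and e^{b-1}; it is the source of the factor
e⁻¹ in the dual form of the entropy. -/
lemma mul_le_mul_log_add_exp {a : ℝ} (ha : 0 ≤ a) (b : ℝ) :
    a * b ≤ a * Real.log a + Real.exp (-1) * Real.exp b := by
  rcases ha.eq_or_lt with rfl | ha
  · simp only [zero_mul, zero_add]; positivity
  · have h1 := Real.add_one_le_exp (b - Real.log a - 1)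
    have h2 : Real.exp (-1) * Real.exp b = a * Real.exp (b - Real.log a - 1) := by
      rw [← Real.exp_add, show -1 + b = Real.log a + (b - Real.log a - 1) by ring, Real.exp_add,
        Real.exp_log ha]
    rw [h2]
    nlinarith

namespace IsTestDensity

variable {r : Space d → ℝ}

lemma measurable (hr : IsTestDensity r) : Measurable r := hr.contDiff.continuous.measurable

lemma integrable (hr : IsTestDensity r) : Integrable r :=
  hr.contDiff.continuous.integrable_of_hasCompactSupport hr.compactSupport

lemma integrable_mul (hr : IsTestDensity r) {ψ : Space d → ℝ} (hψ : Continuous ψ) :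
    Integrable fun x => r x * ψ x :=
  (hr.contDiff.continuous.mul hψ).integrable_of_hasCompactSupport hr.compactSupport.mul_right

lemma integrable_mul_log (hr : IsTestDensity r) : Integrable fun x => r x * Real.log (r x) :=
  (Real.continuous_mul_log.comp hr.contDiff.continuous).integrable_of_hasCompactSupport
    (hr.compactSupport.comp_left (g := fun a : ℝ => a * Real.log a) (by simp))

lemma isProbabilityMeasure (hr : IsTestDensity r) : IsProbabilityMeasure (densityMeasure r) := by
  constructor
  unfold densityMeasure
  rw [withDensity_apply _ MeasurableSet.univ, setLIntegral_univ,
    ← ofReal_integral_eq_lintegral_ofReal hr.integrable (Eventually.of_forall hr.nonneg),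
    hr.integral_eq_one, ENNReal.ofReal_one]

lemma secondMoment_lt (hr : IsTestDensity r) : secondMoment (densityMeasure r) < ⊤ := by
  unfold secondMoment densityMeasure
  rw [lintegral_withDensity_eq_lintegral_mul _ hr.measurable.ennreal_ofReal (by fun_prop)]
  refine lt_of_le_of_lt (le_of_eq ?_)
    (hr.integrable_mul (ψ := fun x => ‖x‖ ^ 2) (by fun_prop)).lintegral_lt_top
  refine lintegral_congr fun x => ?_
  rw [ENNReal.ofReal_mul (hr.nonneg x), ENNReal.ofReal_pow (norm_nonneg _), ofReal_norm]
  rfl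

lemma entropy_eq (hr : IsTestDensity r) :
    entropy (densityMeasure r) = ((∫ x, r x * Real.log (r x) : ℝ) : EReal) :=
  entropy_densityMeasure hr.measurable hr.nonneg hr.integrable_mul_log

lemma integral_le (hr : IsTestDensity r) {ψ : Space d → ℝ} (hψ : Continuous ψ)
    (he : Integrable fun x => Real.exp (ψ x)) :
    ∫ x, ψ x ∂(densityMeasure r) ≤
      (∫ x, r x * Real.log (r x)) + Real.exp (-1) * ∫ x, Real.exp (ψ x) := by
  rw [integral_densityMeasure hr.measurable hr.nonneg, ← integral_const_mul,
    ← integral_add hr.integrable_mul_log (he.const_mul _)]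
  exact integral_mono (hr.integrable_mul hψ) (hr.integrable_mul_log.add (he.const_mul _))
    fun x => mul_le_mul_log_add_exp (hr.nonneg x) _

/-- The dual bound tested with minus the logarithmic weight, and (d + 1)‖x‖ ≤ ((d + 1)² + ‖x‖²)/2.
Only half of the second moment is spent, so that the other half remains available for bounding it.
-/
lemma neg_le_entropy_add (hr : IsTestDensity r) :
    -((d + 1) ^ 2 / 2 + Real.exp (-1) * ∫ x : Space d, Real.exp (-logWeight x)) ≤
      (∫ x, r x * Real.log (r x)) + (∫ x, ‖x‖ ^ 2 ∂(densityMeasure r)) / 2 := by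
  have hp := hr.isProbabilityMeasure
  have h1 := hr.integral_le (ψ := fun x => -logWeight x) continuous_logWeight.neg
    integrable_exp_neg_logWeight
  have h2 : ∫ x, logWeight x ∂(densityMeasure r) ≤
      ∫ x, (((d : ℝ) + 1) ^ 2 / 2 + ‖x‖ ^ 2 / 2) ∂(densityMeasure r) := by
    refine integral_mono (integrable_logWeight (integrable_norm hr.secondMoment_lt))
      ((integrable_const _).add ((integrable_norm_sq hr.secondMoment_lt).div_const _)) fun x => ?_
    have := logWeight_le x
    simp only
    nlinarith [sq_nonneg ((d : ℝ) + 1 - ‖x‖)]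
  rw [integral_add (integrable_const _) ((integrable_norm_sq hr.secondMoment_lt).div_const _),
    integral_const, probReal_univ, one_smul, integral_div] at h2
  rw [integral_neg] at h1
  linarith

end IsTestDensity

/-! ### Growth of the velocity field -/

/-- The growth quotient of a smooth time-dependent field. -/
def fieldGrowth (V : ℝ × Space d → Space d) (z : ℝ × Space d) : ℝ :=
  (‖V z‖ ^ 2 + max (spaceDiv V z) 0) / (1 + ‖z.2‖ ^ 2)

/-- The supremum in space of the growth quotient. -/
def maxGrowth (V : ℝ × Space d → Space d) (t : ℝ) : ℝ := ⨆ x, fieldGrowth V (t, x)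

section Growth

variable {V : ℝ × Space d → Space d}

lemma fieldGrowth_nonneg (z : ℝ × Space d) : 0 ≤ fieldGrowth V z := by
  unfold fieldGrowth; positivity

lemma exists_fieldGrowth_bound (hV : ContDiff ℝ ∞ V) (hVs : HasCompactSupport V) :
    ∃ M, 0 ≤ M ∧ (∀ z, fieldGrowth V z ≤ M) ∧
      ∀ s t x, |fieldGrowth V (t, x) - fieldGrowth V (s, x)| ≤ M * |t - s| := by
  obtain ⟨M, hM0, hM, hML⟩ := exists_bound_lipschitz_of_hasCompactSupport
    (hV.of_le (by simp)) hVs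
  obtain ⟨M', hM0', hM', hML'⟩ := exists_bound_lipschitz_spaceDiv hV hVs
  refine ⟨2 * M * M + M ^ 2 + M', by positivity, fun z => ?_, fun s t x => ?_⟩
  · have h1 : max (spaceDiv V z) 0 ≤ M' := max_le ((le_abs_self _).trans (hM' z)) hM0'
    have h2 : ‖V z‖ ^ 2 ≤ M ^ 2 := by gcongr; exact hM z
    unfold fieldGrowth
    refine (div_le_self (by positivity) (by nlinarith [norm_nonneg z.2])).trans ?_
    nlinarith
  · have h1 : ‖(t, x) - (s, x)‖ = |t - s| := by simp
    have h2 := hML (t, x) (s, x)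
    have h3 := hML' (t, x) (s, x)
    rw [h1] at h2 h3
    have h4 : |max (spaceDiv V (t, x)) 0 - max (spaceDiv V (s, x)) 0| ≤ M' * |t - s| :=
      (abs_max_sub_max_le_abs _ _ _).trans h3
    have h5 : |‖V (t, x)‖ - ‖V (s, x)‖| ≤ M * |t - s| := (abs_norm_sub_norm_le _ _).trans h2
    have h6 : |‖V (t, x)‖ ^ 2 - ‖V (s, x)‖ ^ 2| ≤ 2 * M * M * |t - s| := by
      rw [sq_sub_sq, abs_mul, abs_of_nonneg (by positivity)]
      have := hM (t, x)
      have := hM (s, x)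
      calc _ ≤ (M + M) * (M * |t - s|) := by gcongr
        _ = _ := by ring
    unfold fieldGrowth
    rw [← sub_div, abs_div, abs_of_pos (show 0 < 1 + ‖x‖ ^ 2 by positivity)]
    refine (div_le_self (abs_nonneg _) (by nlinarith [norm_nonneg x])).trans ?_
    rw [add_sub_add_comm]
    refine (abs_add_le _ _).trans ?_
    nlinarith [abs_nonneg (t - s), mul_nonneg (sq_nonneg M) (abs_nonneg (t - s))]

lemma bddAbove_fieldGrowth (hV : ContDiff ℝ ∞ V) (hVs : HasCompactSupport V) (t : ℝ) :
    BddAbove (range fun x => fieldGrowth V (t, x)) := by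
  obtain ⟨M, hM0, hM, hML⟩ := exists_fieldGrowth_bound hV hVs
  exact ⟨M, by rintro _ ⟨x, rfl⟩; exact hM _⟩

/-- A supremum of functions that are Lipschitz in time with a common constant. -/
lemma continuous_maxGrowth (hV : ContDiff ℝ ∞ V) (hVs : HasCompactSupport V) :
    Continuous (maxGrowth V) := by
  obtain ⟨M, hM0, hM, hML⟩ := exists_fieldGrowth_bound hV hVs
  have key : ∀ s t, maxGrowth V t - maxGrowth V s ≤ M * |t - s| := fun s t => by
    rw [sub_le_iff_le_add]
    refine ciSup_le fun x => ?_
    have h1 := le_ciSup (bddAbove_fieldGrowth hV hVs s) x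
    have h2 := (abs_le.1 (hML s t x)).2
    unfold maxGrowth
    linarith
  refine continuous_of_lipschitz_bound (L := M) fun t s => ?_
  rw [Real.norm_eq_abs, Real.norm_eq_abs, abs_le]
  have h1 := key t s
  rw [abs_sub_comm] at h1
  exact ⟨by linarith, key s t⟩

lemma maxGrowth_nonneg (t : ℝ) : 0 ≤ maxGrowth V t :=
  Real.iSup_nonneg fun _ => fieldGrowth_nonneg _

lemma field_le_maxGrowth (hV : ContDiff ℝ ∞ V) (hVs : HasCompactSupport V) (t : ℝ) (x : Space d) :
    ‖V (t, x)‖ ^ 2 ≤ maxGrowth V t * (1 + ‖x‖ ^ 2) ∧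
      spaceDiv V (t, x) ≤ maxGrowth V t * (1 + ‖x‖ ^ 2) := by
  have h1 : fieldGrowth V (t, x) ≤ maxGrowth V t := le_ciSup (bddAbove_fieldGrowth hV hVs t) x
  unfold fieldGrowth at h1
  rw [div_le_iff₀ (by positivity)] at h1
  have h2 := le_max_left (spaceDiv V (t, x)) 0
  have h3 := le_max_right (spaceDiv V (t, x)) 0
  have h4 := sq_nonneg ‖V (t, x)‖
  exact ⟨by linarith, by linarith⟩

lemma fieldGrowth_eq_growthQuotient (hV : ContDiff ℝ ∞ V) {v : ℝ → Space d → Space d} {t : ℝ}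
    (hv : ∀ x, v t x = V (t, x)) (x : Space d) :
    growthQuotient (v t) (fderiv ℝ (v t)) x = fieldGrowth V (t, x) := by
  have h1 : v t = fun x => V (t, x) := funext hv
  have h2 : fderiv ℝ (v t) x = (fderiv ℝ V (t, x)).comp (ContinuousLinearMap.inr ℝ ℝ (Space d)) := by
    rw [h1]
    exact ((hV.differentiable (by simp) (t, x)).hasFDerivAt.comp x
      (hasFDerivAt_prodMk_right t x)).fderiv
  unfold growthQuotient
  rw [h2, hv]
  rfl

/-- For continuous functions the supremum does not exceed the essential supremum. The pointwise
supremum is preferred because it is continuous in time. -/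
lemma ofReal_maxGrowth_le (hV : ContDiff ℝ ∞ V) (hVs : HasCompactSupport V)
    {v : ℝ → Space d → Space d} {t : ℝ} (hv : ∀ x, v t x = V (t, x)) :
    ENNReal.ofReal (maxGrowth V t) ≤ eLpNorm (growthQuotient (v t) (fderiv ℝ (v t))) ⊤ volume := by
  have h1 : growthQuotient (v t) (fderiv ℝ (v t)) = fun x => fieldGrowth V (t, x) :=
    funext (fieldGrowth_eq_growthQuotient hV hv)
  rw [h1]
  obtain ⟨M', hM0', hM', hML'⟩ := exists_bound_lipschitz_spaceDiv hV hVs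
  have hc : Continuous fun x => fieldGrowth V (t, x) := by
    have h2 : Continuous (spaceDiv V) := continuous_of_lipschitz_bound hML'
    have h3 := hV.continuous
    unfold fieldGrowth
    refine Continuous.div (by fun_prop) (by fun_prop) fun x => by positivity
  rcases eq_or_ne (eLpNorm (fun x => fieldGrowth V (t, x)) ⊤ volume) ⊤ with h | h
  · rw [h]; exact le_top
  refine ENNReal.ofReal_le_of_le_toReal (ciSup_le fun x => ?_)
  have h4 := norm_le_toReal_eLpNorm_top hc h x
  exact (le_abs_self _).trans h4

lemma integral_maxGrowth_le (hV : ContDiff ℝ ∞ V) (hVs : HasCompactSupport V)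
    {v : ℝ → Space d → Space d} (hv : ∀ t, 0 ≤ t → ∀ x, v t x = V (t, x)) {T A : ℝ} (hT : 0 ≤ T)
    (hA : 0 ≤ A) (h : ∫⁻ t in Icc 0 T,
      eLpNorm (growthQuotient (v t) (fderiv ℝ (v t))) ⊤ volume ≤ ENNReal.ofReal A) :
    ∫ t in 0..T, maxGrowth V t ≤ A := by
  have hc := continuous_maxGrowth hV hVs
  rw [intervalIntegral.integral_of_le hT, ← integral_Icc_eq_integral_Ioc,
    ← ENNReal.ofReal_le_ofReal_iff hA, ofReal_integral_eq_lintegral_ofReal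
      hc.integrableOn_Icc (Eventually.of_forall maxGrowth_nonneg)]
  refine le_trans (setLIntegral_mono' measurableSet_Icc fun t ht => ?_) h
  exact ofReal_maxGrowth_le hV hVs (hv t ht.1)

end Growth

end NonlocalDiffusion

end

noncomputable section
namespace NonlocalDiffusion
variable {d : ℕ}
set_option maxSynthPendingDepth 3

/-! ### The uniform entropy and dissipation bound -/

lemma integrable_of_lintegral_ofReal_le {g h : Space d → ℝ} (hg : Continuous g)
    (hg0 : ∀ x, 0 ≤ g x) (hh : Integrable h) (hh0 : ∀ x, 0 ≤ h x)
    (hle : ∫⁻ x, ENNReal.ofReal (g x) ≤ ∫⁻ x, ENNReal.ofReal (h x)) :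
    Integrable g ∧ ∫ x, g x ≤ ∫ x, h x := by
  have hi : Integrable g := by
    refine ⟨hg.aestronglyMeasurable, ?_⟩
    rw [hasFiniteIntegral_iff_ofReal (Eventually.of_forall hg0)]
    exact hle.trans_lt hh.lintegral_lt_top
  refine ⟨hi, ?_⟩
  rwa [← ofReal_integral_eq_lintegral_ofReal hi (Eventually.of_forall hg0),
    ← ofReal_integral_eq_lintegral_ofReal hh (Eventually.of_forall hh0),
    ENNReal.ofReal_le_ofReal_iff (integral_nonneg hh0)] at hle

/-- The dual entropy inequality with the dissipation retained on the good side. The divergence of V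
is at most the growth function times 1 + ‖x‖², so its total contribution is at most A(1 + m). -/
theorem Evolution.entropy_add_dissipation_le {k : Space d → ℝ} {B : ℝ} {F' : ℝ → ℝ} {Γ : ℝ}
    {V : ℝ × Space d → Space d} {ρ : ℝ → Measure (Space d)} {G : ℝ → ℝ}
    (E : Evolution k B F' Γ V ρ G) (hF : ∀ a b, 0 ≤ a → a ≤ b → F' a ≤ F' b) {t S A m : ℝ}
    (ht : 0 ≤ t)
    (hS : ∀ ψ : Space d → ℝ, Continuous ψ → Integrable (fun x => Real.exp (ψ x)) →
      ∫ x, ψ x ∂(ρ 0) ≤ S + Real.exp (-1) * ∫ x, Real.exp (ψ x))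
    (hm : 0 ≤ m) (hmom : ∀ s ∈ Icc 0 t, ∫ x, ‖x‖ ^ 2 ∂(ρ s) ≤ m)
    (hA : ∫ s in 0..t, maxGrowth V s ≤ A) :
    ρ t ≪ volume ∧ (∫⁻ x, ENNReal.ofReal (density (ρ t) x * |Real.log (density (ρ t) x)|)) +
      eLpNorm (fun z : ℝ × Space d => dissipationAt k F' (ρ z.1) z.2) 1
        (volume.restrict (Icc 0 t ×ˢ univ)) ≤
      ENNReal.ofReal (S + A * (1 + m) + 3 * (∫ x : Space d, Real.exp (-logWeight x)) +
        2 * ((d + 1) * (1 + m))) := by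
  have hpt := E.prob t ht
  have hn := integrable_norm (E.secondMoment_lt t ht)
  set D := ∫ s in 0..t, ∫ x, dissipationAt k F' (ρ s) x with hD
  set P := ∫ s in 0..t, ∫ x, spaceDiv V (s, x) ∂(ρ s) with hP
  have hD0 : 0 ≤ D := intervalIntegral.integral_nonneg ht fun s hs => by
    have := E.prob s hs.1
    exact integral_nonneg (E.kernel.dissipationAt_nonneg hF (ρ s))
  have hPA : P ≤ A * (1 + m) := by
    have hc := continuous_maxGrowth E.field_contDiff E.field_support
    have h1 : P ≤ ∫ s in 0..t, maxGrowth V s * (1 + m) := by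
      refine intervalIntegral.integral_mono_on ht
        (Evolution.intervalIntegrable_of_continuousOn_Icc ht (E.continuousOn_integral_spaceDiv t))
        ((hc.mul continuous_const).intervalIntegrable _ _) fun s hs => ?_
      have := E.prob s hs.1
      obtain ⟨M, hM0, hM, hML⟩ := E.exists_spaceDiv_bound
      have h2 := integrable_norm_sq (E.secondMoment_lt s hs.1)
      calc ∫ x, spaceDiv V (s, x) ∂(ρ s)
          ≤ ∫ x, maxGrowth V s * (1 + ‖x‖ ^ 2) ∂(ρ s) := by
            refine integral_mono ?_ (((integrable_const _).add h2).const_mul _) fun x =>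
              (field_le_maxGrowth E.field_contDiff E.field_support s x).2
            have h3 : Continuous (spaceDiv V) := continuous_of_lipschitz_bound hML
            exact Integrable.of_bound (h3.comp (by fun_prop)).aestronglyMeasurable M
              (ae_of_all _ fun x => hM (s, x))
        _ = maxGrowth V s * (1 + ∫ x, ‖x‖ ^ 2 ∂(ρ s)) := by
            rw [integral_const_mul, integral_add (integrable_const _) h2, integral_const,
              probReal_univ, one_smul]
        _ ≤ maxGrowth V s * (1 + m) := by
            have := maxGrowth_nonneg (V := V) s
            have := hmom s hs
            gcongr
    rw [intervalIntegral.integral_mul_const] at h1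
    exact h1.trans (by gcongr)
  -- Every test function reached backwards satisfies ∫ e^ψ' ≤ ∫ e^ψ, so the initial entropy bound
  -- applies to all of them with the same right side.
  have h : ∀ (ψ : Space d → ℝ) (Λ : ℝ), 0 ≤ Λ → (∀ x y, ‖ψ x - ψ y‖ ≤ Λ * ‖x - y‖) →
      Integrable (fun x => Real.exp (ψ x)) →
      ∫ x, ψ x ∂(ρ t) ≤ (S - D + P) + Real.exp (-1) * ∫ x, Real.exp (ψ x) := by
    intro ψ Λ hΛ hψ he
    have h1 := E.integral_le_of_initial_le ht hΛ hψ
      (Y := S + Real.exp (-1) * ∫ x, Real.exp (ψ x)) fun ψ' Λ' hψ' hle => by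
        have hc := continuous_of_lipschitz_bound hψ'
        obtain ⟨h2, h3⟩ := integrable_of_lintegral_ofReal_le (Real.continuous_exp.comp hc)
          (fun x => (Real.exp_pos _).le) he (fun x => (Real.exp_pos _).le) hle
        exact (hS ψ' hc h2).trans
          (add_le_add le_rfl (mul_le_mul_of_nonneg_left h3 (Real.exp_pos _).le))
    linarith
  refine ⟨absolutelyContinuous_of_dual_bound hn h, ?_⟩
  have hw0 : 0 ≤ ∫ x, logWeight x ∂(ρ t) := integral_nonneg logWeight_nonneg
  have hW0 : 0 ≤ ∫ x : Space d, Real.exp (-logWeight x) :=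
    integral_nonneg fun x => (Real.exp_pos _).le
  have hx : 0 ≤ S - D + P + 3 * (∫ x : Space d, Real.exp (-logWeight x)) +
      2 * ∫ x, logWeight x ∂(ρ t) := by
    -- `ENNReal.ofReal` is additive only on nonnegative reals. Testing with minus the weight shows
    -- that S - D + P cannot be too negative.
    have h1 := h (fun x => -logWeight x) (d + 1) (by positivity)
      (fun x y => by
        rw [neg_sub_neg, norm_sub_rev]
        exact logWeight_lipschitz x y) integrable_exp_neg_logWeight
    rw [integral_neg] at h1
    have h2 : Real.exp (-1) ≤ 1 := Real.exp_le_one_iff.2 (by norm_num)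
    nlinarith
  have hw : ∫ x, logWeight x ∂(ρ t) ≤ (d + 1) * (1 + m) := by
    have h2 := integrable_norm_sq (E.secondMoment_lt t ht)
    calc ∫ x, logWeight x ∂(ρ t) ≤ ∫ x, ((d : ℝ) + 1) * (1 + ‖x‖ ^ 2) ∂(ρ t) := by
          refine integral_mono (integrable_logWeight hn)
            (((integrable_const _).add h2).const_mul _) fun x => (logWeight_le x).trans ?_
          have : ‖x‖ ≤ 1 + ‖x‖ ^ 2 := by nlinarith [sq_nonneg (‖x‖ - 1)]
          gcongr
      _ = (d + 1) * (1 + ∫ x, ‖x‖ ^ 2 ∂(ρ t)) := by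
          rw [integral_const_mul, integral_add (integrable_const _) h2, integral_const,
            probReal_univ, one_smul]
      _ ≤ _ := by
          have := hmom t ⟨ht, le_rfl⟩
          gcongr
  rw [E.eLpNorm_dissipation hF ht]
  refine (add_le_add_left (lintegral_density_abs_log_le hn h) _).trans ?_
  rw [← ENNReal.ofReal_add hx hD0]
  refine ENNReal.ofReal_le_ofReal ?_
  linarith

/-! ### Well-prepared data -/

/-- A real upper bound on the sum forces the extended term to be finite, after which the inequality
is one between reals. -/
lemma EReal_add_le_real {a b m C : ℝ} {I : ℝ≥0∞} (hm : 0 ≤ m)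
    (h : (a : EReal) + (b : EReal) + ((ENNReal.ofReal m : ℝ≥0∞) : EReal) + (I : EReal) ≤ C) :
    ∃ A, 0 ≤ A ∧ I = ENNReal.ofReal A ∧ a + b + m + A ≤ C := by
  rw [EReal.coe_ennreal_ofReal, max_eq_left hm, ← EReal.coe_add, ← EReal.coe_add] at h
  have hI : I ≠ ⊤ := by
    rintro rfl
    rw [EReal.coe_ennreal_top, EReal.coe_add_top] at h
    exact absurd h (not_le.2 (EReal.coe_lt_top C))
  refine ⟨I.toReal, ENNReal.toReal_nonneg, (ENNReal.ofReal_toReal hI).symm, ?_⟩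
  rw [← EReal.coe_ennreal_toReal hI, ← EReal.coe_add, EReal.coe_le_coe_iff] at h
  exact h

lemma EnergyAssumption.exists_le_integral_of_le {f : ℝ → EReal} (hf : EnergyAssumption d f)
    {γ₀ : ℝ} (hγ₀ : 0 < γ₀) : ∃ K, 0 ≤ K ∧ ∀ (γ : ℝ) (k : Space d → ℝ) (B : ℝ)
      (μ : Measure (Space d)), γ₀ ≤ γ → SmoothKernel k B → IsProbabilityMeasure μ →
      -K ≤ ∫ x, regDensityReal γ f (smooth k μ x) := by
  obtain ⟨K, hK0, hK⟩ := hf.exists_linear_le_regDensityReal hγ₀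
  refine ⟨K, hK0, fun γ k B μ hγ hk hμ => ?_⟩
  obtain ⟨h1, h2⟩ := integrable_smooth (μ := μ) hk.contDiff.continuous hk.integrable
  rw [hk.integral_norm] at h2
  have h3 : ∫ x, smooth k μ x ≤ 1 :=
    (integral_mono h1 h1.norm fun x => le_abs_self _).trans h2
  have h4 : ∫ x, -K * smooth k μ x ≤ ∫ x, regDensityReal γ f (smooth k μ x) :=
    integral_mono (h1.const_mul _) (hf.integrable_regDensityReal (hγ₀.trans_le hγ) hk μ)
      fun x => hK γ hγ _ (hk.smooth_nonneg x)
  rw [integral_const_mul] at h4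
  nlinarith

lemma MollifierAssumption.exists_smoothKernel {φ : Space d → ℝ} (hφ : MollifierAssumption φ)
    {ε : ℝ} (hε : ε ∈ Ioo (0 : ℝ) 1) : ∃ B, SmoothKernel (mollifier φ ε) B ∧
      ∫ x, ‖x‖ ^ 2 * mollifier φ ε x ≤ ∫ x, ‖x‖ ^ 2 * φ x := by
  obtain ⟨B, hk, h⟩ := hφ.smoothKernel hε.1
  refine ⟨B, hk, h.trans_le (mul_le_of_le_one_left ?_ ?_)⟩
  · exact integral_nonneg fun x => mul_nonneg (sq_nonneg _) (hφ.nonneg x)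
  · exact pow_le_one₀ hε.1.le hε.2.le

/-- Only a sum is bounded by hypothesis, and energy and entropy may be negative. Lower bounds for
these two, with the nonnegativity of the other two terms, bound each term separately. -/
theorem WellPrepared.exists_uniform_bound {f : ℝ → EReal} (hf : EnergyAssumption d f)
    {φ : Space d → ℝ} (hφ : MollifierAssumption φ) {δ : ℝ → ℝ} (hδ : ParameterAssumption δ)
    {v : ℝ → Space d → Space d} {μ₀ : Measure (Space d)} (hμ₀ : InitialAssumption f μ₀)
    {r : ℝ → Space d → ℝ} {vs : ℝ → ℝ → Space d → Space d}
    (hprep : WellPrepared f δ φ v μ₀ r vs) {T : ℝ} (hT : 0 < T) :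
    ∃ a₀ c₀ D : ℝ, 0 ≤ a₀ ∧ 0 ≤ c₀ ∧ 0 ≤ D ∧ ∀ ε ∈ Ioo (0 : ℝ) 1,
      (∀ μ : Measure (Space d), IsProbabilityMeasure μ → secondMoment μ < ⊤ →
        -(a₀ + c₀ * ∫ x, ‖x‖ ^ 2 ∂μ) ≤
          ∫ x, regDensityReal (δ ε) f (smooth (mollifier φ ε) μ x)) ∧
      ∫ x, ‖x‖ ^ 2 ∂(densityMeasure (r ε)) ≤ D ∧
      ∫ x, regDensityReal (δ ε) f (smooth (mollifier φ ε) (densityMeasure (r ε)) x) ≤ D ∧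
      ∫ x, r ε x * Real.log (r ε x) ≤ D ∧
      ∫⁻ t in Icc 0 T, eLpNorm (growthQuotient (vs ε t) (fderiv ℝ (vs ε t))) ⊤ volume ≤
        ENNReal.ofReal D := by
  have hκ : 0 ≤ ∫ x, ‖x‖ ^ 2 * φ x :=
    integral_nonneg fun x => mul_nonneg (sq_nonneg _) (hφ.nonneg x)
  obtain ⟨a₀, c₀, ha₀, hc₀, hlow⟩ := hf.exists_le_integral_regDensityReal hκ
  obtain ⟨C, hC⟩ := hprep.bound T hT
  have hev : ∀ᶠ ε in 𝓝[>] (0 : ℝ), wasserstein₂ (densityMeasure (r ε)) μ₀ < 1 :=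
    hprep.tendsto_initial.eventually_lt_const zero_lt_one
  obtain ⟨ε₀, hε₀, hW⟩ := (mem_nhdsGT_iff_exists_Ioo_subset).1 hev
  set ε₁ := min ε₀ (1 / 2) with hε₁
  have hε₁m : ε₁ ∈ Ioo (0 : ℝ) 1 :=
    ⟨lt_min hε₀ (by norm_num), (min_le_right _ _).trans_lt (by norm_num)⟩
  obtain ⟨K, hK0, hK⟩ := hf.exists_le_integral_of_le (hδ.pos ε₁ hε₁m)
  set mbar := ∫ x, ‖x‖ ^ 2 ∂μ₀ with hmbar
  have hmbar0 : 0 ≤ mbar := integral_nonneg fun x => sq_nonneg _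
  set K' := K + (a₀ + c₀ * (2 * mbar + 2)) with hK'
  have hK'0 : 0 ≤ K' := by positivity
  set C₁ := (d + 1 : ℝ) ^ 2 / 2 + Real.exp (-1) * ∫ x : Space d, Real.exp (-logWeight x) with hC₁
  have hW0 : 0 ≤ ∫ x : Space d, Real.exp (-logWeight x) :=
    integral_nonneg fun x => (Real.exp_pos _).le
  have hC₁0 : 0 ≤ C₁ := by positivity
  -- The factor 2 arises because half of the second moment is used to bound the entropy from below.
  refine ⟨a₀, c₀, 2 * (|C| + K' + C₁), ha₀, hc₀, by positivity, fun ε hε => ?_⟩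
  obtain ⟨B, hk, hkκ⟩ := hφ.exists_smoothKernel hε
  have hlow' : ∀ μ : Measure (Space d), IsProbabilityMeasure μ → secondMoment μ < ⊤ →
      -(a₀ + c₀ * ∫ x, ‖x‖ ^ 2 ∂μ) ≤
        ∫ x, regDensityReal (δ ε) f (smooth (mollifier φ ε) μ x) := fun μ hμ hμ2 =>
    hlow (δ ε) _ B μ (hδ.pos ε hε) hk hkκ hμ hμ2
  refine ⟨hlow', ?_⟩
  have hr := hprep.testDensity ε hε
  have hp := hr.isProbabilityMeasure
  have hm2 := hr.secondMoment_lt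
  have hFlow : -K' ≤
      ∫ x, regDensityReal (δ ε) f (smooth (mollifier φ ε) (densityMeasure (r ε)) x) := by
    -- For small ε the data are within Wasserstein distance 1 of the limit, which bounds the moment
    -- and hence the energy below. For ε ≥ ε₁ this is unavailable, but monotonicity keeps δ(ε) ≥
    -- δ(ε₁) > 0 and the linear lower bound on the regularized density applies.
    rcases lt_or_ge ε ε₁ with h | h
    · have h1 := secondMoment_le_of_wasserstein₂_lt
        (hW ⟨hε.1, h.trans_le (min_le_left _ _)⟩ : wasserstein₂ (densityMeasure (r ε)) μ₀ < 1)
      have h2 : ∫ x, ‖x‖ ^ 2 ∂(densityMeasure (r ε)) ≤ 2 * mbar + 2 := by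
        have e : ENNReal.ofReal (2 * mbar + 2) = 2 * ENNReal.ofReal mbar + 2 := by
          rw [ENNReal.ofReal_add (by positivity) (by norm_num), ENNReal.ofReal_mul (by norm_num),
            ENNReal.ofReal_ofNat]
        rw [← ofReal_integral_norm_sq hm2, ← ofReal_integral_norm_sq hμ₀.secondMoment_lt, ← e,
          ENNReal.ofReal_le_ofReal_iff (by positivity)] at h1
        exact h1
      have h3 := hlow' _ hp hm2
      have h4 := mul_le_mul_of_nonneg_left h2 hc₀
      linarith
    · have h1 := hK (δ ε) _ B _ (hδ.mono hε₁m hε h) hk hp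
      have : 0 ≤ a₀ + c₀ * (2 * mbar + 2) := by positivity
      linarith
  have hm0 : 0 ≤ ∫ x, ‖x‖ ^ 2 ∂(densityMeasure (r ε)) := integral_nonneg fun x => sq_nonneg _
  have hSlow := hr.neg_le_entropy_add
  have hsum := hC ε hε
  rw [regEnergy_eq hf (hδ.pos ε hε) hk, hr.entropy_eq, ← ofReal_integral_norm_sq hm2] at hsum
  obtain ⟨A, hA0, hA, hle⟩ := EReal_add_le_real hm0 hsum
  have hCa := le_abs_self C
  rw [hA]
  exact ⟨by linarith, by linarith, by linarith, ENNReal.ofReal_le_ofReal (by linarith)⟩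

end NonlocalDiffusion

end

/-! ### Conclusion. -/

theorem proposition4p4 {d : ℕ} (hd : 1 ≤ d)
    (f : ℝ → EReal) (hf : EnergyAssumption d f)
    (φ : Space d → ℝ) (hφ : MollifierAssumption φ)
    (δ : ℝ → ℝ) (hδ : ParameterAssumption δ)
    (v : ℝ → Space d → Space d) (hv : VelocityAssumption v)
    (μ₀ : Measure (Space d)) (hμ₀ : InitialAssumption f μ₀)
    (r : ℝ → Space d → ℝ) (vs : ℝ → ℝ → Space d → Space d)
    (hprep : WellPrepared f δ φ v μ₀ r vs) :
    ∀ T : ℝ, 0 < T → ∃ C : ℝ, 0 < C ∧ ∀ ε ∈ Ioo (0 : ℝ) 1, ∀ ρ : ℝ → Measure (Space d),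
      IsSolution f φ (δ ε) ε (vs ε) (densityMeasure (r ε)) ρ →
      ∀ t ∈ Icc 0 T,
        ρ t ≪ volume ∧
        AEStronglyMeasurable (dissipation f φ (δ ε) ε ρ)
          (volume.restrict (Icc 0 t ×ˢ univ)) ∧
        (∫⁻ x, ENNReal.ofReal (density (ρ t) x * |Real.log (density (ρ t) x)|)) +
          eLpNorm (dissipation f φ (δ ε) ε ρ) 1 (volume.restrict (Icc 0 t ×ˢ univ)) ≤
          ENNReal.ofReal C := by
  intro T hT
  obtain ⟨a₀, c₀, D, ha₀, hc₀, hD, hdata⟩ := hprep.exists_uniform_bound hf hφ hδ hμ₀ hT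
  obtain ⟨m, hm⟩ := exists_uniform_moment_bound (d := d) hT.le ha₀ hc₀ hD hD hD
  set m' := max m 0 with hm'
  have hW0 : 0 ≤ ∫ x : Space d, Real.exp (-logWeight x) :=
    integral_nonneg fun x => (Real.exp_pos _).le
  refine ⟨D + D * (1 + m') + 3 * (∫ x : Space d, Real.exp (-logWeight x)) +
    2 * ((d + 1) * (1 + m')), ?_, fun ε hε ρ hρ t ht => ?_⟩
  · have : 0 ≤ m' := le_max_right _ _
    positivity
  obtain ⟨hlow, hdm, hdE, hdS, hdA⟩ := hdata ε hε
  obtain ⟨B, hk, -⟩ := hφ.exists_smoothKernel hε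
  obtain ⟨V, hV, hVs, hVv⟩ := hprep.testField ε hε
  have hδε := hδ.pos ε hε
  have hr := hprep.testDensity ε hε
  obtain ⟨G, E⟩ := hρ.exists_evolution hf hδε hk hV hVs hVv
  have hc := continuous_maxGrowth hV hVs
  have hA := integral_maxGrowth_le hV hVs hVv hT.le hD hdA
  have hmom := hm _ B _ _ _ V ρ G (maxGrowth V) E (hf.continuous_regDensityReal hδε)
    EnergyAssumption.regDensityReal_zero (fun a b ha _ => hf.regDensityReal_sub_le hδε ha)
    (fun s hs => hlow (ρ s) (E.prob s hs.1) (E.secondMoment_lt s hs.1))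
    (by rw [hρ.initial]; exact hdm) (by rw [hρ.initial]; exact hdE) hc.continuousOn
    (fun s _ => maxGrowth_nonneg s) (fun s _ x => (field_le_maxGrowth hV hVs s x).1) hA
  have hAt : ∫ s in 0..t, maxGrowth V s ≤ D := by
    refine le_trans ?_ hA
    exact intervalIntegral.integral_mono_interval le_rfl ht.1 ht.2
      (Eventually.of_forall maxGrowth_nonneg) (hc.intervalIntegrable _ _)
  obtain ⟨h1, h2⟩ := E.entropy_add_dissipation_le (t := t) (S := D) (A := D) (m := m')
    (fun a b ha hab => hf.regDensityDeriv_mono hδε ha hab) ht.1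
    (fun ψ hψ he => by
      rw [hρ.initial]
      exact (hr.integral_le hψ he).trans (add_le_add hdS le_rfl))
    (le_max_right _ _)
    (fun s hs => (hmom s ⟨hs.1, hs.2.trans ht.2⟩).trans (le_max_left _ _)) hAt
  -- `dissipation` unfolds definitionally to `dissipationAt` for the kernel `mollifier φ ε` and the
  -- derivative `regDensityDeriv (δ ε) f`.
  exact ⟨h1, E.aestronglyMeasurable_dissipation t, h2⟩
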